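/- **Theorem 6.** *Setting.* Let $S$ be a set of $n$ pairwise disjoint closed line segments with integer endpoints that lie in an axis-parallel box $B$ in the plane, let $q\in B$ be a point with integer coordinates, and let $k\in\mathbb N$. Assume weak general position: $q$ lies on no line through two of the $2n$ segment endpoints (in particular these are $2n$ distinct points). A point $p$ is *$k$-visible* from $q$ if the line segment $pq$ properly intersects at most $k$ segments of $S$, that is, the relative interiors meet ($p$ and $q$ themselves do not count); $V_k(S,q)$ is the set of $k$-visible points of $B$. For $\theta\in[0,2\pi)$ let $r_\theta$ be the ray from $q$ at angle $\theta$, and let $e_\theta(1),e_\theta(2),\dots$ be the segments of $S$ that meet $r_\theta$, in order of distance from $q$, where a segment with an endpoint on $r_\theta$ is listed twice in succession. If $r_\theta$ contains a $k$-visible endpoint of a segment, and $e_\theta(k+2)$ and $e_\theta(k+3)$ exist, then the segment of $r_\theta$ between these two is a *window*; its type is CCW if along it $V_k(S,q)$ lies to the left of $r_\theta$, and CW otherwise. $W_k(S,q)$ is the set of all endpoints of windows, each given as a triple $(\theta,j,\text{type})$ with $j$ the index of the segment on which the endpoint lies. *Model.* A random access machine with a read-only input array, which holds $n$, $s$, $k$,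 $q$ and the endpoints of the segments in words of $w$ bits, a read/write workspace of $O(s)$ words of $O(w)$ bits each, and a write-only output. (For $w=O(\log n)$ these are words of $O(\log n)$ bits.) The angle $\theta$ of a window is written as the index of the segment endpoint on $r_\theta$. A set of points on a segment is reported as a list of subsegments that share at most endpoints and whose union is that set, each end of a subsegment being given by the index of a segment endpoint such that the ray from $q$ through it passes through that end. *Claim.* There is an algorithm that, for all $1\le s\le n$ and all such $S,B,q,k$, reports $W_k(S,q)$ and the $k$-visible part of every segment of $S$ in $O(n^2/s+n\log s)$ time using $O(s)$ words of workspace. If $s=O(1)$, the running time is $O(n^2)$. The implied constants are absolute, except that in the last statement the constant depends on the bound for $s$. -/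

import Mathlib

noncomputable section

namespace KVis

/-! ## Geometry: visibility among segments -/

/-- Points of the plane. -/
abbrev Pt := ℝ × ℝ

/-- A family of `n` segments; `S i false` and `S i true` are the endpoints of the `i`-th one. -/
abbrev Segs (n : ℕ) := Fin n → Bool → Pt

/-- The `i`-th (closed) segment. -/
def seg {n : ℕ} (S : Segs n) (i : Fin n) : Set Pt := segment ℝ (S i false) (S i true)

/-- The line segment `qp` properly intersects the `i`-th segment; the points `p` and `q`
themselves do not count, nor does passing through an endpoint of the `i`-th segment. -/
def Crosses {n : ℕ} (S : Segs n) (q p : Pt) (i : Fin n) : Prop :=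
  (openSegment ℝ q p ∩ openSegment ℝ (S i false) (S i true)).Nonempty

/-- `p` is `k`-visible from `q`. -/
def KVisible {n : ℕ} (S : Segs n) (q : Pt) (k : ℕ) (p : Pt) : Prop :=
  {i | Crosses S q p i}.ncard ≤ k

/-- The `k`-visibility region `V_k(S,q)` of `q` inside the box `B`. -/
def region {n : ℕ} (B : Set Pt) (S : Segs n) (q : Pt) (k : ℕ) : Set Pt :=
  {p | p ∈ B ∧ KVisible S q k p}

/-- The unit vector in direction `θ`. -/
def dir (θ : ℝ) : Pt := (Real.cos θ, Real.sin θ)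

/-- The ray `r_θ` from `q` (without `q`). -/
def ray (q : Pt) (θ : ℝ) : Set Pt := {p | ∃ t : ℝ, 0 < t ∧ p = q + t • dir θ}

/-- The angle in `[0, 2π)` between the ray from `q` through `p` and the positive horizontal
axis. -/
def angle (q p : Pt) : ℝ :=
  toIcoMod Real.two_pi_pos 0 (Complex.arg ⟨p.1 - q.1, p.2 - q.2⟩)

/-- The ray `r_θ` meets the `i`-th segment at distance `t` from `q`. -/
def MeetsAt {n : ℕ} (S : Segs n) (q : Pt) (θ : ℝ) (i : Fin n) (t : ℝ) : Prop :=
  0 < t ∧ q + t • dir θ ∈ seg S i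

/-- The ray `r_θ` meets segment `i` before it meets segment `j`. -/
def Before {n : ℕ} (S : Segs n) (q : Pt) (θ : ℝ) (i j : Fin n) : Prop :=
  ∃ t u : ℝ, MeetsAt S q θ i t ∧ MeetsAt S q θ j u ∧ t < u

open scoped Classical in
/-- The number of entries that segment `i` (met by `r_θ`) has in the edge list of `r_θ`: all
endpoints are critical vertices, and a critical vertex on the ray is counted twice. -/
def mult {n : ℕ} (S : Segs n) (q : Pt) (θ : ℝ) (i : Fin n) : ℕ :=
  if ∃ b, S i b ∈ ray q θ then 2 else 1

open scoped Classical in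
/-- The number of entries of the edge list of `r_θ` that come before segment `j`. -/
def entriesBefore {n : ℕ} (S : Segs n) (q : Pt) (θ : ℝ) (j : Fin n) : ℕ :=
  ∑ i ∈ Finset.univ.filter (fun i => Before S q θ i j), mult S q θ i

/-- Segment `j` is `e_θ(m)`, the `m`-th entry (`m = 1, 2, …`) of the edge list of `r_θ`. -/
def IsEdge {n : ℕ} (S : Segs n) (q : Pt) (θ : ℝ) (m : ℕ) (j : Fin n) : Prop :=
  (∃ t, MeetsAt S q θ j t) ∧ entriesBefore S q θ j < m ∧
    m ≤ entriesBefore S q θ j + mult S q θ j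

/-- The ray `r_θ` stabs a `k`-visible endpoint, and its window is the segment `ab`, where `a`
lies on `e_θ(k+2) = g` and `b` lies on `e_θ(k+3) = h`. -/
def IsWindow {n : ℕ} (S : Segs n) (q : Pt) (k : ℕ) (θ : ℝ) (g h : Fin n) (a b : Pt) : Prop :=
  (∃ i c, S i c ∈ ray q θ ∧ KVisible S q k (S i c)) ∧
    IsEdge S q θ (k + 2) g ∧ IsEdge S q θ (k + 3) h ∧
    a ∈ ray q θ ∩ seg S g ∧ b ∈ ray q θ ∩ seg S h

/-- `p` lies strictly to the left of the (directed) line through the ray `r_θ`. -/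
def LeftOf (q : Pt) (θ : ℝ) (p : Pt) : Prop :=
  0 < (dir θ).1 * (p.2 - q.2) - (dir θ).2 * (p.1 - q.1)

/-- Along the open segment `ab` on `r_θ`, the region `V_k(S,q)` lies to the left of `r_θ`. -/
def RegionOnLeft {n : ℕ} (B : Set Pt) (S : Segs n) (q : Pt) (k : ℕ) (θ : ℝ) (a b : Pt) : Prop :=
  ∀ p ∈ openSegment ℝ a b, ∀ᶠ x in nhds p, LeftOf q θ x → x ∈ region B S q k

/-- The two types of a window. -/
inductive WinType
  | ccw
  | cw

/-- `W_k(S,q)`: the endpoints of the windows, as triples `(θ, j, type)`, where `j` is the index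
of the segment on which the endpoint lies; the type is `ccw` if the region lies to the left of
the ray along the window, and `cw` otherwise. -/
def windowEnds {n : ℕ} (B : Set Pt) (S : Segs n) (q : Pt) (k : ℕ) :
    Set (ℝ × Fin n × WinType) :=
  {x | x.1 ∈ Set.Ico 0 (2 * Real.pi) ∧
    ∃ g h a b, IsWindow S q k x.1 g h a b ∧ (x.2.1 = g ∨ x.2.1 = h) ∧
      (x.2.2 = WinType.ccw ↔ RegionOnLeft B S q k x.1 a b)}

/-- The `k`-visible part of the `i`-th segment. -/
def visiblePart {n : ℕ} (B : Set Pt) (S : Segs n) (q : Pt) (k : ℕ) (i : Fin n) : Set Pt :=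
  seg S i ∩ region B S q k

/-- The part of the `i`-th segment between the rays from `q` through the endpoints
`u` and `w`. -/
def piece {n : ℕ} (S : Segs n) (q : Pt) (i : Fin n) (u w : Fin n × Bool) : Set Pt :=
  {p | ∃ a ∈ ray q (angle q (S u.1 u.2)) ∩ seg S i,
    ∃ b ∈ ray q (angle q (S w.1 w.2)) ∩ seg S i, p ∈ segment ℝ a b}

/-- The assumptions on the input: `n` pairwise disjoint segments in the box `B`, a query point
`q ∈ B`, and weak general position: `q` is on no line through two of the `2n` endpoints. (In
particular the endpoints are distinct points different from `q`.) -/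
structure Valid {n : ℕ} (B : Set Pt) (S : Segs n) (q : Pt) : Prop where
  disjoint : Pairwise fun i j => Disjoint (seg S i) (seg S j)
  inBox : ∀ i, seg S i ⊆ B
  query : q ∈ B
  general : ∀ u w : Fin n × Bool, u ≠ w → ¬ Collinear ℝ {q, S u.1 u.2, S w.1 w.2}

/-! ## The output -/

/-- An item of the output. `window v j τ` stands for the window endpoint `(θ, j, τ)`, where `θ`
is the angle of the endpoint `v`; `part i u w` stands for the part of the `i`-th segment
between the rays through the endpoints `u` and `w`. -/
inductive Item (n : ℕ)
  | window (v : Fin n × Bool) (j : Fin n) (τ : WinType)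
  | part (i : Fin n) (u w : Fin n × Bool)

/-- The number of an endpoint. -/
def vertexCode {n : ℕ} (v : Fin n × Bool) : ℤ := 2 * (v.1 : ℤ) + (if v.2 then 1 else 0)

/-- The number of a type. -/
def WinType.code : WinType → ℤ
  | .ccw => 0
  | .cw => 1

/-- The four words in which an item is written to the output. -/
def Item.words {n : ℕ} : Item n → List ℤ
  | .window v j τ => [0, vertexCode v, (j : ℤ), τ.code]
  | .part i u w => [1, (i : ℤ), vertexCode u, vertexCode w]

/-- `L` is a correct report of `W_k(S,q)` and of the `k`-visible parts of the segments: the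
window items are exactly the elements of `W_k(S,q)`, each listed once, and the part items are
nondegenerate subsegments that do not overlap (two of them share at most a point) and whose
union on each segment is exactly the `k`-visible part of it. -/
structure IsReport {n : ℕ} (B : Set Pt) (S : Segs n) (q : Pt) (k : ℕ) (L : List (Item n)) :
    Prop where
  nodup : L.Nodup
  windows : ∀ θ j τ, (θ, j, τ) ∈ windowEnds B S q k ↔
    ∃ v, Item.window v j τ ∈ L ∧ θ = angle q (S v.1 v.2)
  meets : ∀ i u w, Item.part i u w ∈ L → u ≠ w ∧
    (ray q (angle q (S u.1 u.2)) ∩ seg S i).Nonempty ∧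
    (ray q (angle q (S w.1 w.2)) ∩ seg S i).Nonempty
  parts : ∀ i p, p ∈ visiblePart B S q k i ↔
    ∃ u w, Item.part i u w ∈ L ∧ p ∈ piece S q i u w
  noOverlap : ∀ i u w u' w', Item.part i u w ∈ L → Item.part i u' w' ∈ L →
    (u, w) ≠ (u', w') → (piece S q i u w ∩ piece S q i u' w').Subsingleton

/-! ## The machine: a random access machine with read-only input, workspace and
write-only output -/

/-- Expressions over the read-only input array and the workspace. -/
inductive Expr
  | lit (c : ℤ)
  | cell (a : Expr)
  | inp (a : Expr)
  | add (a b : Expr)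
  | sub (a b : Expr)
  | mul (a b : Expr)
  | div (a b : Expr)

/-- The value of an expression, for the input array `I` and the workspace contents `m`. -/
def Expr.eval (I : List ℤ) (m : ℕ → ℤ) : Expr → ℤ
  | .lit c => c
  | .cell a => m (a.eval I m).toNat
  | .inp a => I.getD (a.eval I m).toNat 0
  | .add a b => a.eval I m + b.eval I m
  | .sub a b => a.eval I m - b.eval I m
  | .mul a b => a.eval I m * b.eval I m
  | .div a b => a.eval I m / b.eval I m

/-- Evaluating an expression takes one step for each of its operations. -/
def Expr.cost : Expr → ℕ
  | .lit _ => 1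
  | .cell a => a.cost + 1
  | .inp a => a.cost + 1
  | .add a b => a.cost + b.cost + 1
  | .sub a b => a.cost + b.cost + 1
  | .mul a b => a.cost + b.cost + 1
  | .div a b => a.cost + b.cost + 1

/-- The address `x` is that of one of the first `len` cells. -/
def InRange (len : ℕ) (x : ℤ) : Prop := 0 ≤ x ∧ x < len

/-- The subexpressions of an expression, including itself. -/
def Expr.subs : Expr → List Expr
  | .lit c => [.lit c]
  | .cell a => .cell a :: a.subs
  | .inp a => .inp a :: a.subs
  | .add a b => .add a b :: (a.subs ++ b.subs)
  | .sub a b => .sub a b :: (a.subs ++ b.subs)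
  | .mul a b => .mul a b :: (a.subs ++ b.subs)
  | .div a b => .div a b :: (a.subs ++ b.subs)

/-- The expression can be evaluated on a machine with `space` cells of workspace and `bits`-bit
words: every address that occurs is valid, and every value that occurs fits into a word. -/
structure Expr.Ok (I : List ℤ) (space bits : ℕ) (m : ℕ → ℤ) (e : Expr) : Prop where
  fits : ∀ f ∈ e.subs, |f.eval I m| < 2 ^ bits
  cells : ∀ a, Expr.cell a ∈ e.subs → InRange space (a.eval I m)
  inputs : ∀ a, Expr.inp a ∈ e.subs → InRange I.length (a.eval I m)

/-- Programs. -/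
inductive Cmd
  | skip
  | assign (a e : Expr)
  | write (e : Expr)
  | seq (c d : Cmd)
  | ite (e : Expr) (c d : Cmd)
  | loop (e : Expr) (c : Cmd)

/-- The workspace contents and the output written so far. -/
structure State where
  mem : ℕ → ℤ
  out : List ℤ

/-- All workspace cells hold zero, and nothing has been written. -/
def State.init : State := ⟨fun _ => 0, []⟩

/-- `Exec I space bits c σ t σ'`: on the read-only input `I`, with `space` cells of workspace
and `bits`-bit words, the program `c`, started in the state `σ`, halts after `t` steps in the
state `σ'`. `assign a e` stores the value of `e` in the cell with address `a`, `write e` appends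
the value of `e` to the output, `ite` and `loop` test whether the value of `e` is positive. -/
inductive Exec (I : List ℤ) (space bits : ℕ) : Cmd → State → ℕ → State → Prop
  | skip (σ : State) : Exec I space bits .skip σ 1 σ
  | assign (σ : State) (a e : Expr) (ha : a.Ok I space bits σ.mem) (he : e.Ok I space bits σ.mem)
      (hr : InRange space (a.eval I σ.mem)) :
      Exec I space bits (.assign a e) σ (a.cost + e.cost + 1)
        ⟨Function.update σ.mem (a.eval I σ.mem).toNat (e.eval I σ.mem), σ.out⟩
  | write (σ : State) (e : Expr) (he : e.Ok I space bits σ.mem) :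
      Exec I space bits (.write e) σ (e.cost + 1) ⟨σ.mem, σ.out ++ [e.eval I σ.mem]⟩
  | seq (c d : Cmd) (σ₀ σ₁ σ₂ : State) (t u : ℕ) (hc : Exec I space bits c σ₀ t σ₁)
      (hd : Exec I space bits d σ₁ u σ₂) : Exec I space bits (.seq c d) σ₀ (t + u) σ₂
  | ite_pos (e : Expr) (c d : Cmd) (σ σ₁ : State) (t : ℕ) (he : e.Ok I space bits σ.mem)
      (h : 0 < e.eval I σ.mem) (hc : Exec I space bits c σ t σ₁) :
      Exec I space bits (.ite e c d) σ (e.cost + 1 + t) σ₁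
  | ite_neg (e : Expr) (c d : Cmd) (σ σ₁ : State) (t : ℕ) (he : e.Ok I space bits σ.mem)
      (h : ¬ 0 < e.eval I σ.mem) (hd : Exec I space bits d σ t σ₁) :
      Exec I space bits (.ite e c d) σ (e.cost + 1 + t) σ₁
  | loop_stop (e : Expr) (c : Cmd) (σ : State) (he : e.Ok I space bits σ.mem)
      (h : ¬ 0 < e.eval I σ.mem) : Exec I space bits (.loop e c) σ (e.cost + 1) σ
  | loop_step (e : Expr) (c : Cmd) (σ σ₁ σ₂ : State) (t u : ℕ) (he : e.Ok I space bits σ.mem)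
      (h : 0 < e.eval I σ.mem) (hc : Exec I space bits c σ t σ₁)
      (hl : Exec I space bits (.loop e c) σ₁ u σ₂) :
      Exec I space bits (.loop e c) σ (e.cost + 1 + t + u) σ₂

/-! ## The computational problem -/

/-- The read-only input array: `n`, `s`, `k`, the query point, and the four coordinates of each
segment. -/
def inputArray {n : ℕ} (s k : ℕ) (S : Fin n → Bool → ℤ × ℤ) (q : ℤ × ℤ) : List ℤ :=
  [(n : ℤ), (s : ℤ), (k : ℤ), q.1, q.2] ++
    (List.ofFn fun i =>
      [(S i false).1, (S i false).2, (S i true).1, (S i true).2]).flatten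

/-- The point of the plane with the given integer coordinates. -/
def toPt (p : ℤ × ℤ) : Pt := ((p.1 : ℝ), (p.2 : ℝ))

/-- For every `k`, every word length `w`, every box and every valid input of `n` segments and a
query point whose numbers fit into words of `w` bits, the program `P` reports `W_k(S,q)` and the
`k`-visible parts of the segments in time at most `T`, using a workspace of `c * s` words of
`c * w` bits each. -/
def Reports (P : Cmd) (c n s : ℕ) (T : ℝ) : Prop :=
  ∀ (k w : ℕ) (S : Fin n → Bool → ℤ × ℤ) (q : ℤ × ℤ) (lo hi : Pt),
    Valid (Set.Icc lo hi) (fun i b => toPt (S i b)) (toPt q) →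
    (∀ x ∈ inputArray s k S q, |x| < 2 ^ w) →
    ∃ (t : ℕ) (σ : State) (L : List (Item n)),
      Exec (inputArray s k S q) (c * s) (c * w) P State.init t σ ∧
      (t : ℝ) ≤ T ∧
      σ.out = (L.map Item.words).flatten ∧
      IsReport (Set.Icc lo hi) (fun i b => toPt (S i b)) (toPt q) k L

end KVis

end

namespace KVis

/-! ## Reasoning about programs -/

/-! The theorem is proved by writing down a program (`sweep`) and verifying it. A ray turns
counterclockwise about the query point through the `2 n` endpoints `V 1, …, V (2 n)`, starting and
ending at the endpoint number `0`. By general position every endpoint is alone on its line through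
`q`, and every segment is seen under an angle strictly between `0` and `π`. Between two consecutive
endpoints ("in a gap") the segments that meet the ray do not change (`Order.act_iff_bef`), and
neither does their order along it (`Sweep.lt_next`), because a swap would force two disjoint
segments to share a point. A point of a segment is `k`-visible exactly if, in a gap whose closed
cone contains its direction, the segment has at most `k` others in front of it
(`Scene.visible_of_vis`, `Scene.exists_vis`).

Hence it suffices to maintain the segment `e` with exactly `k` segments in front; the visible
segments are those not behind `e`. At an endpoint one segment is inserted or removed, and `e` either
stays or moves to its predecessor or successor (`IsKth.insert_of`, `IsKth.erase_of`). A window lies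
on the ray exactly if `e` changes and both the old and the new `e` exist, and these two segments
carry its ends (`Scene.isWindow_iff`, `Sweep.win_iff`). Its type says whether the endpoint is the
first or the last one of its segment, since this decides on which side of the ray that segment is an
additional obstacle (`Scene.regionOnLeft_iff`).

To work with `O(s)` words, the segments are cut into `s` blocks of about `n / s`, and a tournament
tree with `s` leaves stores one winner per block. Three such trees yield the next endpoint, the last
segment before `e` and the first segment after `e`. A node stores a number and no key; keys are
recomputed from the input when they are compared. Therefore a tree stays correct as the ray turns,
as long as the relative order of the keys is the same (`TreeOk.transfer`), and each event requires
only boundedly many leaves to be recomputed, in time `O(n / s + log s)` each (`run_refresh`). With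
`O(n)` events this is the claimed bound.

There is no room to remember since when each segment has been visible. One endpoint is remembered
per block instead. Whenever the visibility of a segment may change, its whole block is reported from
the remembered endpoint up to the current one (`Reported.flush`). Only the segment of the event, the
old `e` and the new `e` can change (`vis_next`), so three blocks per event are affected.

All geometry is expressed by cross products of integer vectors. The distance of a segment on a ray
is a fraction `X / D` whose denominator is linear in the direction, and fractions are compared by
cross multiplication, so that all numbers fit into boundedly many input words. -/

instance : Add Expr := ⟨.add⟩
instance : Sub Expr := ⟨.sub⟩
instance : Mul Expr := ⟨.mul⟩
instance : Div Expr := ⟨.div⟩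
instance (n : ℕ) : OfNat Expr n := ⟨.lit n⟩

infixr:40 " ;; " => Cmd.seq

/-- The register `r`, that is, the workspace cell with the constant address `r`. -/
def rg (r : ℕ) : Expr := .cell (.lit r)

/-- Store a value in the register `r`. -/
def put (r : ℕ) (e : Expr) : Cmd := .assign (.lit r) e

/-- An instance of the machine together with the numbers at the beginning of its input. -/
structure Env where
  I : List ℤ
  n : ℕ
  s : ℕ
  k : ℕ
  w : ℕ
  sp : ℕ
  bits : ℕ
  one_le_s : 1 ≤ s
  s_le_n : s ≤ n
  one_le_w : 1 ≤ w
  length : I.length = 5 + 4 * n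
  inp0 : I.getD 0 0 = n
  inp1 : I.getD 1 0 = s
  inp2 : I.getD 2 0 = k
  small : ∀ x ∈ I, |x| < 2 ^ w
  -- The first `64` cells are for registers, and four trees of `2 * s` cells each are interleaved
  -- behind them; `64 + 8 * s ≤ 72 * s` because `1 ≤ s`.
  space : 72 * s ≤ sp
  word : 1000 * w ≤ bits

/-- `v` fits into `j` words. -/
def Env.Bd (C : Env) (j : ℕ) (v : ℤ) : Prop := |v| ≤ 2 ^ (j * C.w)

/-- All workspace cells hold numbers of at most twenty input words. -/
def Env.MemOk (C : Env) (m : ℕ → ℤ) : Prop := ∀ r, C.Bd 20 (m r)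

/-- A bound for the size, in input words, of the value of an expression. -/
def Expr.grade : Expr → ℕ
  | .lit c => c.natAbs
  | .cell _ => 20
  | .inp _ => 1
  | .add a b => max a.grade b.grade + 1
  | .sub a b => max a.grade b.grade + 1
  | .mul a b => a.grade + b.grade
  | .div a _ => a.grade

/-- The maximal grade of a subexpression. -/
def Expr.maxGrade : Expr → ℕ
  | .lit c => c.natAbs
  | .cell a => max 20 a.maxGrade
  | .inp a => max 1 a.maxGrade
  | .add a b => max (max a.grade b.grade + 1) (max a.maxGrade b.maxGrade)
  | .sub a b => max (max a.grade b.grade + 1) (max a.maxGrade b.maxGrade)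
  | .mul a b => max (a.grade + b.grade) (max a.maxGrade b.maxGrade)
  | .div a b => max a.grade (max a.maxGrade b.maxGrade)

/-- All addresses that occur in the evaluation of an expression are valid. -/
def Expr.Good (C : Env) (m : ℕ → ℤ) : Expr → Prop
  | .lit _ => True
  | .cell a => a.Good C m ∧ InRange C.sp (a.eval C.I m)
  | .inp a => a.Good C m ∧ InRange C.I.length (a.eval C.I m)
  | .add a b => a.Good C m ∧ b.Good C m
  | .sub a b => a.Good C m ∧ b.Good C m
  | .mul a b => a.Good C m ∧ b.Good C m
  | .div a b => a.Good C m ∧ b.Good C m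

section Basic
variable {C : Env} {m : ℕ → ℤ}

theorem Env.Bd.mono {i j : ℕ} {v : ℤ} (h : C.Bd i v) (hij : i ≤ j) : C.Bd j v :=
  h.trans (pow_le_pow_right₀ (by norm_num) (Nat.mul_le_mul_right _ hij))

theorem Env.Bd.add {i : ℕ} {u v : ℤ} (hu : C.Bd i u) (hv : C.Bd i v) : C.Bd (i + 1) (u + v) := by
  unfold Env.Bd at *
  have h1 : (2 : ℤ) * 2 ^ (i * C.w) ≤ 2 ^ ((i + 1) * C.w) := by
    rw [← pow_succ']
    exact pow_le_pow_right₀ (by norm_num) (by nlinarith [C.one_le_w])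
  linarith [abs_add_le u v]

theorem Env.Bd.neg {i : ℕ} {v : ℤ} (hv : C.Bd i v) : C.Bd i (-v) := by
  unfold Env.Bd at *; rwa [abs_neg]

theorem Env.Bd.sub {i : ℕ} {u v : ℤ} (hu : C.Bd i u) (hv : C.Bd i v) : C.Bd (i + 1) (u - v) := by
  rw [sub_eq_add_neg]; exact hu.add hv.neg

theorem Env.Bd.mul {i j : ℕ} {u v : ℤ} (hu : C.Bd i u) (hv : C.Bd j v) : C.Bd (i + j) (u * v) := by
  unfold Env.Bd at *
  rw [abs_mul, add_mul, pow_add]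
  exact mul_le_mul hu hv (abs_nonneg _) (by positivity)

theorem Env.Bd.div {i : ℕ} {u v : ℤ} (hu : C.Bd i u) : C.Bd i (u / v) := by
  unfold Env.Bd at *
  refine le_trans ?_ hu
  have := Int.natAbs_ediv_le_natAbs u v
  rw [Int.abs_eq_natAbs, Int.abs_eq_natAbs]
  exact_mod_cast this

/-- The bound `|c| < 2 ^ |c|` is crude, but it keeps grades free of the word length: they are
numerals that `decide` can compare with the limits. -/
theorem Env.bd_lit (c : ℤ) : C.Bd c.natAbs c := by
  unfold Env.Bd
  rw [Int.abs_eq_natAbs]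
  have h1 : c.natAbs < 2 ^ c.natAbs := Nat.lt_two_pow_self
  have h2 : 2 ^ c.natAbs ≤ 2 ^ (c.natAbs * C.w) :=
    Nat.pow_le_pow_right (by norm_num) (Nat.le_mul_of_pos_right _ C.one_le_w)
  exact_mod_cast (h1.le.trans h2)

theorem Env.bd_inp (j : ℕ) : C.Bd 1 (C.I.getD j 0) := by
  unfold Env.Bd
  rw [one_mul]
  by_cases h : j < C.I.length
  · rw [List.getD_eq_getElem _ _ h]
    exact (C.small _ (List.getElem_mem h)).le
  · rw [List.getD_eq_default _ _ (not_lt.mp h)]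
    simp

theorem Env.n_lt (C : Env) : (C.n : ℤ) < 2 ^ C.w := by
  have h := C.small (C.I.getD 0 0) (by
    rw [List.getD_eq_getElem _ _ (by rw [C.length]; omega)]
    exact List.getElem_mem _)
  rw [C.inp0] at h
  exact (le_abs_self _).trans_lt h

/-- An incremented counter would gain a grade in every iteration, so grades cannot bound counters,
block ends and node numbers. They are bounded by a multiple of `n` instead, which is itself an input
word. -/
theorem Env.bd_index {v : ℤ} (h0 : -4 ≤ v) (h1 : v ≤ 4 * C.n + 4) : C.Bd 20 v := by
  unfold Env.Bd
  have h2 := C.n_lt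
  have h3 : (2 : ℤ) ^ C.w * 2 ^ 4 ≤ 2 ^ (20 * C.w) := by
    rw [← pow_add]
    exact pow_le_pow_right₀ (by norm_num) (by nlinarith [C.one_le_w])
  have h4 : (1 : ℤ) ≤ 2 ^ C.w := one_le_pow₀ (by norm_num)
  rw [abs_le]
  constructor <;> nlinarith

theorem Env.Bd.lt {v : ℤ} {g : ℕ} (h : C.Bd g v) (hg : g < 1000) : |v| < 2 ^ C.bits := by
  refine lt_of_le_of_lt h (pow_lt_pow_right₀ (by norm_num) ?_)
  have := C.word
  have := C.one_le_w
  nlinarith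

theorem Expr.bd_eval (hm : C.MemOk m) (e : Expr) : C.Bd e.grade (e.eval C.I m) := by
  induction e with
  | lit c => exact C.bd_lit c
  | cell a => exact hm _
  | inp a => exact C.bd_inp _
  | add a b iha ihb => exact (iha.mono (le_max_left _ _)).add (ihb.mono (le_max_right _ _))
  | sub a b iha ihb => exact (iha.mono (le_max_left _ _)).sub (ihb.mono (le_max_right _ _))
  | mul a b iha ihb => exact iha.mul ihb
  | div a b iha ihb => exact iha.div

theorem Expr.grade_le_of_mem_subs (e : Expr) : ∀ f ∈ e.subs, f.grade ≤ e.maxGrade := by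
  induction e with
  | lit c => simp [Expr.subs, Expr.maxGrade, Expr.grade]
  | cell a ih | inp a ih =>
    intro f hf
    simp only [Expr.subs, List.mem_cons] at hf
    rcases hf with rfl | hf
    · simp [Expr.maxGrade, Expr.grade]
    · exact (ih f hf).trans (le_max_right _ _)
  | add a b iha ihb | sub a b iha ihb | mul a b iha ihb | div a b iha ihb =>
    intro f hf
    simp only [Expr.subs, List.mem_cons, List.mem_append] at hf
    rcases hf with rfl | hf | hf
    · simp [Expr.maxGrade, Expr.grade]
    · exact (iha f hf).trans ((le_max_left _ _).trans (le_max_right _ _))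
    · exact (ihb f hf).trans ((le_max_right _ _).trans (le_max_right _ _))

theorem Expr.Good.cell_of_mem {e : Expr} (h : e.Good C m) :
    ∀ a, Expr.cell a ∈ e.subs → InRange C.sp (a.eval C.I m) := by
  induction e with
  | lit c => simp [Expr.subs]
  | cell a ih =>
    intro f hf
    simp only [Expr.subs, List.mem_cons, Expr.cell.injEq] at hf
    rcases hf with rfl | hf
    · exact h.2
    · exact ih h.1 f hf
  | inp a ih =>
    intro f hf
    simp only [Expr.subs, List.mem_cons, reduceCtorEq, false_or] at hf
    exact ih h.1 f hf
  | add a b iha ihb | sub a b iha ihb | mul a b iha ihb | div a b iha ihb =>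
    intro f hf
    simp only [Expr.subs, List.mem_cons, List.mem_append, reduceCtorEq, false_or] at hf
    rcases hf with hf | hf
    · exact iha h.1 f hf
    · exact ihb h.2 f hf

theorem Expr.Good.inp_of_mem {e : Expr} (h : e.Good C m) :
    ∀ a, Expr.inp a ∈ e.subs → InRange C.I.length (a.eval C.I m) := by
  induction e with
  | lit c => simp [Expr.subs]
  | inp a ih =>
    intro f hf
    simp only [Expr.subs, List.mem_cons, Expr.inp.injEq] at hf
    rcases hf with rfl | hf
    · exact h.2
    · exact ih h.1 f hf
  | cell a ih =>
    intro f hf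
    simp only [Expr.subs, List.mem_cons, reduceCtorEq, false_or] at hf
    exact ih h.1 f hf
  | add a b iha ihb | sub a b iha ihb | mul a b iha ihb | div a b iha ihb =>
    intro f hf
    simp only [Expr.subs, List.mem_cons, List.mem_append, reduceCtorEq, false_or] at hf
    rcases hf with hf | hf
    · exact iha h.1 f hf
    · exact ihb h.2 f hf

/-- Separates the three reasons why an evaluation is legal: valid addresses, moderate memory
contents, and a numerical condition on the shape of the expression alone. -/
theorem Expr.Good.ok {e : Expr} (h : e.Good C m) (hm : C.MemOk m) (hg : e.maxGrade < 1000) :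
    e.Ok C.I C.sp C.bits m :=
  ⟨fun f hf => (Expr.bd_eval hm f).lt ((e.grade_le_of_mem_subs f hf).trans_lt hg),
    h.cell_of_mem, h.inp_of_mem⟩

end Basic

/-- Started in the state `σ`, whose workspace contains moderate numbers, the program `c` halts
after at most `T` steps in a state that satisfies `Q`. -/
def Run (C : Env) (c : Cmd) (σ : State) (T : ℕ) (Q : State → Prop) : Prop :=
  C.MemOk σ.mem → ∃ t σ', Exec C.I C.sp C.bits c σ t σ' ∧ t ≤ T ∧ C.MemOk σ'.mem ∧ Q σ'

section RunRules
variable {C : Env} {σ : State} {Q : State → Prop}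

theorem Run.mono {c : Cmd} {T T' : ℕ} {Q' : State → Prop} (h : Run C c σ T Q) (hT : T ≤ T')
    (hQ : ∀ σ', C.MemOk σ'.mem → Q σ' → Q' σ') : Run C c σ T' Q' := by
  intro hm
  obtain ⟨t, σ', h1, h2, h3, h4⟩ := h hm
  exact ⟨t, σ', h1, h2.trans hT, h3, hQ _ h3 h4⟩

theorem Run.time {c : Cmd} {T T' : ℕ} (h : Run C c σ T Q) (hT : T ≤ T') : Run C c σ T' Q :=
  h.mono hT fun _ _ h => h

theorem Run.memOk {c : Cmd} {T : ℕ} (h : C.MemOk σ.mem → Run C c σ T Q) : Run C c σ T Q :=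
  fun hm => h hm hm

theorem Run.skip (h : Q σ) : Run C .skip σ 1 Q :=
  fun hm => ⟨1, σ, .skip σ, le_rfl, hm, h⟩

theorem Run.seq {c d : Cmd} {T U : ℕ} (h : Run C c σ T fun σ' => Run C d σ' U Q) :
    Run C (c ;; d) σ (T + U) Q := by
  intro hm
  obtain ⟨t, σ', h1, h2, h3, h4⟩ := h hm
  obtain ⟨u, σ'', h5, h6, h7, h8⟩ := h4 h3
  exact ⟨t + u, σ'', .seq _ _ _ _ _ _ _ h1 h5, by omega, h7, h8⟩

theorem Run.seq_of {c d : Cmd} {T U : ℕ} {R : State → Prop} (h : Run C c σ T R)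
    (h' : ∀ σ', R σ' → Run C d σ' U Q) : Run C (c ;; d) σ (T + U) Q :=
  .seq (h.mono le_rfl fun σ' _ => h' σ')

theorem Run.assign {a e : Expr} (ha : a.Good C σ.mem) (he : e.Good C σ.mem)
    (hr : InRange C.sp (a.eval C.I σ.mem)) (hga : a.maxGrade < 1000) (hge : e.maxGrade < 1000)
    (hv : C.MemOk σ.mem → C.Bd 20 (e.eval C.I σ.mem))
    (hQ : Q ⟨Function.update σ.mem (a.eval C.I σ.mem).toNat (e.eval C.I σ.mem), σ.out⟩) :
    Run C (.assign a e) σ (a.cost + e.cost + 1) Q := by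
  intro hm
  refine ⟨_, _, .assign σ a e (ha.ok hm hga) (he.ok hm hge) hr, le_rfl, ?_, hQ⟩
  intro r
  by_cases h : r = (a.eval C.I σ.mem).toNat
  · subst h; simpa using hv hm
  · simpa [Function.update_of_ne h] using hm r

theorem Env.lt_sp {r : ℕ} (hr : r < 72) : r < C.sp :=
  lt_of_lt_of_le hr (by have := C.space; have := C.one_le_s; omega)

/-- For values whose size follows from an invariant and not from the shape of the expression, such
as counters. -/
theorem Run.putDyn {r : ℕ} {e : Expr} (hr : r < 72) (hge : e.maxGrade < 1000)
    (he : e.Good C σ.mem) (hv : C.Bd 20 (e.eval C.I σ.mem))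
    (hQ : ∀ m', m' r = e.eval C.I σ.mem → (∀ i, i ≠ r → m' i = σ.mem i) → Q ⟨m', σ.out⟩) :
    Run C (put r e) σ (e.cost + 2) Q := by
  refine (Run.assign (a := .lit r) trivial he ?_ ?_ hge (fun _ => hv) ?_).time ?_
  · exact ⟨by simp [Expr.eval], by simpa [Expr.eval] using C.lt_sp hr⟩
  · simp [Expr.maxGrade]; omega
  · exact hQ _ (by simp [Expr.eval]) fun i hi => by simp [Expr.eval, hi]
  · simp [Expr.cost]; omega

theorem Run.put {r : ℕ} {e : Expr} (hr : r < 72) (hg : e.grade ≤ 20) (hge : e.maxGrade < 1000)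
    (he : e.Good C σ.mem)
    (hQ : ∀ m', m' r = e.eval C.I σ.mem → (∀ i, i ≠ r → m' i = σ.mem i) → Q ⟨m', σ.out⟩) :
    Run C (put r e) σ (e.cost + 2) Q :=
  .memOk fun hm => .putDyn hr hge he ((Expr.bd_eval hm e).mono hg) hQ

theorem Run.write {e : Expr} (hge : e.maxGrade < 1000) (he : e.Good C σ.mem)
    (hQ : Q ⟨σ.mem, σ.out ++ [e.eval C.I σ.mem]⟩) :
    Run C (.write e) σ (e.cost + 1) Q :=
  fun hm => ⟨_, _, .write σ e (he.ok hm hge), le_rfl, hm, hQ⟩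

/-- The sum of the bounds of the two branches stands in for their maximum; only constants are lost.
-/
theorem Run.ite {e : Expr} {c d : Cmd} {T U : ℕ} (hge : e.maxGrade < 1000) (he : e.Good C σ.mem)
    (hc : 0 < e.eval C.I σ.mem → Run C c σ T Q) (hd : ¬ 0 < e.eval C.I σ.mem → Run C d σ U Q) :
    Run C (.ite e c d) σ (e.cost + 1 + (T + U)) Q := by
  intro hm
  by_cases h : 0 < e.eval C.I σ.mem
  · obtain ⟨t, σ', h1, h2, h3, h4⟩ := hc h hm
    exact ⟨_, σ', .ite_pos _ _ _ _ _ _ (he.ok hm hge) h h1, by omega, h3, h4⟩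
  · obtain ⟨t, σ', h1, h2, h3, h4⟩ := hd h hm
    exact ⟨_, σ', .ite_neg _ _ _ _ _ _ (he.ok hm hge) h h1, by omega, h3, h4⟩

/-- A loop with invariant `J`, where `J j σ` says that at most `j` iterations remain. -/
theorem Run.loop {e : Expr} {c : Cmd} {T : ℕ} (J : ℕ → State → Prop) (hge : e.maxGrade < 1000)
    (hgood : ∀ j σ, J j σ → e.Good C σ.mem)
    (hstep : ∀ j σ, J j σ → 0 < e.eval C.I σ.mem →
      ∃ j', j = j' + 1 ∧ Run C c σ T (J j'))
    (hend : ∀ j σ, J j σ → ¬ 0 < e.eval C.I σ.mem → Q σ) (j : ℕ) (hJ : J j σ) :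
    Run C (.loop e c) σ (j * (e.cost + 1 + T) + (e.cost + 1)) Q := by
  induction j using Nat.strong_induction_on generalizing σ with
  | _ j ih =>
    intro hm
    by_cases h : 0 < e.eval C.I σ.mem
    · obtain ⟨j', rfl, hr⟩ := hstep j σ hJ h
      obtain ⟨t, σ', h1, h2, h3, h4⟩ := hr hm
      obtain ⟨u, σ'', h5, h6, h7, h8⟩ := ih j' (by omega) h4 h3
      refine ⟨_, σ'', .loop_step _ _ _ _ _ _ _ ((hgood _ _ hJ).ok hm hge) h h1 h5, ?_, h7, h8⟩
      nlinarith
    · exact ⟨_, σ, Exec.loop_stop _ _ _ ((hgood _ _ hJ).ok hm hge) h, by omega, hm, hend _ _ hJ h⟩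

end RunRules

section Eval
variable {C : Env} {I : List ℤ} {m : ℕ → ℤ}

@[simp] theorem eval_rg (r : ℕ) : (rg r).eval I m = m r := rfl
@[simp] theorem eval_add (a b : Expr) : (a + b).eval I m = a.eval I m + b.eval I m := rfl
@[simp] theorem eval_sub (a b : Expr) : (a - b).eval I m = a.eval I m - b.eval I m := rfl
@[simp] theorem eval_mul (a b : Expr) : (a * b).eval I m = a.eval I m * b.eval I m := rfl
@[simp] theorem eval_div (a b : Expr) : (a / b).eval I m = a.eval I m / b.eval I m := rfl
@[simp] theorem eval_ofNat (j : ℕ) : (ofNat(j) : Expr).eval I m = (ofNat(j) : ℤ) := rfl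
@[simp] theorem eval_lit (c : ℤ) : (Expr.lit c).eval I m = c := rfl
@[simp] theorem good_add (a b : Expr) : (a + b).Good C m ↔ a.Good C m ∧ b.Good C m := Iff.rfl
@[simp] theorem good_sub (a b : Expr) : (a - b).Good C m ↔ a.Good C m ∧ b.Good C m := Iff.rfl
@[simp] theorem good_mul (a b : Expr) : (a * b).Good C m ↔ a.Good C m ∧ b.Good C m := Iff.rfl
@[simp] theorem good_div (a b : Expr) : (a / b).Good C m ↔ a.Good C m ∧ b.Good C m := Iff.rfl
@[simp] theorem good_ofNat (j : ℕ) : (ofNat(j) : Expr).Good C m := trivial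

theorem good_rg {r : ℕ} (hr : r < 72) : (rg r).Good C m :=
  ⟨trivial, by simp [Expr.eval], by simpa [Expr.eval] using C.lt_sp hr⟩

end Eval

/-- The input numbers `n`, `s` and `k`. -/
def nE : Expr := .inp 0
def sE : Expr := .inp 1
def kE : Expr := .inp 2

section Inputs
variable {C : Env} {m : ℕ → ℤ}

@[simp] theorem eval_nE : nE.eval C.I m = C.n := C.inp0
@[simp] theorem eval_sE : sE.eval C.I m = C.s := C.inp1
@[simp] theorem eval_kE : kE.eval C.I m = C.k := C.inp2

theorem good_inp_lit {j : ℕ} (hj : j < 5) : (Expr.inp (.lit j)).Good C m :=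
  ⟨trivial, by simp [Expr.eval], by have := C.length; simp only [Expr.eval]; omega⟩

@[simp] theorem good_nE : nE.Good C m := good_inp_lit (j := 0) (by norm_num)
@[simp] theorem good_sE : sE.Good C m := good_inp_lit (j := 1) (by norm_num)
@[simp] theorem good_kE : kE.Good C m := good_inp_lit (j := 2) (by norm_num)

end Inputs

/-! ### Vertices and segments -/

/-- The horizontal coordinate, relative to the query point, of the vertex with number `u`. -/
def px (I : List ℤ) (u : ℤ) : ℤ := I.getD (5 + 2 * u).toNat 0 - I.getD 3 0

/-- The vertical coordinate, relative to the query point, of the vertex with number `u`. -/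
def py (I : List ℤ) (u : ℤ) : ℤ := I.getD (6 + 2 * u).toNat 0 - I.getD 4 0

/-- The cross product of two vertices, relative to the query point. -/
def cr (I : List ℤ) (u v : ℤ) : ℤ := px I u * py I v - py I u * px I v

/-- The inner product of two vertices, relative to the query point. -/
def dt (I : List ℤ) (u v : ℤ) : ℤ := px I u * px I v + py I u * py I v

/-- An expression for `px`. -/
def pxE (u : Expr) : Expr := .inp (5 + 2 * u) - .inp 3

/-- An expression for `py`. -/
def pyE (u : Expr) : Expr := .inp (6 + 2 * u) - .inp 4

/-- An expression for `cr`. -/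
def crE (u v : Expr) : Expr := pxE u * pyE v - pyE u * pxE v

/-- An expression for `dt`. -/
def dtE (u v : Expr) : Expr := pxE u * pxE v + pyE u * pyE v

section Vertices
variable {C : Env} {m : ℕ → ℤ}

@[simp] theorem eval_crE (u v : Expr) :
    (crE u v).eval C.I m = cr C.I (u.eval C.I m) (v.eval C.I m) := rfl

@[simp] theorem eval_dtE (u v : Expr) :
    (dtE u v).eval C.I m = dt C.I (u.eval C.I m) (v.eval C.I m) := rfl

/-- `u` is a good expression for the number of a vertex. -/
def VGood (C : Env) (m : ℕ → ℤ) (u : Expr) : Prop :=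
  u.Good C m ∧ 0 ≤ u.eval C.I m ∧ u.eval C.I m < 2 * C.n

theorem VGood.pxE {u : Expr} (h : VGood C m u) : (pxE u).Good C m := by
  refine ⟨⟨⟨trivial, trivial, h.1⟩, ?_⟩, good_inp_lit (j := 3) (by norm_num)⟩
  have h1 := h.2.1
  have h2 := h.2.2
  have := C.length
  constructor <;> simp only [eval_add, eval_mul, eval_ofNat] <;> omega

theorem VGood.pyE {u : Expr} (h : VGood C m u) : (pyE u).Good C m := by
  refine ⟨⟨⟨trivial, trivial, h.1⟩, ?_⟩, good_inp_lit (j := 4) (by norm_num)⟩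
  have h1 := h.2.1
  have h2 := h.2.2
  have := C.length
  constructor <;> simp only [eval_add, eval_mul, eval_ofNat] <;> omega

theorem VGood.crE {u v : Expr} (hu : VGood C m u) (hv : VGood C m v) : (crE u v).Good C m :=
  ⟨⟨hu.pxE, hv.pyE⟩, hu.pyE, hv.pxE⟩

theorem VGood.dtE {u v : Expr} (hu : VGood C m u) (hv : VGood C m v) : (dtE u v).Good C m :=
  ⟨⟨hu.pxE, hv.pxE⟩, hu.pyE, hv.pyE⟩

end Vertices

/-- The endpoint of segment `x` that comes first in counterclockwise order. -/
def sa (I : List ℤ) (x : ℤ) : ℤ := if 0 < cr I (2 * x) (2 * x + 1) then 2 * x else 2 * x + 1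

/-- The endpoint of segment `x` that comes last in counterclockwise order. -/
def sb (I : List ℤ) (x : ℤ) : ℤ := if 0 < cr I (2 * x) (2 * x + 1) then 2 * x + 1 else 2 * x

/-- The distance from the query point to the segment `x` on the ray through `v` is
`X x / D v x` times the distance to `v`. -/
def X (I : List ℤ) (x : ℤ) : ℤ := cr I (sa I x) (sb I x)

/-- This is linear in the vector of `v`. Hence inverse distances interpolate linearly between two
directions, on which the constancy of the order in a gap rests. -/
def D (I : List ℤ) (v x : ℤ) : ℤ := cr I (sa I x) v + cr I v (sb I x)

/-- Segment `x` meets the rays that come immediately after the one through `v`. -/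
def Act (I : List ℤ) (v x : ℤ) : Prop := 0 ≤ cr I (sa I x) v ∧ 0 < cr I v (sb I x)

/-- Segment `x` meets the rays that come immediately before the one through `v`. -/
def Bef (I : List ℤ) (v x : ℤ) : Prop := 0 < cr I (sa I x) v ∧ 0 ≤ cr I v (sb I x)

/-- Run a program with expressions for the endpoints of segment `x` in counterclockwise order. -/
def withSeg (x : Expr) (f : Expr → Expr → Cmd) : Cmd :=
  .ite (crE (2 * x) (2 * x + 1)) (f (2 * x) (2 * x + 1)) (f (2 * x + 1) (2 * x))

/-- `a` and `b` are expressions for the endpoints, in counterclockwise order, of the segment with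
the number `y`, which is the value of `x`. -/
structure SegExprs (C : Env) (x : Expr) (y : ℤ) (a b : Expr) : Prop where
  lo : 0 ≤ y
  hi : y < C.n
  cases : a = 2 * x ∧ sa C.I y = 2 * y ∧ b = 2 * x + 1 ∧ sb C.I y = 2 * y + 1 ∨
    a = 2 * x + 1 ∧ sa C.I y = 2 * y + 1 ∧ b = 2 * x ∧ sb C.I y = 2 * y

section
variable {C : Env} {σ : State} {Q : State → Prop} {x : Expr} {m : ℕ → ℤ} {a b : Expr} {y : ℤ}

theorem SegExprs.eval_left (h : SegExprs C x y a b) (hx : x.eval C.I m = y) :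
    a.eval C.I m = sa C.I y := by
  rcases h.cases with ⟨rfl, h1, -, -⟩ | ⟨rfl, h1, -, -⟩ <;> simp [h1, hx]

theorem SegExprs.eval_right (h : SegExprs C x y a b) (hx : x.eval C.I m = y) :
    b.eval C.I m = sb C.I y := by
  rcases h.cases with ⟨-, -, rfl, h1⟩ | ⟨-, -, rfl, h1⟩ <;> simp [h1, hx]

theorem SegExprs.good_left (h : SegExprs C x y a b) (hg : x.Good C m) (hx : x.eval C.I m = y) :
    VGood C m a := by
  have := h.lo
  have := h.hi
  rcases h.cases with ⟨rfl, h1, -, -⟩ | ⟨rfl, h1, -, -⟩ <;>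
    exact ⟨by simp [hg], by simp [hx]; omega, by simp [hx]; omega⟩

theorem SegExprs.good_right (h : SegExprs C x y a b) (hg : x.Good C m) (hx : x.eval C.I m = y) :
    VGood C m b := by
  have := h.lo
  have := h.hi
  rcases h.cases with ⟨-, -, rfl, h1⟩ | ⟨-, -, rfl, h1⟩ <;>
    exact ⟨by simp [hg], by simp [hx]; omega, by simp [hx]; omega⟩

theorem Run.withSeg {f : Expr → Expr → Cmd} {T U : ℕ} {y : ℤ}
    (hx : x.Good C σ.mem) (hy : x.eval C.I σ.mem = y) (h0 : 0 ≤ y) (h1 : y < C.n)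
    (hg : (crE (2 * x) (2 * x + 1)).maxGrade < 1000)
    (h : ∀ a b, SegExprs C x y a b → Run C (f a b) σ T Q)
    (hU : (crE (2 * x) (2 * x + 1)).cost + 1 + (T + T) ≤ U) :
    Run C (withSeg x f) σ U Q := by
  have ha : VGood C σ.mem (2 * x) := ⟨⟨trivial, hx⟩, by simp; omega, by simp; omega⟩
  have hb : VGood C σ.mem (2 * x + 1) := ⟨⟨⟨trivial, hx⟩, trivial⟩, by simp; omega, by simp; omega⟩
  refine (Run.ite hg (ha.crE hb) (fun hc => ?_) (fun hc => ?_)).time hU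
  · simp only [eval_crE, eval_add, eval_mul, eval_ofNat, hy] at hc
    exact h _ _ ⟨h0, h1, .inl ⟨rfl, by simp [sa, hc], rfl, by simp [sb, hc]⟩⟩
  · simp only [eval_crE, eval_add, eval_mul, eval_ofNat, hy] at hc
    exact h _ _ ⟨h0, h1, .inr ⟨rfl, by simp [sa, hc], rfl, by simp [sb, hc]⟩⟩

end

end KVis


namespace KVis

/-! ### Keys -/

instance (I : List ℤ) (v x : ℤ) : Decidable (Act I v x) := by unfold Act; infer_instance

/-- The key of segment `x`, where the threshold segment has the distance `EX / ED`: for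
`far = true` the distance of `x` if `x` is farther than the threshold, and for `far = false` the
inverse of the distance of `x` if `x` is nearer. Segments that do not count get the key
`1 / 0`. -/
def segKey (far : Bool) (I : List ℤ) (v lim EX ED x : ℤ) : ℤ × ℤ :=
  if x < lim ∧ Act I v x ∧
      (if far then EX * D I v x < X I x * ED else X I x * ED < EX * D I v x) then
    (if far then (X I x, D I v x) else (D I v x, X I x))
  else (1, 0)

/-- Expressions for `X` and `D` at the vertex in register `0`. -/
def xE (a b : Expr) : Expr := crE a b
def dE (a b : Expr) : Expr := crE a (rg 0) + crE (rg 0) b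

/-- `0 < gtE a b` if the segment with the endpoints `a` and `b` is farther than the threshold. -/
def gtE (a b : Expr) : Expr := xE a b * rg 3 - rg 2 * dE a b
/-- `0 < ltE a b` if the segment with the endpoints `a` and `b` is nearer than the threshold. -/
def ltE (a b : Expr) : Expr := rg 2 * dE a b - xE a b * rg 3

section
variable {C : Env} {m : ℕ → ℤ} {a b x : Expr} {y : ℤ}

theorem SegExprs.eval_xE (h : SegExprs C x y a b) (hx : x.eval C.I m = y) :
    (xE a b).eval C.I m = X C.I y := by
  simp [xE, X, h.eval_left hx, h.eval_right hx]

theorem SegExprs.eval_dE (h : SegExprs C x y a b) (hx : x.eval C.I m = y) :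
    (dE a b).eval C.I m = D C.I (m 0) y := by
  simp [dE, D, h.eval_left hx, h.eval_right hx]

theorem SegExprs.eval_gtE (h : SegExprs C x y a b) (hx : x.eval C.I m = y) :
    (gtE a b).eval C.I m = X C.I y * m 3 - m 2 * D C.I (m 0) y := by
  simp [gtE, h.eval_xE hx, h.eval_dE hx]

theorem SegExprs.eval_ltE (h : SegExprs C x y a b) (hx : x.eval C.I m = y) :
    (ltE a b).eval C.I m = m 2 * D C.I (m 0) y - X C.I y * m 3 := by
  simp [ltE, h.eval_xE hx, h.eval_dE hx]

theorem VGood.rg {r : ℕ} (hr : r < 72) (h0 : 0 ≤ m r) (h1 : m r < 2 * C.n) :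
    VGood C m (rg r) := ⟨good_rg hr, h0, h1⟩

theorem SegExprs.good_xE (h : SegExprs C x y a b) (hg : x.Good C m) (hx : x.eval C.I m = y) :
    (xE a b).Good C m := (h.good_left hg hx).crE (h.good_right hg hx)

theorem SegExprs.good_dE (h : SegExprs C x y a b) (hg : x.Good C m) (hx : x.eval C.I m = y)
    (hv : VGood C m (KVis.rg 0)) : (dE a b).Good C m :=
  ⟨(h.good_left hg hx).crE hv, hv.crE (h.good_right hg hx)⟩

theorem SegExprs.good_gtE (h : SegExprs C x y a b) (hg : x.Good C m) (hx : x.eval C.I m = y)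
    (hv : VGood C m (KVis.rg 0)) : (gtE a b).Good C m :=
  ⟨⟨h.good_xE hg hx, good_rg (by norm_num)⟩, good_rg (by norm_num), h.good_dE hg hx hv⟩

theorem SegExprs.good_ltE (h : SegExprs C x y a b) (hg : x.Good C m) (hx : x.eval C.I m = y)
    (hv : VGood C m (KVis.rg 0)) : (ltE a b).Good C m :=
  ⟨⟨good_rg (by norm_num), h.good_dE hg hx hv⟩, h.good_xE hg hx, good_rg (by norm_num)⟩

theorem VGood.congr {m' : ℕ → ℤ} {r : ℕ} (hr : r < 72) (h : VGood C m (KVis.rg r))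
    (hm : m' r = m r) : VGood C m' (KVis.rg r) :=
  ⟨good_rg hr, by simpa [hm] using h.2.1, by simpa [hm] using h.2.2⟩

end

/-- Store the key of the segment in register `40` in the registers `41` and `42`. -/
def segKeyCmd (far : Bool) : Cmd :=
  put 41 1 ;; put 42 0 ;;
  .ite (rg 4 - rg 40)
    (withSeg (rg 40) fun a b =>
      -- Tests are strict; on integers `0 < c + 1` is the weak test `0 ≤ c` that the first half of
      -- `Act` needs.
      .ite (crE a (rg 0) + 1)
        (.ite (crE (rg 0) b)
          (.ite (if far then gtE a b else ltE a b)
            (put 41 (if far then xE a b else dE a b) ;; put 42 (if far then dE a b else xE a b))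
            .skip)
          .skip)
        .skip)
    .skip

/-- The effect of a program that computes the key `K x` of the number `x` in register `40`. -/
def KeyPost (K : ℤ → ℤ × ℤ) (σ σ' : State) : Prop :=
  σ'.out = σ.out ∧ σ'.mem 41 = (K (σ.mem 40)).1 ∧ σ'.mem 42 = (K (σ.mem 40)).2 ∧
    ∀ r, r ≠ 41 → r ≠ 42 → σ'.mem r = σ.mem r

theorem run_segKeyCmd {C : Env} (far : Bool) {σ : State} (hv : VGood C σ.mem (rg 0))
    (hlim : σ.mem 4 ≤ C.n) (hx : 0 ≤ σ.mem 40) :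
    Run C (segKeyCmd far) σ 3000
      (KeyPost (segKey far C.I (σ.mem 0) (σ.mem 4) (σ.mem 2) (σ.mem 3)) σ) := by
  refine (Run.seq <| Run.put (by norm_num) (by decide) (by decide) (by simp) fun m₁ e₁ f₁ =>
    Run.seq <| Run.put (by norm_num) (by decide) (by decide) (by simp) fun m₂ e₂ f₂ =>
    Run.ite (T := 2000) (U := 1) (by decide)
      (by simp [good_rg]) (fun h => ?_) (fun h => Run.skip ?_)).time (by decide)
  · simp [f₁, f₂] at h
    have h40 : (rg 40).eval C.I m₂ = σ.mem 40 := by simp [f₁, f₂]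
    refine Run.withSeg (T := 900) (good_rg (by norm_num)) h40 hx
      (by omega) (by decide) (fun a b hab => ?_) (by decide)
    have hv' := hv.congr (by norm_num) (show m₂ 0 = σ.mem 0 by simp [f₁, f₂])
    have hg := good_rg (C := C) (m := m₂) (r := 40) (by norm_num)
    have g : (crE a (rg 0) + 1).maxGrade < 1000 ∧ (crE (rg 0) b).maxGrade < 1000 ∧
        (if far then gtE a b else ltE a b).maxGrade < 1000 ∧
        (if far then xE a b else dE a b).grade ≤ 20 ∧
        (if far then xE a b else dE a b).maxGrade < 1000 ∧
        (if far then dE a b else xE a b).grade ≤ 20 ∧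
        (if far then dE a b else xE a b).maxGrade < 1000 ∧
        (crE a (rg 0) + 1).cost + (crE (rg 0) b).cost + (if far then gtE a b else ltE a b).cost +
        (if far then xE a b else dE a b).cost + (if far then dE a b else xE a b).cost < 800 := by
      rcases hab.cases with ⟨rfl, -, rfl, -⟩ | ⟨rfl, -, rfl, -⟩ <;> cases far <;> decide
    obtain ⟨g1, g2, g3, g4, g5, g6, g7, g8⟩ := g
    refine (Run.ite g1 ⟨(hab.good_left hg h40).crE hv', trivial⟩
      (fun h1 => Run.ite g2 (hv'.crE (hab.good_right hg h40))
      (fun h2 => Run.ite g3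
        (by cases far; exacts [hab.good_ltE hg h40 hv', hab.good_gtE hg h40 hv']) (fun h3 =>
        Run.seq <| Run.put (by norm_num) g4 g5
          (by cases far; exacts [hab.good_dE hg h40 hv', hab.good_xE hg h40]) fun m₃ e₃ f₃ =>
          Run.put (by norm_num) g6 g7 (by
            have hg' := good_rg (C := C) (m := m₃) (r := 40) (by norm_num)
            have h40' : (rg 40).eval C.I m₃ = σ.mem 40 := by simp [f₁, f₂, f₃]
            have hv'' := hv'.congr (by norm_num) (show m₃ 0 = m₂ 0 by simp [f₃])
            cases far; exacts [hab.good_xE hg' h40', hab.good_dE hg' h40' hv''])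
            fun m₄ e₄ f₄ => ?_) (fun h3 => Run.skip ?_))
        (fun h2 => Run.skip ?_)) (fun h1 => Run.skip ?_)).time (by omega)
    · have h40' : (rg 40).eval C.I m₃ = σ.mem 40 := by simp [f₁, f₂, f₃]
      refine ⟨rfl, ?_, ?_, fun r hr hr' => by simp [f₄, f₃, f₂, f₁, hr, hr']⟩ <;> cases far <;>
        simp_all [hab.eval_xE h40, hab.eval_dE h40, hab.eval_gtE h40, hab.eval_ltE h40,
          hab.eval_xE h40', hab.eval_dE h40', segKey, Act, hab.eval_left h40, hab.eval_right h40]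
    all_goals
      refine ⟨rfl, ?_, ?_, fun r hr hr' => by simp [f₂, f₁, hr, hr']⟩ <;> cases far <;>
        simp_all [hab.eval_gtE h40, hab.eval_ltE h40, segKey, Act, hab.eval_left h40,
          hab.eval_right h40] <;>
        first
        | rw [if_neg (not_lt.mpr h3)]
        | rw [if_neg fun h => absurd h.1 (not_lt.mpr h2)]
        | rw [if_neg fun h => absurd h.1.1 (not_le.mpr h1)]
  · simp [f₁, f₂] at h
    refine ⟨rfl, ?_, ?_, fun r hr hr' => by simp [f₂, f₁, hr, hr']⟩ <;>
      simp [segKey, f₂, e₁, e₂, not_lt.mpr h]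

end KVis


namespace KVis

/-! ### Tournament trees -/

/-- The comparison of keys, as the programs do it. -/
def KeyLt (p q : ℤ × ℤ) : Prop := p.1 * q.2 < q.1 * p.2

/-- A key is a fraction with positive denominator or the pair `(1, 0)`. -/
def ValidKey (p : ℤ × ℤ) : Prop := 0 < p.2 ∨ p = (1, 0)

/-- The value of a key. -/
noncomputable def keyVal (p : ℤ × ℤ) : WithTop ℚ := if 0 < p.2 then ((p.1 / p.2 : ℚ) : WithTop ℚ) else ⊤

theorem keyVal_top : keyVal (1, 0) = ⊤ := by simp [keyVal]

theorem keyVal_eq_top {p : ℤ × ℤ} (hp : ValidKey p) : keyVal p = ⊤ ↔ p = (1, 0) := by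
  rcases hp with hp | rfl
  · have : p ≠ (1, 0) := by rintro rfl; simp at hp
    simp [keyVal, hp, this]
  · simp [keyVal]

/-- Cross multiplication treats `(1, 0)` as infinity without a special case: `p.1 * 0 < 1 * p.2`
says that the denominator of `p` is positive. So the programs never have to ask whether a key is
finite. -/
theorem keyLt_iff {p q : ℤ × ℤ} (hp : ValidKey p) (hq : ValidKey q) :
    KeyLt p q ↔ keyVal p < keyVal q := by
  rcases hp with hp | rfl <;> rcases hq with hq | rfl
  · have hp' : (0 : ℚ) < p.2 := by exact_mod_cast hp
    have hq' : (0 : ℚ) < q.2 := by exact_mod_cast hq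
    simp only [keyVal, hp, hq, if_true, WithTop.coe_lt_coe, KeyLt]
    rw [div_lt_div_iff₀ hp' hq']
    exact_mod_cast Iff.rfl
  · simp only [keyVal, hp, if_true, KeyLt]
    simp [hp]
  · simp only [keyVal, hq, if_true, KeyLt]
    simp [hq.le]
  · simp [keyVal, KeyLt]

/-- `w` is a winner among the numbers that satisfy `S`, that is, one with the smallest key; if
there is none with a finite key, it is the number `M`. -/
def IsWin (K : ℤ → ℤ × ℤ) (M : ℤ) (S : ℤ → Prop) (w : ℤ) : Prop :=
  (w = M ∨ S w ∧ keyVal (K w) ≠ ⊤) ∧ ∀ y, S y → keyVal (K w) ≤ keyVal (K y)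

section
variable {K : ℤ → ℤ × ℤ} {M : ℤ} {S S' : ℤ → Prop} {w w' : ℤ}

theorem IsWin.congr (h : IsWin K M S w) (hS : ∀ y, S y ↔ S' y) : IsWin K M S' w := by
  have : S = S' := funext fun y => propext (hS y)
  rwa [← this]

theorem isWin_empty (hS : ∀ y, ¬ S y) : IsWin K M S M :=
  ⟨.inl rfl, fun y hy => absurd hy (hS y)⟩

theorem IsWin.union (h : IsWin K M S w) (h' : IsWin K M S' w')
    (hw : ValidKey (K w)) (hw' : ValidKey (K w')) :
    (KeyLt (K w') (K w) → IsWin K M (fun y => S y ∨ S' y) w') ∧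
      (¬ KeyLt (K w') (K w) → IsWin K M (fun y => S y ∨ S' y) w) := by
  rw [keyLt_iff hw' hw]
  constructor
  · intro hlt
    refine ⟨h'.1.imp_right fun h => ⟨.inr h.1, h.2⟩, fun y hy => ?_⟩
    rcases hy with hy | hy
    · exact hlt.le.trans (h.2 y hy)
    · exact h'.2 y hy
  · intro hle
    refine ⟨h.1.imp_right fun h => ⟨.inl h.1, h.2⟩, fun y hy => ?_⟩
    rcases hy with hy | hy
    · exact h.2 y hy
    · exact (not_lt.mp hle).trans (h'.2 y hy)

/-- A number that wins a strict comparison has a finite key, whatever it beats. This is what allows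
it to replace the default `M`. -/
theorem IsWin.insert (h : IsWin K M S w) (hw : ValidKey (K w)) (hw' : ValidKey (K w')) :
    (KeyLt (K w') (K w) → IsWin K M (fun y => S y ∨ y = w') w') ∧
      (¬ KeyLt (K w') (K w) → IsWin K M (fun y => S y ∨ y = w') w) := by
  rw [keyLt_iff hw' hw]
  constructor
  · intro hlt
    refine ⟨.inr ⟨.inr rfl, (hlt.trans_le le_top).ne⟩, fun y hy => ?_⟩
    rcases hy with hy | rfl
    · exact hlt.le.trans (h.2 y hy)
    · exact le_rfl
  · intro hle
    refine ⟨h.1.imp_right fun h => ⟨.inl h.1, h.2⟩, fun y hy => ?_⟩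
    rcases hy with hy | rfl
    · exact h.2 y hy
    · exact not_lt.mp hle

end

/-- In a binary tree in which node `x` has the children `2 * x` and `2 * x + 1`, node `y` lies in
the subtree of node `x`. -/
def Below (x y : ℕ) : Prop := ∃ j, y / 2 ^ j = x

theorem below_self (x : ℕ) : Below x x := ⟨0, by simp⟩

theorem below_zero {x : ℕ} (hx : 1 ≤ x) : ¬ Below x 0 := by
  rintro ⟨j, hj⟩
  simp at hj
  omega

theorem Below.le {x y : ℕ} (h : Below x y) : x ≤ y := by
  obtain ⟨j, rfl⟩ := h
  exact Nat.div_le_self _ _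

theorem below_half {x y : ℕ} : Below x y ↔ x = y ∨ Below x (y / 2) := by
  constructor
  · rintro ⟨j, rfl⟩
    cases j with
    | zero => left; simp
    | succ j => right; exact ⟨j, by rw [Nat.div_div_eq_div_mul, pow_succ']⟩
  · rintro (rfl | ⟨j, rfl⟩)
    · exact below_self x
    · exact ⟨j + 1, by rw [Nat.div_div_eq_div_mul, pow_succ']⟩

theorem below_children {x y : ℕ} : Below x y ↔ x = y ∨ Below (2 * x) y ∨ Below (2 * x + 1) y := by
  constructor
  · rintro ⟨j, rfl⟩
    cases j with
    | zero => left; simp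
    | succ j =>
      right
      have h : y / 2 ^ (j + 1) = y / 2 ^ j / 2 := by rw [pow_succ, Nat.div_div_eq_div_mul]
      rcases Nat.even_or_odd' (y / 2 ^ j) with ⟨c, hc | hc⟩
      · left; exact ⟨j, by omega⟩
      · right; exact ⟨j, by omega⟩
  · rintro (rfl | ⟨j, h⟩ | ⟨j, h⟩)
    · exact below_self _
    · refine ⟨j + 1, ?_⟩
      rw [pow_succ, ← Nat.div_div_eq_div_mul]; omega
    · refine ⟨j + 1, ?_⟩
      rw [pow_succ, ← Nat.div_div_eq_div_mul]; omega

theorem below_one {y : ℕ} (hy : 1 ≤ y) : Below 1 y := by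
  induction y using Nat.strong_induction_on with
  | _ y ih =>
    rw [below_half]
    by_cases h : 1 = y
    · exact .inl h
    · exact .inr (ih _ (by omega) (by omega))

/-- A proper ancestor of node `s + c` is at most `(s + c) / 2 < s`, hence not a leaf. The number of
leaves need not be a power of two. -/
theorem below_leaf {s b c : ℕ} (hc : c < s) : Below (s + b) (s + c) ↔ c = b := by
  constructor
  · intro h
    rcases below_half.mp h with h | h
    · omega
    · have := h.le
      omega
  · rintro rfl; exact below_self _

/-- The number `y` is stored in a leaf below the node `x` of a tree with `s` leaves, each of
which holds a block of `sz` consecutive numbers. -/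
def InTree (s : ℕ) (M sz : ℤ) (x : ℕ) (y : ℤ) : Prop :=
  0 ≤ y ∧ y < M ∧ Below x (s + (y / sz).toNat)

/-- All nodes of the tree number `τ` contain numbers between `0` and `M`. -/
def TreeRange (s τ : ℕ) (M : ℤ) (m : ℕ → ℤ) : Prop :=
  ∀ x : ℕ, 1 ≤ x → x < 2 * s → 0 ≤ m (64 + 4 * x + τ) ∧ m (64 + 4 * x + τ) ≤ M

/-- The tree number `τ` is correct, except for the nodes above dirty leaves. -/
def TreeOk (K : ℤ → ℤ × ℤ) (s τ : ℕ) (M sz : ℤ) (dirty : Set ℕ) (m : ℕ → ℤ) : Prop :=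
  TreeRange s τ M m ∧ ∀ x : ℕ, 1 ≤ x → x < 2 * s → (∀ b ∈ dirty, ¬ Below x (s + b)) →
    IsWin K M (InTree s M sz x) (m (64 + 4 * x + τ))

theorem TreeOk.root {K : ℤ → ℤ × ℤ} {s τ : ℕ} {M sz : ℤ} {m : ℕ → ℤ} (hs : 1 ≤ s)
    (h : TreeOk K s τ M sz ∅ m) : IsWin K M (fun y => 0 ≤ y ∧ y < M) (m (68 + τ)) :=
  (h.2 1 le_rfl (by omega) (by simp)).congr fun y =>
    ⟨fun h => ⟨h.1, h.2.1⟩, fun h => ⟨h.1, h.2, below_one (by omega)⟩⟩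

/-- A tree remains correct, except for dirty leaves, if the keys of the numbers in the other
leaves change, but their order does not. -/
theorem TreeOk.transfer {K K' : ℤ → ℤ × ℤ} {s τ : ℕ} {M sz : ℤ} {dirty dirty' : Set ℕ}
    {m m' : ℕ → ℤ} (h : TreeOk K s τ M sz dirty m) (hm : ∀ r, 64 ≤ r → m' r = m r)
    (hM : K M = (1, 0)) (hM' : K' M = (1, 0)) (hd : dirty ⊆ dirty')
    (hK : ∀ y, 0 ≤ y → y < M → (y / sz).toNat ∉ dirty' →
      (keyVal (K y) = ⊤ ↔ keyVal (K' y) = ⊤) ∧ ∀ z, 0 ≤ z → z < M → (z / sz).toNat ∉ dirty' →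
        keyVal (K y) ≤ keyVal (K z) → keyVal (K' y) ≤ keyVal (K' z)) :
    TreeOk K' s τ M sz dirty' m' := by
  refine ⟨fun x h1 h2 => by rw [hm _ (by omega)]; exact h.1 x h1 h2, fun x h1 h2 hx => ?_⟩
  rw [hm _ (by omega)]
  obtain ⟨h3, h4⟩ := h.2 x h1 h2 fun b hb => hx b (hd hb)
  set w := m (64 + 4 * x + τ)
  have key : ∀ y, InTree s M sz x y → (y / sz).toNat ∉ dirty' := fun y hy hb =>
    hx _ hb hy.2.2
  have hMtop : keyVal (K M) = ⊤ := by rw [hM, keyVal_top]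
  have hMtop' : keyVal (K' M) = ⊤ := by rw [hM', keyVal_top]
  -- A stored default `M` means that all keys below the node were infinite, and infinite keys stay
  -- infinite; otherwise the winner keeps a finite key and its order relative to the others.
  rcases h3 with h3 | ⟨h3, h5⟩
  · refine ⟨.inl h3, fun y hy => ?_⟩
    have := h4 y hy
    rw [h3, hMtop, top_le_iff, (hK y hy.1 hy.2.1 (key y hy)).1] at this
    rw [this]; exact le_top
  · refine ⟨.inr ⟨h3, ?_⟩, fun y hy => ?_⟩
    · rwa [Ne, ← (hK w h3.1 h3.2.1 (key w h3)).1]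
    · exact (hK w h3.1 h3.2.1 (key w h3)).2 y hy.1 hy.2.1 (key y hy) (h4 y hy)

theorem TreeOk.congr_mem {K : ℤ → ℤ × ℤ} {s τ : ℕ} {M sz : ℤ} {dirty : Set ℕ}
    {m m' : ℕ → ℤ} (h : TreeOk K s τ M sz dirty m)
    (hm : ∀ x : ℕ, 1 ≤ x → x < 2 * s → m' (64 + 4 * x + τ) = m (64 + 4 * x + τ)) :
    TreeOk K s τ M sz dirty m' :=
  ⟨fun x h1 h2 => by rw [hm x h1 h2]; exact h.1 x h1 h2,
    fun x h1 h2 hx => by rw [hm x h1 h2]; exact h.2 x h1 h2 hx⟩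

end KVis

/-! ### Recomputing a leaf of a tournament tree and its ancestors -/

namespace KVis

/-- The address of node `e` of the tree number `τ`. -/
def nodeE (τ : ℕ) (e : Expr) : Expr := 64 + 4 * e + .lit τ

/-- The cell of node `e` of the tree number `τ`. -/
def treeE (τ : ℕ) (e : Expr) : Expr := .cell (nodeE τ e)

/-- Recompute the leaf with the number in register `30` of the tree number `τ`, and the nodes
above it. The leaf holds a block of `size` of the numbers below `M`. -/
def refresh (τ : ℕ) (size M : Expr) (key : Cmd) : Cmd :=
  put 40 (rg 30 * size) ;; put 32 (rg 40 + size) ;; .ite (rg 32 - M) (put 32 M) .skip ;;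
  put 33 M ;; put 34 1 ;; put 35 0 ;;
  .loop (rg 32 - rg 40)
    (key ;;
      .ite (rg 34 * rg 42 - rg 41 * rg 35) (put 33 (rg 40) ;; put 34 (rg 41) ;; put 35 (rg 42))
        .skip ;;
      put 40 (rg 40 + 1)) ;;
  -- Leaf `b` is node `s + b`. Halving the number leads to the root, which is node `1`, and then to
  -- `0`, where the loop stops.
  put 31 (rg 30 + sE) ;; .assign (nodeE τ (rg 31)) (rg 33) ;; put 31 (rg 31 / 2) ;;
  .loop (rg 31)
    (put 40 (treeE τ (2 * rg 31)) ;; key ;;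
      put 33 (rg 40) ;; put 34 (rg 41) ;; put 35 (rg 42) ;;
      put 40 (treeE τ (2 * rg 31 + 1)) ;; key ;;
      .ite (rg 34 * rg 42 - rg 41 * rg 35) (put 33 (rg 40)) .skip ;;
      .assign (nodeE τ (rg 31)) (rg 33) ;; put 31 (rg 31 / 2))

/-- `refresh` changes only temporary registers and the tree number `τ`. -/
def RefreshFrame (s τ : ℕ) (m m' : ℕ → ℤ) : Prop :=
  ∀ r, r ≤ 30 ∨ 50 ≤ r → (∀ x : ℕ, 1 ≤ x → x < 2 * s → r ≠ 64 + 4 * x + τ) → m' r = m r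

/-- The setting of `refresh`: `key` computes `K` as long as the first thirty registers are those
of `m`. -/
structure RefreshData (C : Env) (τ : ℕ) (size M : Expr) (key : Cmd) (K : ℤ → ℤ × ℤ) (sz Mv : ℤ)
    (m : ℕ → ℤ) : Prop where
  tree : τ < 4
  valid : ∀ y, ValidKey (K y)
  top : K Mv = (1, 0)
  run : ∀ σ, (∀ r, r < 30 → σ.mem r = m r) → 0 ≤ σ.mem 40 → σ.mem 40 ≤ Mv →
    Run C key σ 3000 (KeyPost K σ)
  size_good : ∀ m', (∀ r, r < 30 → m' r = m r) → size.Good C m' ∧ size.eval C.I m' = sz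
  M_good : ∀ m', (∀ r, r < 30 → m' r = m r) → M.Good C m' ∧ M.eval C.I m' = Mv
  size_grade : size.maxGrade < 100
  M_grade : M.maxGrade < 100
  size_cost : size.cost ≤ 10
  M_cost : M.cost ≤ 10
  size_pos : 1 ≤ sz
  cover : Mv ≤ C.s * sz
  size_le : C.s * sz ≤ 4 * C.n
  M_nonneg : 0 ≤ Mv
  M_le : Mv ≤ 2 * C.n

theorem Expr.grade_le_maxGrade (e : Expr) : e.grade ≤ e.maxGrade := by
  cases e <;> simp [Expr.grade, Expr.maxGrade]

theorem eval_nodeE {I : List ℤ} {m : ℕ → ℤ} {τ : ℕ} {e : Expr} :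
    (nodeE τ e).eval I m = 64 + 4 * e.eval I m + τ := by
  simp [nodeE]

theorem eval_treeE {I : List ℤ} {m : ℕ → ℤ} {τ x : ℕ} {e : Expr} (h : e.eval I m = x) :
    (treeE τ e).eval I m = m (64 + 4 * x + τ) := by
  simp only [treeE, Expr.eval, eval_nodeE, h]
  congr 1

theorem good_nodeE {C : Env} {m : ℕ → ℤ} {τ : ℕ} {e : Expr} (he : e.Good C m) :
    (nodeE τ e).Good C m := ⟨⟨trivial, trivial, he⟩, trivial⟩

theorem inRange_node {C : Env} {τ x : ℕ} (hτ : τ < 4) (hx : x < 2 * C.s) :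
    InRange C.sp (64 + 4 * (x : ℤ) + τ) := by
  have := C.space
  have := C.one_le_s
  constructor <;> omega

theorem good_treeE {C : Env} {m : ℕ → ℤ} {τ x : ℕ} {e : Expr} (he : e.Good C m)
    (h : e.eval C.I m = x) (hτ : τ < 4) (hx : x < 2 * C.s) : (treeE τ e).Good C m := by
  refine ⟨⟨⟨trivial, trivial, he⟩, trivial⟩, ?_⟩
  rw [eval_nodeE, h]
  exact inRange_node hτ hx

/-- The state during the scan of a block, when the numbers below that in register `40` have been
seen. -/
structure ScanInv (K : ℤ → ℤ × ℤ) (Mv lo hi : ℤ) (σ₀ : State) (j : ℕ) (σ : State) : Prop where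
  out : σ.out = σ₀.out
  frame : ∀ r, r ≤ 30 ∨ 50 ≤ r → σ.mem r = σ₀.mem r
  hi_eq : σ.mem 32 = hi
  lo_le : lo ≤ σ.mem 40
  le_max : σ.mem 40 ≤ max lo hi
  rest : j = (hi - σ.mem 40).toNat
  win : IsWin K Mv (fun y => lo ≤ y ∧ y < σ.mem 40) (σ.mem 33)
  num : σ.mem 34 = (K (σ.mem 33)).1
  den : σ.mem 35 = (K (σ.mem 33)).2

theorem run_scan {C : Env} {τ : ℕ} {size M : Expr} {key : Cmd} {K : ℤ → ℤ × ℤ} {sz Mv : ℤ}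
    {σ₀ : State} (h : RefreshData C τ size M key K sz Mv σ₀.mem) {lo hi : ℤ} (hlo : 0 ≤ lo)
    (hhi : hi ≤ Mv) {j : ℕ} {σ : State} (hσ : ScanInv K Mv lo hi σ₀ j σ) :
    Run C (.loop (rg 32 - rg 40)
      (key ;;
        .ite (rg 34 * rg 42 - rg 41 * rg 35) (put 33 (rg 40) ;; put 34 (rg 41) ;; put 35 (rg 42))
          .skip ;;
        put 40 (rg 40 + 1))) σ (j * 3100 + 10)
      (fun σ' => ∃ j', ScanInv K Mv lo hi σ₀ j' σ' ∧ hi ≤ σ'.mem 40) := by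
  refine (Run.loop (T := 3050) (ScanInv K Mv lo hi σ₀) (by decide)
    (fun j σ _ => (good_sub _ _).2 ⟨good_rg (by norm_num), good_rg (by norm_num)⟩) (fun j σ hσ hpos => ?_)
    (fun j σ hσ hpos => ?_) j hσ).time ?_
  · simp only [eval_sub, eval_rg, hσ.hi_eq] at hpos
    refine ⟨j - 1, by have := hσ.rest; omega, ?_⟩
    have h40 := hσ.lo_le
    refine (Run.seq_of (h.run σ (fun r hr => hσ.frame r (by omega)) (by omega) (by omega))
      fun σ₁ ⟨ho, hn, hd, hf⟩ => Run.seq (Run.ite (by decide) (by simp [good_rg])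
        (fun hlt => Run.seq <| Run.put (by norm_num) (by decide) (by decide)
            (good_rg (by norm_num)) fun m₂ e₂ f₂ =>
          Run.seq <| Run.put (by norm_num) (by decide) (by decide)
            (good_rg (by norm_num)) fun m₃ e₃ f₃ =>
          Run.put (by norm_num) (by decide) (by decide)
            (good_rg (by norm_num)) fun m₄ e₄ f₄ =>
          Run.putDyn (by norm_num) (by decide) (by simp [good_rg]) ?_ fun m₅ e₅ f₅ => ?_)
        (fun hlt => Run.skip <|
          Run.putDyn (by norm_num) (by decide) (by simp [good_rg]) ?_ fun m₅ e₅ f₅ => ?_)))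
      |>.time (by decide)
    · simp [f₄, f₃, f₂, hf]
      have := h.M_le
      exact C.bd_index (by omega) (by omega)
    · simp [hn, hd, hf, hσ.num, hσ.den] at hlt
      have hwin := (hσ.win.insert (h.valid _) (h.valid (σ.mem 40))).1 (by simpa [KeyLt] using hlt)
      refine ⟨by simp [ho, hσ.out], fun r hr => ?_, ?_, ?_, ?_, ?_, ?_, ?_, ?_⟩
      · simp [f₅ r (by omega), f₄ r (by omega), f₃ r (by omega), f₂ r (by omega),
          hf r (by omega) (by omega), hσ.frame r hr]
      · simp [f₅, f₄, f₃, f₂, hf, hσ.hi_eq]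
      · simp [e₅, f₄, f₃, f₂, hf]; omega
      · simp only [e₅, f₄, f₃, f₂, hf, eval_add, eval_rg, eval_ofNat, ne_eq,
          Nat.reduceEqDiff, not_false_eq_true]; omega
      · simp [e₅, f₄, f₃, f₂, hf]; have := hσ.rest; omega
      · simp only [f₅, f₄, f₃, f₂, hf, e₅, e₂, eval_rg, eval_add, eval_ofNat, ne_eq,
          Nat.reduceEqDiff, not_false_eq_true]
        exact hwin.congr fun y => by omega
      · simp [f₅, f₄, e₃, e₂, f₃, f₂, hf, hn]
      · simp [f₅, e₄, e₂, f₃, f₄, f₂, hf, hd]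
    · simp [hf]
      have := h.M_le
      exact C.bd_index (by omega) (by omega)
    · simp [hn, hd, hf, hσ.num, hσ.den] at hlt
      have hwin := (hσ.win.insert (h.valid _) (h.valid (σ.mem 40))).2
        (by simpa [KeyLt] using hlt)
      refine ⟨by simp [ho, hσ.out], fun r hr => ?_, ?_, ?_, ?_, ?_, ?_, ?_, ?_⟩
      · simp [f₅ r (by omega), hf r (by omega) (by omega), hσ.frame r hr]
      · simp [f₅, hf, hσ.hi_eq]
      · simp [e₅, hf]; omega
      · simp only [e₅, hf, eval_add, eval_rg, eval_ofNat, ne_eq,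
          Nat.reduceEqDiff, not_false_eq_true]; omega
      · simp [e₅, hf]; have := hσ.rest; omega
      · simp only [f₅, hf, e₅, eval_rg, eval_add, eval_ofNat, ne_eq,
          Nat.reduceEqDiff, not_false_eq_true]
        exact hwin.congr fun y => by omega
      · simp [f₅, hf, hσ.num]
      · simp [f₅, hf, hσ.den]
  · simp only [eval_sub, eval_rg, hσ.hi_eq] at hpos
    exact ⟨j, hσ, by omega⟩
  · have : (rg 32 - rg 40).cost = 5 := by decide
    rw [this]; omega

/-- The state while the nodes above leaf `b` are recomputed. The nodes above the one in register
`31`, and that one, have not been recomputed yet. -/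
structure ClimbInv (K : ℤ → ℤ × ℤ) (s τ : ℕ) (Mv sz : ℤ) (dirty : Set ℕ) (σ₀ : State) (j : ℕ)
    (σ : State) : Prop where
  out : σ.out = σ₀.out
  frame : RefreshFrame s τ σ₀.mem σ.mem
  range : TreeRange s τ Mv σ.mem
  node : ∃ ν : ℕ, σ.mem 31 = ν ∧ ν < 2 ^ j ∧ ν < s ∧ ∀ x : ℕ, 1 ≤ x → x < 2 * s →
    (∀ c ∈ dirty, ¬ Below x (s + c)) → ¬ Below x ν →
      IsWin K Mv (InTree s Mv sz x) (σ.mem (64 + 4 * x + τ))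

theorem inTree_children {s x : ℕ} {M sz : ℤ} (hx : x < s) (y : ℤ) :
    InTree s M sz x y ↔ InTree s M sz (2 * x) y ∨ InTree s M sz (2 * x + 1) y := by
  unfold InTree
  rw [below_children]
  have : x ≠ s + (y / sz).toNat := by omega
  tauto

/-- The number `j` of remaining levels bounds the current node by `2 ^ j`. Each level recomputes the
keys of two stored winners, which gives a constant cost per level. -/
theorem run_climb {C : Env} {τ : ℕ} {size M : Expr} {key : Cmd} {K : ℤ → ℤ × ℤ} {sz Mv : ℤ}
    {σ₀ : State} (h : RefreshData C τ size M key K sz Mv σ₀.mem) {dirty : Set ℕ}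
    {j : ℕ} {σ : State} (hσ : ClimbInv K C.s τ Mv sz dirty σ₀ j σ) :
    Run C (.loop (rg 31)
    (put 40 (treeE τ (2 * rg 31)) ;; key ;;
      put 33 (rg 40) ;; put 34 (rg 41) ;; put 35 (rg 42) ;;
      put 40 (treeE τ (2 * rg 31 + 1)) ;; key ;;
      .ite (rg 34 * rg 42 - rg 41 * rg 35) (put 33 (rg 40)) .skip ;;
      .assign (nodeE τ (rg 31)) (rg 33) ;; put 31 (rg 31 / 2))) σ (j * 6200 + 10)
      (fun σ' => σ'.out = σ₀.out ∧ RefreshFrame C.s τ σ₀.mem σ'.mem ∧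
        TreeOk K C.s τ Mv sz dirty σ'.mem) := by
  have hτ := h.tree
  have g1 : (nodeE τ (rg 31)).maxGrade < 1000 ∧ (treeE τ (2 * rg 31)).maxGrade < 1000 ∧
      (treeE τ (2 * rg 31 + 1)).maxGrade < 1000 ∧ (treeE τ (2 * rg 31)).grade ≤ 20 ∧
      (treeE τ (2 * rg 31 + 1)).grade ≤ 20 ∧ (nodeE τ (rg 31)).cost = 8 ∧
      (treeE τ (2 * rg 31)).cost = 11 ∧ (treeE τ (2 * rg 31 + 1)).cost = 13 := by
    interval_cases τ <;> decide
  obtain ⟨g1, g2, g3, g4, g5, g6, g7, g8⟩ := g1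
  refine (Run.loop (T := 6150) (ClimbInv K C.s τ Mv sz dirty σ₀) (by decide)
    (fun j σ _ => good_rg (by norm_num)) (fun j σ hσ hpos => ?_)
    (fun j σ hσ hpos => ?_) j hσ).time ?_
  · obtain ⟨ho, hfr, hrange, ν, hν, hνj, hνs, hwin⟩ := hσ
    simp only [eval_rg, hν] at hpos
    have hpos' : 0 < ν := by exact_mod_cast hpos
    obtain ⟨j, rfl⟩ : ∃ j', j = j' + 1 :=
      ⟨j - 1, by rcases j with _ | j <;> simp at hνj ⊢ <;> omega⟩
    refine ⟨j, rfl, ?_⟩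
    have hl := hrange (2 * ν) (by omega) (by omega)
    have hr := hrange (2 * ν + 1) (by omega) (by omega)
    have e1 : (2 * rg 31).eval C.I σ.mem = ((2 * ν : ℕ) : ℤ) := by simp [hν]
    refine (Run.seq <| Run.put (by norm_num) g4 g2
      (good_treeE (x := 2 * ν) (by simp [good_rg]) e1 hτ (by omega)) fun m₁ e₁ f₁ =>
      Run.seq_of (h.run _ (fun r hr => ?_) ?_ ?_) fun σ₂ ⟨o₂, n₂, d₂, f₂⟩ =>
      Run.seq <| Run.put (by norm_num) (by decide) (by decide) (good_rg (by norm_num))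
        fun m₃ e₃ f₃ =>
      Run.seq <| Run.put (by norm_num) (by decide) (by decide) (good_rg (by norm_num))
        fun m₄ e₄ f₄ =>
      Run.seq <| Run.put (by norm_num) (by decide) (by decide) (good_rg (by norm_num))
        fun m₅ e₅ f₅ =>
      Run.seq <| Run.put (by norm_num) g5 g3
        (good_treeE (x := 2 * ν + 1) (by simp [good_rg]) ?_ hτ (by omega)) fun m₆ e₆ f₆ =>
      Run.seq_of (h.run _ (fun r hr => ?_) ?_ ?_) fun σ₇ ⟨o₇, n₇, d₇, f₇⟩ =>
      Run.seq_of (T := 50) (U := 40) (R := fun σ₈ => σ₈.out = σ₀.out ∧ (∀ r, r ≠ 33 → σ₈.mem r = σ₇.mem r) ∧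
          0 ≤ σ₈.mem 33 ∧ σ₈.mem 33 ≤ Mv ∧ ((∀ c ∈ dirty, ¬ Below ν (C.s + c)) →
          IsWin K Mv (InTree C.s Mv sz ν) (σ₈.mem 33))) ?_ fun σ₈ ⟨o₈, f₈, r₈, r₈', w₈⟩ => ?_).time ?_
    all_goals try dsimp only at *
    · exact (f₁ r (by omega)).trans (hfr r (by omega) fun x _ _ => by omega)
    · have := eval_treeE (I := C.I) (τ := τ) e1
      rw [this] at e₁
      simp only [e₁]; exact hl.1
    · have := eval_treeE (I := C.I) (τ := τ) e1
      rw [this] at e₁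
      simp only [e₁]; exact hl.2
    · simp [f₅, f₄, f₃, f₂, f₁, hν]
    · rw [f₆ r (by omega), f₅ r (by omega), f₄ r (by omega), f₃ r (by omega),
        f₂ r (by omega) (by omega)]
      exact (f₁ r (by omega)).trans (hfr r (by omega) fun x _ _ => by omega)
    · rw [eval_treeE (x := 2 * ν + 1) (by simp [f₅, f₄, f₃, f₂, f₁, hν])] at e₆
      simp only [e₆]
      rw [f₅ _ (by omega), f₄ _ (by omega), f₃ _ (by omega), f₂ _ (by omega) (by omega),
        f₁ _ (by omega)]
      exact hr.1
    · rw [eval_treeE (x := 2 * ν + 1) (by simp [f₅, f₄, f₃, f₂, f₁, hν])] at e₆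
      simp only [e₆]
      rw [f₅ _ (by omega), f₄ _ (by omega), f₃ _ (by omega), f₂ _ (by omega) (by omega),
        f₁ _ (by omega)]
      exact hr.2
    · rw [eval_treeE (x := 2 * ν + 1) (by simp [f₅, f₄, f₃, f₂, f₁, hν])] at e₆
      rw [f₅ _ (by omega), f₄ _ (by omega), f₃ _ (by omega), f₂ _ (by omega) (by omega),
        f₁ _ (by omega)] at e₆
      rw [eval_treeE e1] at e₁
      have h33 : σ₇.mem 33 = σ.mem (64 + 4 * (2 * ν) + τ) := by
        simp [f₇, f₆, f₅, f₄, e₃, f₂, e₁]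
      have h40 : σ₇.mem 40 = σ.mem (64 + 4 * (2 * ν + 1) + τ) := by simp [f₇, e₆]
      have h41 : σ₇.mem 41 = (K (σ.mem (64 + 4 * (2 * ν + 1) + τ))).1 := by simp [n₇, e₆]
      have h42 : σ₇.mem 42 = (K (σ.mem (64 + 4 * (2 * ν + 1) + τ))).2 := by simp [d₇, e₆]
      have h34 : σ₇.mem 34 = (K (σ.mem (64 + 4 * (2 * ν) + τ))).1 := by
        simp [f₇, f₆, f₅, e₄, f₃, n₂, e₁]
      have h35 : σ₇.mem 35 = (K (σ.mem (64 + 4 * (2 * ν) + τ))).2 := by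
        simp [f₇, f₆, e₅, f₄, f₃, d₂, e₁]
      -- Both children have numbers greater than `ν`, so they are not among the ancestors of `ν` and
      -- already hold correct winners.
      have hd : (∀ c ∈ dirty, ¬ Below ν (C.s + c)) →
          IsWin K Mv (InTree C.s Mv sz (2 * ν)) (σ.mem (64 + 4 * (2 * ν) + τ)) ∧
          IsWin K Mv (InTree C.s Mv sz (2 * ν + 1)) (σ.mem (64 + 4 * (2 * ν + 1) + τ)) := by
        intro hd
        constructor
        · exact hwin _ (by omega) (by omega)
            (fun c hc hb => hd c hc (below_children.2 (.inr (.inl hb))))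
            fun hb => by have := hb.le; omega
        · exact hwin _ (by omega) (by omega)
            (fun c hc hb => hd c hc (below_children.2 (.inr (.inr hb))))
            fun hb => by have := hb.le; omega
      refine (Run.ite (by decide) (by simp [good_rg])
        (fun hlt => Run.put (by norm_num) (by decide) (by decide) (good_rg (by norm_num))
          fun m₈ e₈ f₈ => ?_) (fun hlt => Run.skip ?_)).time (by decide)
      · simp [h41, h42, h34, h35] at hlt
        refine ⟨by simp [o₇, o₂, ho], f₈, ?_, ?_, fun hd' => ?_⟩
        · simp only [e₈, eval_rg, h40]; exact hr.1
        · simp only [e₈, eval_rg, h40]; exact hr.2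
        · simp only [e₈, eval_rg, h40]
          exact (((hd hd').1.union (hd hd').2 (h.valid _) (h.valid _)).1 hlt).congr fun y =>
            (inTree_children hνs y).symm
      · simp [h41, h42, h34, h35] at hlt
        refine ⟨by simp [o₇, o₂, ho], fun _ _ => rfl, ?_, ?_, fun hd' => ?_⟩
        · rw [h33]; exact hl.1
        · rw [h33]; exact hl.2
        · rw [h33]
          exact (((hd hd').1.union (hd hd').2 (h.valid _) (h.valid _)).2 (not_lt.mpr hlt)).congr
            fun y => (inTree_children hνs y).symm
    · have h31 : σ₈.mem 31 = ν := by simp [f₈, f₇, f₆, f₅, f₄, f₃, f₂, f₁, hν]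
      have htree : ∀ r, 50 ≤ r ∨ r ≤ 30 → σ₈.mem r = σ.mem r := fun r hr => by
        rw [f₈ _ (by omega), f₇ _ (by omega) (by omega), f₆ _ (by omega), f₅ _ (by omega),
          f₄ _ (by omega), f₃ _ (by omega), f₂ _ (by omega) (by omega), f₁ _ (by omega)]
      have haddr : ((64 : ℤ) + 4 * ν + τ).toNat = 64 + 4 * ν + τ := by omega
      refine (Run.seq (Run.assign (good_nodeE (good_rg (by norm_num)))
        (good_rg (by norm_num)) ?_ g1 (by decide) (fun hm => hm 33) <|
        Run.put (by norm_num) (by decide) (by decide) (by simp [good_rg])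
        fun m₁₀ e₁₀ f₁₀ => ?_)).time ?_
      · rw [eval_nodeE, eval_rg, h31]; exact inRange_node hτ (by omega)
      · have h10 : ∀ r, r ≠ 31 → m₁₀ r = if r = 64 + 4 * ν + τ then σ₈.mem 33 else σ₈.mem r := by
          intro r hr
          rw [f₁₀ r hr]
          simp only [eval_nodeE, eval_rg, h31, haddr, Function.update_apply]
        refine ⟨by simp [o₈], fun r hr hr' => ?_, fun x h1 h2 => ?_, ν / 2, ?_, ?_, by omega,
          fun x h1 h2 hd hx => ?_⟩ <;> try dsimp only
        · rw [h10 r (by omega), if_neg (hr' ν (by omega) (by omega)), htree r (by omega)]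
          exact hfr r hr hr'
        · rw [h10 _ (by omega)]
          split_ifs with hc
          · exact ⟨r₈, r₈'⟩
          · rw [htree _ (by omega)]; exact hrange x h1 h2
        · simp [e₁₀, eval_nodeE, h31, haddr, Function.update_apply]
          rw [if_neg (by omega)]
        · rw [pow_succ] at hνj; omega
        · rw [h10 _ (by omega)]
          split_ifs with hc
          · obtain rfl : x = ν := by omega
            exact w₈ hd
          · rw [htree _ (by omega)]
            exact hwin x h1 h2 hd fun hb => by
              rcases below_half.mp hb with rfl | hb
              · exact hc rfl
              · exact hx hb
      · have : (rg 33).cost = 2 ∧ (rg 31 / 2).cost = 4 := by decide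
        rw [this.1, this.2, g6]; norm_num
    · have : (rg 40).cost = 2 ∧ (rg 41).cost = 2 ∧ (rg 42).cost = 2 := by decide
      rw [this.1, this.2.1, this.2.2, g7, g8]; norm_num
  · obtain ⟨ho, hfr, hrange, ν, hν, hνj, hνs, hwin⟩ := hσ
    simp only [eval_rg, hν] at hpos
    have : ν = 0 := by omega
    subst this
    exact ⟨ho, hfr, hrange, fun x h1 h2 hx => hwin x h1 h2 hx (below_zero h1)⟩
  · have : (rg 31).cost = 2 := by decide
    rw [this]; omega

/-- The cost of `refresh`. -/
def refreshTime (C : Env) (sz : ℤ) : ℕ := 3100 * sz.toNat + 6200 * (Nat.log 2 C.s + 1) + 200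

/-- A leaf summarizes a whole block, so its winner must be found by scanning the block again; after
that only the path to the root is affected. This yields `O(sz + log s)` and makes leaf `b` clean,
whatever it held before. -/
theorem run_refresh {C : Env} {τ : ℕ} {size M : Expr} {key : Cmd} {K : ℤ → ℤ × ℤ} {sz Mv : ℤ}
    {σ : State} (h : RefreshData C τ size M key K sz Mv σ.mem) {dirty : Set ℕ} {b : ℕ}
    (hb : b < C.s) (h30 : σ.mem 30 = b) (hT : TreeOk K C.s τ Mv sz dirty σ.mem) :
    Run C (refresh τ size M key) σ (refreshTime C sz) (fun σ' =>
      σ'.out = σ.out ∧ RefreshFrame C.s τ σ.mem σ'.mem ∧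
        TreeOk K C.s τ Mv sz (dirty \ {b}) σ'.mem) := by
  have hτ := h.tree
  have hsz := h.size_pos
  have hb0 : (b : ℤ) * sz + sz ≤ 4 * C.n := by
    have h1 : ((b : ℤ) + 1) * sz ≤ C.s * sz :=
      mul_le_mul_of_nonneg_right (by omega) (by omega)
    linarith [h.size_le]
  have hb1 : 0 ≤ (b : ℤ) * sz := by positivity
  have hMle := h.M_le
  have hM0 := h.M_nonneg
  have hm1 := h.size_grade
  have hm2 := h.M_grade
  have hc1 := h.size_cost
  have hc2 := h.M_cost
  obtain ⟨lo, hlo⟩ : ∃ lo, lo = (b : ℤ) * sz := ⟨_, rfl⟩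
  obtain ⟨hi, hhi⟩ : ∃ hi, hi = min Mv (lo + sz) := ⟨_, rfl⟩
  refine (Run.seq <| Run.putDyn (by norm_num) ?_ ?_ ?_ fun m₁ e₁ f₁ =>
    Run.seq <| Run.putDyn (by norm_num) ?_ ?_ ?_ fun m₂ e₂ f₂ =>
    Run.seq_of (T := 60) (R := fun σ₃ => σ₃.out = σ.out ∧ σ₃.mem 32 = hi ∧
      σ₃.mem 40 = lo ∧ ∀ r, r ≠ 32 → r ≠ 40 → σ₃.mem r = σ.mem r) ?_ fun σ₃ ⟨o₃, e₃, e₃', f₃⟩ =>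
    Run.seq <| Run.putDyn (by norm_num) ?_ (h.M_good _ ?_).1 ?_ fun m₄ e₄ f₄ =>
    Run.seq <| Run.put (by norm_num) (by decide) (by decide) (by simp) fun m₅ e₅ f₅ =>
    Run.seq <| Run.put (by norm_num) (by decide) (by decide) (by simp) fun m₆ e₆ f₆ =>
    Run.seq_of (run_scan (j := (hi - lo).toNat) (lo := lo) (hi := hi) h (by omega) (by omega) ?_)
      fun σ₇ ⟨j, hσ₇, hj⟩ =>
    Run.seq <| Run.putDyn (by norm_num) (by decide) (by simp [good_rg]) ?_ fun m₈ e₈ f₈ =>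
    Run.seq_of (T := 20) (R := fun σ₉ => σ₉.out = σ.out ∧ ∀ r,
      σ₉.mem r = if r = 64 + 4 * (C.s + b) + τ then m₈ 33 else m₈ r) ?_ fun σ₉ ⟨o₉, f₉⟩ =>
    Run.seq <| Run.put (by norm_num) (by decide) (by decide) (by simp [good_rg])
      fun m₁₀ e₁₀ f₁₀ =>
    run_climb (j := Nat.log 2 C.s + 1) h ?_).time ?_
  all_goals try dsimp only at *
  · change max ((rg 30).grade + size.grade) (max (rg 30).maxGrade size.maxGrade) < 1000
    have := size.grade_le_maxGrade
    have e1 : (rg 30).grade = 20 := rfl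
    have e2 : (rg 30).maxGrade = 30 := rfl
    omega
  · exact ⟨good_rg (by norm_num), (h.size_good _ fun _ _ => rfl).1⟩
  · rw [eval_mul, eval_rg, (h.size_good _ fun _ _ => rfl).2, h30]
    exact C.bd_index (by omega) (by omega)
  · change max (max (rg 40).grade size.grade + 1) (max (rg 40).maxGrade size.maxGrade) < 1000
    have := size.grade_le_maxGrade
    have e1 : (rg 40).grade = 20 := rfl
    have e2 : (rg 40).maxGrade = 40 := rfl
    omega
  · exact ⟨good_rg (by norm_num), (h.size_good _ fun r hr => f₁ r (by omega)).1⟩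
  · rw [eval_mul, eval_rg, (h.size_good _ fun _ _ => rfl).2, h30] at e₁
    rw [eval_add, eval_rg, (h.size_good _ fun r hr => f₁ r (by omega)).2, e₁]
    exact C.bd_index (by omega) (by omega)
  · rw [eval_mul, eval_rg, (h.size_good _ fun _ _ => rfl).2, h30] at e₁
    rw [eval_add, eval_rg, (h.size_good _ fun r hr => f₁ r (by omega)).2, e₁] at e₂
    have hg := h.M_good m₂ fun r hr => by rw [f₂ r (by omega), f₁ r (by omega)]
    have f : ∀ r, r ≠ 32 → r ≠ 40 → m₂ r = σ.mem r := fun r h1 h2 => by rw [f₂ r h1, f₁ r h2]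
    refine (Run.ite (T := 12) (U := 1) ?_ ((good_sub _ _).2 ⟨good_rg (by norm_num), hg.1⟩) (fun hlt => ?_)
      (fun hlt => Run.skip ?_)).time ?_
    · change max (max (rg 32).grade M.grade + 1) (max (rg 32).maxGrade M.maxGrade) < 1000
      have := M.grade_le_maxGrade
      have e1 : (rg 32).grade = 20 := rfl
      have e2 : (rg 32).maxGrade = 32 := rfl
      omega
    · simp only [eval_sub, eval_rg, hg.2, e₂] at hlt
      refine (Run.putDyn (by norm_num) (by omega) hg.1 ?_ fun m₃ e₃ f₃ => ?_).time (by omega)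
      · rw [hg.2]; exact C.bd_index (by omega) (by omega)
      · refine ⟨rfl, ?_, ?_, fun r h1 h2 => by simp only [f₃ r h1]; exact f r h1 h2⟩
        · simp only [e₃, hg.2]; omega
        · simp only [f₃ 40 (by norm_num), f₂ 40 (by norm_num), e₁, hlo]
    · simp only [eval_sub, eval_rg, hg.2, e₂] at hlt
      refine ⟨rfl, ?_, ?_, f⟩
      · simp only [e₂]; omega
      · simp only [f₂ 40 (by norm_num), e₁, hlo]
    · change ((rg 32).cost + M.cost + 1) + 1 + 13 ≤ 60
      have e1 : (rg 32).cost = 2 := rfl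
      omega
  · omega
  · exact fun r hr => f₃ r (by omega) (by omega)
  · rw [(h.M_good _ fun r hr => f₃ r (by omega) (by omega)).2]
    exact C.bd_index (by omega) (by omega)
  · rw [(h.M_good _ fun r hr => f₃ r (by omega) (by omega)).2] at e₄
    have h33 : m₆ 33 = Mv := by rw [f₆ _ (by omega), f₅ _ (by omega), e₄]
    have h40 : m₆ 40 = lo := by rw [f₆ _ (by omega), f₅ _ (by omega), f₄ _ (by omega), e₃']
    refine ⟨o₃, fun r hr => ?_, ?_, ?_, ?_, ?_, ?_, ?_, ?_⟩ <;> try dsimp only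
    · rw [f₆ _ (by omega), f₅ _ (by omega), f₄ _ (by omega), f₃ _ (by omega) (by omega)]
    · rw [f₆ _ (by omega), f₅ _ (by omega), f₄ _ (by omega), e₃]
    · rw [h40]
    · rw [h40]; exact le_max_left _ _
    · rw [h40]
    · rw [h33]; exact isWin_empty fun y => by omega
    · rw [h33, h.top, f₆ _ (by omega), e₅]; rfl
    · rw [h33, h.top, e₆]; rfl
  · rw [eval_add, eval_rg, eval_sE, hσ₇.frame 30 (by omega), h30]
    have := C.s_le_n
    exact C.bd_index (by omega) (by omega)
  · rw [eval_add, eval_rg, eval_sE, hσ₇.frame 30 (by omega), h30] at e₈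
    have haddr : ((64 : ℤ) + 4 * (b + C.s) + τ).toNat = 64 + 4 * (C.s + b) + τ := by omega
    refine (Run.assign (good_nodeE (good_rg (by norm_num)))
      (good_rg (by norm_num)) ?_ ?_ (by decide) (fun hm => hm 33) ⟨hσ₇.out, fun r => ?_⟩).time ?_
    · rw [eval_nodeE, eval_rg]; dsimp only
      rw [e₈]
      have := inRange_node (C := C) (x := C.s + b) hτ (by omega)
      push_cast at this
      rwa [add_comm (b : ℤ)]
    · clear hT h; interval_cases τ <;> decide
    · have : (nodeE τ (rg 31)).cost = 8 := by clear hT h; interval_cases τ <;> decide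
      rw [this]; decide
    · dsimp only
      rw [Function.update_apply, eval_nodeE, eval_rg, e₈, haddr]; rfl
  · rw [eval_add, eval_rg, eval_sE, hσ₇.frame 30 (by omega), h30] at e₈
    have hm : ∀ r, r ≠ 31 → m₁₀ r = if r = 64 + 4 * (C.s + b) + τ then σ₇.mem 33 else σ₇.mem r := by
      intro r hr
      rw [f₁₀ r hr, f₉, f₈ 33 (by omega), f₈ r hr]
    have hleaf : IsWin K Mv (InTree C.s Mv sz (C.s + b)) (σ₇.mem 33) := by
      refine hσ₇.win.congr fun y => ?_
      have hrest := hσ₇.rest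
      have h1 := hσ₇.lo_le
      have h0 := hσ₇.le_max
      constructor
      · rintro ⟨h2, h3⟩
        have h4 : y < hi := by omega
        have h5 : y / sz = b := le_antisymm
          (Int.lt_add_one_iff.mp (Int.ediv_lt_of_lt_mul (by omega) (by linarith [h4, hhi.le, min_le_right Mv (lo + sz)])))
          (Int.le_ediv_of_mul_le (by omega) (by omega))
        refine ⟨by omega, by omega, ?_⟩
        rw [h5, Int.toNat_natCast]
        exact below_self _
      · rintro ⟨h2, h3, h4⟩
        have h5 : y / sz < C.s := Int.ediv_lt_of_lt_mul (by omega) (by linarith [h.cover])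
        have h6 : 0 ≤ y / sz := Int.ediv_nonneg h2 (by omega)
        have h7 := (below_leaf (by omega)).1 h4
        have h8 : y / sz = b := by omega
        have h9 := Int.ediv_mul_le y (show sz ≠ 0 by omega)
        have h10 := Int.lt_ediv_add_one_mul_self y (show 0 < sz by omega)
        rw [h8] at h9 h10
        have h11 : y < lo + sz := by linarith
        omega
    have hrange33 : 0 ≤ σ₇.mem 33 ∧ σ₇.mem 33 ≤ Mv := by
      rcases hleaf.1 with h | h
      · omega
      · exact ⟨h.1.1, h.1.2.1.le⟩
    refine ⟨o₉, fun r hr hr' => ?_, fun x h1 h2 => ?_, (C.s + b) / 2, ?_, ?_, ?_,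
      fun x h1 h2 hd hx => ?_⟩ <;> try dsimp only
    · rw [hm r (by omega), if_neg (hr' _ (by omega) (by omega)), hσ₇.frame r hr]
    · rw [hm _ (by omega)]
      split_ifs
      · exact hrange33
      · rw [hσ₇.frame _ (by omega)]; exact hT.1 x h1 h2
    · rw [e₁₀, eval_div, eval_rg, f₉, if_neg (by omega), e₈, eval_ofNat]
      push_cast
      rw [add_comm]
    · have := Nat.lt_pow_succ_log_self (b := 2) (by norm_num) C.s
      omega
    · omega
    · rw [hm _ (by omega)]
      split_ifs with hc
      · obtain rfl : x = C.s + b := by omega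
        exact hleaf
      · rw [hσ₇.frame _ (by omega)]
        -- Here `x` is neither the leaf `b` nor an ancestor of its parent, so the dirtiness of `b`
        -- did not concern `x`.
        refine hT.2 x h1 h2 fun c hcd => ?_
        by_cases hcb : c = b
        · subst hcb
          rw [below_half]
          rintro (h3 | h3)
          · omega
          · exact hx h3
        · exact hd c ⟨hcd, hcb⟩
  · have : (rg 30).cost = 2 ∧ (rg 40).cost = 2 ∧ (1 : Expr).cost = 1 ∧ (0 : Expr).cost = 1 ∧
      (rg 30 + sE).cost = 5 ∧ (rg 31 / 2).cost = 4 := by decide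
    obtain ⟨c1, c2, c3, c4, c5, c6⟩ := this
    change ((rg 30).cost + size.cost + 1) + 2 + (((rg 40).cost + size.cost + 1) + 2 + _) ≤ _
    rw [c1, c2, c3, c4, c5, c6, refreshTime]
    have : (hi - lo).toNat ≤ sz.toNat := by omega
    omega

end KVis

namespace KVis

/-! ### The circular order of the vertices -/

/-- The direction of the vertex `w`, as a fraction that increases with the angle between `w` and
the vertex `0`. -/
def vKey (I : List ℤ) (w : ℤ) : ℤ × ℤ :=
  if 0 < cr I 0 w then
    (if 0 < dt I 0 w then (-dt I 0 w, cr I 0 w + dt I 0 w)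
      else (-dt I 0 w, cr I 0 w - dt I 0 w))
  else
    (if 0 < dt I 0 w then (4 * (dt I 0 w - cr I 0 w) + dt I 0 w, dt I 0 w - cr I 0 w)
      else (4 * (0 - cr I 0 w - dt I 0 w) + dt I 0 w, 0 - cr I 0 w - dt I 0 w))

/-- The value of `vKey`. -/
def vVal (I : List ℤ) (w : ℤ) : ℚ := (vKey I w).1 / (vKey I w).2

/-- The general position of the vertices. -/
structure Gen (I : List ℤ) (n : ℕ) : Prop where
  pos : 1 ≤ n
  gp : ∀ u v : ℤ, 0 ≤ u → u < 2 * n → 0 ≤ v → v < 2 * n → u ≠ v → cr I u v ≠ 0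

theorem cr_self (I : List ℤ) (u : ℤ) : cr I u u = 0 := by unfold cr; ring
theorem cr_swap (I : List ℤ) (u v : ℤ) : cr I v u = -cr I u v := by unfold cr; ring

/-- The Grassmann–Plücker relation. -/
theorem cr_plucker (I : List ℤ) (a b c d : ℤ) :
    cr I a b * cr I c d - cr I a c * cr I b d + cr I a d * cr I b c = 0 := by unfold cr; ring

section
variable {I : List ℤ} {n : ℕ} (h : Gen I n)
include h

/-- Vertex `0` differs from the query point, since its cross product with vertex `1` does not
vanish. It can therefore serve as the direction of reference. -/
theorem Gen.dt_zero_pos : 0 < dt I 0 0 := by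
  have h1 := h.gp 0 1 (by norm_num) (by have := h.pos; omega) (by norm_num)
    (by have := h.pos; omega) (by norm_num)
  unfold cr at h1
  unfold dt
  by_contra h2
  have h3 : px I 0 = 0 := by nlinarith [mul_self_nonneg (px I 0), mul_self_nonneg (py I 0)]
  have h4 : py I 0 = 0 := by nlinarith [mul_self_nonneg (px I 0), mul_self_nonneg (py I 0)]
  simp [h3, h4] at h1

theorem Gen.cr_zero {w : ℤ} (hw : 0 ≤ w) (hw' : w < 2 * n) : cr I 0 w = 0 ↔ w = 0 := by
  constructor
  · intro h1
    by_contra h2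
    exact h.gp 0 w le_rfl (by have := h.pos; omega) hw hw' (Ne.symm h2) h1
  · rintro rfl; exact cr_self _ _

/-- With respect to vertex `0`, the denominator is `|cr| + |dt|`, and `dt / (|cr| + |dt|)` is a
rational substitute for the cosine. Its negative, from `-1` to `1`, is used to the left of vertex
`0`; on the rest the value is `4` plus the quotient, from `3` to `5`. Vertex `0` itself gets the
largest value `5`. -/
theorem Gen.vKey_den_pos {w : ℤ} (hw : 0 ≤ w) (hw' : w < 2 * n) : 0 < (vKey I w).2 := by
  have h0 := h.cr_zero hw hw'
  have h1 := h.dt_zero_pos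
  unfold vKey
  split_ifs with h2 h3 h3
  · dsimp; omega
  · dsimp; omega
  · dsimp; omega
  · dsimp
    by_contra h4
    have h5 : cr I 0 w = 0 := by omega
    rw [h0] at h5
    subst h5
    exact h3 h1

theorem Gen.vVal_lt {u w : ℤ} (hu : 0 ≤ u) (hu' : u < 2 * n) (hw : 0 ≤ w) (hw' : w < 2 * n) :
    vVal I u < vVal I w ↔ (vKey I u).1 * (vKey I w).2 < (vKey I w).1 * (vKey I u).2 := by
  have h1 : (0 : ℚ) < (vKey I u).2 := by exact_mod_cast h.vKey_den_pos hu hu'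
  have h2 : (0 : ℚ) < (vKey I w).2 := by exact_mod_cast h.vKey_den_pos hw hw'
  unfold vVal
  rw [div_lt_div_iff₀ h1 h2]
  exact_mod_cast Iff.rfl

/-- The order of the vertices by direction, starting behind the vertex `0`. -/
theorem Gen.before {u w : ℤ} (hu : 0 ≤ u) (hu' : u < 2 * n) (hw : 0 ≤ w) (hw' : w < 2 * n)
    (huw : vVal I u < vVal I w) :
    (0 < cr I 0 u ∧ ¬ 0 < cr I 0 w) ∨ ((0 < cr I 0 u ↔ 0 < cr I 0 w) ∧ 0 < cr I u w) := by
  rw [h.vVal_lt hu hu' hw hw'] at huw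
  have h0 := h.dt_zero_pos
  -- In coordinates along and across vertex `0`, the cross product of `u` and `w` is a two-by-two
  -- determinant, up to a positive factor.
  have key : cr I u w * dt I 0 0 = dt I 0 u * cr I 0 w - cr I 0 u * dt I 0 w := by
    unfold cr dt; ring
  have hu0 := h.vKey_den_pos hu hu'
  have hw0 := h.vKey_den_pos hw hw'
  have fin : 0 < dt I 0 u * cr I 0 w - cr I 0 u * dt I 0 w → 0 < cr I u w := by
    intro h1
    rw [← key] at h1
    exact (pos_iff_pos_of_mul_pos h1).2 h0
  have ha : ∀ x : ℤ, 0 ≤ x → x < 2 * n → ¬ 0 < dt I 0 x → cr I 0 x ≠ 0 := fun x h1 h2 h3 h4 => by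
    rw [h.cr_zero h1 h2] at h4
    exact h3 (h4 ▸ h0)
  have hau := ha u hu hu'
  have haw := ha w hw hw'
  clear ha
  revert key fin huw hu0 hw0 hau haw
  unfold vKey
  generalize cr I 0 u = a
  generalize cr I 0 w = b
  generalize dt I 0 u = c
  generalize dt I 0 w = d
  intro huw key hu0 hw0 fin hau haw
  by_cases h1 : 0 < a <;> by_cases h2 : 0 < b
  · refine .inr ⟨by simp [h1, h2], fin ?_⟩
    by_cases h3 : 0 < c <;> by_cases h4 : 0 < d <;> simp [h1, h2, h3, h4] at huw hu0 hw0 <;>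
      nlinarith
  · exact .inl ⟨h1, h2⟩
  -- Values to the left of vertex `0` are at most `1`, the other values at least `3`.
  · exfalso
    by_cases h3 : 0 < c <;> by_cases h4 : 0 < d <;> simp [h1, h2, h3, h4] at huw hu0 hw0 <;>
      nlinarith
  · refine .inr ⟨by simp [h1, h2], fin ?_⟩
    by_cases h3 : 0 < c <;> by_cases h4 : 0 < d <;> simp [h1, h2, h3, h4] at huw hu0 hw0
    · nlinarith
    · nlinarith
    · have h5 : a < 0 := lt_of_le_of_ne (not_lt.mp h1) (hau h3)
      nlinarith [mul_pos (neg_pos.mpr h5) h4, mul_nonneg_of_nonpos_of_nonpos (not_lt.mp h3) (not_lt.mp h2)]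
    · nlinarith

/-- Equal values mean equal directions, hence a vanishing cross product, which general position
permits only for equal vertices. -/
theorem Gen.vVal_inj {u w : ℤ} (hu : 0 ≤ u) (hu' : u < 2 * n) (hw : 0 ≤ w) (hw' : w < 2 * n)
    (huw : vVal I u = vVal I w) : u = w := by
  by_contra hne
  refine h.gp u w hu hu' hw hw' hne ?_
  have h0 := h.dt_zero_pos
  have key : cr I u w * dt I 0 0 = dt I 0 u * cr I 0 w - cr I 0 u * dt I 0 w := by
    unfold cr dt; ring
  have hu0 := h.vKey_den_pos hu hu'
  have hw0 := h.vKey_den_pos hw hw'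
  have fin : dt I 0 u * cr I 0 w - cr I 0 u * dt I 0 w = 0 → cr I u w = 0 := by
    intro h1
    rw [← key] at h1
    exact (mul_eq_zero.mp h1).resolve_right h0.ne'
  have huw : (vKey I u).1 * (vKey I w).2 = (vKey I w).1 * (vKey I u).2 := by
    have h1 := mt (h.vVal_lt hu hu' hw hw').2 huw.not_lt
    have h2 := mt (h.vVal_lt hw hw' hu hu').2 huw.not_gt
    linarith
  have ha : ∀ x : ℤ, 0 ≤ x → x < 2 * n → ¬ 0 < dt I 0 x → cr I 0 x ≠ 0 := fun x h1 h2 h3 h4 => by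
    rw [h.cr_zero h1 h2] at h4
    exact h3 (h4 ▸ h0)
  have hau := ha u hu hu'
  have haw := ha w hw hw'
  clear ha
  revert key fin huw hu0 hw0 hau haw
  unfold vKey
  generalize cr I 0 u = a
  generalize cr I 0 w = b
  generalize dt I 0 u = c
  generalize dt I 0 w = d
  intro key hu0 hw0 fin huw hau haw
  refine fin ?_
  by_cases h1 : 0 < a <;> by_cases h2 : 0 < b <;> by_cases h3 : 0 < c <;> by_cases h4 : 0 < d <;>
    simp [h1, h2, h3, h4] at huw hu0 hw0 <;> nlinarith

/-- The vertices in the order in which the sweep visits them. -/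
theorem Gen.exists_order : ∃ V : ℕ → ℤ, V 0 = 0 ∧ (∀ m, 0 ≤ V m ∧ V m < 2 * n) ∧
    (∀ w : ℤ, 0 ≤ w → w < 2 * n → ∃ m, 1 ≤ m ∧ m ≤ 2 * n ∧ V m = w) ∧
    ∀ i j, 1 ≤ i → i < j → j ≤ 2 * n → vVal I (V i) < vVal I (V j) := by
  have hn := h.pos
  set F : Finset ℚ := (Finset.Ico (0 : ℤ) (2 * n)).image (vVal I) with hF
  have hcard : F.card = 2 * n := by
    rw [hF, Finset.card_image_of_injOn]
    · rw [Int.card_Ico]; omega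
    · intro u hu w hw huw
      simp only [Finset.coe_Ico, Set.mem_Ico] at hu hw
      exact h.vVal_inj hu.1 hu.2 hw.1 hw.2 huw
  let e := F.orderEmbOfFin hcard
  have hex : ∀ i : Fin (2 * n), ∃ w : ℤ, (0 ≤ w ∧ w < 2 * n) ∧ vVal I w = e i := by
    intro i
    have := F.orderEmbOfFin_mem hcard i
    obtain ⟨w, hw, hwe⟩ := Finset.mem_image.mp this
    exact ⟨w, by simpa using hw, hwe⟩
  choose f hf hfe using hex
  -- The sorted list is indexed from `1`; index `0` is the start of the sweep at vertex `0`, which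
  -- occurs again at the end. The default `0` beyond `2 * n` only keeps `V` total with values that
  -- are vertices.
  refine ⟨fun m => if hm : 1 ≤ m ∧ m ≤ 2 * n then f ⟨m - 1, by omega⟩ else 0, by simp, ?_, ?_, ?_⟩
  · intro m
    dsimp only
    split_ifs
    · exact hf _
    · omega
  · intro w hw hw'
    have hmem : vVal I w ∈ Set.range e := by
      rw [Finset.range_orderEmbOfFin]
      exact_mod_cast Finset.mem_image_of_mem _ (by simp [hw, hw'])
    obtain ⟨i, hi⟩ := hmem
    refine ⟨i + 1, by omega, by omega, ?_⟩
    have hi' : 1 ≤ (i : ℕ) + 1 ∧ (i : ℕ) + 1 ≤ 2 * n := by omega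
    simp only [hi', and_self, dif_pos, Nat.add_sub_cancel, Fin.eta]
    exact h.vVal_inj (hf i).1 (hf i).2 hw hw' (by rw [hfe, hi])
  · intro i j h1 h2 h3
    dsimp only
    rw [dif_pos ⟨h1, by omega⟩, dif_pos ⟨by omega, h3⟩, hfe, hfe]
    exact e.strictMono (by simp; omega)

end

/-- `V` lists the vertices by direction, starting and ending with the vertex `0`. -/
structure Order (I : List ℤ) (n : ℕ) (V : ℕ → ℤ) : Prop where
  gen : Gen I n
  zero : V 0 = 0
  mem : ∀ m, 0 ≤ V m ∧ V m < 2 * n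
  surj : ∀ w : ℤ, 0 ≤ w → w < 2 * n → ∃ m, 1 ≤ m ∧ m ≤ 2 * n ∧ V m = w
  mono : ∀ i j, 1 ≤ i → i < j → j ≤ 2 * n → vVal I (V i) < vVal I (V j)

section
variable {I : List ℤ} {n : ℕ} {V : ℕ → ℤ} (h : Order I n V)
include h

theorem Order.inj {i j : ℕ} (hi : 1 ≤ i) (hi' : i ≤ 2 * n) (hj : 1 ≤ j) (hj' : j ≤ 2 * n)
    (hij : V i = V j) : i = j := by
  rcases lt_trichotomy i j with h1 | h1 | h1
  · exact absurd (h.mono i j hi h1 hj') (by simp [hij])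
  · exact h1
  · exact absurd (h.mono j i hj h1 hi') (by simp [hij])

/-- Nothing comes after vertex `0` in the order: its cross product with itself is not positive, and
neither alternative of `Gen.before` can then hold. -/
theorem Order.last : V (2 * n) = 0 := by
  have hn := h.gen.pos
  obtain ⟨m, h1, h2, h3⟩ := h.surj 0 le_rfl (by omega)
  rcases h2.lt_or_eq with h4 | h4
  · exfalso
    have h5 := h.mono m _ h1 h4 le_rfl
    have hm := h.mem (2 * n)
    rw [h3] at h5
    have h6 := h.gen.before le_rfl (by omega) hm.1 hm.2 h5
    simp only [cr_self, lt_irrefl, false_and, false_or, not_lt] at h6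
    exact absurd h6.2 (by simpa using h6.1)
  · rw [← h4, h3]

/-- The next vertex is the first one in the given order. -/
theorem Order.le_next {m : ℕ} (hm : m < 2 * n) {w : ℤ} (hw : 0 ≤ w) (hw' : w < 2 * n)
    (hmw : m = 0 ∨ vVal I (V m) < vVal I w) : w = V (m + 1) ∨ vVal I (V (m + 1)) < vVal I w := by
  obtain ⟨j, h1, h2, rfl⟩ := h.surj w hw hw'
  have hj : m < j := by
    rcases hmw with rfl | hmw
    · omega
    · by_contra hj
      rcases (not_lt.mp hj).lt_or_eq with h3 | rfl
      · exact lt_asymm hmw (h.mono j m h1 h3 hm.le)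
      · exact lt_irrefl _ hmw
  rcases (show m + 1 ≤ j from hj).lt_or_eq with h3 | h3
  · exact .inr (h.mono _ _ (by omega) h3 h2)
  · exact .inl (by rw [h3])

/-- There is no vertex between two consecutive ones. -/
theorem Order.next {m : ℕ} (hm : m < 2 * n) {w : ℤ} (hw : 0 ≤ w) (hw' : w < 2 * n)
    (hc : 0 < cr I (V m) w) :
    w = V (m + 1) ∨ (0 < cr I (V m) (V (m + 1)) ∧ 0 < cr I (V (m + 1)) w) := by
  have hv := h.mem m
  have hv' := h.mem (m + 1)
  rcases Nat.eq_zero_or_pos m with rfl | hm0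
  · rw [h.zero] at hc ⊢
    rcases h.le_next hm hw hw' (.inl rfl) with h1 | h1
    · exact .inl h1
    · rcases h.gen.before hv'.1 hv'.2 hw hw' h1 with h2 | h2
      · exact absurd hc h2.2
      · exact .inr ⟨h2.1.2 hc, h2.2⟩
  · have hmono := h.mono m (m + 1) hm0 (by omega) (by omega)
    have hb := h.gen.before hv.1 hv.2 hv'.1 hv'.2 hmono
    have hv0 : cr I 0 (V m) ≠ 0 := by
      rw [Ne, h.gen.cr_zero hv.1 hv.2, ← h.last]
      exact fun h1 => by have := h.inj hm0 hm.le (by omega) le_rfl h1; omega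
    -- The values know only in which half-plane of vertex `0` a direction lies. The three-term
    -- relation among the four vectors determines the sign that this leaves open.
    have hp := cr_plucker I 0 (V m) (V (m + 1)) w
    rcases lt_trichotomy (vVal I (V m)) (vVal I w) with h1 | h1 | h1
    · rcases h.le_next hm hw hw' (.inr h1) with h2 | h2
      · exact .inl h2
      · right
        have hb' := h.gen.before hv'.1 hv'.2 hw hw' h2
        have hb'' := h.gen.before hv.1 hv.2 hw hw' h1
        revert hp hb hb' hb'' hc hv0
        generalize cr I 0 (V m) = a
        generalize cr I 0 (V (m + 1)) = b
        generalize cr I 0 w = c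
        generalize cr I (V m) (V (m + 1)) = d
        generalize cr I (V m) w = e
        generalize cr I (V (m + 1)) w = f
        intro he hb ha hp hb' hb''
        by_cases g1 : 0 < a <;> by_cases g2 : 0 < b <;> by_cases g3 : 0 < c <;>
          simp [g1, g2, g3] at hb hb' hb''
        · exact ⟨hb, hb'⟩
        · refine ⟨hb, ?_⟩
          by_contra g4
          nlinarith [mul_nonneg (neg_nonneg.mpr (not_lt.mp g3)) hb.le, mul_pos g2 he,
            mul_nonneg g1.le (neg_nonneg.mpr (not_lt.mp g4))]
        · refine ⟨?_, hb'⟩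
          by_contra g4
          nlinarith [mul_pos g1 hb', mul_nonneg (neg_nonneg.mpr (not_lt.mp g2)) he.le,
            mul_nonneg (neg_nonneg.mpr (not_lt.mp g3)) (neg_nonneg.mpr (not_lt.mp g4))]
        · exact ⟨hb, hb'⟩
    · have := h.gen.vVal_inj hv.1 hv.2 hw hw' h1
      rw [← this, cr_self] at hc
      exact absurd hc (lt_irrefl _)
    · right
      have hb' := h.gen.before hw hw' hv.1 hv.2 h1
      rw [cr_swap I (V m) w] at hb'
      revert hp hb hb' hc hv0
      generalize cr I 0 (V m) = a
      generalize cr I 0 (V (m + 1)) = b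
      generalize cr I 0 w = c
      generalize cr I (V m) (V (m + 1)) = d
      generalize cr I (V m) w = e
      generalize cr I (V (m + 1)) w = f
      intro he hb ha hp hb'
      have g3 : 0 < c := by
        rcases hb' with hb' | hb'
        · exact hb'.1
        · omega
      have g1 : ¬ 0 < a := by
        rcases hb' with hb' | hb'
        · exact hb'.2
        · omega
      simp [g1] at hb
      refine ⟨hb.2, ?_⟩
      by_contra g4
      have g5 : a < 0 := by omega
      nlinarith [mul_pos g3 hb.2, mul_nonneg (neg_nonneg.mpr hb.1) he.le,
        mul_nonneg (neg_nonneg.mpr g5.le) (neg_nonneg.mpr (not_lt.mp g4))]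

end

end KVis

namespace KVis

section
variable {I : List ℤ} {n : ℕ} {V : ℕ → ℤ} (h : Order I n V)
include h

/-- There is no vertex between two consecutive ones. -/
theorem Order.prev {m : ℕ} (hm : m < 2 * n) {w : ℤ} (hw : 0 ≤ w) (hw' : w < 2 * n)
    (hc : 0 < cr I w (V (m + 1))) :
    w = V m ∨ (0 < cr I (V m) (V (m + 1)) ∧ 0 < cr I w (V m)) := by
  have hv := h.mem m
  have hv' := h.mem (m + 1)
  have hne : w ≠ V (m + 1) := by
    rintro rfl
    rw [cr_self] at hc
    exact lt_irrefl _ hc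
  by_cases hwv : w = V m
  · exact .inl hwv
  right
  by_cases hgt : m = 0 ∨ vVal I (V m) < vVal I w
  · have h1 := (h.le_next hm hw hw' hgt).resolve_left hne
    have hb := h.gen.before hv'.1 hv'.2 hw hw' h1
    have hcs := cr_swap I (V (m + 1)) w
    rcases hb with hb | hb
    · rcases Nat.eq_zero_or_pos m with rfl | hm0
      · have h2 := mt (h.gen.cr_zero hw hw').1 (h.zero ▸ hwv)
        rw [h.zero, cr_swap I 0 w]
        exact ⟨hb.1, by omega⟩
      · have hmono := h.mono m (m + 1) hm0 (by omega) (by omega)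
        have hb' := h.gen.before hv.1 hv.2 hv'.1 hv'.2 hmono
        have hp := cr_plucker I 0 w (V m) (V (m + 1))
        have hb1 : 0 < cr I 0 (V m) := by
          rcases hb' with h3 | h3
          · exact h3.1
          · exact h3.1.2 hb.1
        have hb2 : 0 < cr I (V m) (V (m + 1)) := by
          rcases hb' with h3 | h3
          · exact absurd hb.1 h3.2
          · exact h3.2
        refine ⟨hb2, ?_⟩
        by_contra h4
        nlinarith [mul_pos hb1 hc, mul_nonneg (neg_nonneg.mpr (not_lt.mp hb.2)) hb2.le,
          mul_nonneg hb.1.le (neg_nonneg.mpr (not_lt.mp h4))]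
    · omega
  · rw [not_or, not_lt] at hgt
    have h1 : vVal I w < vVal I (V m) :=
      lt_of_le_of_ne hgt.2 fun h2 => hwv (h.gen.vVal_inj hw hw' hv.1 hv.2 h2)
    have hmono := h.mono m (m + 1) (by omega) (by omega) (by omega)
    have hb := h.gen.before hv.1 hv.2 hv'.1 hv'.2 hmono
    have hb' := h.gen.before hw hw' hv.1 hv.2 h1
    have hp := cr_plucker I 0 w (V m) (V (m + 1))
    revert hp hb hb' hc
    generalize cr I 0 (V m) = a
    generalize cr I 0 (V (m + 1)) = b
    generalize cr I 0 w = c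
    generalize cr I (V m) (V (m + 1)) = d
    generalize cr I w (V m) = e
    generalize cr I w (V (m + 1)) = f
    intro hf hb hb' hp
    by_cases g1 : 0 < a <;> by_cases g2 : 0 < b <;> by_cases g3 : 0 < c <;>
      simp [g1, g2, g3] at hb hb'
    · exact ⟨hb, hb'⟩
    · refine ⟨?_, hb'⟩
      by_contra g4
      nlinarith [mul_pos g1 hf, mul_nonneg (neg_nonneg.mpr (not_lt.mp g2)) hb'.le,
        mul_nonneg g3.le (neg_nonneg.mpr (not_lt.mp g4))]
    · refine ⟨hb, ?_⟩
      by_contra g4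
      nlinarith [mul_pos g3 hb, mul_nonneg (neg_nonneg.mpr (not_lt.mp g1)) hf.le,
        mul_nonneg (neg_nonneg.mpr (not_lt.mp g2)) (neg_nonneg.mpr (not_lt.mp g4))]
    · exact ⟨hb, hb'⟩

end

/-! ### The segments that meet a ray -/

/-- The vertices `sa x` and `sb x` are the vertices of segment `x`. -/
theorem sa_sb (I : List ℤ) (x : ℤ) :
    (sa I x = 2 * x ∧ sb I x = 2 * x + 1) ∨ (sa I x = 2 * x + 1 ∧ sb I x = 2 * x) := by
  unfold sa sb; split_ifs <;> simp

/-- The closed segment `x` meets the ray through the vertex `v`. -/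
def Cl (I : List ℤ) (v x : ℤ) : Prop :=
  0 ≤ cr I (sa I x) v ∧ 0 ≤ cr I v (sb I x) ∧ 0 < D I v x

/-- On the ray through `v`, segment `x` comes before segment `y`. -/
def Lt (I : List ℤ) (v x y : ℤ) : Prop := X I x * D I v y < X I y * D I v x

instance (I : List ℤ) (v x y : ℤ) : Decidable (Lt I v x y) := by unfold Lt; infer_instance

theorem Act.cl {I : List ℤ} {v x : ℤ} (h : Act I v x) : Cl I v x :=
  ⟨h.1, h.2.le, add_pos_of_nonneg_of_pos h.1 h.2⟩

theorem Bef.cl {I : List ℤ} {v x : ℤ} (h : Bef I v x) : Cl I v x :=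
  ⟨h.1.le, h.2, add_pos_of_pos_of_nonneg h.1 h.2⟩

/-- The vertices in circular order, and disjoint segments: the distances of two segments in a
direction `(dx, dy)` differ. -/
structure Sweep (I : List ℤ) (n : ℕ) (V : ℕ → ℤ) : Prop extends Order I n V where
  sep : ∀ x y : ℤ, 0 ≤ x → x < n → 0 ≤ y → y < n → x ≠ y → ∀ dx dy : ℤ,
    0 ≤ px I (sa I x) * dy - py I (sa I x) * dx → 0 ≤ dx * py I (sb I x) - dy * px I (sb I x) →
    0 ≤ px I (sa I y) * dy - py I (sa I y) * dx → 0 ≤ dx * py I (sb I y) - dy * px I (sb I y) →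
    0 < px I (sa I x) * dy - py I (sa I x) * dx + (dx * py I (sb I x) - dy * px I (sb I x)) →
    0 < px I (sa I y) * dy - py I (sa I y) * dx + (dx * py I (sb I y) - dy * px I (sb I y)) →
    X I x * (px I (sa I y) * dy - py I (sa I y) * dx + (dx * py I (sb I y) - dy * px I (sb I y))) ≠
    X I y * (px I (sa I x) * dy - py I (sa I x) * dx + (dx * py I (sb I x) - dy * px I (sb I x)))

section
variable {I : List ℤ} {n : ℕ} {V : ℕ → ℤ} {v x y z : ℤ} {m : ℕ}

theorem sa_mem (I : List ℤ) (hx : 0 ≤ x ∧ x < n) : 0 ≤ sa I x ∧ sa I x < 2 * n := by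
  rcases sa_sb I x with h | h <;> omega

theorem sb_mem (I : List ℤ) (hx : 0 ≤ x ∧ x < n) : 0 ≤ sb I x ∧ sb I x < 2 * n := by
  rcases sa_sb I x with h | h <;> omega

theorem Gen.X_pos (h : Gen I n) (hx : 0 ≤ x ∧ x < n) : 0 < X I x := by
  have h1 := h.gp (2 * x) (2 * x + 1) (by omega) (by omega) (by omega) (by omega) (by omega)
  unfold X sa sb
  split_ifs with h2
  · exact h2
  · rw [cr_swap]; omega

theorem Gen.cr_eq_zero (h : Gen I n) {u w : ℤ} (hu : 0 ≤ u ∧ u < 2 * n) (hw : 0 ≤ w ∧ w < 2 * n) :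
    cr I u w = 0 ↔ u = w := by
  constructor
  · intro h1
    by_contra h2
    exact h.gp u w hu.1 hu.2 hw.1 hw.2 h2 h1
  · rintro rfl; exact cr_self _ _

/-- The vertex `v` is the first or the last one of the segment to which it belongs. -/
theorem owner (I : List ℤ) (v : ℤ) : v = sa I (v / 2) ∨ v = sb I (v / 2) := by
  rcases sa_sb I (v / 2) with h | h <;> omega

theorem eq_owner (h : v = sa I x ∨ v = sb I x) : x = v / 2 := by
  rcases sa_sb I x with h' | h' <;> omega

/-- The two notions differ only where a cross product with `v` vanishes, and that happens only for
the segment that owns `v`. So an event changes the status of one segment. -/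
theorem Gen.act_iff_bef (h : Gen I n) (hv : 0 ≤ v ∧ v < 2 * n) (hx : 0 ≤ x ∧ x < n)
    (hne : x ≠ v / 2) : Act I v x ↔ Bef I v x := by
  have h1 := h.cr_eq_zero (sa_mem I hx) hv
  have h2 := h.cr_eq_zero hv (sb_mem I hx)
  have h3 : cr I (sa I x) v ≠ 0 := fun h4 => hne (eq_owner (.inl (h1.1 h4).symm))
  have h4 : cr I v (sb I x) ≠ 0 := fun h4 => hne (eq_owner (.inr (h2.1 h4)))
  unfold Act Bef
  omega

theorem Gen.act_sa (h : Gen I n) (hx : 0 ≤ x ∧ x < n) : Act I (sa I x) x ∧ ¬ Bef I (sa I x) x := by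
  have h1 := cr_self I (sa I x)
  have h2 := h.X_pos hx
  unfold X at h2
  unfold Act Bef
  omega

theorem Gen.bef_sb (h : Gen I n) (hx : 0 ≤ x ∧ x < n) : ¬ Act I (sb I x) x ∧ Bef I (sb I x) x := by
  have h1 := cr_self I (sb I x)
  have h2 := h.X_pos hx
  unfold X at h2
  unfold Act Bef
  omega

/-- Between two consecutive vertices, the same segments meet the rays. -/
theorem Order.act_iff_bef (h : Order I n V) (hm : m < 2 * n) (hx : 0 ≤ x ∧ x < n) :
    Act I (V m) x ↔ Bef I (V (m + 1)) x := by
  have hX := h.gen.X_pos hx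
  have ha := sa_mem I hx
  have hb := sb_mem I hx
  have hp := cr_plucker I (sa I x) (V m) (V (m + 1)) (sb I x)
  unfold X at hX
  constructor
  · rintro ⟨h1, h2⟩
    rcases h.next hm hb.1 hb.2 h2 with h3 | ⟨h3, h4⟩
    · rw [Bef, ← h3, cr_self]
      exact ⟨hX, le_rfl⟩
    · refine ⟨?_, h4.le⟩
      by_contra h5
      nlinarith [mul_nonneg h1 h4.le, mul_pos hX h3,
        mul_nonneg (neg_nonneg.mpr (not_lt.mp h5)) h2.le]
  · rintro ⟨h1, h2⟩
    rcases h.prev hm ha.1 ha.2 h1 with h3 | ⟨h3, h4⟩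
    · rw [Act, ← h3, cr_self]
      exact ⟨le_rfl, hX⟩
    · refine ⟨h4.le, ?_⟩
      by_contra h5
      nlinarith [mul_nonneg h4.le h2, mul_pos hX h3,
        mul_nonneg (neg_nonneg.mpr (not_lt.mp h5)) h1.le]

/-- Two segments at the same distance on one ray would have a point in common. -/
theorem Sweep.lt_total (h : Sweep I n V) (hx : 0 ≤ x ∧ x < n) (hy : 0 ≤ y ∧ y < n) (hxy : x ≠ y)
    (hcx : Cl I v x) (hcy : Cl I v y) : Lt I v x y ∨ Lt I v y x :=
  lt_or_gt_of_ne (h.sep x y hx.1 hx.2 hy.1 hy.2 hxy (px I v) (py I v) hcx.1 hcx.2.1 hcy.1 hcy.2.1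
    hcx.2.2 hcy.2.2)

theorem lt_irrefl' (I : List ℤ) (v x : ℤ) : ¬ Lt I v x x := lt_irrefl _

theorem lt_trans' (hx : 0 < D I v x) (hy : 0 < D I v y) (hz : 0 < D I v z)
    (h1 : Lt I v x y) (h2 : Lt I v y z) : Lt I v x z := by
  unfold Lt at *
  have h3 := mul_lt_mul_of_pos_right h1 hz
  have h4 := mul_lt_mul_of_pos_right h2 hx
  have h5 : X I x * D I v z * D I v y < X I z * D I v x * D I v y := by linarith
  exact lt_of_mul_lt_mul_right h5 hy.le

/-- Between two consecutive vertices, the order of the segments does not change. -/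
theorem Sweep.lt_next (h : Sweep I n V) (hm : m < 2 * n) (hx : 0 ≤ x ∧ x < n)
    (hy : 0 ≤ y ∧ y < n) (hax : Act I (V m) x) (hay : Act I (V m) y) :
    Lt I (V m) x y ↔ Lt I (V (m + 1)) x y := by
  by_cases hxy : x = y
  · subst hxy; simp [lt_irrefl']
  have hbx := (h.act_iff_bef hm hx).1 hax
  have hby := (h.act_iff_bef hm hy).1 hay
  have key : ∀ x y : ℤ, (0 ≤ x ∧ x < n) → (0 ≤ y ∧ y < n) → x ≠ y → Act I (V m) x → Act I (V m) y →
      Bef I (V (m + 1)) x → Bef I (V (m + 1)) y → Lt I (V m) x y → ¬ Lt I (V (m + 1)) y x := by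
    intro x y hx hy hxy hax hay hbx hby h1 h2
    unfold Lt at h1 h2
    -- The difference `X y * D x - X x * D y` is linear in the direction; it is `p > 0` at `V m` and
    -- `-r < 0` at `V (m + 1)`. It vanishes at the integer combination `r * V m + p * V (m + 1)`,
    -- where `sep` forbids this.
    obtain ⟨p, hp⟩ : ∃ p, p = X I y * D I (V m) x - X I x * D I (V m) y := ⟨_, rfl⟩
    obtain ⟨r, hr⟩ : ∃ r, r = X I x * D I (V (m + 1)) y - X I y * D I (V (m + 1)) x := ⟨_, rfl⟩
    have hp0 : 0 < p := by omega
    have hr0 : 0 < r := by omega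
    have e1 : ∀ z, px I (sa I z) * (r * py I (V m) + p * py I (V (m + 1))) -
        py I (sa I z) * (r * px I (V m) + p * px I (V (m + 1))) =
        r * cr I (sa I z) (V m) + p * cr I (sa I z) (V (m + 1)) := fun z => by unfold cr; ring
    have e2 : ∀ z, (r * px I (V m) + p * px I (V (m + 1))) * py I (sb I z) -
        (r * py I (V m) + p * py I (V (m + 1))) * px I (sb I z) =
        r * cr I (V m) (sb I z) + p * cr I (V (m + 1)) (sb I z) := fun z => by unfold cr; ring
    have e3 : ∀ z, r * cr I (sa I z) (V m) + p * cr I (sa I z) (V (m + 1)) +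
        (r * cr I (V m) (sb I z) + p * cr I (V (m + 1)) (sb I z)) =
        r * D I (V m) z + p * D I (V (m + 1)) z := fun z => by unfold D; ring
    have hs := h.sep x y hx.1 hx.2 hy.1 hy.2 hxy (r * px I (V m) + p * px I (V (m + 1)))
      (r * py I (V m) + p * py I (V (m + 1)))
    simp only [e1, e2, e3] at hs
    have q1 := hax.1
    have q2 := hax.2.le
    have q3 := hbx.1.le
    have q4 := hbx.2
    have q5 := hay.1
    have q6 := hay.2.le
    have q7 := hby.1.le
    have q8 := hby.2
    have q9 := hax.cl.2.2
    have q10 := hay.cl.2.2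
    have q11 := hbx.cl.2.2
    have q12 := hby.cl.2.2
    refine hs (by positivity) (by positivity) (by positivity) (by positivity) (by positivity)
      (by positivity) ?_
    rw [hp, hr]
    ring
  constructor
  · intro h1
    exact (h.lt_total hx hy hxy hbx.cl hby.cl).resolve_right
      (key x y hx hy hxy hax hay hbx hby h1)
  · intro h1
    refine (h.lt_total hx hy hxy hax.cl hay.cl).resolve_right fun h2 => ?_
    exact key y x hy hx (Ne.symm hxy) hay hax hby hbx h2 h1

end

end KVis

namespace KVis

/-! ### The element of a given rank -/

/-- `r` is a strict linear order on `A`. -/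
structure LinOn (r : ℤ → ℤ → Prop) (A : Finset ℤ) : Prop where
  irrefl : ∀ x ∈ A, ¬ r x x
  trans : ∀ x ∈ A, ∀ y ∈ A, ∀ z ∈ A, r x y → r y z → r x z
  total : ∀ x ∈ A, ∀ y ∈ A, x ≠ y → r x y ∨ r y x

open scoped Classical in
/-- The number of elements of `G` that come before `x`. -/
noncomputable def rank (r : ℤ → ℤ → Prop) (G : Finset ℤ) (x : ℤ) : ℕ := (G.filter fun y => r y x).card

/-- `e` is the element of `G` that comes after exactly `k` others; it is `n` if there is none. -/
def IsKth (r : ℤ → ℤ → Prop) (n k : ℕ) (G : Finset ℤ) (e : ℤ) : Prop :=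
  (e ∈ G ∧ rank r G e = k) ∨ (e = n ∧ G.card ≤ k)

/-- `x` comes before `e`, where `n` stands for an element after all others. -/
def Near (r : ℤ → ℤ → Prop) (n : ℕ) (e x : ℤ) : Prop := e = n ∨ r x e

/-- `x` comes after `e`, where `n` stands for an element after all others. -/
def Far (r : ℤ → ℤ → Prop) (n : ℕ) (e x : ℤ) : Prop := e ≠ n ∧ r e x

section
variable {r : ℤ → ℤ → Prop} {A G : Finset ℤ} {n k : ℕ} {e e' i x : ℤ}

theorem LinOn.asymm (h : LinOn r A) {x y : ℤ} (hx : x ∈ A) (hy : y ∈ A) (h1 : r x y) : ¬ r y x :=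
  fun h2 => h.irrefl x hx (h.trans x hx y hy x hx h1 h2)

theorem LinOn.not_iff (h : LinOn r A) {x y : ℤ} (hx : x ∈ A) (hy : y ∈ A) (hxy : x ≠ y) :
    ¬ r x y ↔ r y x :=
  ⟨fun h1 => (h.total x hx y hy hxy).resolve_left h1, fun h1 => h.asymm hy hx h1⟩

theorem rank_congr {r' : ℤ → ℤ → Prop} (h : ∀ y ∈ G, r y x ↔ r' y x) : rank r G x = rank r' G x := by
  classical
  unfold rank
  rw [Finset.filter_congr h]

/-- The elements of rank at most `k` are those that do not come after `e`. -/
theorem IsKth.rank_le_iff (h : IsKth r n k G e) (hA : LinOn r A) (hG : G ⊆ A) (hn : (n : ℤ) ∉ A)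
    (hx : x ∈ G) : rank r G x ≤ k ↔ ¬ Far r n e x := by
  classical
  rcases h with ⟨h1, h2⟩ | ⟨h1, h2⟩
  · have hen : e ≠ n := fun h3 => hn (h3 ▸ hG h1)
    simp only [Far, hen, ne_eq, not_false_eq_true, true_and, ← h2]
    constructor
    · intro h3 h4
      refine absurd h3 (not_le.mpr (Finset.card_lt_card ?_))
      rw [Finset.ssubset_iff_of_subset]
      · exact ⟨e, by simp [h1, h4], by simp [hA.irrefl e (hG h1)]⟩
      · intro y hy
        simp only [Finset.mem_filter] at hy ⊢
        exact ⟨hy.1, hA.trans y (hG hy.1) e (hG h1) x (hG hx) hy.2 h4⟩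
    · intro h3
      by_cases hxe : x = e
      · rw [hxe]
      · have h4 := (hA.not_iff (hG h1) (hG hx) (Ne.symm hxe)).1 h3
        refine Finset.card_le_card fun y hy => ?_
        simp only [Finset.mem_filter] at hy ⊢
        exact ⟨hy.1, hA.trans y (hG hy.1) x (hG hx) e (hG h1) hy.2 h4⟩
  · simp only [Far, h1, ne_eq, not_true_eq_false, false_and, not_false_eq_true, iff_true]
    exact (Finset.card_filter_le _ _).trans h2

theorem rank_insert_of (hi : i ∉ G) (h : r i x) : rank r (insert i G) x = rank r G x + 1 := by
  classical
  unfold rank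
  rw [Finset.filter_insert, if_pos h, Finset.card_insert_of_notMem (by simp [hi])]

theorem rank_insert_of_not (h : ¬ r i x) : rank r (insert i G) x = rank r G x := by
  classical
  unfold rank
  rw [Finset.filter_insert, if_neg h]

/-- There are two reasons for no change: the new element comes after `e`, or there was no element of
rank `k` and there still is none. -/
theorem IsKth.insert_of_not (h : IsKth r n k G e) (hG : insert i G ⊆ A)
    (hn : (n : ℤ) ∉ A) (hi : i ∉ G) (hc : ¬ (k < (insert i G).card ∧ Near r n e i)) :
    IsKth r n k (insert i G) e := by
  classical
  have hcard := Finset.card_insert_of_notMem hi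
  rcases h with ⟨h1, h2⟩ | ⟨h1, h2⟩
  · have hen : e ≠ n := fun h3 => hn (h3 ▸ hG (Finset.mem_insert_of_mem h1))
    refine .inl ⟨Finset.mem_insert_of_mem h1, ?_⟩
    rw [rank_insert_of_not, h2]
    intro h3
    refine hc ⟨?_, .inr h3⟩
    have : rank r G e ≤ G.card := Finset.card_filter_le _ _
    omega
  · refine .inr ⟨h1, ?_⟩
    by_contra h3
    exact hc ⟨by omega, .inl h1⟩

/-- The elements before the last one of an initial section are the others of this section, so
counting the section gives the rank of the predecessor of `e`. Here `e` need not belong to `G`. -/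
theorem rank_max (hA : LinOn r A) (hG : G ⊆ A) {S : Finset ℤ} (hS : ∀ y, y ∈ S ↔ y ∈ G ∧ Near r n e y)
    (he : e = n ∨ e ∈ A)
    (he' : e' ∈ S) (hmax : ∀ y ∈ S, ¬ r e' y) : rank r G e' + 1 = S.card := by
  classical
  have h1 : G.filter (fun y => r y e') = S.erase e' := by
    ext y
    simp only [Finset.mem_filter, Finset.mem_erase]
    have hGe := ((hS e').1 he').1
    constructor
    · rintro ⟨h2, h3⟩
      refine ⟨fun h4 => hA.irrefl e' (hG hGe) (h4 ▸ h3), (hS y).2 ⟨h2, ?_⟩⟩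
      rcases he with he | he
      · exact .inl he
      · exact ((hS e').1 he').2.imp_right fun h4 => hA.trans y (hG h2) e' (hG hGe) e he h3 h4
    · rintro ⟨h2, h3⟩
      have h4 := ((hS y).1 h3).1
      exact ⟨h4, (hA.not_iff (hG hGe) (hG h4) (Ne.symm h2)).1 (hmax y h3)⟩
  rw [rank, h1, Finset.card_erase_of_mem he']
  have := Finset.card_pos.mpr ⟨e', he'⟩
  omega

/-- After the insertion of `i` before `e`, the predecessor of `e` has rank `k`. -/
theorem IsKth.insert_of (h : IsKth r n k G e) (hA : LinOn r A) (hG : insert i G ⊆ A)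
    (hn : (n : ℤ) ∉ A) (hi : i ∉ G) (hc : k < (insert i G).card ∧ Near r n e i)
    (he' : e' ∈ insert i G) (hne' : Near r n e e') (hmax : ∀ y ∈ insert i G, Near r n e y → ¬ r e' y) :
    IsKth r n k (insert i G) e' := by
  classical
  refine .inl ⟨he', ?_⟩
  have hcard := Finset.card_insert_of_notMem hi
  have h0 : e = n ∨ e ∈ A := by
    rcases h with h | h
    · exact .inr (hG (Finset.mem_insert_of_mem h.1))
    · exact .inl h.1
  have h1 := rank_max (S := (insert i G).filter (Near r n e)) hA hG (by simp) h0
    (by simpa using ⟨by simpa using he', hne'⟩)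
    (fun y hy => by
      rw [Finset.mem_filter] at hy
      exact hmax y hy.1 hy.2)
  -- If `e` exists, the `k` elements before it are joined by `i`. If `e = n`, the whole set counts;
  -- it had at most `k` elements and now has more than `k`.
  have h2 : ((insert i G).filter (Near r n e)).card = k + 1 := by
    rcases h with ⟨h3, h4⟩ | ⟨h3, h4⟩
    · have hen : e ≠ n := fun h3' => hn (h3' ▸ hG (Finset.mem_insert_of_mem h3))
      have : (insert i G).filter (Near r n e) = (insert i G).filter (fun y => r y e) :=
        Finset.filter_congr fun y _ => by simp [Near, hen]
      rw [this]
      have h5 := rank_insert_of (r := r) (x := e) hi (hc.2.resolve_left hen)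
      rw [rank] at h5
      omega
    · have : (insert i G).filter (Near r n e) = insert i G :=
        Finset.filter_true_of_mem fun y _ => .inl h3
      rw [this]
      have := hc.1
      omega
  omega

theorem IsKth.erase_of_not (h : IsKth r n k G e) (hA : LinOn r A) (hG : G ⊆ A) (hi : i ∈ G)
    (hc : Far r n e i) : IsKth r n k (G.erase i) e := by
  have h1 : e ∈ G ∧ rank r G e = k := h.resolve_right fun h => hc.1 h.1
  have hei : e ≠ i := by rintro rfl; exact hA.irrefl e (hG hi) hc.2
  refine .inl ⟨Finset.mem_erase.mpr ⟨hei, h1.1⟩, ?_⟩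
  have h2 := rank_insert_of_not (r := r) (G := G.erase i) (hA.asymm (hG h1.1) (hG hi) hc.2)
  rw [Finset.insert_erase hi] at h2
  omega

/-- The number of elements that remain in front after the removal of `i`. -/
theorem IsKth.card_erase (h : IsKth r n k G e) (hA : LinOn r A) (hG : G ⊆ A) (hn : (n : ℤ) ∉ A)
    (hi : i ∈ G) (hc : ¬ Far r n e i) {S : Finset ℤ}
    (hS : ∀ y, y ∈ S ↔ y ∈ G.erase i ∧ ¬ Far r n e y) : S.card ≤ k ∧ (e ≠ n → S.card = k) := by
  classical
  rcases h with ⟨h1, h2⟩ | ⟨h1, h2⟩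
  · have hen : e ≠ n := fun h3' => hn (h3' ▸ hG h1)
    suffices S.card = k from ⟨this.le, fun _ => this⟩
    have h3 : insert e (G.filter fun y => r y e) = insert i S := by
      ext y
      simp only [Finset.mem_insert, Finset.mem_filter, hS, Finset.mem_erase]
      simp only [Far, hen, ne_eq, not_false_eq_true, true_and] at hc ⊢
      constructor
      · rintro (rfl | ⟨h3, h4⟩)
        · by_cases h5 : y = i
          · exact .inl h5
          · exact .inr ⟨⟨h5, h1⟩, hA.irrefl y (hG h1)⟩
        · by_cases h5 : y = i
          · exact .inl h5
          · exact .inr ⟨⟨h5, h3⟩, hA.asymm (hG h3) (hG h1) h4⟩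
      · have key : ∀ y ∈ G, ¬ r e y → y = e ∨ y ∈ G ∧ r y e := by
          intro y hy h4
          by_cases h5 : y = e
          · exact .inl h5
          · exact .inr ⟨hy, (hA.not_iff (hG h1) (hG hy) (Ne.symm h5)).1 h4⟩
        rintro (rfl | ⟨⟨h3, h4⟩, h5⟩)
        · exact key y hi hc
        · exact key y h4 h5
    have h4 := congrArg Finset.card h3
    rw [Finset.card_insert_of_notMem (by simp [hA.irrefl e (hG h1)]),
      Finset.card_insert_of_notMem (by simp [hS])] at h4
    rw [rank] at h2
    omega
  · refine ⟨?_, fun h3 => absurd h1 h3⟩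
    refine (Finset.card_le_card fun y hy => ?_).trans h2
    exact (Finset.mem_erase.mp ((hS y).1 hy).1).2

/-- After the removal of `i` not behind `e`, the successor of `e` has rank `k`. -/
theorem IsKth.erase_of (h : IsKth r n k G e) (hA : LinOn r A) (hG : G ⊆ A) (hn : (n : ℤ) ∉ A)
    (hi : i ∈ G) (hc : ¬ Far r n e i)
    (he' : e' ∈ G.erase i) (hne' : Far r n e e')
    (hmin : ∀ y ∈ G.erase i, Far r n e y → ¬ r y e') : IsKth r n k (G.erase i) e' := by
  classical
  refine .inl ⟨he', ?_⟩
  have heG : e ∈ G := (h.resolve_right fun h => hne'.1 h.1).1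
  rw [← (h.card_erase hA hG hn hi hc (S := (G.erase i).filter fun y => ¬ Far r n e y) (by simp)).2
    hne'.1]
  unfold rank
  congr 1
  refine Finset.filter_congr fun y hy => ?_
  have hyG := hG (Finset.mem_erase.mp hy).2
  have heG' := hG (Finset.mem_erase.mp he').2
  constructor
  · exact fun h1 h2 => hmin y hy h2 h1
  · intro h1
    have h2 : ¬ r e y := fun h2 => h1 ⟨hne'.1, h2⟩
    by_cases h3 : e = y
    · exact h3 ▸ hne'.2
    · exact hA.trans y hyG e (hG heG) e' heG' ((hA.not_iff (hG heG) hyG h3).1 h2) hne'.2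

theorem IsKth.erase_of_none (h : IsKth r n k G e) (hA : LinOn r A) (hG : G ⊆ A) (hn : (n : ℤ) ∉ A)
    (hi : i ∈ G) (hc : ¬ Far r n e i) (hmin : ∀ y ∈ G.erase i, ¬ Far r n e y) :
    IsKth r n k (G.erase i) n :=
  .inr ⟨rfl, (h.card_erase hA hG hn hi hc (S := G.erase i)
    (fun y => ⟨fun h1 => ⟨h1, hmin y h1⟩, fun h1 => h1.1⟩)).1⟩

/-- `Near` and `Far` agree for `e` and its predecessor. -/
theorem near_far_pred (hA : LinOn r A) (hG : G ⊆ A) (hn : (n : ℤ) ∉ A) (he : e = n ∨ e ∈ A)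
    (he' : e' ∈ G) (hne' : Near r n e e') (hmax : ∀ y ∈ G, Near r n e y → ¬ r e' y)
    (hx : x ∈ G) (hxe : x ≠ e) (hxe' : x ≠ e') :
    (Near r n e x ↔ Near r n e' x) ∧ (Far r n e x ↔ Far r n e' x) := by
  have hen : e' ≠ n := fun h => hn (h ▸ hG he')
  simp only [Near, Far, hen, false_or, ne_eq, not_false_eq_true, true_and] at *
  have h1 := hmax x hx
  have h2 := hA.not_iff (hG he') (hG hx) (Ne.symm hxe')
  rcases he with he | he
  · simp only [he, true_or, not_true_eq_false, false_and, true_iff, false_iff] at *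
    tauto
  · have hen' : e ≠ n := fun h => hn (h ▸ he)
    simp only [hen', false_or, not_false_eq_true, true_and] at *
    have h3 := hA.trans x (hG hx) e' (hG he') e he
    have h4 := hA.trans e' (hG he') e he x (hG hx)
    have h5 := hA.not_iff (hG hx) he hxe
    tauto

/-- `Near` and `Far` agree for `e` and its successor. -/
theorem near_far_succ (hA : LinOn r A) (hG : G ⊆ A) (hn : (n : ℤ) ∉ A) (he : e ∈ A)
    (he' : e' ∈ G) (hne' : Far r n e e') (hmin : ∀ y ∈ G, Far r n e y → ¬ r y e')
    (hx : x ∈ G) (hxe : x ≠ e) (hxe' : x ≠ e') :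
    (Near r n e x ↔ Near r n e' x) ∧ (Far r n e x ↔ Far r n e' x) := by
  have hen : e' ≠ n := fun h => hn (h ▸ hG he')
  have hen' : e ≠ n := fun h => hn (h ▸ he)
  simp only [Near, Far, hen, hen', false_or, ne_eq, not_false_eq_true, true_and] at *
  have h1 := hmin x hx
  have h2 := hA.not_iff (hG hx) (hG he') hxe'
  have h3 := hA.trans x (hG hx) e he e' (hG he')
  have h4 := hA.trans e he e' (hG he') x (hG hx)
  have h5 := hA.not_iff (hG hx) he hxe
  tauto

theorem near_far_none (hA : LinOn r A) (hG : G ⊆ A) (he : e = n ∨ e ∈ A)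
    (hmin : ∀ y ∈ G, ¬ Far r n e y) (hx : x ∈ G) (hxe : x ≠ e) :
    (Near r n e x ↔ Near r n n x) ∧ (Far r n e x ↔ Far r n n x) := by
  have h1 := hmin x hx
  simp only [Near, Far, true_or, iff_true, ne_eq, not_true_eq_false, false_and, iff_false] at *
  refine ⟨?_, h1⟩
  by_cases hen : e = n
  · exact .inl hen
  · refine .inr ((hA.not_iff (he.resolve_left hen) (hG hx) (Ne.symm hxe)).1 fun h2 => h1 ⟨hen, h2⟩)

end

end KVis

namespace KVis

/-! ### The trees for the segments before and after a given one -/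

/-- The size of a block. -/
def Env.B (C : Env) : ℤ := (C.n : ℤ) / C.s + 1

section
variable {C : Env}

theorem Env.B_pos (C : Env) : 1 ≤ C.B := by
  have : 0 ≤ (C.n : ℤ) / C.s := by positivity
  unfold Env.B; omega

theorem Env.lt_B (C : Env) : (C.n : ℤ) < C.s * C.B := by
  have h1 := Int.lt_ediv_add_one_mul_self (C.n : ℤ) (show (0 : ℤ) < C.s by have := C.one_le_s; omega)
  rw [Env.B, mul_comm]; exact h1

/-- The rounding adds at most `s ≤ n`. Both the size of block ends and the final estimate `B ≤ 2 n /
s` come from here. -/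
theorem Env.B_le (C : Env) : C.s * C.B ≤ 2 * C.n := by
  have h1 := Int.ediv_mul_le (C.n : ℤ) (show (C.s : ℤ) ≠ 0 by have := C.one_le_s; omega)
  have h2 := C.s_le_n
  have h3 : (C.s : ℤ) * C.B = (C.n : ℤ) / C.s * C.s + C.s := by rw [Env.B]; ring
  omega

theorem Env.B_le_n (C : Env) : C.B ≤ 2 * C.n := by
  have h1 := C.B_le
  have h2 := C.one_le_s
  have h3 := C.B_pos
  nlinarith

/-- The block that contains `x`. -/
def Env.blk (C : Env) (x : ℤ) : ℕ := (x / C.B).toNat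

theorem Env.blk_cast {x : ℤ} (hx : 0 ≤ x) : ((C.blk x : ℕ) : ℤ) = x / C.B := by
  have := C.B_pos
  exact Int.toNat_of_nonneg (Int.ediv_nonneg hx (by omega))

/-- The value `x = n` is included on purpose: the default `e = n` also has a block, so the programs
can refresh or report the block of `e` without asking whether `e` exists. This is why a block has
size `n / s + 1`. -/
theorem Env.blk_lt {x : ℤ} (hx : 0 ≤ x) (hx' : x ≤ C.n) : C.blk x < C.s := by
  have h1 := C.B_pos
  have h2 := C.lt_B
  have h3 : x / C.B < C.s := Int.ediv_lt_of_lt_mul (by omega) (by omega)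
  have := Env.blk_cast (C := C) hx
  omega

/-- The segments with a number below `lim` that meet the rays immediately after the one through
`v`. -/
noncomputable def Gs (I : List ℤ) (lim v : ℤ) : Finset ℤ := (Finset.Ico 0 lim).filter fun x => Act I v x

theorem mem_Gs {I : List ℤ} {lim v x : ℤ} : x ∈ Gs I lim v ↔ (0 ≤ x ∧ x < lim) ∧ Act I v x := by
  simp [Gs]

/-- The distance of segment `e`, as a fraction, on the ray through `v`. -/
def thr (I : List ℤ) (n : ℕ) (v e : ℤ) : ℤ × ℤ := if e < n then (X I e, D I v e) else (1, 0)

open scoped Classical in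
/-- The key of segment `x` in the tree of the segments after `e`. -/
noncomputable def farKey (I : List ℤ) (n : ℕ) (v lim e x : ℤ) : ℤ × ℤ :=
  if x ∈ Gs I lim v ∧ Far (Lt I v) n e x then (X I x, D I v x) else (1, 0)

open scoped Classical in
/-- The key of segment `x` in the tree of the segments before `e`. -/
noncomputable def nearKey (I : List ℤ) (n : ℕ) (v lim e x : ℤ) : ℤ × ℤ :=
  if x ∈ Gs I lim v ∧ Near (Lt I v) n e x then (D I v x, X I x) else (1, 0)

/-- For `e = n` the threshold is the infinite fraction `(1, 0)`, and the same cross multiplication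
then finds no segment behind it. -/
theorem segKey_true {I : List ℤ} {n : ℕ} {v lim e x : ℤ} (hx : 0 ≤ x) (he : e ≤ n) :
    segKey true I v lim (thr I n v e).1 (thr I n v e).2 x = farKey I n v lim e x := by
  unfold segKey farKey
  by_cases h : x < lim ∧ Act I v x
  · have hd := h.2.cl.2.2
    have : ((thr I n v e).1 * D I v x < X I x * (thr I n v e).2) ↔ Far (Lt I v) n e x := by
      unfold Far Lt thr
      split_ifs with h1
      · simp [h1.ne]
      · simp [le_antisymm he (not_lt.mp h1), hd.le]
    classical exact if_congr (by rw [this, mem_Gs]; tauto) rfl rfl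
  · rw [if_neg fun h' => h ⟨h'.1, h'.2.1⟩, if_neg fun h' => h ⟨(mem_Gs.1 h'.1).1.2, (mem_Gs.1 h'.1).2⟩]

theorem segKey_false {I : List ℤ} {n : ℕ} {v lim e x : ℤ} (hx : 0 ≤ x) (he : e ≤ n) :
    segKey false I v lim (thr I n v e).1 (thr I n v e).2 x = nearKey I n v lim e x := by
  unfold segKey nearKey
  by_cases h : x < lim ∧ Act I v x
  · have hd := h.2.cl.2.2
    have : (X I x * (thr I n v e).2 < (thr I n v e).1 * D I v x) ↔ Near (Lt I v) n e x := by
      unfold Near Lt thr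
      split_ifs with h1
      · simp [h1.ne]
      · simp [le_antisymm he (not_lt.mp h1), hd]
    classical exact if_congr (by rw [this, mem_Gs]; tauto) rfl rfl
  · rw [if_neg fun h' => h ⟨h'.1, h'.2.1⟩, if_neg fun h' => h ⟨(mem_Gs.1 h'.1).1.2, (mem_Gs.1 h'.1).2⟩]

theorem validKey_far (I : List ℤ) (n : ℕ) (v lim e x : ℤ) : ValidKey (farKey I n v lim e x) := by
  unfold farKey
  split_ifs with h
  · exact .inl (mem_Gs.1 h.1).2.cl.2.2
  · exact .inr rfl

theorem validKey_near {I : List ℤ} {n : ℕ} (h : Gen I n) {v lim : ℤ} (hl : lim ≤ n) (e x : ℤ) :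
    ValidKey (nearKey I n v lim e x) := by
  unfold nearKey
  split_ifs with h1
  · exact .inl (h.X_pos ⟨(mem_Gs.1 h1.1).1.1, (mem_Gs.1 h1.1).1.2.trans_le hl⟩)
  · exact .inr rfl

theorem keyVal_far {I : List ℤ} {n : ℕ} {v lim e x : ℤ} :
    keyVal (farKey I n v lim e x) = ⊤ ↔ ¬ (x ∈ Gs I lim v ∧ Far (Lt I v) n e x) := by
  rw [keyVal_eq_top (validKey_far ..), farKey]
  split_ifs with h1
  · simp only [h1, and_self, not_true_eq_false, iff_false]
    intro h2
    have := (mem_Gs.1 h1.1).2.cl.2.2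
    rw [(Prod.mk.inj h2).2] at this
    exact lt_irrefl _ this
  · simp [h1]

theorem keyVal_near {I : List ℤ} {n : ℕ} (h : Gen I n) {v lim e x : ℤ} (hl : lim ≤ n) :
    keyVal (nearKey I n v lim e x) = ⊤ ↔ ¬ (x ∈ Gs I lim v ∧ Near (Lt I v) n e x) := by
  rw [keyVal_eq_top (validKey_near h hl ..), nearKey]
  split_ifs with h1
  · simp only [h1, and_self, not_true_eq_false, iff_false]
    intro h2
    have := h.X_pos ⟨(mem_Gs.1 h1.1).1.1, (mem_Gs.1 h1.1).1.2.trans_le hl⟩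
    rw [(Prod.mk.inj h2).2] at this
    exact lt_irrefl _ this
  · simp [h1]

theorem keyVal_far_le {I : List ℤ} {n : ℕ} {v lim e x y : ℤ}
    (hx : x ∈ Gs I lim v ∧ Far (Lt I v) n e x) (hy : y ∈ Gs I lim v ∧ Far (Lt I v) n e y) :
    keyVal (farKey I n v lim e x) ≤ keyVal (farKey I n v lim e y) ↔ ¬ Lt I v y x := by
  rw [← not_lt, ← keyLt_iff (validKey_far ..) (validKey_far ..), farKey, farKey, if_pos hx, if_pos hy]
  rfl

/-- The keys are inverse distances, so the minimum is the last segment before `e`, and one program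
for minima serves both trees. -/
theorem keyVal_near_le {I : List ℤ} {n : ℕ} (h : Gen I n) {v lim e x y : ℤ} (hl : lim ≤ n)
    (hx : x ∈ Gs I lim v ∧ Near (Lt I v) n e x) (hy : y ∈ Gs I lim v ∧ Near (Lt I v) n e y) :
    keyVal (nearKey I n v lim e x) ≤ keyVal (nearKey I n v lim e y) ↔ ¬ Lt I v x y := by
  rw [← not_lt, ← keyLt_iff (validKey_near h hl ..) (validKey_near h hl ..), nearKey, nearKey,
    if_pos hx, if_pos hy, KeyLt, Lt]
  simp only [mul_comm]

/-- The trees for the segments before and after `e` are correct, except for dirty leaves. -/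
structure Trees (C : Env) (v lim e : ℤ) (dirty : Set ℕ) (m : ℕ → ℤ) : Prop where
  near : TreeOk (nearKey C.I C.n v lim e) C.s 1 C.n C.B dirty m
  far : TreeOk (farKey C.I C.n v lim e) C.s 2 C.n C.B dirty m

/-- Node `x` of tree `τ` is cell `64 + 4 * x + τ`; hence from `64` on, the residue modulo `4` tells
to which tree a cell belongs. -/
theorem Trees.congr_mem {v lim e : ℤ} {dirty : Set ℕ} {m m' : ℕ → ℤ} (h : Trees C v lim e dirty m)
    (hm : ∀ r, 64 ≤ r → r % 4 = 1 ∨ r % 4 = 2 → m' r = m r) : Trees C v lim e dirty m' :=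
  ⟨h.near.congr_mem fun x _ _ => hm _ (by omega) (by omega),
    h.far.congr_mem fun x _ _ => hm _ (by omega) (by omega)⟩

/-- The trees remain correct if the segments in other leaves remain in place. -/
theorem Trees.transfer {v lim e v' lim' e' : ℤ} {dirty dirty' : Set ℕ} {m : ℕ → ℤ}
    (h : Trees C v lim e dirty m) (hg : Gen C.I C.n) (hl : lim ≤ C.n) (hl' : lim' ≤ C.n)
    (hd : dirty ⊆ dirty')
    (hG : ∀ x : ℤ, 0 ≤ x → x < C.n → C.blk x ∉ dirty' → (x ∈ Gs C.I lim v ↔ x ∈ Gs C.I lim' v'))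
    (hN : ∀ x : ℤ, x ∈ Gs C.I lim v → C.blk x ∉ dirty' →
      ((Near (Lt C.I v) C.n e x ↔ Near (Lt C.I v') C.n e' x) ∧
        (Far (Lt C.I v) C.n e x ↔ Far (Lt C.I v') C.n e' x)) ∧
      ∀ y : ℤ, y ∈ Gs C.I lim v → C.blk y ∉ dirty' → (Lt C.I v x y ↔ Lt C.I v' x y)) :
    Trees C v' lim' e' dirty' m := by
  have hn : ∀ lim v : ℤ, lim ≤ C.n → (C.n : ℤ) ∉ Gs C.I lim v := fun lim v hl h => by
    have := (mem_Gs.1 h).1.2; omega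
  constructor
  · refine h.near.transfer (fun _ _ => rfl) (if_neg fun h => hn _ _ hl h.1)
      (if_neg fun h => hn _ _ hl' h.1) hd fun y h0 h1 hy => ?_
    have e1 : ∀ y : ℤ, 0 ≤ y → y < C.n → C.blk y ∉ dirty' → (y ∈ Gs C.I lim v ∧ Near (Lt C.I v) C.n e y ↔
        y ∈ Gs C.I lim' v' ∧ Near (Lt C.I v') C.n e' y) := fun y h0 h1 hy => by
      rw [← hG y h0 h1 hy]
      exact and_congr_right fun h2 => (hN y h2 hy).1.1
    refine ⟨?_, fun z h2 h3 hz hle => ?_⟩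
    · rw [keyVal_near hg hl, keyVal_near hg hl', e1 y h0 h1 hy]
    · by_cases hz' : z ∈ Gs C.I lim v ∧ Near (Lt C.I v) C.n e z
      · by_cases hy' : y ∈ Gs C.I lim v ∧ Near (Lt C.I v) C.n e y
        · rw [keyVal_near_le hg hl hy' hz'] at hle
          rw [keyVal_near_le hg hl' ((e1 y h0 h1 hy).1 hy') ((e1 z h2 h3 hz).1 hz')]
          rwa [← (hN y hy'.1 hy).2 z hz'.1 hz]
        · rw [(keyVal_near hg hl).2 hy', top_le_iff, keyVal_near hg hl] at hle
          exact absurd hz' hle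
      · rw [e1 z h2 h3 hz, ← keyVal_near hg hl'] at hz'
        rw [hz']; exact le_top
  · refine h.far.transfer (fun _ _ => rfl) (if_neg fun h => hn _ _ hl h.1)
      (if_neg fun h => hn _ _ hl' h.1) hd fun y h0 h1 hy => ?_
    have e1 : ∀ y : ℤ, 0 ≤ y → y < C.n → C.blk y ∉ dirty' → (y ∈ Gs C.I lim v ∧ Far (Lt C.I v) C.n e y ↔
        y ∈ Gs C.I lim' v' ∧ Far (Lt C.I v') C.n e' y) := fun y h0 h1 hy => by
      rw [← hG y h0 h1 hy]
      exact and_congr_right fun h2 => (hN y h2 hy).1.2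
    refine ⟨?_, fun z h2 h3 hz hle => ?_⟩
    · rw [keyVal_far, keyVal_far, e1 y h0 h1 hy]
    · by_cases hz' : z ∈ Gs C.I lim v ∧ Far (Lt C.I v) C.n e z
      · by_cases hy' : y ∈ Gs C.I lim v ∧ Far (Lt C.I v) C.n e y
        · rw [keyVal_far_le hy' hz'] at hle
          rw [keyVal_far_le ((e1 y h0 h1 hy).1 hy') ((e1 z h2 h3 hz).1 hz')]
          rwa [← (hN z hz'.1 hz).2 y hy'.1 hy]
        · rw [keyVal_far.2 hy', top_le_iff, keyVal_far] at hle
          exact absurd hz' hle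
      · rw [e1 z h2 h3 hz, ← keyVal_far] at hz'
        rw [hz']; exact le_top

/-- The root of the tree of the segments before `e` holds the last one of them. -/
theorem Trees.near_root {v lim e : ℤ} {m : ℕ → ℤ} (h : Trees C v lim e ∅ m) (hg : Gen C.I C.n)
    (hl : lim ≤ C.n) :
    (m 69 = C.n ∧ ∀ y ∈ Gs C.I lim v, ¬ Near (Lt C.I v) C.n e y) ∨
    (m 69 ∈ Gs C.I lim v ∧ Near (Lt C.I v) C.n e (m 69) ∧
      ∀ y ∈ Gs C.I lim v, Near (Lt C.I v) C.n e y → ¬ Lt C.I v (m 69) y) := by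
  obtain ⟨h1, h2⟩ := h.near.root C.one_le_s
  by_cases h3 : m 69 ∈ Gs C.I lim v ∧ Near (Lt C.I v) C.n e (m 69)
  · refine .inr ⟨h3.1, h3.2, fun y hy hy' => ?_⟩
    rw [← keyVal_near_le hg hl h3 ⟨hy, hy'⟩]
    have := (mem_Gs.1 hy).1
    exact h2 y ⟨this.1, by omega⟩
  · have h4 := (keyVal_near hg hl).2 h3
    refine .inl ⟨h1.resolve_right fun h => h.2 h4, fun y hy hy' => ?_⟩
    have := (mem_Gs.1 hy).1
    have h5 := h2 y ⟨this.1, by omega⟩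
    rw [h4, top_le_iff, keyVal_near hg hl] at h5
    exact h5 ⟨hy, hy'⟩

/-- The root of the tree of the segments after `e` holds the first one of them. -/
theorem Trees.far_root {v lim e : ℤ} {m : ℕ → ℤ} (h : Trees C v lim e ∅ m)
    (hl : lim ≤ C.n) :
    (m 70 = C.n ∧ ∀ y ∈ Gs C.I lim v, ¬ Far (Lt C.I v) C.n e y) ∨
    (m 70 ∈ Gs C.I lim v ∧ Far (Lt C.I v) C.n e (m 70) ∧
      ∀ y ∈ Gs C.I lim v, Far (Lt C.I v) C.n e y → ¬ Lt C.I v y (m 70)) := by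
  obtain ⟨h1, h2⟩ := h.far.root C.one_le_s
  by_cases h3 : m 70 ∈ Gs C.I lim v ∧ Far (Lt C.I v) C.n e (m 70)
  · refine .inr ⟨h3.1, h3.2, fun y hy hy' => ?_⟩
    rw [← keyVal_far_le h3 ⟨hy, hy'⟩]
    have := (mem_Gs.1 hy).1
    exact h2 y ⟨this.1, by omega⟩
  · have h4 := keyVal_far.2 h3
    refine .inl ⟨h1.resolve_right fun h => h.2 h4, fun y hy hy' => ?_⟩
    have := (mem_Gs.1 hy).1
    have h5 := h2 y ⟨this.1, by omega⟩
    rw [h4, top_le_iff, keyVal_far] at h5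
    exact h5 ⟨hy, hy'⟩

end

/-- Store the distance of the segment in register `1`. -/
def setE : Cmd :=
  .ite (nE - rg 1) (withSeg (rg 1) fun a b => put 2 (xE a b) ;; put 3 (dE a b)) (put 2 1 ;; put 3 0)

theorem run_setE {C : Env} {σ : State} {v e : ℤ} (h0 : σ.mem 0 = v) (hv : 0 ≤ v ∧ v < 2 * C.n)
    (h1 : σ.mem 1 = e) (he : 0 ≤ e) :
    Run C setE σ 1000 (fun σ' => σ'.out = σ.out ∧ σ'.mem 2 = (thr C.I C.n v e).1 ∧
      σ'.mem 3 = (thr C.I C.n v e).2 ∧ ∀ r, r ≠ 2 → r ≠ 3 → σ'.mem r = σ.mem r) := by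
  refine (Run.ite (T := 900) (U := 10) (by decide)
    ((good_sub _ _).2 ⟨good_nE, good_rg (by norm_num)⟩) (fun hlt => ?_) (fun hlt => ?_)).time (by decide)
  · simp only [eval_sub, eval_nE, eval_rg, h1] at hlt
    refine Run.withSeg (T := 400) (good_rg (by norm_num)) (by simpa using h1) he (by omega) (by decide)
      (fun a b hab => ?_) (by decide)
    have g : (xE a b).grade ≤ 20 ∧ (xE a b).maxGrade < 1000 ∧ (dE a b).grade ≤ 20 ∧
        (dE a b).maxGrade < 1000 ∧ (xE a b).cost + (dE a b).cost < 395 := by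
      rcases hab.cases with ⟨rfl, -, rfl, -⟩ | ⟨rfl, -, rfl, -⟩ <;> decide
    obtain ⟨g1, g2, g3, g4, g5⟩ := g
    have hv0 : VGood C σ.mem (rg 0) := .rg (by norm_num) (by omega) (by omega)
    refine (Run.seq <| Run.put (by norm_num) g1 g2
      (hab.good_xE (good_rg (by norm_num)) (by simpa using h1)) fun m₁ e₁ f₁ =>
      Run.put (by norm_num) g3 g4 (hab.good_dE (good_rg (by norm_num)) (by simpa [f₁] using h1)
        (hv0.congr (by norm_num) (by simp [f₁]))) fun m₂ e₂ f₂ => ?_).time (by omega)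
    rw [hab.eval_xE (by simpa using h1)] at e₁
    rw [hab.eval_dE (by simpa [f₁] using h1)] at e₂
    simp only [f₁, ne_eq, Nat.reduceEqDiff, not_false_eq_true, h0] at e₂
    refine ⟨rfl, ?_, ?_, fun r h2 h3 => by simp [f₂ r h3, f₁ r h2]⟩
    · simp [f₂, e₁, thr, show e < C.n by omega]
    · simp [e₂, thr, show e < C.n by omega]
  · simp only [eval_sub, eval_nE, eval_rg, h1] at hlt
    refine (Run.seq <| Run.put (by norm_num) (by decide) (by decide)
      (by simp) fun m₁ e₁ f₁ =>
      Run.put (by norm_num) (by decide) (by decide) (by simp) fun m₂ e₂ f₂ => ?_).time (by decide)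
    refine ⟨rfl, ?_, ?_, fun r h2 h3 => by simp [f₂ r h3, f₁ r h2]⟩
    · simp [f₂, e₁, thr, show ¬ e < C.n by omega]
    · simp [e₂, thr, show ¬ e < C.n by omega]

/-- Refresh the trees for the segments before and after the one in register `1`. -/
def refreshNF : Cmd :=
  refresh 1 (rg 8) nE (segKeyCmd false) ;; refresh 2 (rg 8) nE (segKeyCmd true)

/-- The registers as they are when the trees for the segments before and after `e` are used. -/
structure Regs (C : Env) (v lim e : ℤ) (m : ℕ → ℤ) : Prop where
  gen : Gen C.I C.n
  v_mem : 0 ≤ v ∧ v < 2 * C.n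
  lim_le : lim ≤ C.n
  e_mem : 0 ≤ e ∧ e ≤ C.n
  r0 : m 0 = v
  r2 : m 2 = (thr C.I C.n v e).1
  r3 : m 3 = (thr C.I C.n v e).2
  r4 : m 4 = lim
  r8 : m 8 = C.B

theorem Regs.congr {C : Env} {v lim e : ℤ} {m m' : ℕ → ℤ} (h : Regs C v lim e m)
    (hm : ∀ r, r = 0 ∨ r = 2 ∨ r = 3 ∨ r = 4 ∨ r = 8 → m' r = m r) : Regs C v lim e m' :=
  ⟨h.gen, h.v_mem, h.lim_le, h.e_mem, by simp [hm, h.r0], by simp [hm, h.r2], by simp [hm, h.r3],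
    by simp [hm, h.r4], by simp [hm, h.r8]⟩

theorem KeyPost.of_eq {K K' : ℤ → ℤ × ℤ} {σ σ' : State} (h : KeyPost K σ σ')
    (hK : K (σ.mem 40) = K' (σ.mem 40)) : KeyPost K' σ σ' :=
  ⟨h.1, hK ▸ h.2.1, hK ▸ h.2.2.1, h.2.2.2⟩

theorem Regs.near {C : Env} {v lim e : ℤ} {m : ℕ → ℤ} (h : Regs C v lim e m) :
    RefreshData C 1 (rg 8) nE (segKeyCmd false) (nearKey C.I C.n v lim e) C.B C.n m where
  tree := by norm_num
  valid := validKey_near h.gen h.lim_le e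
  top := if_neg fun h' => by have := (mem_Gs.1 h'.1).1; have := h.lim_le; omega
  run := fun σ hσ h0 h1 => by
    have h2 := h.v_mem
    have h3 := h.lim_le
    have e0 := (hσ 0 (by norm_num)).trans h.r0
    have e4 := (hσ 4 (by norm_num)).trans h.r4
    refine (run_segKeyCmd false (.rg (by norm_num) (by omega) (by omega)) (by omega)
      h0).mono le_rfl fun σ' _ h' => h'.of_eq ?_
    rw [e0, e4, hσ 2 (by norm_num), h.r2, hσ 3 (by norm_num), h.r3, segKey_false h0 h.e_mem.2]
  size_good := fun m' hm' => ⟨good_rg (by norm_num), by simp [hm', h.r8]⟩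
  M_good := fun m' _ => ⟨good_nE, eval_nE⟩
  size_grade := by decide
  M_grade := by decide
  size_cost := by decide
  M_cost := by decide
  size_pos := C.B_pos
  cover := C.lt_B.le
  size_le := by have := C.B_le; omega
  M_nonneg := by positivity
  M_le := by omega

theorem Regs.far {C : Env} {v lim e : ℤ} {m : ℕ → ℤ} (h : Regs C v lim e m) :
    RefreshData C 2 (rg 8) nE (segKeyCmd true) (farKey C.I C.n v lim e) C.B C.n m where
  tree := by norm_num
  valid := validKey_far _ _ _ _ _
  top := if_neg fun h' => by have := (mem_Gs.1 h'.1).1; have := h.lim_le; omega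
  run := fun σ hσ h0 h1 => by
    have h2 := h.v_mem
    have h3 := h.lim_le
    have e0 := (hσ 0 (by norm_num)).trans h.r0
    have e4 := (hσ 4 (by norm_num)).trans h.r4
    refine (run_segKeyCmd true (.rg (by norm_num) (by omega) (by omega)) (by omega)
      h0).mono le_rfl fun σ' _ h' => h'.of_eq ?_
    rw [e0, e4, hσ 2 (by norm_num), h.r2, hσ 3 (by norm_num), h.r3, segKey_true h0 h.e_mem.2]
  size_good := fun m' hm' => ⟨good_rg (by norm_num), by simp [hm', h.r8]⟩
  M_good := fun m' _ => ⟨good_nE, eval_nE⟩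
  size_grade := by decide
  M_grade := by decide
  size_cost := by decide
  M_cost := by decide
  size_pos := C.B_pos
  cover := C.lt_B.le
  size_le := by have := C.B_le; omega
  M_nonneg := by positivity
  M_le := by omega

theorem run_refreshNF {C : Env} {σ : State} {v lim e : ℤ} {dirty : Set ℕ} {b : ℕ}
    (h : Regs C v lim e σ.mem) (hT : Trees C v lim e dirty σ.mem) (hb : b < C.s)
    (h30 : σ.mem 30 = b) :
    Run C refreshNF σ (2 * refreshTime C C.B) (fun σ' => σ'.out = σ.out ∧
      Trees C v lim e (dirty \ {b}) σ'.mem ∧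
      ∀ r, r ≤ 30 ∨ 50 ≤ r → r < 64 ∨ r % 4 = 0 ∨ r % 4 = 3 → σ'.mem r = σ.mem r) := by
  refine (Run.seq_of (run_refresh h.near hb h30 hT.near) fun σ₁ ⟨o₁, f₁, t₁⟩ => ?_).time
    (two_mul _).ge
  have hr : ∀ r, r ≤ 30 → σ₁.mem r = σ.mem r := fun r hr => f₁ r (by omega) fun _ _ _ => by omega
  have h' : Regs C v lim e σ₁.mem := h.congr fun r hr' => hr r (by omega)
  have hT' : TreeOk (farKey C.I C.n v lim e) C.s 2 C.n C.B dirty σ₁.mem :=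
    hT.far.congr_mem fun x _ _ => f₁ _ (by omega) fun _ _ _ => by omega
  refine (run_refresh h'.far hb ((hr 30 le_rfl).trans h30) hT').mono le_rfl
    fun σ₂ _ ⟨o₂, f₂, t₂⟩ => ⟨o₂.trans o₁, ⟨?_, t₂⟩, fun r h1 h2 => ?_⟩
  · exact t₁.congr_mem fun x _ _ => f₂ _ (by omega) fun _ _ _ => by omega
  · rw [f₂ r h1 fun _ _ _ => by omega, f₁ r h1 fun _ _ _ => by omega]

/-- Refresh the trees for the leaf that contains segment `x`. -/
def refreshBoth (x : Expr) : Cmd := put 30 (x / rg 8) ;; refreshNF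

theorem run_refreshBoth {C : Env} {σ : State} {v lim e : ℤ} {dirty : Set ℕ} {r : ℕ} {x : ℤ}
    (h : Regs C v lim e σ.mem) (hT : Trees C v lim e dirty σ.mem) (hr : r < 30)
    (hx : σ.mem r = x) (h0 : 0 ≤ x) (h1 : x ≤ C.n) :
    Run C (refreshBoth (rg r)) σ (2 * refreshTime C C.B + 10) (fun σ' => σ'.out = σ.out ∧
      Trees C v lim e (dirty \ {C.blk x}) σ'.mem ∧
      ∀ r, r < 30 ∨ 50 ≤ r → r < 64 ∨ r % 4 = 0 ∨ r % 4 = 3 → σ'.mem r = σ.mem r) := by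
  have hg : (rg r / rg 8).grade ≤ 20 ∧ (rg r / rg 8).maxGrade < 1000 := by
    constructor
    · exact le_rfl
    · simp only [Expr.maxGrade, HDiv.hDiv, Div.div, KVis.rg, Expr.grade]
      omega
  refine (Run.seq <| Run.put (by norm_num) hg.1 hg.2 ((good_div _ _).2
    ⟨good_rg (by omega), good_rg (by norm_num)⟩) fun m₁ e₁ f₁ =>
    (run_refreshNF (b := C.blk x) (v := v) (lim := lim) (e := e) (dirty := dirty)
      (h.congr fun r hr => f₁ r (by omega)) (hT.congr_mem fun r _ _ => f₁ r (by omega))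
      (Env.blk_lt h0 h1) ?_).mono le_rfl fun σ₂ _ h₂ => ?_).time ?_
  rotate_left
  · obtain ⟨o₂, t₂, f₂⟩ := h₂
    refine ⟨o₂, t₂, fun r h1 h2 => ?_⟩
    rw [f₂ r (by omega) h2]
    exact f₁ r (by omega)
  · change (5 : ℕ) + 2 + _ ≤ _
    omega
  · simp only [e₁, eval_div, eval_rg, hx, h.r8, Env.blk_cast h0]

end KVis

namespace KVis

/-! ### Insertion and removal of a segment -/

/-- The segments with a number below `lim` that meet the ray through `v`. -/
noncomputable def Cs (I : List ℤ) (lim v : ℤ) : Finset ℤ :=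
  open scoped Classical in (Finset.Ico 0 lim).filter fun x => Cl I v x

theorem mem_Cs {I : List ℤ} {lim v x : ℤ} : x ∈ Cs I lim v ↔ (0 ≤ x ∧ x < lim) ∧ Cl I v x := by
  simp [Cs]

theorem Gs_subset_Cs (I : List ℤ) (lim v : ℤ) : Gs I lim v ⊆ Cs I lim v := fun _ hx =>
  mem_Cs.2 ⟨(mem_Gs.1 hx).1, (mem_Gs.1 hx).2.cl⟩

/-- The order is needed on all segments that touch the ray, not only on those behind or ahead of it
in the sweep: a segment that ends at `v` must still be compared with `e`, and may be `e` itself. -/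
theorem Sweep.linOn {I : List ℤ} {n : ℕ} {V : ℕ → ℤ} (h : Sweep I n V) {lim v : ℤ} (hl : lim ≤ n) :
    LinOn (Lt I v) (Cs I lim v) where
  irrefl := fun x _ => lt_irrefl' I v x
  trans := fun _ hx _ hy _ hz =>
    lt_trans' (mem_Cs.1 hx).2.2.2 (mem_Cs.1 hy).2.2.2 (mem_Cs.1 hz).2.2.2
  total := fun x hx y hy hxy => by
    obtain ⟨hx, hx'⟩ := mem_Cs.1 hx
    obtain ⟨hy, hy'⟩ := mem_Cs.1 hy
    exact h.lt_total ⟨hx.1, by omega⟩ ⟨hy.1, by omega⟩ hxy hx' hy'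

/-- The segment `i` is inserted (`st = 1`) into or removed (`st = 0`) from the set `G`, in which
`e` has the rank `k`. -/
structure Update (C : Env) (v lim e i st : ℤ) (G : Finset ℤ) : Prop where
  lin : LinOn (Lt C.I v) (Cs C.I lim v)
  old : G ⊆ Cs C.I lim v
  kth : IsKth (Lt C.I v) C.n C.k G e
  i_mem : i ∈ Cs C.I lim v
  upd : st = 1 ∧ i ∉ G ∧ Gs C.I lim v = insert i G ∨ st = 0 ∧ i ∈ G ∧ Gs C.I lim v = G.erase i

/-- The segment `e'` has the rank `k` after the update. -/
structure Updated (C : Env) (v lim e e' : ℤ) : Prop where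
  kth : IsKth (Lt C.I v) C.n C.k (Gs C.I lim v) e'
  same : ∀ x ∈ Gs C.I lim v, x ≠ e → x ≠ e' →
    (Near (Lt C.I v) C.n e x ↔ Near (Lt C.I v) C.n e' x) ∧
      (Far (Lt C.I v) C.n e x ↔ Far (Lt C.I v) C.n e' x)

theorem IsKth.mem_range {r : ℤ → ℤ → Prop} {n k : ℕ} {G : Finset ℤ} {e : ℤ} (h : IsKth r n k G e)
    (hG : ∀ x ∈ G, 0 ≤ x ∧ x < n) : 0 ≤ e ∧ e ≤ n := by
  rcases h with h | h
  · have := hG e h.1; omega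
  · omega

/-- Choose the segment of rank `k` after the insertion or removal of the one in register `9`. -/
def choose : Cmd :=
  .ite (rg 10)
    (.ite (rg 7 - kE) (withSeg (rg 9) fun a b => .ite (ltE a b) (put 1 (rg 69)) .skip) .skip)
    (withSeg (rg 9) fun a b => .ite (gtE a b) .skip (put 1 (rg 70)))

/-- The trees already reflect the insertion or removal, but still refer to the old `e`. So the root
in cell `69` is the predecessor and the root in cell `70` the successor of `e` in the new set. The
test of the count matters only for `e = n`, when the set may still be too small to have an element
of rank `k`. -/
theorem run_choose {C : Env} {σ : State} {v lim e i st : ℤ} {G : Finset ℤ}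
    (h : Regs C v lim e σ.mem) (hT : Trees C v lim e ∅ σ.mem) (hU : Update C v lim e i st G)
    (h1 : σ.mem 1 = e) (h7 : σ.mem 7 = (Gs C.I lim v).card) (h9 : σ.mem 9 = i)
    (h10 : σ.mem 10 = st) :
    Run C choose σ 3000 (fun σ' => σ'.out = σ.out ∧ Updated C v lim e (σ'.mem 1) ∧
      ∀ r, r ≠ 1 → σ'.mem r = σ.mem r) := by
  obtain ⟨hi, hci⟩ := mem_Cs.1 hU.i_mem
  have hl := h.lim_le
  have hn : (C.n : ℤ) ∉ Cs C.I lim v := fun h => by have := (mem_Cs.1 h).1; omega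
  have hGs := Gs_subset_Cs C.I lim v
  have he := h.e_mem
  have hv := h.v_mem
  have hv0 : VGood C σ.mem (rg 0) := .rg (by norm_num) (by rw [h.r0]; omega) (by rw [h.r0]; omega)
  have hg9 : (rg 9).Good C σ.mem := good_rg (by norm_num)
  have he9 : (rg 9).eval C.I σ.mem = i := h9
  have hlt : X C.I i * (thr C.I C.n v e).2 < (thr C.I C.n v e).1 * D C.I v i ↔
      Near (Lt C.I v) C.n e i := by
    unfold Near Lt thr
    split_ifs with h1
    · simp [h1.ne]
    · simp [le_antisymm he.2 (not_lt.mp h1), hci.2.2]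
  have hgt : (thr C.I C.n v e).1 * D C.I v i < X C.I i * (thr C.I C.n v e).2 ↔
      Far (Lt C.I v) C.n e i := by
    unfold Far Lt thr
    split_ifs with h1
    · simp [h1.ne]
    · simp [le_antisymm he.2 (not_lt.mp h1), hci.2.2.le]
  have g : ∀ a b, SegExprs C (rg 9) i a b → (ltE a b).maxGrade < 1000 ∧ (gtE a b).maxGrade < 1000 ∧
      (ltE a b).cost + (gtE a b).cost < 500 := by
    intro a b hab
    rcases hab.cases with ⟨rfl, -, rfl, -⟩ | ⟨rfl, -, rfl, -⟩ <;> decide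
  have he0 : e = C.n ∨ e ∈ Cs C.I lim v := by
    rcases hU.kth with h | h
    · exact .inr (hU.old h.1)
    · exact .inl h.1
  refine (Run.ite (T := 1300) (U := 1200) (by decide) (good_rg (by norm_num)) (fun hst => ?_)
    (fun hst => ?_)).time (by decide)
  · simp only [eval_rg, h10] at hst
    obtain ⟨-, hiG, hG⟩ := hU.upd.resolve_right (by omega)
    have hold : insert i G ⊆ Cs C.I lim v := hG ▸ hGs
    have keep : ¬ (C.k < (insert i G).card ∧ Near (Lt C.I v) C.n e i) →
        Updated C v lim e (σ.mem 1) := fun hc =>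
      ⟨h1 ▸ hG ▸ hU.kth.insert_of_not hold hn hiG hc,
        fun x _ _ _ => by rw [h1]; exact ⟨Iff.rfl, Iff.rfl⟩⟩
    refine (Run.ite (T := 1200) (U := 1) (by decide) ((good_sub _ _).2 ⟨good_rg (by norm_num), good_kE⟩)
      (fun hk => ?_) (fun hk => Run.skip ⟨rfl, keep ?_, fun _ _ => rfl⟩)).time (by decide)
    · simp only [eval_sub, eval_rg, eval_kE, h7, hG] at hk
      refine Run.withSeg (T := 520) hg9 he9 hi.1 (by omega) (by decide) (fun a b hab => ?_) (by decide)
      refine (Run.ite (T := 4) (U := 1) (g a b hab).1 (hab.good_ltE hg9 he9 hv0) (fun hne => ?_)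
        (fun hne => Run.skip ⟨rfl, keep ?_, fun _ _ => rfl⟩)).time (by have := (g a b hab).2.2; omega)
      · rw [hab.eval_ltE he9, h.r0, h.r2, h.r3, sub_pos, hlt] at hne
        refine Run.put (by norm_num) (by decide) (by decide) (good_rg (by norm_num)) fun m' em fm =>
          ⟨rfl, ?_, fm⟩
        simp only [em, eval_rg]
        obtain ⟨-, h3⟩ | ⟨h3, h4, h5⟩ := hT.near_root h.gen hl
        · exact absurd hne (h3 i (by simp [hG]))
        · refine ⟨?_, fun x hx hxe hxe' =>
            near_far_pred hU.lin hGs hn he0 h3 h4 h5 hx hxe hxe'⟩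
          rw [hG] at h3 h5 ⊢
          exact hU.kth.insert_of hU.lin hold hn hiG ⟨by omega, hne⟩ h3 h4 h5
      · rw [hab.eval_ltE he9, h.r0, h.r2, h.r3, sub_pos, hlt] at hne
        exact fun h => hne h.2
    · simp only [eval_sub, eval_rg, eval_kE, h7, hG] at hk
      exact fun h => hk (by omega)
  · simp only [eval_rg, h10] at hst
    obtain ⟨-, hiG, hG⟩ := hU.upd.resolve_left (by omega)
    refine Run.withSeg (T := 520) hg9 he9 hi.1 (by omega) (by decide) (fun a b hab => ?_) (by decide)
    refine (Run.ite (T := 1) (U := 4) (g a b hab).2.1 (hab.good_gtE hg9 he9 hv0)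
      (fun hne => Run.skip ?_) (fun hne => ?_)).time ?_
    · rw [hab.eval_gtE he9, h.r0, h.r2, h.r3, sub_pos, hgt] at hne
      rw [h1]
      exact ⟨rfl, ⟨hG ▸ hU.kth.erase_of_not hU.lin hU.old hiG hne,
        fun x _ _ _ => ⟨Iff.rfl, Iff.rfl⟩⟩, fun _ _ => rfl⟩
    · rw [hab.eval_gtE he9, h.r0, h.r2, h.r3, sub_pos, hgt] at hne
      refine Run.put (by norm_num) (by decide) (by decide) (good_rg (by norm_num)) fun m' em fm =>
        ⟨rfl, ?_, fm⟩
      simp only [em, eval_rg]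
      obtain ⟨h2, h3⟩ | ⟨h3, h4, h5⟩ := hT.far_root hl
      · rw [h2]
        refine ⟨?_, fun x hx hxe _ => near_far_none hU.lin hGs he0 h3 hx hxe⟩
        rw [hG] at h3 ⊢
        exact hU.kth.erase_of_none hU.lin hU.old hn hiG hne h3
      · refine ⟨?_, fun x hx hxe hxe' =>
          near_far_succ hU.lin hGs hn (he0.resolve_left h4.1) h3 h4 h5 hx hxe hxe'⟩
        rw [hG] at h3 h5 ⊢
        exact hU.kth.erase_of hU.lin hU.old hn hiG hne h3 h4 h5
    · have := (g a b hab).2.2; omega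

/-- Insert or remove the segment in register `9`, and find the segment of rank `k`. -/
def part1 : Cmd :=
  put 7 (rg 7 + 2 * rg 10 - 1) ;; setE ;; refreshBoth (rg 9) ;; put 11 (rg 1) ;; choose

/-- The registers, nodes and other cells that are not used by `part1` and `part2`. -/
def Kept (m m' : ℕ → ℤ) : Prop :=
  ∀ r, r < 30 ∨ 50 ≤ r → r ≠ 1 → r ≠ 2 → r ≠ 3 → r ≠ 7 → r ≠ 11 →
    r < 64 ∨ r % 4 = 0 ∨ r % 4 = 3 → m' r = m r

theorem Kept.trans {m m' m'' : ℕ → ℤ} (h : Kept m m') (h' : Kept m' m'') : Kept m m'' :=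
  fun r h1 h2 h3 h4 h5 h6 h7 => (h' r h1 h2 h3 h4 h5 h6 h7).trans (h r h1 h2 h3 h4 h5 h6 h7)

theorem run_part1 {C : Env} {σ : State} {v lim e i st : ℤ} {G : Finset ℤ}
    (hg : Gen C.I C.n) (hv : 0 ≤ v ∧ v < 2 * C.n) (hl : lim ≤ C.n)
    (hT : Trees C v lim e {C.blk i} σ.mem) (hU : Update C v lim e i st G)
    (h0 : σ.mem 0 = v) (h1 : σ.mem 1 = e) (h4 : σ.mem 4 = lim) (h7 : σ.mem 7 = G.card)
    (h8 : σ.mem 8 = C.B) (h9 : σ.mem 9 = i) (h10 : σ.mem 10 = st) :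
    Run C part1 σ (2 * refreshTime C C.B + 4100) (fun σ' => σ'.out = σ.out ∧
      Regs C v lim e σ'.mem ∧ Trees C v lim e ∅ σ'.mem ∧ Updated C v lim e (σ'.mem 1) ∧
      σ'.mem 7 = (Gs C.I lim v).card ∧ σ'.mem 11 = e ∧ Kept σ.mem σ'.mem) := by
  have he : 0 ≤ e ∧ e ≤ C.n := hU.kth.mem_range fun x hx => by
    have := (mem_Cs.1 (hU.old hx)).1; omega
  have hi := (mem_Cs.1 hU.i_mem).1
  -- The number `2 * st - 1` is `1` for an insertion and `-1` for a removal.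
  have hcard : (Gs C.I lim v).card = σ.mem 7 + 2 * σ.mem 10 - 1 := by
    rw [h7, h10]
    rcases hU.upd with ⟨rfl, h2, h3⟩ | ⟨rfl, h2, h3⟩
    · rw [h3, Finset.card_insert_of_notMem h2]; push_cast; ring
    · rw [h3, Finset.card_erase_of_mem h2]
      have := Finset.card_pos.mpr ⟨i, h2⟩
      omega
  have hcard' : (Gs C.I lim v).card ≤ lim.toNat := by
    have := Finset.card_filter_le (Finset.Ico 0 lim) (fun x => Act C.I v x)
    simpa [Gs] using this
  refine (Run.seq <| Run.putDyn (by norm_num) (by decide) (by simp [good_rg]) ?bd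
    fun m₁ e₁ f₁ =>
    Run.seq_of (run_setE (v := v) (e := e) (by simp [f₁, h0]) hv (by simp [f₁, h1]) he.1)
      fun σ₂ ⟨o₂, a₂, b₂, f₂⟩ =>
    Run.seq_of (run_refreshBoth (v := v) (lim := lim) (e := e) (dirty := {C.blk i}) (x := i)
      ?regs ?trees (by norm_num) ?i hi.1 (by omega)) fun σ₃ ⟨o₃, t₃, f₃⟩ =>
    Run.seq <| Run.put (by norm_num) (by decide) (by decide) (good_rg (by norm_num)) fun m₄ e₄ f₄ =>
    (run_choose (v := v) (lim := lim) (e := e) (i := i) (st := st) ?regs' ?trees' hU ?e ?cnt ?i'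
      ?st).mono le_rfl fun σ₅ _ h₅ => ?post).time ?time
  all_goals try dsimp only at *
  case bd =>
    rw [eval_sub, eval_add, eval_mul, eval_rg, eval_rg, eval_ofNat]
    change C.Bd 20 (σ.mem 7 + 2 * σ.mem 10 - 1)
    rw [← hcard]
    exact C.bd_index (by omega) (by omega)
  case regs =>
    exact ⟨hg, hv, hl, he, by simp [f₂, f₁, h0], a₂, b₂, by simp [f₂, f₁, h4], by simp [f₂, f₁, h8]⟩
  case trees => exact hT.congr_mem fun r _ _ => by rw [f₂ r (by omega) (by omega), f₁ r (by omega)]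
  case i => simp [f₂, f₁, h9]
  case regs' =>
    refine ⟨hg, hv, hl, he, ?_, ?_, ?_, ?_, ?_⟩ <;>
      simp [f₄, f₃, f₂, f₁, a₂, b₂, h0, h4, h8]
  case trees' =>
    have := t₃.congr_mem (m' := m₄) fun r _ _ => f₄ r (by omega)
    simpa using this
  case e => simp [f₄, f₃, f₂, f₁, h1]
  case cnt => simp [f₄, f₃, f₂, e₁, hcard]
  case i' => simp [f₄, f₃, f₂, f₁, h9]
  case st => simp [f₄, f₃, f₂, f₁, h10]
  case post =>
    obtain ⟨o₅, u₅, f₅⟩ := h₅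
    refine ⟨by rw [o₅, o₃, o₂], ⟨hg, hv, hl, he, ?_, ?_, ?_, ?_, ?_⟩, ?_, u₅, ?_, ?_, ?_⟩
    any_goals simp [f₅, f₄, f₃, f₂, f₁, a₂, b₂, h0, h4, h8]
    · have := t₃.congr_mem (m' := σ₅.mem) fun r _ _ => by rw [f₅ r (by omega), f₄ r (by omega)]
      simpa using this
    · simp [e₁, hcard]
    · simp [e₄, f₃, f₂, f₁, h1]
    · intro r q1 q2 q3 q4 q5 q6 q7
      rw [f₅ r q2, f₄ r q6, f₃ r q1 q7, f₂ r q3 q4, f₁ r q5]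
  case time =>
    have : (rg 7 + 2 * rg 10 - 1).cost = 9 ∧ (rg 1).cost = 2 := by decide
    rw [this.1, this.2]
    omega

/-- Update the trees after the segment of rank `k` has been replaced. -/
def part2 : Cmd := setE ;; refreshBoth (rg 11) ;; refreshBoth (rg 1)

/-- When the threshold moves from `e` to its neighbour `e'`, all other segments stay on their side
of it. So at most the leaves of these two become dirty. -/
theorem run_part2 {C : Env} {σ : State} {v lim e e' : ℤ}
    (hR : Regs C v lim e σ.mem) (hT : Trees C v lim e ∅ σ.mem)
    (hU : Updated C v lim e e') (h1 : σ.mem 1 = e') (h11 : σ.mem 11 = e) :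
    Run C part2 σ (4 * refreshTime C C.B + 1020) (fun σ' => σ'.out = σ.out ∧
      Trees C v lim e' ∅ σ'.mem ∧ σ'.mem 1 = e' ∧ σ'.mem 7 = σ.mem 7 ∧ σ'.mem 11 = e ∧ Kept σ.mem σ'.mem) := by
  have he' : 0 ≤ e' ∧ e' ≤ C.n := hU.kth.mem_range fun x hx => by
    have := (mem_Gs.1 hx).1; have := hR.lim_le; omega
  have he := hR.e_mem
  have hT' : Trees C v lim e' {C.blk e, C.blk e'} σ.mem :=
    hT.transfer hR.gen hR.lim_le hR.lim_le (Set.empty_subset _) (fun _ _ _ _ => Iff.rfl)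
      fun x hx hxd => by
        simp only [Set.mem_insert_iff, Set.mem_singleton_iff, not_or] at hxd
        exact ⟨hU.same x hx (fun h => hxd.1 (h ▸ rfl)) fun h => hxd.2 (h ▸ rfl),
          fun _ _ _ => Iff.rfl⟩
  refine (Run.seq_of (run_setE (v := v) (e := e') hR.r0 hR.v_mem h1 he'.1)
      fun σ₂ ⟨o₂, a₂, b₂, f₂⟩ =>
    Run.seq_of (run_refreshBoth (v := v) (lim := lim) (e := e') (dirty := {C.blk e, C.blk e'})
      (x := e) ?_ ?_ (by norm_num) ?_ he.1 he.2) fun σ₃ ⟨o₃, t₃, f₃⟩ =>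
    (run_refreshBoth (v := v) (lim := lim) (e := e')
      (x := e') ?_ t₃ (by norm_num) ?_ he'.1 he'.2).mono le_rfl fun σ₅ _ h₅ => ?_).time (by omega)
  · exact ⟨hR.gen, hR.v_mem, hR.lim_le, he', by simp [f₂, hR.r0], a₂, b₂, by simp [f₂, hR.r4],
      by simp [f₂, hR.r8]⟩
  · exact hT'.congr_mem fun r _ _ => by rw [f₂ r (by omega) (by omega)]
  · simp [f₂, h11]
  · refine ⟨hR.gen, hR.v_mem, hR.lim_le, he', ?_, ?_, ?_, ?_, ?_⟩ <;>
      simp [f₃, f₂, a₂, b₂, hR.r0, hR.r4, hR.r8]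
  · simp [f₃, f₂, h1]
  · obtain ⟨o₅, t₅, f₅⟩ := h₅
    refine ⟨by rw [o₅, o₃, o₂], ?_, by simp [f₅, f₃, f₂, h1], by simp [f₅, f₃, f₂],
      by simp [f₅, f₃, f₂, h11], ?_⟩
    · convert t₅ using 1
      ext x; simp
    · intro r q1 q2 q3 q4 q5 q6 q7
      rw [f₅ r q1 q7, f₃ r q1 q7, f₂ r q3 q4]

end KVis

namespace KVis

/-! ### The next vertex -/

/-- Store two values in the registers `41` and `42`. -/
def pair (f g : Expr) : Cmd := put 41 f ;; put 42 g

/-- Store the direction of the vertex in register `40` in the registers `41` and `42`. -/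
def diamond : Cmd :=
  .ite (crE 0 (rg 40))
    (.ite (dtE 0 (rg 40)) (pair (0 - dtE 0 (rg 40)) (crE 0 (rg 40) + dtE 0 (rg 40)))
      (pair (0 - dtE 0 (rg 40)) (crE 0 (rg 40) - dtE 0 (rg 40))))
    (.ite (dtE 0 (rg 40))
      (pair (4 * (dtE 0 (rg 40) - crE 0 (rg 40)) + dtE 0 (rg 40)) (dtE 0 (rg 40) - crE 0 (rg 40)))
      (pair (4 * (0 - crE 0 (rg 40) - dtE 0 (rg 40)) + dtE 0 (rg 40))
        (0 - crE 0 (rg 40) - dtE 0 (rg 40))))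

theorem run_pair {C : Env} {σ : State} {f g : Expr} {y z : ℤ} {T : ℕ}
    (hf : f.grade ≤ 20 ∧ f.maxGrade < 1000) (hg : g.grade ≤ 20 ∧ g.maxGrade < 1000)
    (hf' : f.Good C σ.mem) (hg' : ∀ m, (∀ r, r ≠ 41 → m r = σ.mem r) → g.Good C m ∧ g.eval C.I m = z)
    (hy : f.eval C.I σ.mem = y) (hT : f.cost + g.cost + 4 ≤ T) :
    Run C (pair f g) σ T (fun σ' => σ'.out = σ.out ∧ σ'.mem 41 = y ∧ σ'.mem 42 = z ∧
      ∀ r, r ≠ 41 → r ≠ 42 → σ'.mem r = σ.mem r) :=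
  (Run.seq <| Run.put (by norm_num) hf.1 hf.2 hf' fun m₁ e₁ f₁ =>
    Run.put (by norm_num) hg.1 hg.2 (hg' m₁ f₁).1 fun m₂ e₂ f₂ =>
      ⟨rfl, by simp [f₂, e₁, hy], by simp [e₂, (hg' m₁ f₁).2], fun r h1 h2 =>
        (f₂ r h2).trans (f₁ r h1)⟩).time (by omega)

theorem run_diamond {C : Env} {σ : State} (hn : 1 ≤ C.n) (h0 : 0 ≤ σ.mem 40)
    (h1 : σ.mem 40 < 2 * C.n) :
    Run C diamond σ 1500 (KeyPost (vKey C.I) σ) := by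
  have hz : ∀ m, VGood C m 0 := fun m => ⟨trivial, le_rfl, by simp [-Nat.cast_ofNat]; omega⟩
  have hw : ∀ m : ℕ → ℤ, (∀ r, r ≠ 41 → m r = σ.mem r) → VGood C m (rg 40) := fun m hm =>
    .rg (by norm_num) (by rw [hm _ (by norm_num)]; exact h0) (by rw [hm _ (by norm_num)]; exact h1)
  have hc : ∀ m : ℕ → ℤ, (∀ r, r ≠ 41 → m r = σ.mem r) → (crE 0 (rg 40)).Good C m ∧
      (crE 0 (rg 40)).eval C.I m = cr C.I 0 (σ.mem 40) := fun m hm =>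
    ⟨(hz m).crE (hw m hm), by simp [hm]⟩
  have hd : ∀ m : ℕ → ℤ, (∀ r, r ≠ 41 → m r = σ.mem r) → (dtE 0 (rg 40)).Good C m ∧
      (dtE 0 (rg 40)).eval C.I m = dt C.I 0 (σ.mem 40) := fun m hm =>
    ⟨(hz m).dtE (hw m hm), by simp [hm]⟩
  have c0 := hc σ.mem fun _ _ => rfl
  have d0 := hd σ.mem fun _ _ => rfl
  refine (Run.ite (T := 700) (U := 700) (by decide) c0.1 (fun k1 => Run.ite (T := 300) (U := 300)
      (by decide) d0.1 (fun k2 => ?_) (fun k2 => ?_) |>.time (by decide))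
    (fun k1 => Run.ite (T := 300) (U := 300) (by decide) d0.1 (fun k2 => ?_) (fun k2 => ?_)
      |>.time (by decide))).time (by decide)
  all_goals
    rw [c0.2] at k1
    rw [d0.2] at k2
    exact run_pair (by decide) (by decide) (by simp [c0.1, d0.1])
      (fun m hm => ⟨by simp [hc m hm, hd m hm], by simp [hm, vKey, k1, k2]⟩)
      (by simp [vKey, k1, k2]) (by decide)

instance (p q : ℤ × ℤ) : Decidable (KeyLt p q) := by unfold KeyLt; infer_instance

/-- The key of the vertex `w` in the tree of the vertices behind the direction `cur`. -/
def dirKey (I : List ℤ) (n : ℕ) (cur : ℤ × ℤ) (w : ℤ) : ℤ × ℤ :=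
  if w < 2 * n ∧ 0 ≤ w ∧ KeyLt cur (vKey I w) then vKey I w else (1, 0)

/-- Store the key of the vertex in register `40` in the registers `41` and `42`. -/
def keyV : Cmd :=
  .ite (2 * nE - rg 40)
    (diamond ;; .ite (rg 41 * rg 6 - rg 5 * rg 42) .skip (pair 1 0))
    (pair 1 0)

theorem run_keyV {C : Env} {σ : State} {cur : ℤ × ℤ} (hn : 1 ≤ C.n) (h0 : 0 ≤ σ.mem 40)
    (h5 : σ.mem 5 = cur.1) (h6 : σ.mem 6 = cur.2) :
    Run C keyV σ 3000 (KeyPost (dirKey C.I C.n cur) σ) := by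
  have one : ∀ σ₁ : State, Run C (pair 1 0) σ₁ 6 (fun σ' => σ'.out = σ₁.out ∧ σ'.mem 41 = 1 ∧
      σ'.mem 42 = 0 ∧ ∀ r, r ≠ 41 → r ≠ 42 → σ'.mem r = σ₁.mem r) := fun σ₁ =>
    run_pair (by decide) (by decide) (by simp) (fun m _ => ⟨by simp, by simp⟩) (by simp)
      (by decide)
  refine (Run.ite (T := 2000) (U := 6) (by decide)
    (by simp [good_rg]) (fun h1 => ?_) (fun h1 => (one σ).mono le_rfl fun σ' _ h => ?_)).time (by decide)
  · simp only [eval_sub, eval_mul, eval_nE, eval_rg, eval_ofNat] at h1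
    refine (Run.seq_of (run_diamond hn h0 (by omega)) fun σ₁ ⟨o₁, a₁, b₁, f₁⟩ =>
      Run.ite (T := 1) (U := 6) (by decide) (by simp [good_rg])
        (fun h2 => Run.skip ?_) (fun h2 => (one σ₁).mono le_rfl fun σ' _ h => ?_)).time (by decide)
    · simp [f₁, a₁, b₁, h5, h6] at h2
      have : dirKey C.I C.n cur (σ.mem 40) = vKey C.I (σ.mem 40) :=
        if_pos ⟨by omega, h0, h2⟩
      exact ⟨o₁, by rw [this, a₁], by rw [this, b₁], f₁⟩
    · simp [f₁, a₁, b₁, h5, h6] at h2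
      have : dirKey C.I C.n cur (σ.mem 40) = (1, 0) :=
        if_neg fun h => (not_lt.mpr h2) h.2.2
      exact ⟨h.1.trans o₁, by rw [this, h.2.1], by rw [this, h.2.2.1], fun r h3 h4 =>
        (h.2.2.2 r h3 h4).trans (f₁ r h3 h4)⟩
  · simp only [eval_sub, eval_mul, eval_nE, eval_rg, eval_ofNat] at h1
    have : dirKey C.I C.n cur (σ.mem 40) = (1, 0) :=
        if_neg fun h => h1 (by have := h.1; omega)
    rw [KeyPost, this]
    exact h

/-- Recompute a leaf of the tree of the vertices. -/
def refreshV : Cmd := refresh 0 (2 * rg 8) (2 * nE) keyV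

theorem validKey_dir {I : List ℤ} {n : ℕ} (h : Gen I n) (cur : ℤ × ℤ) (w : ℤ) :
    ValidKey (dirKey I n cur w) := by
  unfold dirKey
  split_ifs with h1
  · exact .inl (h.vKey_den_pos h1.2.1 h1.1)
  · exact .inr rfl

theorem refreshData_dir {C : Env} {m : ℕ → ℤ} {cur : ℤ × ℤ} (h : Gen C.I C.n)
    (h5 : m 5 = cur.1) (h6 : m 6 = cur.2) (h8 : m 8 = C.B) :
    RefreshData C 0 (2 * rg 8) (2 * nE) keyV (dirKey C.I C.n cur) (2 * C.B) (2 * C.n) m where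
  tree := by norm_num
  valid := validKey_dir h cur
  top := if_neg fun h => by have := h.1; omega
  run := fun σ hσ h0 _ => run_keyV h.pos h0 ((hσ 5 (by norm_num)).trans h5)
    ((hσ 6 (by norm_num)).trans h6)
  size_good := fun m' hm' => ⟨by simp [good_rg], by simp [hm', h8]⟩
  M_good := fun m' _ => ⟨by simp, by simp⟩
  size_grade := by decide
  M_grade := by decide
  size_cost := by decide
  M_cost := by decide
  size_pos := by have := C.B_pos; omega
  cover := by have := C.lt_B; linarith
  size_le := by have := C.B_le; linarith
  M_nonneg := by positivity
  M_le := by omega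

/-- The direction in which the search for the next vertex starts. -/
def cursor (I : List ℤ) (V : ℕ → ℤ) (m : ℕ) : ℤ × ℤ := if m = 0 then (-2, 1) else vKey I (V m)

/-- The starting value `-2` lies below every direction, as these are at least `-1`. The key of
vertex `0` would not do, since it is the largest. -/
theorem keyLt_cursor {I : List ℤ} {n : ℕ} {V : ℕ → ℤ} (h : Order I n V) {m : ℕ} {w : ℤ}
    (hw : 0 ≤ w) (hw' : w < 2 * n) :
    KeyLt (cursor I V m) (vKey I w) ↔ m = 0 ∨ vVal I (V m) < vVal I w := by
  unfold cursor
  split_ifs with h0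
  · simp only [h0, true_or, iff_true, KeyLt]
    have h1 := h.gen.vKey_den_pos hw hw'
    revert h1
    unfold vKey
    split_ifs <;> dsimp only <;> omega
  · have hm := h.mem m
    rw [h.gen.vVal_lt hm.1 hm.2 hw hw', KeyLt]
    simp [h0]

theorem keyVal_vKey {I : List ℤ} {n : ℕ} (h : Gen I n) {w : ℤ} (hw : 0 ≤ w) (hw' : w < 2 * n) :
    keyVal (vKey I w) = (vVal I w : WithTop ℚ) := by
  rw [keyVal, if_pos (h.vKey_den_pos hw hw'), vVal]

/-- The tree of the vertices behind `V m` is correct. -/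
def VTree (C : Env) (V : ℕ → ℤ) (m : ℕ) (dirty : Set ℕ) (mem : ℕ → ℤ) : Prop :=
  TreeOk (dirKey C.I C.n (cursor C.I V m)) C.s 0 (2 * C.n) (2 * C.B) dirty mem

theorem keyVal_dirKey {I : List ℤ} {n : ℕ} {V : ℕ → ℤ} (h : Order I n V) {m : ℕ} {w : ℤ}
    (hw : 0 ≤ w) (hw' : w < 2 * n) : keyVal (dirKey I n (cursor I V m) w) =
      open scoped Classical in
      if m = 0 ∨ vVal I (V m) < vVal I w then (vVal I w : WithTop ℚ) else ⊤ := by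
  unfold dirKey
  by_cases h1 : m = 0 ∨ vVal I (V m) < vVal I w
  · rw [if_pos h1, if_pos ⟨hw', hw, (keyLt_cursor h hw hw').2 h1⟩, keyVal_vKey h.gen hw hw']
  · rw [if_neg h1, if_neg fun h2 => h1 ((keyLt_cursor h hw hw').1 h2.2.2), keyVal_top]

theorem VTree.root {C : Env} {V : ℕ → ℤ} {m : ℕ} {mem : ℕ → ℤ} (h : Order C.I C.n V)
    (hT : VTree C V m ∅ mem) (hm : m < 2 * C.n) : mem 68 = V (m + 1) := by
  obtain ⟨h1, h2⟩ := TreeOk.root C.one_le_s hT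
  have hv := h.mem (m + 1)
  have h3 := h2 _ hv
  have h4 : m = 0 ∨ vVal C.I (V m) < vVal C.I (V (m + 1)) := by
    rcases Nat.eq_zero_or_pos m with h0 | h0
    · exact .inl h0
    · exact .inr (h.mono _ _ h0 (by omega) (by omega))
  rw [keyVal_dirKey h hv.1 hv.2, if_pos h4] at h3
  change keyVal (dirKey C.I C.n (cursor C.I V m) (mem 68)) ≤ _ at h3
  rcases h1 with h1 | ⟨h1, h5⟩
  · change mem 68 = 2 * C.n at h1
    rw [h1, dirKey, if_neg (by omega), keyVal_top] at h3
    simp at h3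
  · change 0 ≤ mem 68 ∧ mem 68 < 2 * C.n at h1
    change keyVal (dirKey C.I C.n (cursor C.I V m) (mem 68)) ≠ _ at h5
    rw [keyVal_dirKey h h1.1 h1.2] at h3 h5
    split_ifs at h3 h5 with h6
    · rcases h.le_next hm h1.1 h1.2 h6 with h7 | h7
      · exact h7
      · exact absurd (WithTop.coe_le_coe.mp h3) (not_le.mpr h7)
    · exact absurd rfl h5

/-- Advancing the cursor makes the key of `V (m + 1)` infinite and changes no other key, because no
vertex lies in between. -/
theorem VTree.step {C : Env} {V : ℕ → ℤ} {m : ℕ} {mem : ℕ → ℤ} (h : Order C.I C.n V)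
    (hT : VTree C V m ∅ mem) (hm : m < 2 * C.n) :
    VTree C V (m + 1) {(V (m + 1) / (2 * C.B)).toNat} mem := by
  refine TreeOk.transfer hT (fun _ _ => rfl) (if_neg fun h => by have := h.1; omega)
    (if_neg fun h => by have := h.1; omega) (Set.empty_subset _) fun y h0 h1 hy => ?_
  have key : ∀ y : ℤ, 0 ≤ y → y < 2 * C.n → (y / (2 * C.B)).toNat ∉
      ({(V (m + 1) / (2 * C.B)).toNat} : Set ℕ) →
      keyVal (dirKey C.I C.n (cursor C.I V m) y) =
        keyVal (dirKey C.I C.n (cursor C.I V (m + 1)) y) := by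
    intro y h0 h1 hy
    rw [keyVal_dirKey h h0 h1, keyVal_dirKey h h0 h1]
    classical
    refine if_congr ⟨fun h2 => .inr ?_, fun h2 => ?_⟩ rfl rfl
    · exact (h.le_next hm h0 h1 h2).resolve_left fun h3 => hy (by rw [h3]; rfl)
    · rcases Nat.eq_zero_or_pos m with h4 | h4
      · exact .inl h4
      · exact .inr ((h.mono _ _ h4 (by omega) (by omega)).trans (h2.resolve_left (by omega)))
  refine ⟨by rw [key y h0 h1 hy], fun z h2 h3 hz hle => ?_⟩
  rwa [← key y h0 h1 hy, ← key z h2 h3 hz]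

/-- Go to the next vertex, and find out whether it is the first one of its segment. -/
def advance : Cmd :=
  put 40 (rg 68) ;; put 0 (rg 40) ;; diamond ;; put 5 (rg 41) ;; put 6 (rg 42) ;;
  put 30 (rg 0 / (2 * rg 8)) ;; refreshV ;; put 9 (rg 0 / 2) ;; put 10 0 ;;
  -- The endpoints of segment `z` are `2 * z` and `2 * z + 1`, so `4 * z + 1 - v` is the one that is
  -- not `v`; `v` is the first one if it is followed by a left turn.
  .ite (crE (rg 0) (4 * rg 9 + 1 - rg 0)) (put 10 1) .skip

theorem run_advance {C : Env} {σ : State} {V : ℕ → ℤ} {m : ℕ} (h : Order C.I C.n V)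
    (hT : VTree C V m ∅ σ.mem) (hm : m < 2 * C.n) (h8 : σ.mem 8 = C.B) :
    Run C advance σ (refreshTime C (2 * C.B) + 2000) (fun σ' => σ'.out = σ.out ∧
      VTree C V (m + 1) ∅ σ'.mem ∧ σ'.mem 0 = V (m + 1) ∧
      σ'.mem 5 = (cursor C.I V (m + 1)).1 ∧ σ'.mem 6 = (cursor C.I V (m + 1)).2 ∧
      σ'.mem 9 = V (m + 1) / 2 ∧
      σ'.mem 10 = (if V (m + 1) = sa C.I (V (m + 1) / 2) then 1 else 0) ∧
      ∀ r, r < 30 ∨ 50 ≤ r → r ≠ 0 → r ≠ 5 → r ≠ 6 → r ≠ 9 → r ≠ 10 → r < 64 ∨ r % 4 ≠ 0 →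
        σ'.mem r = σ.mem r) := by
  have hv := h.mem (m + 1)
  have h68 := hT.root h hm
  have hB := C.B_pos
  have hcur : cursor C.I V (m + 1) = vKey C.I (V (m + 1)) := if_neg (by omega)
  have hb0 : 0 ≤ V (m + 1) / (2 * C.B) := Int.ediv_nonneg hv.1 (by omega)
  have hb1 : V (m + 1) / (2 * C.B) < C.s :=
    Int.ediv_lt_of_lt_mul (by omega) (by have := C.lt_B; linarith)
  refine (Run.seq <| Run.put (by norm_num) (by decide) (by decide) (good_rg (by norm_num))
    fun m₁ e₁ f₁ =>
    Run.seq <| Run.put (by norm_num) (by decide) (by decide) (good_rg (by norm_num)) fun m₂ e₂ f₂ =>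
    Run.seq_of (run_diamond h.gen.pos ?lo ?hi) fun σ₃ ⟨o₃, a₃, b₃, f₃⟩ =>
    Run.seq <| Run.put (by norm_num) (by decide) (by decide) (good_rg (by norm_num)) fun m₄ e₄ f₄ =>
    Run.seq <| Run.put (by norm_num) (by decide) (by decide) (good_rg (by norm_num)) fun m₅ e₅ f₅ =>
    Run.seq <| Run.put (by norm_num) (by decide) (by decide) (by simp [good_rg]) fun m₆ e₆ f₆ =>
    Run.seq_of (run_refresh (b := (V (m + 1) / (2 * C.B)).toNat)
      (dirty := {(V (m + 1) / (2 * C.B)).toNat})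
      (refreshData_dir h.gen (cur := cursor C.I V (m + 1)) ?c5 ?c6 ?c8) (by omega) ?c30 ?tree)
      fun σ₇ ⟨o₇, f₇, t₇⟩ =>
    Run.seq <| Run.put (by norm_num) (by decide) (by decide) (by simp [good_rg]) fun m₈ e₈ f₈ =>
    Run.seq <| Run.put (by norm_num) (by decide) (by decide) (by simp) fun m₉ e₉ f₉ =>
    Run.ite (T := 3) (U := 1) (by decide) ?good (fun hc => Run.put (by norm_num) (by decide)
      (by decide) (by simp) fun m' em fm => ?p1) (fun hc => Run.skip ?p2)).time ?time
  all_goals try dsimp only at *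
  case time =>
    have : (rg 68).cost + (rg 40).cost + (rg 41).cost + (rg 42).cost + (rg 0 / (2 * rg 8)).cost +
      (rg 0 / 2).cost + (0 : Expr).cost + (1 : Expr).cost +
      (crE (rg 0) (4 * rg 9 + 1 - rg 0)).cost ≤ 200 := by decide
    omega
  case lo => simp only [f₂, e₁, h68, eval_rg, ne_eq, Nat.reduceEqDiff, not_false_eq_true]; exact hv.1
  case hi => simp only [f₂, e₁, h68, eval_rg, ne_eq, Nat.reduceEqDiff, not_false_eq_true]; exact hv.2
  all_goals
    simp only [f₂, e₁, h68, eval_rg, ne_eq, Nat.reduceEqDiff, not_false_eq_true] at a₃ b₃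
  case c5 => simp [f₆, f₅, e₄, a₃, hcur]
  case c6 => simp [f₆, e₅, f₄, b₃, hcur]
  case c8 => simp [f₆, f₅, f₄, f₃, f₂, f₁, h8]
  case c30 => simp [e₆, f₅, f₄, f₃, e₂, e₁, f₂, f₁, h68, h8]; omega
  case tree =>
    refine (hT.step h hm).congr_mem fun x _ _ => ?_
    rw [f₆ _ (by omega), f₅ _ (by omega), f₄ _ (by omega), f₃ _ (by omega) (by omega),
      f₂ _ (by omega), f₁ _ (by omega)]
  all_goals
    have f : ∀ r, r < 30 ∨ 50 ≤ r → r ≠ 0 → r ≠ 5 → r ≠ 6 → r ≠ 9 → r ≠ 10 → r < 64 ∨ r % 4 ≠ 0 →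
        m₉ r = σ.mem r := fun r q1 q2 q3 q4 q5 q6 q7 => by
      rw [f₉ r q6, f₈ r q5, f₇ r (by omega) fun _ _ _ => by omega, f₆ r (by omega), f₅ r q4, f₄ r q3,
        f₃ r (by omega) (by omega), f₂ r q2, f₁ r (by omega)]
    have g0 : m₉ 0 = V (m + 1) := by
      simp only [f₉, f₈, ne_eq, Nat.reduceEqDiff, not_false_eq_true]
      rw [f₇ 0 (by omega) fun _ _ _ => by omega]
      simp [f₆, f₅, f₄, f₃, e₂, e₁, h68]
    have g5 : m₉ 5 = (cursor C.I V (m + 1)).1 := by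
      simp only [f₉, f₈, ne_eq, Nat.reduceEqDiff, not_false_eq_true]
      rw [f₇ 5 (by omega) fun _ _ _ => by omega]
      simp [f₆, f₅, e₄, a₃, hcur]
    have g6 : m₉ 6 = (cursor C.I V (m + 1)).2 := by
      simp only [f₉, f₈, ne_eq, Nat.reduceEqDiff, not_false_eq_true]
      rw [f₇ 6 (by omega) fun _ _ _ => by omega]
      simp [f₆, e₅, f₄, b₃, hcur]
    have g9 : m₉ 9 = V (m + 1) / 2 := by
      rw [← g0, f₉ 9 (by omega), e₈, f₉ 0 (by omega), f₈ 0 (by omega)]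
      simp
    have t9 : VTree C V (m + 1) ∅ m₉ := by
      have := TreeOk.congr_mem t₇ (m' := m₉) fun x _ _ => by rw [f₉ _ (by omega), f₈ _ (by omega)]
      simpa [VTree] using this
  case good =>
    refine VGood.crE (.rg (by norm_num) (by rw [g0]; omega) (by rw [g0]; omega))
      ⟨by simp [good_rg], ?_, ?_⟩ <;> simp [g9, g0] <;> omega
  all_goals
    have hX := h.gen.X_pos (x := V (m + 1) / 2) (by omega)
    have hother : sa C.I (V (m + 1) / 2) = V (m + 1) ∧
        sb C.I (V (m + 1) / 2) = 4 * (V (m + 1) / 2) + 1 - V (m + 1) ∨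
        sb C.I (V (m + 1) / 2) = V (m + 1) ∧
        sa C.I (V (m + 1) / 2) = 4 * (V (m + 1) / 2) + 1 - V (m + 1) := by
      rcases sa_sb C.I (V (m + 1) / 2) with h | h <;> omega
    unfold X at hX
    simp [g0, g9] at hc
  case p1 =>
    refine ⟨o₇.trans o₃, ?_, by simp [fm, g0], by simp [fm, g5], by simp [fm, g6], by simp [fm, g9], ?_,
      fun r q1 q2 q3 q4 q5 q6 q7 => (fm r q6).trans (f r q1 q2 q3 q4 q5 q6 q7)⟩
    · exact TreeOk.congr_mem t9 fun x _ _ => fm _ (by omega)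
    · rw [if_pos]
      · simp [em]
      · rcases hother with h1 | h1
        · exact h1.1.symm
        · rw [h1.1, h1.2, cr_swap] at hX; omega
  case p2 =>
    refine ⟨o₇.trans o₃, t9, g0, g5, g6, g9, ?_, f⟩
    rw [if_neg]
    · simp [e₉]
    · intro h2
      rcases hother with h1 | h1
      · rw [h1.1, h1.2] at hX; omega
      · rw [h1.1, h1.2] at hX
        rw [h1.2] at h2
        omega

end KVis

namespace KVis

/-! ### Output -/

/-- Report the two ends of the window between the segments in the registers `1` and `11`. -/
def windows : Cmd :=
  -- The square is positive exactly if the two segments differ; the other tests exclude the default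
  -- `n`.
  .ite (nE - rg 1) (.ite (nE - rg 11) (.ite ((rg 1 - rg 11) * (rg 1 - rg 11))
    (.write 0 ;; .write (rg 0) ;; .write (rg 11) ;; .write (rg 10) ;;
      .write 0 ;; .write (rg 0) ;; .write (rg 1) ;; .write (rg 10)) .skip) .skip) .skip

theorem run_windows {C : Env} {σ : State} :
    Run C windows σ 100 (fun σ' => σ'.mem = σ.mem ∧ σ'.out = σ.out ++
      if σ.mem 1 < C.n ∧ σ.mem 11 < C.n ∧ σ.mem 1 ≠ σ.mem 11 then
        [0, σ.mem 0, σ.mem 11, σ.mem 10, 0, σ.mem 0, σ.mem 1, σ.mem 10] else []) := by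
  have g : ∀ {m : ℕ → ℤ} {r : ℕ}, r < 72 → (rg r).Good C m := good_rg
  refine (Run.ite (T := 80) (U := 1) (by decide) (by simp [g]) (fun h1 => Run.ite (T := 60) (U := 1)
    (by decide) (by simp [g]) (fun h2 => Run.ite (T := 40) (U := 1) (by decide) (by simp [g])
    (fun h3 => (Run.seq <| Run.write (by decide) (by simp) <|
      Run.seq <| Run.write (by decide) (g (by norm_num)) <|
      Run.seq <| Run.write (by decide) (g (by norm_num)) <|
      Run.seq <| Run.write (by decide) (g (by norm_num)) <|
      Run.seq <| Run.write (by decide) (by simp) <|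
      Run.seq <| Run.write (by decide) (g (by norm_num)) <|
      Run.seq <| Run.write (by decide) (g (by norm_num)) <|
      Run.write (by decide) (g (by norm_num)) ⟨rfl, ?_⟩).time (by decide))
    (fun h3 => Run.skip ⟨rfl, ?_⟩) |>.time (by decide))
    (fun h2 => Run.skip ⟨rfl, ?_⟩) |>.time (by decide))
    (fun h1 => Run.skip ⟨rfl, ?_⟩)).time (by decide)
  · simp at h1 h2 h3
    rw [if_pos ⟨h1, h2, fun h => h3 (by rw [h, sub_self])⟩]
    simp
  · simp at h1 h2 h3
    rw [if_neg fun h => h.2.2 (by omega)]; simp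
  · simp at h1 h2
    rw [if_neg fun h => by omega]; simp
  · simp at h1
    rw [if_neg fun h => by omega]; simp

/-- Report the visible parts, up to the current vertex, of the segments in the block in
register `30`. -/
def flush : Cmd :=
  put 20 (treeE 3 (rg 30)) ;;
  .ite ((rg 20 - rg 0) * (rg 20 - rg 0))
    (put 22 (rg 30 * rg 8) ;; put 21 (rg 22 + rg 8) ;; .ite (rg 21 - nE) (put 21 nE) .skip ;;
      .loop (rg 21 - rg 22)
        (withSeg (rg 22) (fun a b =>
          .ite (crE a (rg 0))
            (.ite (crE (rg 0) b + 1)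
              (.ite (gtE a b) .skip
                (.write 1 ;; .write (rg 22) ;; .write (rg 20) ;; .write (rg 0)))
              .skip)
            .skip) ;;
        put 22 (rg 22 + 1)) ;;
      .assign (nodeE 3 (rg 30)) (rg 0))
    .skip

/-- The segments whose visible parts are reported. -/
def Shown (C : Env) (v e x : ℤ) : Prop := Bef C.I v x ∧ ¬ Far (Lt C.I v) C.n e x

/-- The state during the report of a block. -/
structure FlushInv (C : Env) (v e u lo hi : ℤ) (σ₀ : State) (j : ℕ) (σ : State) : Prop where
  frame : ∀ r, r ≠ 22 → σ.mem r = σ₀.mem r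
  lo_le : lo ≤ σ.mem 22
  rest : j = (hi - σ.mem 22).toNat
  le_max : σ.mem 22 ≤ max lo hi
  out : ∃ l : List ℤ, l.Nodup ∧ (∀ x, x ∈ l ↔ (lo ≤ x ∧ x < σ.mem 22) ∧ Shown C v e x) ∧
    σ.out = σ₀.out ++ l.flatMap fun x => [1, x, u, v]

theorem run_flush_loop {C : Env} {v e u lo hi : ℤ} {σ₀ : State} {j : ℕ} {σ : State}
    (hR : Regs C v C.n e σ₀.mem) (hlo : 0 ≤ lo) (hhi : hi ≤ C.n) (h21 : σ₀.mem 21 = hi)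
    (h20 : σ₀.mem 20 = u) (hσ : FlushInv C v e u lo hi σ₀ j σ) :
    Run C (.loop (rg 21 - rg 22)
        (withSeg (rg 22) (fun a b =>
          .ite (crE a (rg 0))
            (.ite (crE (rg 0) b + 1)
              (.ite (gtE a b) .skip
                (.write 1 ;; .write (rg 22) ;; .write (rg 20) ;; .write (rg 0)))
              .skip)
            .skip) ;;
        put 22 (rg 22 + 1))) σ (j * 2000 + 10)
      (fun σ' => ∃ j', FlushInv C v e u lo hi σ₀ j' σ' ∧ hi ≤ σ'.mem 22) := by
  refine (Run.loop (T := 1900) (FlushInv C v e u lo hi σ₀) (by decide)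
    (fun j σ _ => (good_sub _ _).2 ⟨good_rg (by norm_num), good_rg (by norm_num)⟩)
    (fun j σ hσ hpos => ?_) (fun j σ hσ hpos => ?_) j hσ).time ?_
  · simp only [eval_sub, eval_rg, hσ.frame 21 (by norm_num), h21] at hpos
    refine ⟨j - 1, by have := hσ.rest; omega, ?_⟩
    have h22 := hσ.lo_le
    obtain ⟨x, hx⟩ : ∃ x, x = σ.mem 22 := ⟨_, rfl⟩
    have hX := hR.gen.X_pos (x := x) (by omega)
    have hR' : Regs C v C.n e σ.mem := hR.congr fun r hr => hσ.frame r (by omega)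
    have hv := hR.v_mem
    have hv0 : VGood C σ.mem (rg 0) := .rg (by norm_num) (by rw [hR'.r0]; omega)
      (by rw [hR'.r0]; omega)
    have hg : (rg 22).Good C σ.mem := good_rg (by norm_num)
    have he : (rg 22).eval C.I σ.mem = x := hx.symm
    obtain ⟨l, hl1, hl2, hl3⟩ := hσ.out
    refine (Run.seq_of (R := fun σ₁ => σ₁.mem = σ.mem ∧ (Shown C v e x ∧
      σ₁.out = σ.out ++ [1, x, u, v] ∨ ¬ Shown C v e x ∧ σ₁.out = σ.out))
      (Run.withSeg (T := 700) (U := 1800) hg he (by omega) (by omega) (by decide)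
        (fun a b hab => ?_) (by decide)) fun σ₁ ⟨f₁, o₁⟩ =>
      Run.putDyn (by norm_num) (by decide) (by simp [good_rg]) ?_ fun m₂ e₂ f₂ => ?_).time (by decide)
    · have g : (crE a (rg 0)).maxGrade < 1000 ∧ (crE (rg 0) b + 1).maxGrade < 1000 ∧
          (gtE a b).maxGrade < 1000 ∧
          (crE a (rg 0)).cost + (crE (rg 0) b + 1).cost + (gtE a b).cost < 600 := by
        rcases hab.cases with ⟨rfl, -, rfl, -⟩ | ⟨rfl, -, rfl, -⟩ <;> decide
      obtain ⟨g1, g2, g3, g4⟩ := g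
      have hd : 0 < D C.I v x → ((thr C.I C.n v e).1 * D C.I v x < X C.I x * (thr C.I C.n v e).2 ↔
          Far (Lt C.I v) C.n e x) := fun hd => by
        have := hR.e_mem
        unfold Far Lt thr
        split_ifs with h1
        · simp [h1.ne]
        · simp [le_antisymm this.2 (not_lt.mp h1), hd.le]
      refine (Run.ite g1 ((hab.good_left hg he).crE hv0) (fun h1 => Run.ite g2
        ((good_add _ _).2 ⟨hv0.crE (hab.good_right hg he), by simp⟩)
        (fun h2 => Run.ite g3 (hab.good_gtE hg he hv0) (fun h3 => Run.skip ⟨rfl, ?_⟩)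
          (fun h3 => (Run.seq <| Run.write (by decide) (by simp) <|
            Run.seq <| Run.write (by decide) (good_rg (by norm_num)) <|
            Run.seq <| Run.write (by decide) (good_rg (by norm_num)) <|
            Run.write (by decide) (good_rg (by norm_num)) ⟨rfl, ?_⟩).time (show _ ≤ 30 by decide)))
        (fun h2 => Run.skip ⟨rfl, ?_⟩)) (fun h1 => Run.skip ⟨rfl, ?_⟩)).time (by omega)
      · simp only [eval_crE, eval_add, eval_rg, hab.eval_left he, hab.eval_right he, hR'.r0,
          eval_ofNat] at h1 h2
        rw [hab.eval_gtE he, hR'.r0, hR'.r2, hR'.r3, sub_pos, hd (by unfold D; omega)] at h3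
        exact .inr ⟨fun h => h.2 h3, rfl⟩
      · simp only [eval_crE, eval_add, eval_rg, hab.eval_left he, hab.eval_right he, hR'.r0,
          eval_ofNat] at h1 h2
        rw [hab.eval_gtE he, hR'.r0, hR'.r2, hR'.r3, sub_pos, hd (by unfold D; omega)] at h3
        refine .inl ⟨⟨⟨h1, by omega⟩, h3⟩, ?_⟩
        simp [← hx, hσ.frame, h20, hR.r0]
      · simp only [eval_crE, eval_add, eval_rg, hab.eval_right he, hR'.r0, eval_ofNat] at h2
        exact .inr ⟨fun h => by have := h.1.2; omega, rfl⟩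
      · simp only [eval_crE, eval_rg, hab.eval_left he, hR'.r0] at h1
        exact .inr ⟨fun h => h1 h.1.1, rfl⟩
    · simp only [eval_add, eval_rg, f₁, eval_ofNat]
      exact C.bd_index (by omega) (by omega)
    · simp only [eval_add, eval_rg, f₁, eval_ofNat] at e₂
      refine ⟨fun r hr => ?_, ?_, ?_, ?_, ?_⟩ <;> try dsimp only
      · rw [f₂ r hr, f₁, hσ.frame r hr]
      · omega
      · have := hσ.rest; omega
      · omega
      · rcases o₁ with ⟨hs, o₁⟩ | ⟨hs, o₁⟩
        · refine ⟨l ++ [x], ?_, fun y => ?_, ?_⟩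
          · refine List.Nodup.append hl1 (List.nodup_singleton x) ?_
            rw [List.disjoint_singleton, hl2]
            omega
          · rw [List.mem_append, hl2, List.mem_singleton, e₂, ← hx]
            constructor
            · rintro (h | rfl)
              · exact ⟨⟨h.1.1, by omega⟩, h.2⟩
              · exact ⟨⟨by omega, by omega⟩, hs⟩
            · rintro ⟨h1, h2⟩
              by_cases hyx : y = x
              · exact .inr hyx
              · exact .inl ⟨⟨h1.1, by omega⟩, h2⟩
          · rw [o₁, hl3]; simp
        · refine ⟨l, hl1, fun y => ?_, by rw [o₁, hl3]⟩
          rw [hl2, e₂, ← hx]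
          constructor
          · exact fun h => ⟨⟨h.1.1, by omega⟩, h.2⟩
          · rintro ⟨h1, h2⟩
            refine ⟨⟨h1.1, ?_⟩, h2⟩
            have : y ≠ x := by rintro rfl; exact hs h2
            omega
  · simp only [eval_sub, eval_rg, hσ.frame 21 (by norm_num), h21] at hpos
    exact ⟨j, hσ, by omega⟩
  · have : (rg 21 - rg 22).cost = 5 := by decide
    rw [this]; omega

/-- Tree `3` is used as a plain array, with block `b` at index `b`, for the vertices up to which the
blocks have been reported. If that vertex is the current one, nothing is written: usually the block
has just been reported. -/
theorem run_flush {C : Env} {σ : State} {v e u : ℤ} {b : ℕ} (hR : Regs C v C.n e σ.mem)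
    (hb : b < C.s) (h30 : σ.mem 30 = b) (hu : σ.mem (64 + 4 * b + 3) = u) :
    Run C flush σ (2000 * C.B.toNat + 500) (fun σ' =>
      (∃ l : List ℤ, l.Nodup ∧
        (∀ x, x ∈ l ↔ (0 ≤ x ∧ x < C.n) ∧ C.blk x = b ∧ Shown C v e x) ∧
        σ'.out = σ.out ++ if u = v then [] else l.flatMap fun x => [1, x, u, v]) ∧
      σ'.mem (64 + 4 * b + 3) = v ∧
      ∀ r, r ≠ 20 → r ≠ 21 → r ≠ 22 → r ≠ 64 + 4 * b + 3 → σ'.mem r = σ.mem r) := by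
  have hB := C.B_pos
  have hBn := C.B_le_n
  have hb0 : (b : ℤ) * C.B + C.B ≤ 2 * C.n := by
    have h1 : ((b : ℤ) + 1) * C.B ≤ C.s * C.B :=
      mul_le_mul_of_nonneg_right (by omega) (by omega)
    linarith [C.B_le]
  have hb1 : 0 ≤ (b : ℤ) * C.B := by positivity
  obtain ⟨lo, hlo⟩ : ∃ lo, lo = (b : ℤ) * C.B := ⟨_, rfl⟩
  obtain ⟨hi, hhi⟩ : ∃ hi, hi = min (C.n : ℤ) (lo + C.B) := ⟨_, rfl⟩
  have hmem : ∀ x : ℤ, ((lo ≤ x ∧ x < hi) ↔ (0 ≤ x ∧ x < C.n) ∧ C.blk x = b) := by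
    intro x
    constructor
    · rintro ⟨h2, h3⟩
      have h0 : 0 ≤ x := by omega
      have h5 : x / C.B = b := le_antisymm
        (Int.lt_add_one_iff.mp (Int.ediv_lt_of_lt_mul (by omega) (by linarith [h3, hhi.le, min_le_right (C.n : ℤ) (lo + C.B)])))
        (Int.le_ediv_of_mul_le (by omega) (by omega))
      have := Env.blk_cast (C := C) h0
      exact ⟨⟨h0, by omega⟩, by omega⟩
    · rintro ⟨⟨h2, h3⟩, h4⟩
      have h8 := Env.blk_cast (C := C) h2
      rw [h4] at h8
      have h9 := Int.ediv_mul_le x (show C.B ≠ 0 by omega)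
      have h10 := Int.lt_ediv_add_one_mul_self x (show 0 < C.B by omega)
      rw [← h8] at h9 h10
      have h11 : x < lo + C.B := by linarith
      omega
  have h20 : (treeE 3 (rg 30)).eval C.I σ.mem = u := by
    rw [eval_treeE (x := b) (by simpa using h30), hu]
  refine (Run.seq <| Run.put (by norm_num) (by decide) (by decide)
    (good_treeE (x := b) (good_rg (by norm_num)) (by simpa using h30) (by norm_num) (by omega))
    fun m₁ e₁ f₁ => Run.ite (T := 2000 * C.B.toNat + 100) (U := 1) (by decide) (by simp [good_rg])
      (fun hne => ?_) (fun hne => Run.skip ?_)).time ?time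
  case time =>
    have : (treeE 3 (rg 30)).cost + ((rg 20 - rg 0) * (rg 20 - rg 0)).cost ≤ 100 := by decide
    omega
  · rw [h20] at e₁
    have hne' : u ≠ v := by
      rintro rfl
      simp [e₁, f₁, hR.r0] at hne
    refine (Run.seq <| Run.putDyn (by norm_num) (by decide) (by simp [good_rg]) ?d1
      fun m₂ e₂ f₂ =>
      Run.seq <| Run.putDyn (by norm_num) (by decide) (by simp [good_rg]) ?d2 fun m₃ e₃ f₃ =>
      Run.seq_of (T := 12) (R := fun σ₄ => σ₄.out = σ.out ∧ σ₄.mem 21 = hi ∧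
        ∀ r, r ≠ 21 → σ₄.mem r = m₃ r) ?c1 fun σ₄ ⟨o₄, a₄, f₄⟩ =>
      Run.seq_of (run_flush_loop (j := (hi - lo).toNat) (v := v) (e := e) (u := u) (lo := lo)
        (hi := hi) (hR.congr ?c3) (by omega) (by omega) a₄ ?c4 ?c5) fun σ₅ ⟨j, h₅, hj⟩ =>
      Run.assign (good_nodeE (good_rg (by norm_num))) (good_rg (by norm_num)) ?c6 (by decide)
        (by decide) (fun hm => hm 0) ?c7).time ?c8
    all_goals try dsimp only at *
    case c8 =>
      have : (rg 30 * rg 8).cost + (rg 22 + rg 8).cost + (nodeE 3 (rg 30)).cost + (rg 0).cost ≤ 40 := by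
        decide
      omega
    case d1 =>
      simp only [eval_mul, eval_rg, f₁ 30 (by omega), f₁ 8 (by omega), h30, hR.r8, ← hlo]
      exact C.bd_index (by omega) (by omega)
    all_goals
      simp only [eval_mul, eval_rg, f₁ 30 (by omega), f₁ 8 (by omega), h30, hR.r8, ← hlo] at e₂
    case d2 =>
      simp only [eval_add, eval_rg, f₂ 8 (by omega), f₁ 8 (by omega), hR.r8, e₂]
      exact C.bd_index (by omega) (by omega)
    all_goals
      simp [f₂, f₁, e₂, hR.r8] at e₃
    case c1 =>
      refine (Run.ite (T := 4) (U := 1) (by decide) (by simp [good_rg])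
          (fun hlt => Run.put (by norm_num) (by decide) (by decide) (by simp) fun m' em fm =>
            ⟨rfl, ?_, fm⟩) (fun hlt => Run.skip ⟨rfl, ?_, fun _ _ => rfl⟩)).time (by decide)
      · simp [e₃] at hlt; simp [e₃]; omega
      · simp [e₃] at hlt; simp [em]; omega
    case c3 =>
      intro r hr
      rw [f₄ r (by omega), f₃ r (by omega), f₂ r (by omega), f₁ r (by omega)]
    case c4 => rw [f₄ _ (by omega), f₃ _ (by omega), f₂ _ (by omega), e₁]
    case c5 =>
      have e22 : σ₄.mem 22 = lo := by rw [f₄ _ (by omega), f₃ _ (by omega), e₂]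
      exact ⟨fun _ _ => rfl, e22.ge, by rw [e22], by rw [e22]; exact le_max_left _ _, [],
        List.nodup_nil, fun x => by rw [e22]; simp, by simp⟩
    all_goals
      have h30' : σ₅.mem 30 = b := by
        rw [h₅.frame _ (by omega), f₄ _ (by omega), f₃ _ (by omega), f₂ _ (by omega), f₁ _ (by omega),
          h30]
    case c6 =>
      rw [eval_nodeE, eval_rg, h30']
      exact inRange_node (by norm_num) (by omega)
    case c7 =>
      have haddr : ((64 : ℤ) + 4 * b + (3 : ℕ)).toNat = 64 + 4 * b + 3 := by omega
      have h0 : σ₅.mem 0 = v := by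
        rw [h₅.frame _ (by omega), f₄ _ (by omega), f₃ _ (by omega), f₂ _ (by omega), f₁ _ (by omega),
          hR.r0]
      rw [eval_nodeE, eval_rg, eval_rg, h30', haddr, h0]
      obtain ⟨l, hl1, hl2, hl3⟩ := h₅.out
      refine ⟨⟨l, hl1, fun x => ?_, ?_⟩, ?_, fun r q1 q2 q3 q4 => ?_⟩ <;> try dsimp only
      · rw [hl2, ← and_assoc, ← hmem]
        have := h₅.le_max
        have : lo ≤ x ∧ x < σ₅.mem 22 ↔ lo ≤ x ∧ x < hi := by omega
        rw [this]
      · rw [hl3, o₄, if_neg hne']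
      · rw [Function.update_self]
      · rw [Function.update_of_ne q4, h₅.frame _ q3, f₄ _ q2, f₃ _ q2, f₂ _ q3, f₁ _ q1]
  · rw [h20] at e₁
    have huv : u = v := by
      by_contra h
      have : 0 < (u - v) * (u - v) := mul_self_pos.mpr (sub_ne_zero.mpr h)
      exact hne (by simpa [e₁, f₁, hR.r0] using this)
    classical
    refine ⟨⟨((Finset.Ico lo hi).filter fun x => Shown C v e x).toList, Finset.nodup_toList _,
      fun x => ?_, by simp [huv]⟩, ?_, fun r q1 _ _ _ => f₁ r q1⟩
    · rw [Finset.mem_toList, Finset.mem_filter, Finset.mem_Ico, hmem]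
      tauto
    · dsimp only
      rw [f₁ _ (by omega), hu, huv]

end KVis

namespace KVis

/-! ### What the sweep reports -/

theorem IsKth.unique {r : ℤ → ℤ → Prop} {n k : ℕ} {A G : Finset ℤ} {e e' : ℤ} (h : IsKth r n k G e)
    (h' : IsKth r n k G e') (hA : LinOn r A) (hG : G ⊆ A) (hn : (n : ℤ) ∉ A) : e = e' := by
  classical
  have aux : ∀ e e' : ℤ, IsKth r n k G e → IsKth r n k G e' → e ∈ G → e' ∈ G → ¬ r e e' := by
    intro e e' h h' he he' hr
    have h1 := (h'.resolve_right fun h => hn (h.1 ▸ hG he')).2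
    have h2 := (h.resolve_right fun h => hn (h.1 ▸ hG he)).2
    refine absurd (h1.trans h2.symm) (ne_of_gt (Finset.card_lt_card ?_))
    rw [Finset.ssubset_iff_of_subset]
    · exact ⟨e, by simp [he, hr], by simp [hA.irrefl e (hG he)]⟩
    · intro y hy
      simp only [Finset.mem_filter] at hy ⊢
      exact ⟨hy.1, hA.trans y (hG hy.1) e (hG he) e' (hG he') hy.2 hr⟩
  have lt : ∀ e ∈ G, rank r G e < G.card := fun e he => by
    refine Finset.card_lt_card ?_
    rw [Finset.ssubset_iff_of_subset (Finset.filter_subset _ _)]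
    exact ⟨e, he, by simp [hA.irrefl e (hG he)]⟩
  have h0 := h
  have h0' := h'
  rcases h with ⟨h1, h2⟩ | ⟨h1, h2⟩ <;> rcases h' with ⟨h3, h4⟩ | ⟨h3, h4⟩
  · by_contra hne
    rcases hA.total e (hG h1) e' (hG h3) hne with h5 | h5
    · exact aux _ _ h0 h0' h1 h3 h5
    · exact aux _ _ h0' h0 h3 h1 h5
  · have := lt e h1; omega
  · have := lt e' h3; omega
  · rw [h1, h3]

/-- Segment `x` is visible where it meets the rays between the vertices `V m` and
`V (m + 1)`. -/
def Vis (C : Env) (V : ℕ → ℤ) (m : ℕ) (x : ℤ) : Prop :=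
  x ∈ Gs C.I C.n (V m) ∧ rank (Lt C.I (V m)) (Gs C.I C.n (V m)) x ≤ C.k

/-- `e` has the rank `k` on the rays between the vertices `V m` and `V (m + 1)`. -/
def Kth (C : Env) (V : ℕ → ℤ) (m : ℕ) (e : ℤ) : Prop :=
  IsKth (Lt C.I (V m)) C.n C.k (Gs C.I C.n (V m)) e

/-- Whether the vertex `v` is the first one of its segment. -/
def first (I : List ℤ) (v : ℤ) : ℤ := if v = sa I (v / 2) then 1 else 0

/-- On the ray through `V (m + 1)` there is a window with an end on `y`. -/
def Win (C : Env) (V : ℕ → ℤ) (m : ℕ) (y τ : ℤ) : Prop :=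
  ∃ e e', Kth C V m e ∧ Kth C V (m + 1) e' ∧ e < C.n ∧ e' < C.n ∧ e ≠ e' ∧ (y = e ∨ y = e') ∧
    τ = first C.I (V (m + 1))

/-- A reported item: the end on segment `y` of a window on the ray through `V (m + 1)`, or the part
of segment `x` between the rays through two vertices. -/
abbrev Entry := (ℕ × ℤ × ℤ) ⊕ (ℤ × ℕ × ℕ)

/-- The words that are written for an item. -/
def Entry.words (V : ℕ → ℤ) : Entry → List ℤ
  | .inl (m, y, τ) => [0, V (m + 1), y, τ]
  | .inr (x, a, b) => [1, x, V a, V b]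

/-- The windows at the vertices `V 1, …, V w` have been reported, and the visible parts of the
segments in block `b` up to the vertex `V (l b)`. -/
structure Reported (C : Env) (V : ℕ → ℤ) (w : ℕ) (l : ℕ → ℕ) (L : List Entry) : Prop where
  nodup : L.Nodup
  win : ∀ (m : ℕ) (y τ : ℤ), .inl (m, y, τ) ∈ L ↔ m < w ∧ Win C V m y τ
  part : ∀ (x : ℤ) (a b : ℕ), .inr (x, a, b) ∈ L →
    (0 ≤ x ∧ x < C.n) ∧ a < b ∧ b ≤ l (C.blk x) ∧ ∀ j, a ≤ j → j < b → Vis C V j x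
  disj : ∀ (x : ℤ) (a b a' b' : ℕ), .inr (x, a, b) ∈ L → .inr (x, a', b') ∈ L →
    (a = a' ∧ b = b') ∨ b ≤ a' ∨ b' ≤ a
  cover : ∀ (x : ℤ) (j : ℕ), 0 ≤ x → x < C.n → j < l (C.blk x) → Vis C V j x →
    ∃ a b, .inr (x, a, b) ∈ L ∧ a ≤ j ∧ j < b

section
variable {C : Env} {V : ℕ → ℤ} {w m : ℕ} {l : ℕ → ℕ} {L : List Entry}

theorem Reported.windows (h : Reported C V m l L) {M : List Entry} (hn : M.Nodup)
    (hM : ∀ t, t ∈ M ↔ ∃ y τ, t = .inl (m, y, τ) ∧ Win C V m y τ) :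
    Reported C V (m + 1) l (L ++ M) where
  nodup := by
    refine h.nodup.append hn fun t h1 h2 => ?_
    obtain ⟨y, τ, rfl, -⟩ := (hM t).1 h2
    have := ((h.win _ _ _).1 h1).1
    omega
  win := fun j y τ => by
    rw [List.mem_append, h.win, hM]
    constructor
    · rintro (h1 | ⟨y', τ', h1, h2⟩)
      · exact ⟨by omega, h1.2⟩
      · cases h1; exact ⟨by omega, h2⟩
    · rintro ⟨h1, h2⟩
      rcases Nat.lt_succ_iff_lt_or_eq.mp h1 with h3 | rfl
      · exact .inl ⟨h3, h2⟩
      · exact .inr ⟨_, _, rfl, h2⟩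
  part := fun x a b hx => by
    rcases List.mem_append.mp hx with h1 | h1
    · exact h.part _ _ _ h1
    · obtain ⟨y, τ, h2, -⟩ := (hM _).1 h1
      cases h2
  disj := fun x a b a' b' hx hx' => by
    have aux : ∀ {x a b}, Sum.inr (x, a, b) ∈ L ++ M → Sum.inr (x, a, b) ∈ L := by
      intro x a b hx
      rcases List.mem_append.mp hx with h1 | h1
      · exact h1
      · obtain ⟨y, τ, h2, -⟩ := (hM _).1 h1
        cases h2
    exact h.disj _ _ _ _ _ (aux hx) (aux hx')
  cover := fun x j h1 h2 h3 h4 => by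
    obtain ⟨a, b, h5, h6⟩ := h.cover x j h1 h2 h3 h4
    exact ⟨a, b, List.mem_append_left _ h5, h6⟩

/-- One piece per visible segment suffices, because by `hc` no segment of the block has changed its
visibility since gap `l b`. Earlier pieces of these segments end at `l b` or before, so the new ones
do not overlap them. -/
theorem Reported.flush (h : Reported C V w l L) {b : ℕ} (hl : l b ≤ m)
    (hc : ∀ x : ℤ, 0 ≤ x → x < C.n → C.blk x = b → ∀ j, l b ≤ j → j ≤ m → (Vis C V j x ↔ Vis C V m x))
    {xs : List ℤ} (hn : xs.Nodup)
    (hx : ∀ x, x ∈ xs ↔ (0 ≤ x ∧ x < C.n) ∧ C.blk x = b ∧ Vis C V m x) :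
    Reported C V w (Function.update l b (m + 1))
      (L ++ xs.map fun x => .inr (x, l b, m + 1)) where
  nodup := by
    refine h.nodup.append (hn.map fun x y hxy => by cases hxy; rfl) fun t h1 h2 => ?_
    obtain ⟨x, h3, rfl⟩ := List.mem_map.mp h2
    have h4 := (h.part _ _ _ h1).2.2.1
    rw [((hx x).1 h3).2.1] at h4
    omega
  win := fun j y τ => by
    rw [List.mem_append, h.win]
    simp
  part := fun x a c hx' => by
    rcases List.mem_append.mp hx' with h1 | h1
    · obtain ⟨h2, h3, h4, h5⟩ := h.part _ _ _ h1
      refine ⟨h2, h3, ?_, h5⟩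
      rw [Function.update_apply]
      split_ifs with h6
      · rw [h6] at h4; omega
      · exact h4
    · obtain ⟨y, h2, h3⟩ := List.mem_map.mp h1
      cases h3
      obtain ⟨h4, h5, h6⟩ := (hx x).1 h2
      refine ⟨h4, by omega, by rw [h5, Function.update_self], fun j h7 h8 => ?_⟩
      exact (hc x h4.1 h4.2 h5 j h7 (by omega)).2 h6
  disj := fun x a c a' c' h1 h2 => by
    have old : ∀ {a c}, Sum.inr (x, a, c) ∈ L → c ≤ l (C.blk x) := fun h' => (h.part _ _ _ h').2.2.1
    have new : ∀ {a c}, Sum.inr (x, a, c) ∈ xs.map (fun x => (.inr (x, l b, m + 1) : Entry)) →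
        a = l (C.blk x) ∧ c = m + 1 := by
      intro a c h'
      obtain ⟨y, h2, h3⟩ := List.mem_map.mp h'
      cases h3
      exact ⟨by rw [((hx _).1 h2).2.1], rfl⟩
    rcases List.mem_append.mp h1 with h1 | h1 <;> rcases List.mem_append.mp h2 with h2 | h2
    · exact h.disj _ _ _ _ _ h1 h2
    · have := old h1; have := new h2; omega
    · have := old h2; have := new h1; omega
    · have := new h1; have := new h2; omega
  cover := fun x j h1 h2 h3 h4 => by
    by_cases h5 : j < l (C.blk x)
    · obtain ⟨a, b, h5, h6⟩ := h.cover x j h1 h2 h5 h4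
      exact ⟨a, b, List.mem_append_left _ h5, h6⟩
    · have h6 : C.blk x = b := by
        by_contra h6
        rw [Function.update_of_ne h6] at h3
        exact h5 h3
      rw [h6] at h5
      rw [h6, Function.update_self] at h3
      refine ⟨l b, m + 1, List.mem_append_right _ (List.mem_map.mpr ⟨x, (hx x).2 ⟨⟨h1, h2⟩, h6, ?_⟩,
        rfl⟩), by omega, h3⟩
      exact (hc x h1 h2 h6 j (by omega) (by omega)).1 h4

/-- Nothing has to be reported for a block whose segments are not visible. -/
theorem Reported.skip (h : Reported C V w l L) {b : ℕ} (hl : l b ≤ m)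
    (hc : ∀ x : ℤ, 0 ≤ x → x < C.n → C.blk x = b → ∀ j, l b ≤ j → j ≤ m → ¬ Vis C V j x) :
    Reported C V w (Function.update l b (m + 1)) L := by
  have := h.flush (xs := []) hl (fun x h1 h2 h3 j h4 h5 =>
    iff_of_false (hc x h1 h2 h3 j h4 h5) (hc x h1 h2 h3 m hl le_rfl)) List.nodup_nil fun x => by
      simp only [List.not_mem_nil, false_iff]
      exact fun h1 => hc x h1.1.1 h1.1.2 h1.2.1 m hl le_rfl h1.2.2
  simpa using this

end

section
variable {C : Env} {V : ℕ → ℤ} {m : ℕ} {e e' x y : ℤ}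

theorem mem_Gs_next (h : Order C.I C.n V) (hm : m < 2 * C.n) :
    x ∈ Gs C.I C.n (V m) ↔ (0 ≤ x ∧ x < C.n) ∧ Bef C.I (V (m + 1)) x := by
  rw [mem_Gs]
  exact and_congr_right fun h1 => h.act_iff_bef hm h1

theorem Gs_subset_next (h : Order C.I C.n V) (hm : m < 2 * C.n) :
    Gs C.I C.n (V m) ⊆ Cs C.I C.n (V (m + 1)) := fun x hx => by
  have := (mem_Gs_next h hm).1 hx
  exact mem_Cs.2 ⟨this.1, this.2.cl⟩

theorem n_notMem_Cs (C : Env) (v : ℤ) : (C.n : ℤ) ∉ Cs C.I C.n v := fun h => by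
  have := (mem_Cs.1 h).1; omega

theorem lt_next_of_mem (h : Sweep C.I C.n V) (hm : m < 2 * C.n) (hx : x ∈ Gs C.I C.n (V m))
    (hy : y ∈ Gs C.I C.n (V m)) : Lt C.I (V m) x y ↔ Lt C.I (V (m + 1)) x y :=
  h.lt_next hm (mem_Gs.1 hx).1 (mem_Gs.1 hy).1 (mem_Gs.1 hx).2 (mem_Gs.1 hy).2

theorem kth_next (h : Sweep C.I C.n V) (hm : m < 2 * C.n) (he : Kth C V m e) :
    IsKth (Lt C.I (V (m + 1))) C.n C.k (Gs C.I C.n (V m)) e := by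
  rcases he with ⟨h1, h2⟩ | h1
  · refine .inl ⟨h1, ?_⟩
    rw [← h2]
    exact rank_congr fun y hy => (lt_next_of_mem h hm hy h1).symm
  · exact .inr h1

theorem near_far_next (h : Sweep C.I C.n V) (hm : m < 2 * C.n) (he : Kth C V m e)
    (hx : x ∈ Gs C.I C.n (V m)) :
    (Near (Lt C.I (V m)) C.n e x ↔ Near (Lt C.I (V (m + 1))) C.n e x) ∧
      (Far (Lt C.I (V m)) C.n e x ↔ Far (Lt C.I (V (m + 1))) C.n e x) := by
  unfold Near Far
  rcases he with h1 | h1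
  · rw [lt_next_of_mem h hm hx h1.1, lt_next_of_mem h hm h1.1 hx]
    exact ⟨Iff.rfl, Iff.rfl⟩
  · simp [h1.1]

theorem vis_iff_not_far (h : Sweep C.I C.n V) (he : Kth C V m e) :
    Vis C V m x ↔ x ∈ Gs C.I C.n (V m) ∧ ¬ Far (Lt C.I (V m)) C.n e x :=
  and_congr_right fun hx => he.rank_le_iff (h.linOn le_rfl) (Gs_subset_Cs _ _ _) (n_notMem_Cs _ _) hx

/-- A block is reported when register `0` already holds `V (m + 1)`, so the gap `m` must be
recognized from its end: `Bef` replaces `Act`, and the comparison with `e` is made on the ray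
through `V (m + 1)`. -/
theorem vis_iff_shown (h : Sweep C.I C.n V) (hm : m < 2 * C.n) (he : Kth C V m e)
    (hx : 0 ≤ x ∧ x < C.n) : Vis C V m x ↔ Shown C (V (m + 1)) e x := by
  rw [vis_iff_not_far h he, Shown]
  constructor
  · exact fun h1 => ⟨((mem_Gs_next h.toOrder hm).1 h1.1).2, (near_far_next h hm he h1.1).2.not.1 h1.2⟩
  · intro h1
    have h2 := (mem_Gs_next h.toOrder hm).2 ⟨hx, h1.1⟩
    exact ⟨h2, (near_far_next h hm he h2).2.not.2 h1.2⟩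

/-- The segment of the vertex `V (m + 1)` is inserted if this is its first vertex, and removed
otherwise. -/
theorem Sweep.update (h : Sweep C.I C.n V) (hm : m < 2 * C.n) (he : Kth C V m e) :
    Update C (V (m + 1)) C.n e (V (m + 1) / 2) (first C.I (V (m + 1))) (Gs C.I C.n (V m)) := by
  have hv := h.mem (m + 1)
  have hi : 0 ≤ V (m + 1) / 2 ∧ V (m + 1) / 2 < C.n := by omega
  have hother : ∀ x, x ≠ V (m + 1) / 2 →
      (x ∈ Gs C.I C.n (V (m + 1)) ↔ x ∈ Gs C.I C.n (V m)) := fun x hx => by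
    rw [mem_Gs_next h.toOrder hm, mem_Gs]
    exact and_congr_right fun h1 => h.gen.act_iff_bef hv h1 hx
  refine ⟨h.linOn le_rfl, Gs_subset_next h.toOrder hm, kth_next h hm he, ?_, ?_⟩
  · refine mem_Cs.2 ⟨hi, ?_⟩
    rcases owner C.I (V (m + 1)) with h1 | h1
    · have := (h.gen.act_sa hi).1
      rw [← h1] at this
      exact this.cl
    · have := (h.gen.bef_sb hi).2
      rw [← h1] at this
      exact this.cl
  · unfold first
    split_ifs with h1
    · have := h.gen.act_sa hi
      rw [← h1] at this
      refine .inl ⟨rfl, fun h2 => this.2 ((mem_Gs_next h.toOrder hm).1 h2).2, ?_⟩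
      ext x
      rw [Finset.mem_insert]
      by_cases hx : x = V (m + 1) / 2
      · subst hx
        simp only [true_or, iff_true]
        exact mem_Gs.2 ⟨hi, this.1⟩
      · simp [hother x hx, hx]
    · have := h.gen.bef_sb hi
      rw [← (owner C.I (V (m + 1))).resolve_left h1] at this
      refine .inr ⟨rfl, (mem_Gs_next h.toOrder hm).2 ⟨hi, this.2⟩, ?_⟩
      ext x
      rw [Finset.mem_erase]
      by_cases hx : x = V (m + 1) / 2
      · subst hx
        simp only [ne_eq, not_true_eq_false, false_and, iff_false]
        exact fun h2 => this.1 (mem_Gs.1 h2).2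
      · simp [hother x hx, hx]

theorem Sweep.mem_Gs_iff (h : Sweep C.I C.n V) (hm : m < 2 * C.n) (hx : x ≠ V (m + 1) / 2) :
    x ∈ Gs C.I C.n (V m) ↔ x ∈ Gs C.I C.n (V (m + 1)) := by
  rw [mem_Gs_next h.toOrder hm, mem_Gs]
  exact and_congr_right fun h1 => (h.gen.act_iff_bef (h.mem _) h1 hx).symm

/-- The trees remain correct at the next vertex, except for its segment. -/
theorem Trees.next {mem : ℕ → ℤ} (h : Sweep C.I C.n V) (hm : m < 2 * C.n) (he : Kth C V m e)
    (hT : Trees C (V m) C.n e ∅ mem) :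
    Trees C (V (m + 1)) C.n e {C.blk (V (m + 1) / 2)} mem :=
  hT.transfer h.gen le_rfl le_rfl (Set.empty_subset _)
    (fun x _ _ hx => h.mem_Gs_iff hm fun h1 => hx (by rw [h1]; rfl))
    fun x hx _ => ⟨near_far_next h hm he hx, fun y hy _ => lt_next_of_mem h hm hx hy⟩

/-- The visibility of a segment does not change if it is not involved in the update. -/
theorem vis_next (h : Sweep C.I C.n V) (hm : m < 2 * C.n) (he : Kth C V m e)
    (hU : Updated C (V (m + 1)) C.n e e') (hx : x ≠ V (m + 1) / 2) (hxe : x ≠ e) (hxe' : x ≠ e') :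
    Vis C V m x ↔ Vis C V (m + 1) x := by
  rw [vis_iff_not_far h he, vis_iff_not_far (e := e') h hU.kth, h.mem_Gs_iff hm hx]
  refine and_congr_right fun h1 => not_congr ?_
  rw [(near_far_next h hm he ((h.mem_Gs_iff hm hx).2 h1)).2]
  exact (hU.same x h1 hxe hxe').2

/-- No segment meets all rays. -/
theorem exists_not_vis (h : Sweep C.I C.n V) (hx : 0 ≤ x ∧ x < C.n) :
    ∃ j < 2 * C.n, ¬ Vis C V j x := by
  have hb := sb_mem C.I hx
  have h1 := (h.gen.bef_sb hx).1
  obtain ⟨j, h2, h3, h4⟩ := h.surj _ hb.1 hb.2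
  rcases h3.lt_or_eq with h5 | rfl
  · exact ⟨j, h5, fun h6 => h1 (h4 ▸ (mem_Gs.1 h6.1).2)⟩
  · refine ⟨0, by omega, fun h6 => h1 ?_⟩
    rw [← h4, h.last, ← h.zero]
    exact (mem_Gs.1 h6.1).2

end

end KVis

namespace KVis

/-! ### The sweep -/

/-- What has been reported when the rays before the vertex `V (m + 1)` have been seen: the windows
at the vertices `V 1, …, V w`, and the visible parts of the segments in block `b` up to the vertex
`V (l b)`, since when their visibility has not changed. -/
structure Ledger (C : Env) (V : ℕ → ℤ) (m w : ℕ) (l : ℕ → ℕ) (σ : State) : Prop where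
  cell : ∀ b < C.s, σ.mem (64 + 4 * b + 3) = V (l b)
  le : ∀ b < C.s, l b ≤ m + 1
  const : ∀ b < C.s, ∀ x : ℤ, 0 ≤ x → x < C.n → C.blk x = b →
    ∀ j, l b ≤ j → j ≤ m → (Vis C V j x ↔ Vis C V m x)
  rep : ∃ L, Reported C V w l L ∧ σ.out = L.flatMap (Entry.words V)

section
variable {C : Env} {V : ℕ → ℤ} {m w : ℕ} {l : ℕ → ℕ} {σ σ' : State} {e : ℤ}

theorem Ledger.congr (h : Ledger C V m w l σ) (ho : σ'.out = σ.out)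
    (hm : ∀ r, 64 ≤ r → r % 4 = 3 → σ'.mem r = σ.mem r) : Ledger C V m w l σ' :=
  ⟨fun b hb => by rw [hm _ (by omega) (by omega), h.cell b hb], h.le, h.const, by rw [ho]; exact h.rep⟩

/-- The program compares vertices, whereas the ledger compares indices. The two disagree only
between `0` and `2 * n`, which denote the same vertex. -/
theorem run_flush_ledger (hS : Sweep C.I C.n V) (hm : m < 2 * C.n)
    (hR : Regs C (V (m + 1)) C.n e σ.mem) (he : Kth C V m e) {b : ℕ} (hb : b < C.s)
    (h30 : σ.mem 30 = b) (h : Ledger C V m w l σ) :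
    Run C flush σ (2000 * C.B.toNat + 500) (fun σ' =>
      Ledger C V m w (Function.update l b (m + 1)) σ' ∧
      ∀ r, r ≠ 20 → r ≠ 21 → r ≠ 22 → r < 64 ∨ r % 4 ≠ 3 → σ'.mem r = σ.mem r) := by
  refine (run_flush hR hb h30 (h.cell b hb)).mono le_rfl fun σ' _ ⟨⟨xs, x1, x2, x3⟩, hc, hf⟩ =>
    ⟨⟨fun c hcs => ?_, fun c hcs => ?_, fun c hcs x hx hx' hxb j h1 h2 => ?_, ?_⟩,
      fun r q1 q2 q3 q4 => hf r q1 q2 q3 (by omega)⟩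
  · rw [Function.update_apply]
    split_ifs with h1
    · rw [h1, hc]
    · rw [hf _ (by omega) (by omega) (by omega) (by omega), h.cell c hcs]
  · rw [Function.update_apply]
    split_ifs
    · exact le_rfl
    · exact h.le c hcs
  · rw [Function.update_apply] at h1
    split_ifs at h1
    · omega
    · exact h.const c hcs x hx hx' hxb j h1 h2
  · obtain ⟨L, hL, ho⟩ := h.rep
    have hle := h.le b hb
    rcases hle.lt_or_eq with hlt | heq
    · by_cases huv : V (l b) = V (m + 1)
      · rw [if_pos huv, List.append_nil] at x3
        refine ⟨L, hL.skip (by omega) fun x hx hx' hxb j h1 h2 hvis => ?_, x3.trans ho⟩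
        -- Equal vertices with different indices: the block has not been reported during the full
        -- turn. Writing nothing is right, since a segment of constant visibility for a full turn is
        -- invisible; no segment meets all rays.
        have h0 : l b = 0 := by
          by_contra h0
          have := hS.inj (by omega) (by omega) (by omega) (by omega) huv
          omega
        have h1' : m + 1 = 2 * C.n := by
          rw [h0, hS.zero, ← hS.last] at huv
          exact (hS.inj (by omega) le_rfl (by omega) (by omega) huv).symm
        obtain ⟨j', h3, h4⟩ := exists_not_vis hS ⟨hx, hx'⟩
        have hc := h.const b hb x hx hx' hxb
        exact h4 ((hc j' (by omega) (by omega)).2 ((hc j h1 h2).1 hvis))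
      · rw [if_neg huv] at x3
        refine ⟨_, hL.flush (by omega) (h.const b hb) x1 fun x => ?_, ?_⟩
        · rw [x2]
          exact and_congr_right fun hx => and_congr_right fun _ =>
            (vis_iff_shown hS hm he hx).symm
        · rw [x3, ho, List.flatMap_append]
          congr 1
          rw [List.flatMap_map]
          rfl
    · rw [if_pos (by rw [heq]), List.append_nil] at x3
      refine ⟨L, ?_, x3.trans ho⟩
      rwa [← heq, Function.update_eq_self]

/-- Report the visible parts of the segments in the block of `x`. -/
def flushAt (x : Expr) : Cmd := put 30 (x / rg 8) ;; flush

theorem run_flushAt (hS : Sweep C.I C.n V) (hm : m < 2 * C.n)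
    (hR : Regs C (V (m + 1)) C.n e σ.mem) (he : Kth C V m e) {r : ℕ} {x : ℤ} (hr : r < 20)
    (hx : σ.mem r = x) (h0 : 0 ≤ x) (h1 : x ≤ C.n) (h : Ledger C V m w l σ) :
    Run C (flushAt (rg r)) σ (2000 * C.B.toNat + 510) (fun σ' =>
      Ledger C V m w (Function.update l (C.blk x) (m + 1)) σ' ∧
      ∀ r, r < 20 ∨ 64 ≤ r ∧ r % 4 ≠ 3 → σ'.mem r = σ.mem r) := by
  have hg : (rg r / rg 8).grade ≤ 20 ∧ (rg r / rg 8).maxGrade < 1000 := by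
    constructor
    · exact le_rfl
    · simp only [Expr.maxGrade, HDiv.hDiv, Div.div, KVis.rg, Expr.grade]
      omega
  refine (Run.seq <| Run.put (by norm_num) hg.1 hg.2 ((good_div _ _).2
    ⟨good_rg (by omega), good_rg (by norm_num)⟩) fun m₁ e₁ f₁ =>
    (run_flush_ledger (σ := ⟨m₁, σ.out⟩) (w := w) (l := l) hS hm (hR.congr (m' := m₁) fun r hr => f₁ r (by omega)) he
      (Env.blk_lt h0 h1) ?_ (h.congr rfl fun r _ _ => f₁ r (by omega))).mono le_rfl
        fun σ₂ _ h₂ => ?_).time ?_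
  rotate_left
  · obtain ⟨l₂, f₂⟩ := h₂
    refine ⟨l₂, fun r q => ?_⟩
    rw [f₂ r (by omega) (by omega) (by omega) (by omega)]
    exact f₁ r (by omega)
  · change (5 : ℕ) + 2 + _ ≤ _
    omega
  · simp only [e₁, eval_div, eval_rg, hx, hR.r8, Env.blk_cast h0]

end

/-- The state of the sweep at the vertex `V m`. -/
structure SweepInv (C : Env) (V : ℕ → ℤ) (m : ℕ) (σ : State) : Prop where
  m_le : m ≤ 2 * C.n
  r0 : σ.mem 0 = V m
  kth : Kth C V m (σ.mem 1)
  r4 : σ.mem 4 = C.n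
  r5 : σ.mem 5 = (cursor C.I V m).1
  r6 : σ.mem 6 = (cursor C.I V m).2
  r7 : σ.mem 7 = (Gs C.I C.n (V m)).card
  r8 : σ.mem 8 = C.B
  r11 : ∀ j, m = j + 1 → Kth C V j (σ.mem 11)
  trees : Trees C (V m) C.n (σ.mem 1) ∅ σ.mem
  vtree : VTree C V m ∅ σ.mem
  ledger : ∃ l, (∀ b < C.s, l b ≤ m) ∧ Ledger C V m m l σ

/-- Process the next vertex. -/
def event : Cmd :=
  advance ;; part1 ;; windows ;; flushAt (rg 9) ;; flushAt (rg 11) ;; flushAt (rg 1) ;; part2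

/-- The cost of `event`. -/
def eventTime (C : Env) : ℕ :=
  refreshTime C (2 * C.B) + 6 * refreshTime C C.B + 6000 * C.B.toNat + 10000

theorem kth_mem_range {C : Env} {V : ℕ → ℤ} {m : ℕ} {e : ℤ} (h : Kth C V m e) : 0 ≤ e ∧ e ≤ C.n :=
  h.mem_range fun _ hx => (mem_Gs.1 hx).1

/-- The reports stand between `part1` and `part2` because they concern the gap before the vertex:
the threshold in registers `2` and `3` must still be that of the old `e`, while the new `e` is
already needed for the window and for the choice of blocks. -/
theorem run_event {C : Env} {V : ℕ → ℤ} {m : ℕ} {σ : State} (hS : Sweep C.I C.n V)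
    (hm : m < 2 * C.n) (h : SweepInv C V m σ) :
    Run C event σ (eventTime C) (fun σ' => SweepInv C V (m + 1) σ' ∧ σ'.mem 12 = σ.mem 12) := by
  obtain ⟨l, hl, hled⟩ := h.ledger
  have hv := hS.mem (m + 1)
  have hrange := kth_mem_range h.kth
  refine (Run.seq_of (run_advance hS.toOrder h.vtree hm h.r8)
      fun σ₁ ⟨o₁, t₁, p0, p5, p6, p9, p10, f₁⟩ =>
    Run.seq_of (run_part1 (lim := C.n) hS.gen hv le_rfl ?trees
      (hS.update hm h.kth) p0 ?r1 ?r4 ?r7 ?r8 p9 p10)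
      fun σ₂ ⟨o₂, R₂, T₂, U₂, c₂, e₂, K₂⟩ =>
    Run.seq_of run_windows fun σ₃ ⟨f₃, o₃⟩ =>
    Run.seq_of (run_flushAt (w := m + 1) (l := l) (x := V (m + 1) / 2) hS hm (e := σ.mem 1)
      (by rw [f₃]; exact R₂) h.kth (by norm_num) ?x9 (by omega) (by omega) ?led)
      fun σ₄ ⟨l₄, f₄⟩ =>
    Run.seq_of (run_flushAt (x := σ.mem 1) hS hm (e := σ.mem 1) ?reg4 h.kth (by norm_num) ?x11
      hrange.1 hrange.2 l₄) fun σ₅ ⟨l₅, f₅⟩ =>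
    Run.seq_of (run_flushAt (x := σ₂.mem 1) hS hm (e := σ.mem 1) ?reg5 h.kth (by norm_num) ?x1
      ?lo ?hi l₅) fun σ₆ ⟨l₆, f₆⟩ =>
    (run_part2 ?reg6 ?trees6 U₂ ?y1 ?y11).mono le_rfl fun σ₇ _ ⟨o₇, t₇, a₇, b₇, c₇, K₇⟩ => ?post).time ?time
  case time => rw [eventTime]; omega
  case trees =>
    exact (h.trees.next hS hm h.kth).congr_mem fun r _ _ =>
      f₁ r (by omega) (by omega) (by omega) (by omega) (by omega) (by omega) (by omega)
  case r1 => exact f₁ 1 (by omega) (by omega) (by omega) (by omega) (by omega) (by omega) (by omega)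
  case r4 =>
    rw [f₁ 4 (by omega) (by omega) (by omega) (by omega) (by omega) (by omega) (by omega), h.r4]
  case r7 =>
    rw [f₁ 7 (by omega) (by omega) (by omega) (by omega) (by omega) (by omega) (by omega), h.r7]
  case r8 =>
    rw [f₁ 8 (by omega) (by omega) (by omega) (by omega) (by omega) (by omega) (by omega), h.r8]
  all_goals
    have g : ∀ r, r = 9 ∨ r = 0 ∨ r = 5 ∨ r = 6 ∨ r = 8 ∨ r = 4 ∨ r = 10 ∨ r = 12 →
      σ₂.mem r = σ₁.mem r := fun r hr =>
      K₂ r (by omega) (by omega) (by omega) (by omega) (by omega) (by omega) (by omega)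
  case x9 => rw [f₃, g 9 (by omega), p9]
  case led =>
    have hled' : Ledger C V m m l σ₂ := hled.congr (by rw [o₂, o₁]) fun r h1 h2 => by
      rw [K₂ r (by omega) (by omega) (by omega) (by omega) (by omega) (by omega) (by omega),
        f₁ r (by omega) (by omega) (by omega) (by omega) (by omega) (by omega) (by omega)]
    obtain ⟨L, hL, ho⟩ := hled'.rep
    refine ⟨fun b hb => by rw [f₃]; exact hled'.cell b hb, hled'.le, hled'.const, ?_⟩
    have huniq : ∀ a a' y τ : ℤ, Kth C V m a → Kth C V (m + 1) a' → a = σ.mem 1 ∧ a' = σ₂.mem 1 :=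
      fun a a' _ _ h1 h2 => ⟨h1.unique h.kth (hS.linOn le_rfl) (Gs_subset_Cs _ _ _) (n_notMem_Cs _ _),
        IsKth.unique h2 U₂.kth (hS.linOn le_rfl) (Gs_subset_Cs _ _ _) (n_notMem_Cs _ _)⟩
    rw [e₂, g 0 (by omega), g 10 (by omega), p0, p10] at o₃
    by_cases hw : σ₂.mem 1 < C.n ∧ σ.mem 1 < C.n ∧ σ₂.mem 1 ≠ σ.mem 1
    · rw [if_pos hw] at o₃
      refine ⟨L ++ [.inl (m, σ.mem 1, first C.I (V (m + 1))),
        .inl (m, σ₂.mem 1, first C.I (V (m + 1)))], hL.windows ?_ fun t => ?_, ?_⟩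
      · simp [hw.2.2.symm]
      · simp only [List.mem_cons, List.not_mem_nil, or_false]
        constructor
        · rintro (rfl | rfl)
          · exact ⟨_, _, rfl, _, _, h.kth, U₂.kth, hw.2.1, hw.1, hw.2.2.symm, .inl rfl, rfl⟩
          · exact ⟨_, _, rfl, _, _, h.kth, U₂.kth, hw.2.1, hw.1, hw.2.2.symm, .inr rfl, rfl⟩
        · rintro ⟨y, τ, rfl, a, a', h1, h2, -, -, -, h3, rfl⟩
          obtain ⟨rfl, rfl⟩ := huniq a a' 0 0 h1 h2
          rcases h3 with rfl | rfl
          · exact .inl rfl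
          · exact .inr rfl
      · rw [o₃, ho, List.flatMap_append]
        rfl
    · rw [if_neg hw] at o₃
      refine ⟨L ++ [], hL.windows List.nodup_nil fun t => ?_, by rw [o₃, ho, List.append_nil,
        List.append_nil]⟩
      simp only [List.not_mem_nil, false_iff]
      rintro ⟨y, τ, rfl, a, a', h1, h2, h3, h4, h5, -⟩
      obtain ⟨rfl, rfl⟩ := huniq a a' 0 0 h1 h2
      exact hw ⟨h4, h3, h5.symm⟩
  all_goals
    have hrange' : 0 ≤ σ₂.mem 1 ∧ σ₂.mem 1 ≤ C.n := U₂.kth.mem_range fun _ hx => (mem_Gs.1 hx).1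
  case lo => exact hrange'.1
  case hi => exact hrange'.2
  case reg4 => exact R₂.congr fun r hr => by rw [f₄ r (by omega), f₃]
  case reg5 => exact R₂.congr fun r hr => by rw [f₅ r (by omega), f₄ r (by omega), f₃]
  case reg6 => exact R₂.congr fun r hr => by rw [f₆ r (by omega), f₅ r (by omega), f₄ r (by omega), f₃]
  case x11 => rw [f₄ _ (by omega), f₃, e₂]
  case x1 => rw [f₅ _ (by omega), f₄ _ (by omega), f₃]
  case y1 => rw [f₆ _ (by omega), f₅ _ (by omega), f₄ _ (by omega), f₃]
  case y11 => rw [f₆ _ (by omega), f₅ _ (by omega), f₄ _ (by omega), f₃, e₂]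
  case trees6 =>
    exact T₂.congr_mem fun r _ _ => by rw [f₆ r (by omega), f₅ r (by omega), f₄ r (by omega), f₃]
  case post =>
    have f : ∀ r, r = 9 ∨ r = 0 ∨ r = 5 ∨ r = 6 ∨ r = 8 ∨ r = 4 ∨ r = 10 ∨ r = 12 →
        σ₇.mem r = σ₁.mem r := fun r hr => by
      rw [K₇ r (by omega) (by omega) (by omega) (by omega) (by omega) (by omega) (by omega),
        f₆ r (by omega), f₅ r (by omega), f₄ r (by omega), f₃, g r hr]
    have f' : ∀ r, r = 8 ∨ r = 4 ∨ r = 12 → σ₇.mem r = σ.mem r := fun r hr => by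
      rw [f r (by omega), f₁ r (by omega) (by omega) (by omega) (by omega) (by omega) (by omega)
        (by omega)]
    refine ⟨⟨hm, by rw [f 0 (by omega), p0], by rw [a₇]; exact U₂.kth, by rw [f' 4 (by omega), h.r4],
      by rw [f 5 (by omega), p5], by rw [f 6 (by omega), p6],
      by rw [b₇, f₆ _ (by omega), f₅ _ (by omega), f₄ _ (by omega), f₃, c₂],
      by rw [f' 8 (by omega), h.r8], ?_, by rw [a₇]; exact t₇, ?_, ?_⟩, f' 12 (by omega)⟩
    · intro j hj
      obtain rfl : m = j := by omega
      rw [c₇]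
      exact h.kth
    · refine TreeOk.congr_mem t₁ fun x _ _ => ?_
      rw [K₇ _ (by omega) (by omega) (by omega) (by omega) (by omega) (by omega) (by omega),
        f₆ _ (by omega), f₅ _ (by omega), f₄ _ (by omega), f₃,
        K₂ _ (by omega) (by omega) (by omega) (by omega) (by omega) (by omega) (by omega)]
    · have l₇ := l₆.congr o₇ fun r h1 h2 =>
        K₇ r (by omega) (by omega) (by omega) (by omega) (by omega) (by omega) (by omega)
      refine ⟨_, l₇.le, l₇.cell, fun b hb => (l₇.le b hb).trans (by omega),
        fun b hb x hx hx' hxb j h1 h2 => ?_, l₇.rep⟩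
      rcases h2.lt_or_eq with h2 | rfl
      swap; · rfl
      have h3 := l₇.const b hb x hx hx' hxb j h1 (by omega)
      rw [h3]
      have hne : ∀ y : ℤ, b = C.blk y ∨ x ≠ y := fun y => by
        by_cases h : x = y
        · left; rw [← hxb, h]
        · exact .inr h
      simp only [Function.update_apply] at h1
      split_ifs at h1 with h4 h5 h6
      · omega
      · omega
      · omega
      -- A block that was not reported now contains neither the segment of the vertex nor the old or
      -- new `e`, so nothing in it has changed.
      · exact vis_next hS hm h.kth U₂ ((hne _).resolve_left h6) ((hne _).resolve_left h5)
          ((hne _).resolve_left h4)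

end KVis

namespace KVis

/-! ### The program -/

/-- The registers before the sweep, when the segments with the numbers below `lim` have been
inserted. -/
structure Start (C : Env) (V : ℕ → ℤ) (lim e : ℤ) (σ : State) : Prop where
  lim_mem : 0 ≤ lim ∧ lim ≤ C.n
  r0 : σ.mem 0 = 0
  r1 : σ.mem 1 = e
  kth : IsKth (Lt C.I 0) C.n C.k (Gs C.I lim 0) e
  r4 : σ.mem 4 = lim
  r5 : σ.mem 5 = (cursor C.I V 0).1
  r6 : σ.mem 6 = (cursor C.I V 0).2
  r7 : σ.mem 7 = (Gs C.I lim 0).card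
  r8 : σ.mem 8 = C.B
  cell : ∀ b < C.s, σ.mem (64 + 4 * b + 3) = 0
  out : σ.out = []

theorem Start.congr {C : Env} {V : ℕ → ℤ} {lim e : ℤ} {σ σ' : State} (h : Start C V lim e σ)
    (ho : σ'.out = σ.out) (hm : ∀ r, r < 9 ∨ 64 ≤ r ∧ r % 4 = 3 → r ≠ 2 → r ≠ 3 → σ'.mem r = σ.mem r) :
    Start C V lim e σ' :=
  ⟨h.lim_mem, by simp [hm, h.r0], by simp [hm, h.r1], h.kth, by simp [hm, h.r4], by simp [hm, h.r5],
    by simp [hm, h.r6], by simp [hm, h.r7], by simp [hm, h.r8],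
    fun b hb => by rw [hm _ (by omega) (by omega) (by omega), h.cell b hb], ho.trans h.out⟩

/-- Compute the leaves in register `13` of all trees. -/
def buildLeaf : Cmd := put 30 (rg 13) ;; refreshV ;; refreshNF ;; put 13 (rg 13 + 1)

/-- The state while the trees are built. -/
structure BuildInv (C : Env) (V : ℕ → ℤ) (j : ℕ) (σ : State) : Prop where
  start : Start C V 0 C.n σ
  r2 : σ.mem 2 = 1
  r3 : σ.mem 3 = 0
  r13 : σ.mem 13 = (C.s : ℤ) - j
  j_le : j ≤ C.s
  trees : Trees C 0 0 C.n {b | C.s - j ≤ b ∧ b < C.s} σ.mem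
  vtree : VTree C V 0 {b | C.s - j ≤ b ∧ b < C.s} σ.mem

theorem dirty_step {s j : ℕ} (h : j + 1 ≤ s) :
    {b | s - (j + 1) ≤ b ∧ b < s} \ {s - (j + 1)} = {b | s - j ≤ b ∧ b < s} := by
  ext b
  simp only [Set.mem_sdiff, Set.mem_ofPred_eq, Set.mem_singleton_iff]
  omega

theorem run_build {C : Env} {V : ℕ → ℤ} (hS : Sweep C.I C.n V) {j : ℕ} {σ : State}
    (h : BuildInv C V j σ) :
    Run C (.loop (sE - rg 13) buildLeaf) σ
      (j * (refreshTime C (2 * C.B) + 2 * refreshTime C C.B + 30) + 10) (BuildInv C V 0) := by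
  refine (Run.loop (T := refreshTime C (2 * C.B) + 2 * refreshTime C C.B + 15)
    (BuildInv C V) (by decide) (fun j σ _ => by simp [good_rg]) (fun j σ h hpos => ?_)
    (fun j σ h hpos => ?_) j h).time ?_
  · simp only [eval_sub, eval_sE, eval_rg, h.r13] at hpos
    obtain ⟨j, rfl⟩ : ∃ i, j = i + 1 := ⟨j - 1, by omega⟩
    refine ⟨j, rfl, ?_⟩
    have hj := h.j_le
    have hn := hS.gen.pos
    refine (Run.seq <| Run.put (by norm_num) (by decide) (by decide) (good_rg (by norm_num))
        fun m₁ e₁ f₁ =>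
      Run.seq_of (run_refresh (b := C.s - (j + 1)) (dirty := {b | C.s - (j + 1) ≤ b ∧ b < C.s})
        (refreshData_dir hS.gen (cur := cursor C.I V 0) ?c5 ?c6 ?c8) (by omega) ?c30 ?vt)
        fun σ₂ ⟨o₂, f₂, t₂⟩ =>
      Run.seq_of (run_refreshNF (v := 0) (lim := 0) (e := C.n) (b := C.s - (j + 1))
        (dirty := {b | C.s - (j + 1) ≤ b ∧ b < C.s}) ?regs ?tr (by omega) ?d30)
        fun σ₃ ⟨o₃, t₃, f₃⟩ =>
      Run.putDyn (by norm_num) (by decide) (by simp [good_rg]) ?bd fun m₄ e₄ f₄ => ?post).time ?time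
    all_goals try dsimp only at *
    case time =>
      have : (rg 13).cost + (rg 13 + 1).cost = 6 := by decide
      omega
    case c5 => rw [f₁ _ (by omega), h.start.r5]
    case c6 => rw [f₁ _ (by omega), h.start.r6]
    case c8 => rw [f₁ _ (by omega), h.start.r8]
    case c30 => rw [e₁, eval_rg, h.r13]; omega
    case vt => exact TreeOk.congr_mem h.vtree fun x _ _ => f₁ _ (by omega)
    all_goals
      have g : ∀ r, r < 30 ∨ 64 ≤ r ∧ r % 4 ≠ 0 → σ₂.mem r = σ.mem r := fun r hr => by
        rw [f₂ r (by omega) fun _ _ _ => by omega, f₁ r (by omega)]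
    case regs =>
      refine ⟨hS.gen, by omega, by omega, by omega, by rw [g 0 (by omega), h.start.r0], ?_, ?_,
        by rw [g 4 (by omega), h.start.r4], by rw [g 8 (by omega), h.start.r8]⟩
      · rw [g 2 (by omega), h.r2]; simp [thr]
      · rw [g 3 (by omega), h.r3]; simp [thr]
    case tr => exact h.trees.congr_mem fun r h1 h2 => g r (by omega)
    case d30 =>
      rw [f₂ 30 (by omega) fun _ _ _ => by omega, e₁, eval_rg, h.r13]; omega
    case bd =>
      rw [eval_add, eval_rg, f₃ 13 (by omega) (by omega), g 13 (by omega), h.r13]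
      have := C.s_le_n
      exact C.bd_index (by simp; omega) (by simp; omega)
    case post =>
      have g' : ∀ r, r < 13 ∨ 64 ≤ r ∧ r % 4 = 3 → m₄ r = σ.mem r := fun r hr => by
        rw [f₄ r (by omega), f₃ r (by omega) (by omega), g r (by omega)]
      refine ⟨h.start.congr (o₃.trans o₂) fun r hr _ _ => g' r (by omega), (g' 2 (by omega)).trans h.r2,
        (g' 3 (by omega)).trans h.r3, ?_, by omega, ?_, ?_⟩
      · dsimp only
        rw [e₄, eval_add, eval_rg, f₃ 13 (by omega) (by omega), g 13 (by omega), h.r13]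
        simp; omega
      · rw [dirty_step hj] at t₃
        exact t₃.congr_mem fun r _ _ => f₄ r (by omega)
      · rw [dirty_step hj] at t₂
        refine TreeOk.congr_mem t₂ fun x _ _ => ?_
        dsimp only
        rw [f₄ _ (by omega), f₃ _ (by omega) (by omega)]
  · simp only [eval_sub, eval_sE, eval_rg, h.r13] at hpos
    obtain rfl : j = 0 := by have := h.j_le; omega
    exact h
  · have : (sE - rg 13).cost = 5 := by decide
    rw [this]
    have : 5 + 1 + (refreshTime C (2 * C.B) + 2 * refreshTime C C.B + 15) ≤
      refreshTime C (2 * C.B) + 2 * refreshTime C C.B + 30 := by omega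
    have := Nat.mul_le_mul_left j this
    omega

/-- Set register `10` if the segment in register `9` meets the rays immediately after the one
through the vertex in register `0`. -/
def testAct : Cmd := withSeg (rg 9) fun a b =>
  .ite (crE a (rg 0) + 1) (.ite (crE (rg 0) b) (put 10 1) .skip) .skip

theorem run_testAct {C : Env} {σ : State} {v t : ℤ} (h0 : σ.mem 0 = v) (hv : 0 ≤ v ∧ v < 2 * C.n)
    (h9 : σ.mem 9 = t) (ht : 0 ≤ t ∧ t < C.n) (h10 : σ.mem 10 = 0) :
    Run C testAct σ 1000 (fun σ' => σ'.out = σ.out ∧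
      (Act C.I v t ∧ σ'.mem 10 = 1 ∨ ¬ Act C.I v t ∧ σ'.mem 10 = 0) ∧
      ∀ r, r ≠ 10 → σ'.mem r = σ.mem r) := by
  have hv0 : VGood C σ.mem (rg 0) := .rg (by norm_num) (by omega) (by omega)
  have hg : (rg 9).Good C σ.mem := good_rg (by norm_num)
  have h9' : (rg 9).eval C.I σ.mem = t := h9
  refine Run.withSeg (T := 400) hg h9' ht.1 ht.2 (by decide) (fun a b hab => ?_) (by decide)
  have g : (crE a (rg 0) + 1).maxGrade < 1000 ∧ (crE (rg 0) b).maxGrade < 1000 ∧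
      (crE a (rg 0) + 1).cost + (crE (rg 0) b).cost < 300 := by
    rcases hab.cases with ⟨rfl, -, rfl, -⟩ | ⟨rfl, -, rfl, -⟩ <;> decide
  obtain ⟨g1, g2, g3⟩ := g
  have eA : (crE a (rg 0) + 1).eval C.I σ.mem = cr C.I (sa C.I t) v + 1 := by
    simp [hab.eval_left h9', h0]
  have eB : (crE (rg 0) b).eval C.I σ.mem = cr C.I v (sb C.I t) := by
    simp [hab.eval_right h9', h0]
  have hc : (1 : Expr).cost = 1 := rfl
  refine (Run.ite (T := (crE (rg 0) b).cost + 1 + (3 + 1)) (U := 1) g1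
    ((good_add _ _).2 ⟨(hab.good_left hg h9').crE hv0, trivial⟩) (fun h1 =>
    Run.ite g2 (hv0.crE (hab.good_right hg h9')) (fun h2 => ?_) (fun h2 => ?_))
    (fun h1 => ?_)).time ?_
  · rw [eA] at h1
    rw [eB] at h2
    exact Run.put (by norm_num) (by decide) (by decide) trivial fun m' e' f' =>
      ⟨rfl, .inl ⟨⟨by omega, h2⟩, e'⟩, f'⟩
  · rw [eB] at h2
    exact Run.skip ⟨rfl, .inr ⟨fun h => h2 h.2, h10⟩, fun _ _ => rfl⟩
  · rw [eA] at h1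
    exact Run.skip ⟨rfl, .inr ⟨fun h => h1 (by have := h.1; omega), h10⟩, fun _ _ => rfl⟩
  · omega

/-- Insert the next segment if it meets the rays that come immediately after the vertex `0`. -/
def insertNext : Cmd :=
  put 9 (rg 4) ;; put 4 (rg 4 + 1) ;; put 10 0 ;; testAct ;; .ite (rg 10) (part1 ;; part2) .skip

/-- The state while the segments are inserted. -/
structure InsertInv (C : Env) (V : ℕ → ℤ) (j : ℕ) (σ : State) : Prop where
  j_le : j ≤ C.n
  start : ∃ e, Start C V (C.n - j) e σ ∧ Trees C 0 (C.n - j) e ∅ σ.mem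
  vtree : VTree C V 0 ∅ σ.mem

theorem Gs_succ {I : List ℤ} {lim v : ℤ} (h : 0 ≤ lim) :
    (Act I v lim → lim ∉ Gs I lim v ∧ Gs I (lim + 1) v = insert lim (Gs I lim v)) ∧
    (¬ Act I v lim → Gs I (lim + 1) v = Gs I lim v) := by
  refine ⟨fun h1 => ⟨fun h2 => by have := (mem_Gs.1 h2).1; omega, ?_⟩, fun h1 => ?_⟩
  · ext x
    rw [Finset.mem_insert, mem_Gs, mem_Gs]
    by_cases hx : x = lim
    · subst hx; simp [h1, h]
    · have : x < lim + 1 ↔ x < lim := by omega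
      simp [hx, this]
  · ext x
    rw [mem_Gs, mem_Gs]
    by_cases hx : x = lim
    · subst hx; simp [h1]
    · have : x < lim + 1 ↔ x < lim := by omega
      simp [this]

/-- The segment of rank `k` on the first ray is found by inserting the segments one by one with the
update used in the sweep; `lim` plays the role of time. This costs `n` updates, no more than the
sweep itself. -/
theorem run_insert {C : Env} {V : ℕ → ℤ} (hS : Sweep C.I C.n V) {j : ℕ} {σ : State}
    (h : InsertInv C V j σ) :
    Run C (.loop (nE - rg 4) insertNext) σ
      (j * (6 * refreshTime C C.B + 7000) + 10) (InsertInv C V 0) := by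
  refine (Run.loop (T := 6 * refreshTime C C.B + 6900)
    (InsertInv C V) (by decide) (fun j σ _ => by simp [good_rg]) (fun j σ h hpos => ?_)
    (fun j σ h hpos => ?_) j h).time ?_
  · obtain ⟨e, hs, hT⟩ := h.start
    simp only [eval_sub, eval_nE, eval_rg, hs.r4] at hpos
    obtain ⟨j, rfl⟩ : ∃ i, j = i + 1 := ⟨j - 1, by omega⟩
    refine ⟨j, rfl, ?_⟩
    have hj := h.j_le
    obtain ⟨t, ht⟩ : ∃ t : ℤ, t = C.n - (j + 1 : ℕ) := ⟨_, rfl⟩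
    have ht' : (C.n : ℤ) - j = t + 1 := by omega
    rw [← ht] at hs hT
    have ht0 : 0 ≤ t ∧ t < C.n := by omega
    have he := hs.kth.mem_range (n := C.n) fun x hx => by have := (mem_Gs.1 hx).1; omega
    have hn := hS.gen.pos
    have hlin := hS.linOn (lim := t + 1) (v := 0) (by omega)
    obtain ⟨hG1, hG2⟩ := Gs_succ (I := C.I) (v := 0) ht0.1
    refine (Run.seq <| Run.put (by norm_num) (by decide) (by decide) (good_rg (by norm_num))
        fun m₁ e₁ f₁ =>
      Run.seq <| Run.putDyn (by norm_num) (by decide) (by simp [good_rg]) ?bd fun m₂ e₂ f₂ =>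
      Run.seq <| Run.put (by norm_num) (by decide) (by decide) (by simp) fun m₃ e₃ f₃ =>
      Run.seq_of (T := 1000) (R := fun σ₄ => σ₄.out = [] ∧
        (Act C.I 0 t ∧ σ₄.mem 10 = 1 ∨ ¬ Act C.I 0 t ∧ σ₄.mem 10 = 0) ∧
        ∀ r, r ≠ 10 → σ₄.mem r = m₃ r) ?seg fun σ₄ ⟨o₄, a₄, f₄⟩ =>
      Run.ite (T := 6 * refreshTime C C.B + 5200) (U := 1) (by decide) (good_rg (by norm_num))
        (fun hc => ?pos) (fun hc => Run.skip ?neg)).time ?time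
    all_goals try dsimp only at *
    case time =>
      have : (rg 4).cost + (rg 4 + 1).cost + (0 : Expr).cost + (rg 10).cost = 9 := by decide
      omega
    case bd =>
      rw [eval_add, eval_rg, f₁ _ (by omega), hs.r4]
      exact C.bd_index (by simp; omega) (by simp; omega)
    all_goals
      have r9 : m₃ 9 = t := by rw [f₃ _ (by omega), f₂ _ (by omega), e₁, eval_rg, hs.r4]
      have r4 : m₃ 4 = t + 1 := by
        rw [f₃ _ (by omega), e₂, eval_add, eval_rg, f₁ _ (by omega), hs.r4]; simp
      have g : ∀ r, r ≠ 4 → r ≠ 9 → r ≠ 10 → m₃ r = σ.mem r := fun r h1 h2 h3 => by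
        rw [f₃ r h3, f₂ r h1, f₁ r h2]
    case seg =>
      exact (run_testAct (σ := ⟨m₃, σ.out⟩) (v := 0)
        ((g 0 (by omega) (by omega) (by omega)).trans hs.r0) (by omega) r9 ht0
        e₃).mono le_rfl fun σ₄ _ ⟨a, b, c⟩ => ⟨a.trans hs.out, b, c⟩
    all_goals
      have g4 : ∀ r, r ≠ 4 → r ≠ 9 → r ≠ 10 → σ₄.mem r = σ.mem r := fun r h1 h2 h3 => by
        rw [f₄ r h3, g r h1 h2 h3]
      have r4' : σ₄.mem 4 = t + 1 := by rw [f₄ 4 (by omega), r4]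
      have r9' : σ₄.mem 9 = t := by rw [f₄ 9 (by omega), r9]
    case pos =>
      rw [eval_rg] at hc
      have hact := (a₄.resolve_right fun h => by omega)
      obtain ⟨hact, h10⟩ := hact
      obtain ⟨hn1, hn2⟩ := hG1 hact
      have hU : Update C 0 (t + 1) e t 1 (Gs C.I t 0) := by
        refine ⟨hlin, fun x hx => ?_, hs.kth, mem_Cs.2 ⟨by omega, hact.cl⟩, .inl ⟨rfl, hn1, hn2⟩⟩
        have := mem_Gs.1 hx
        exact mem_Cs.2 ⟨by omega, this.2.cl⟩
      -- Raising the limit affects the key of segment `t` only, so only its leaf becomes dirty.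
      have hT' : Trees C 0 (t + 1) e {C.blk t} σ₄.mem := by
        refine (hT.transfer hS.gen (by omega) (by omega) (Set.empty_subset _) (fun x _ _ hx => ?_)
          fun x _ _ => ⟨⟨Iff.rfl, Iff.rfl⟩, fun y _ _ => Iff.rfl⟩).congr_mem fun r _ _ =>
            g4 r (by omega) (by omega) (by omega)
        rw [hn2, Finset.mem_insert, or_iff_right]
        rintro rfl
        exact hx rfl
      refine (Run.seq_of (run_part1 hS.gen (by omega) (by omega) hT' hU ?q0 ?q1 r4' ?q7 ?q8 r9' h10)
        fun σ₅ ⟨o₅, R₅, T₅, U₅, c₅, e₅, K₅⟩ =>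
        (run_part2 R₅ T₅ U₅ rfl e₅).mono le_rfl fun σ₆ _ ⟨o₆, t₆, b₆, d₆, p₆, K₆⟩ => ?post).time ?time
      case time => omega
      case q0 => rw [g4 0 (by omega) (by omega) (by omega), hs.r0]
      case q1 => rw [g4 1 (by omega) (by omega) (by omega), hs.r1]
      case q7 => rw [g4 7 (by omega) (by omega) (by omega), hs.r7]
      case q8 => rw [g4 8 (by omega) (by omega) (by omega), hs.r8]
      case post =>
        have K : ∀ r, r = 0 ∨ r = 5 ∨ r = 6 ∨ r = 8 ∨ r = 4 ∨ 64 ≤ r ∧ (r % 4 = 0 ∨ r % 4 = 3) →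
            σ₆.mem r = σ₄.mem r := fun r hr =>
          (K₅.trans K₆) r (by omega) (by omega) (by omega) (by omega) (by omega) (by omega) (by omega)
        have K' : ∀ r, r = 0 ∨ r = 5 ∨ r = 6 ∨ r = 8 ∨ 64 ≤ r ∧ (r % 4 = 0 ∨ r % 4 = 3) →
            σ₆.mem r = σ.mem r := fun r hr => by
          rw [K r (by omega), g4 r (by omega) (by omega) (by omega)]
        refine ⟨by omega, ⟨_, ?_, by rw [ht']; exact t₆⟩, h.vtree.congr_mem fun x _ _ => K' _ (by omega)⟩
        rw [ht']
        exact ⟨by omega, by rw [K' 0 (by omega), hs.r0], b₆, U₅.kth, by rw [K 4 (by omega), r4'],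
          by rw [K' 5 (by omega), hs.r5], by rw [K' 6 (by omega), hs.r6], by rw [d₆, c₅],
          by rw [K' 8 (by omega), hs.r8], fun b hb => by rw [K' _ (by omega), hs.cell b hb],
          by rw [o₆, o₅, o₄]⟩
    case neg =>
      rw [eval_rg] at hc
      have hact := (a₄.resolve_left fun h => by omega).1
      have hg := hG2 hact
      refine ⟨by omega, ⟨e, ?_, ?_⟩, h.vtree.congr_mem fun x _ _ => g4 _ (by omega) (by omega) (by omega)⟩
      · rw [ht']
        exact ⟨by omega, by rw [g4 0 (by omega) (by omega) (by omega), hs.r0],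
          by rw [g4 1 (by omega) (by omega) (by omega), hs.r1], by rw [hg]; exact hs.kth, r4',
          by rw [g4 5 (by omega) (by omega) (by omega), hs.r5],
          by rw [g4 6 (by omega) (by omega) (by omega), hs.r6],
          by rw [g4 7 (by omega) (by omega) (by omega), hs.r7, hg],
          by rw [g4 8 (by omega) (by omega) (by omega), hs.r8],
          fun b hb => by rw [g4 _ (by omega) (by omega) (by omega), hs.cell b hb], o₄⟩
      · rw [ht']
        exact (hT.transfer hS.gen (by omega) (by omega) le_rfl (fun x _ _ hx => by rw [hg])
          fun x _ _ => ⟨⟨Iff.rfl, Iff.rfl⟩, fun y _ _ => Iff.rfl⟩).congr_mem fun r _ _ =>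
            g4 r (by omega) (by omega) (by omega)
  · obtain ⟨e, hs, hT⟩ := h.start
    simp only [eval_sub, eval_nE, eval_rg, hs.r4] at hpos
    obtain rfl : j = 0 := by have := h.j_le; omega
    exact h
  · have h5 : (nE - rg 4).cost = 5 := by decide
    generalize refreshTime C C.B = r
    exact Nat.add_le_add (Nat.mul_le_mul_left j (by omega)) (by omega)

end KVis

/-! ### Initialization, the complete program and its running time -/

namespace KVis

theorem exists_leaf_below {s x : ℕ} (h1 : 1 ≤ x) (h2 : x < 2 * s) : ∃ b < s, Below x (s + b) := by
  induction h : 2 * s - x using Nat.strong_induction_on generalizing x with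
  | _ d ih =>
    by_cases hx : s ≤ x
    · exact ⟨x - s, by omega, ⟨0, by simp; omega⟩⟩
    · obtain ⟨b, hb, j, hj⟩ := ih (2 * s - 2 * x) (by omega) (x := 2 * x) (by omega) (by omega) rfl
      exact ⟨b, hb, j + 1, by rw [pow_succ, ← Nat.div_div_eq_div_mul, hj]; omega⟩

/-- Every node lies above some leaf, so if all leaves are dirty, nothing is claimed about winners
and zeros are a legitimate start. Refreshing the leaves one after another then builds the tree. -/
theorem TreeOk.initial (K : ℤ → ℤ × ℤ) {s τ : ℕ} {M sz : ℤ} (hM : 0 ≤ M) {m : ℕ → ℤ}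
    (hm : ∀ r, 64 ≤ r → m r = 0) {dirty : Set ℕ} (hd : ∀ b < s, b ∈ dirty) :
    TreeOk K s τ M sz dirty m := by
  refine ⟨fun x _ _ => by simp [hm _ (show 64 ≤ 64 + 4 * x + τ by omega), hM], fun x h1 h2 h3 => ?_⟩
  obtain ⟨b, hb, h⟩ := exists_leaf_below h1 h2
  exact absurd h (h3 b (hd b hb))

/-- Set up the registers. -/
def prepare : Cmd := put 8 (nE / sE + 1) ;; put 1 nE ;; put 5 (0 - 2) ;; put 6 1 ;; setE

theorem run_prepare {C : Env} {V : ℕ → ℤ} (hS : Sweep C.I C.n V) :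
    Run C prepare State.init 1100 (BuildInv C V C.s) := by
  have hn := hS.gen.pos
  refine (Run.seq <| Run.put (by norm_num) (by decide) (by decide) (by simp) fun m₁ e₁ f₁ =>
    Run.seq <| Run.put (by norm_num) (by decide) (by decide) (by simp) fun m₂ e₂ f₂ =>
    Run.seq <| Run.put (by norm_num) (by decide) (by decide) (by simp) fun m₃ e₃ f₃ =>
    Run.seq <| Run.put (by norm_num) (by decide) (by decide) (by simp) fun m₄ e₄ f₄ =>
    (run_setE (σ := ⟨m₄, _⟩) (v := 0) (e := C.n) ?h0 (by omega) ?h1 (by omega)).mono le_rfl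
      fun σ₅ _ h₅ => ?post).time ?time
  all_goals try dsimp only [State.init] at *
  case time =>
    decide
  case h0 => simp [f₁, f₂, f₃, f₄]
  case h1 => simp [f₃, f₄, e₂]
  case post =>
    obtain ⟨o₅, t₂, t₃, f₅⟩ := h₅
    have g : ∀ r, r ≠ 1 → r ≠ 2 → r ≠ 3 → r ≠ 5 → r ≠ 6 → r ≠ 8 → σ₅.mem r = 0 :=
      fun r q1 q2 q3 q5 q6 q8 => by rw [f₅ r q2 q3, f₄ r q6, f₃ r q5, f₂ r q1, f₁ r q8]
    have hG : Gs C.I 0 0 = ∅ := by ext x; simp [mem_Gs]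
    refine ⟨⟨by omega, by simp [g], by simp [f₅, f₄, f₃, e₂], .inr ⟨rfl, by simp [hG]⟩, by simp [g],
        by simp [f₅, f₄, e₃, cursor], by simp [f₅, e₄, cursor], by simp [g, hG],
        by simp [f₅, f₄, f₃, f₂, e₁, Env.B], fun b _ => g _ (by omega) (by omega) (by omega) (by omega)
          (by omega) (by omega), o₅⟩, by simp [t₂, thr], by simp [t₃, thr], by simp [g], le_rfl,
        ⟨?_, ?_⟩, ?_⟩
    all_goals
      exact TreeOk.initial _ (by omega) (fun r _ => g r (by omega) (by omega) (by omega) (by omega)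
          (by omega) (by omega)) fun b hb => ⟨by omega, hb⟩

/-- Process all vertices. -/
def sweepLoop : Cmd := .loop (rg 12) (event ;; put 12 (rg 12 - 1))

theorem run_sweepLoop {C : Env} {V : ℕ → ℤ} {σ : State} (hS : Sweep C.I C.n V) {j : ℕ}
    (hj : j ≤ 2 * C.n) (h12 : σ.mem 12 = j) (h : SweepInv C V (2 * C.n - j) σ) :
    Run C sweepLoop σ (j * (eventTime C + 10) + 3) (SweepInv C V (2 * C.n)) := by
  refine (Run.loop (T := eventTime C + 6)
    (fun j σ => j ≤ 2 * C.n ∧ σ.mem 12 = j ∧ SweepInv C V (2 * C.n - j) σ) (by decide)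
    (fun j σ _ => good_rg (by norm_num)) (fun j σ hJ hpos => ?_)
    (fun j σ hJ hpos => ?_) j ⟨hj, h12, h⟩).time ?_
  · obtain ⟨h1, h2, h3⟩ := hJ
    rw [eval_rg, h2] at hpos
    obtain ⟨j, rfl⟩ : ∃ i, j = i + 1 := ⟨j - 1, by omega⟩
    refine ⟨j, rfl, (Run.seq_of (run_event hS (by omega) h3) fun σ₁ ⟨h4, h5⟩ =>
      Run.putDyn (by norm_num) (by decide) (by simp [good_rg]) ?bd fun m₂ e₂ f₂ =>
        ⟨by omega, ?r12, ?inv⟩).time ?time⟩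
    case time =>
      have : (rg 12 - 1).cost = 4 := by decide
      omega
    case bd =>
      rw [eval_sub, eval_rg, h5, h2]
      exact C.bd_index (by simp only [eval_ofNat]; push_cast; omega) (by simp only [eval_ofNat]; push_cast; omega)
    case r12 =>
      dsimp only
      rw [e₂, eval_sub, eval_rg, h5, h2, eval_ofNat]
      push_cast
      ring
    case inv =>
      rw [show 2 * C.n - (j + 1) + 1 = 2 * C.n - j by omega] at h4
      exact ⟨h4.m_le, by rw [← h4.r0]; exact f₂ 0 (by omega),
        by rw [show State.mem ⟨m₂, σ₁.out⟩ 1 = σ₁.mem 1 from f₂ 1 (by omega)]; exact h4.kth,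
        by rw [← h4.r4]; exact f₂ _ (by omega), by rw [← h4.r5]; exact f₂ _ (by omega),
        by rw [← h4.r6]; exact f₂ _ (by omega), by rw [← h4.r7]; exact f₂ _ (by omega),
        by rw [← h4.r8]; exact f₂ _ (by omega),
        fun i hi => by rw [show State.mem ⟨m₂, σ₁.out⟩ 11 = σ₁.mem 11 from f₂ 11 (by omega)]; exact h4.r11 i hi,
        by
          rw [show State.mem ⟨m₂, σ₁.out⟩ 1 = σ₁.mem 1 from f₂ 1 (by omega)]
          exact h4.trees.congr_mem fun r _ _ => f₂ r (by omega),
        h4.vtree.congr_mem fun x _ _ => f₂ _ (by omega), by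
          obtain ⟨l, h6, h7⟩ := h4.ledger
          exact ⟨l, h6, h7.congr rfl fun r _ _ => f₂ r (by omega)⟩⟩
  · obtain ⟨h1, h2, h3⟩ := hJ
    rw [eval_rg, h2] at hpos
    obtain rfl : j = 0 := by omega
    exact h3
  · have : (rg 12).cost = 2 := by decide
    exact Nat.add_le_add (Nat.mul_le_mul_left j (by omega)) (by omega)

/-- Report what has not been reported before the end of the sweep. -/
def finish : Cmd :=
  put 1 (rg 11) ;; setE ;; put 13 0 ;;
  .loop (sE - rg 13) (put 30 (rg 13) ;; flush ;; put 13 (rg 13 + 1))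

/-- The last gap has the index `2 * n - 1`; its segment of rank `k` is the old one of the last
event, kept in register `11`, and it has to be restored as the threshold before the blocks are
reported. -/
theorem run_finish {C : Env} {V : ℕ → ℤ} {σ : State} (hS : Sweep C.I C.n V)
    (h : SweepInv C V (2 * C.n) σ) :
    Run C finish σ (C.s * (2000 * C.B.toNat + 550) + 1100) (fun σ' =>
      ∃ l L, (∀ b < C.s, l b = 2 * C.n) ∧ Reported C V (2 * C.n) l L ∧
        σ'.out = L.flatMap (Entry.words V)) := by
  have hn := hS.gen.pos
  obtain ⟨N, hN⟩ : ∃ N, 2 * C.n = N + 1 := ⟨2 * C.n - 1, by omega⟩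
  have hv := hS.mem (2 * C.n)
  obtain ⟨e, he⟩ : ∃ e, e = σ.mem 11 := ⟨_, rfl⟩
  have hk := h.r11 N hN
  rw [← he] at hk
  have hr := kth_mem_range hk
  obtain ⟨l₀, hl₀, hled⟩ := h.ledger
  have hled' : Ledger C V N (2 * C.n) l₀ σ :=
    ⟨hled.cell, fun b hb => by have := hl₀ b hb; omega, fun b hb x h1 h2 h3 j h4 h5 => by
      rw [hled.const b hb x h1 h2 h3 j h4 (by omega)]
      by_cases h6 : l₀ b ≤ N
      · rw [hled.const b hb x h1 h2 h3 N h6 (by omega)]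
      · have := hl₀ b hb; omega, hled.rep⟩
  refine (Run.seq <| Run.put (by norm_num) (by decide) (by decide) (good_rg (by norm_num))
      fun m₁ e₁ f₁ =>
    Run.seq_of (run_setE (σ := ⟨m₁, σ.out⟩) (v := V (2 * C.n)) (e := e)
      ((f₁ 0 (by omega)).trans h.r0) hv (e₁.trans he.symm) hr.1) fun σ₂ ⟨o₂, a₂, b₂, f₂⟩ =>
    Run.seq <| Run.put (by norm_num) (by decide) (by decide) (by simp) fun m₃ e₃ f₃ =>
    (Run.loop (T := 2000 * C.B.toNat + 520)
      (fun j σ => j ≤ C.s ∧ σ.mem 13 = (C.s : ℤ) - j ∧ Regs C (V (2 * C.n)) C.n e σ.mem ∧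
        ∃ l, (∀ b < C.s - j, l b = 2 * C.n) ∧ Ledger C V N (2 * C.n) l σ) (by decide)
      (fun j σ _ => by simp [good_rg]) (fun j σ ⟨h1, h2, h3, l, h4, h5⟩ hpos => ?step)
      (fun j σ ⟨h1, h2, h3, l, h4, h5⟩ hpos => ?fin) C.s ⟨le_rfl, ?r13, ?regs, l₀, ?vac, ?led⟩)).time ?time
  case time =>
    have h1 : (rg 11).cost = 2 ∧ (0 : Expr).cost = 1 ∧ (sE - rg 13).cost = 5 := by decide
    rw [h1.1, h1.2.1, h1.2.2]
    have := Nat.mul_le_mul_left C.s (show 5 + 1 + (2000 * C.B.toNat + 520) ≤ 2000 * C.B.toNat + 550 by omega)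
    omega
  case r13 => exact e₃.trans (by simp)
  case regs =>
    refine ⟨hS.gen, hv, le_rfl, hr, ?_, ?_, ?_, ?_, ?_⟩ <;> simp [f₃, f₂, f₁, a₂, b₂, h.r0, h.r4, h.r8]
  case vac => intro b hb; omega
  case led => exact hled'.congr o₂ fun r _ _ => by
                dsimp only
                rw [f₃ r (by omega), f₂ r (by omega) (by omega)]
                exact f₁ r (by omega)
  case step =>
    simp only [eval_sub, eval_sE, eval_rg, h2] at hpos
    obtain ⟨j, rfl⟩ : ∃ i, j = i + 1 := ⟨j - 1, by omega⟩
    refine ⟨j, rfl, (Run.seq <| Run.put (by norm_num) (by decide) (by decide) (good_rg (by norm_num))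
        fun m₁ e₁ f₁ =>
      Run.seq_of (run_flush_ledger (σ := ⟨m₁, σ.out⟩) (m := N) (w := 2 * C.n) (l := l) (e := e)
        (b := C.s - (j + 1)) hS (by omega) ?regs' hk (by omega) ?r30 ?led')
        fun σ₂ ⟨l₂, f₂⟩ =>
      Run.putDyn (by norm_num) (by decide) (by simp [good_rg]) ?bd fun m₃ e₃ f₃ =>
        ⟨by omega, ?r13', ?regs3, Function.update l (C.s - (j + 1)) (N + 1), ?upd, ?led3⟩).time ?time'⟩
    case time' =>
      have : (rg 13).cost + (rg 13 + 1).cost = 6 := by decide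
      omega
    case regs' => rw [← hN]; exact h3.congr fun r hr => f₁ r (by omega)
    case r30 => dsimp only; rw [e₁, eval_rg, h2]; omega
    case led' => exact h5.congr rfl fun r _ _ => f₁ r (by omega)
    case bd =>
      rw [eval_add, eval_rg, f₂ 13 (by omega) (by omega) (by omega) (by omega)]
      dsimp only
      rw [f₁ 13 (by omega), h2]
      have := C.s_le_n
      exact C.bd_index (by simp; omega) (by simp; omega)
    case r13' =>
      dsimp only
      rw [e₃, eval_add, eval_rg, f₂ 13 (by omega) (by omega) (by omega) (by omega)]
      dsimp only
      rw [f₁ 13 (by omega), h2]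
      simp; omega
    case regs3 => exact h3.congr fun r hr => by
                    dsimp only
                    rw [f₃ r (by omega), f₂ r (by omega) (by omega) (by omega) (by omega)]
                    exact f₁ r (by omega)
    case upd =>
      intro b hb
      rw [Function.update_apply]
      split_ifs with h6
      · exact hN.symm
      · exact h4 b (by omega)
    case led3 => exact l₂.congr rfl fun r _ _ => f₃ r (by omega)
  case fin =>
    simp only [eval_sub, eval_sE, eval_rg, h2] at hpos
    obtain rfl : j = 0 := by omega
    obtain ⟨L, hL, ho⟩ := h5.rep
    exact ⟨l, L, h4, hL, ho⟩

/-- The program. -/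
def sweep : Cmd :=
  prepare ;; .loop (sE - rg 13) buildLeaf ;; .loop (nE - rg 4) insertNext ;; put 12 (2 * nE) ;;
  sweepLoop ;; finish

theorem Reported.nil (C : Env) (V : ℕ → ℤ) : Reported C V 0 (fun _ => 0) [] :=
  ⟨List.nodup_nil, by simp, by simp, by simp, by simp⟩

/-- The program reports the windows and the visible parts of the segments. -/
theorem run_sweep {C : Env} {V : ℕ → ℤ} (hS : Sweep C.I C.n V) :
    Run C sweep State.init (4 * C.n * (eventTime C + 20) + 3000) (fun σ' =>
      ∃ l L, (∀ b < C.s, l b = 2 * C.n) ∧ Reported C V (2 * C.n) l L ∧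
        σ'.out = L.flatMap (Entry.words V)) := by
  have hn := hS.gen.pos
  refine (Run.seq_of (run_prepare hS) fun σ₁ h₁ => Run.seq_of (run_build hS h₁) fun σ₂ h₂ =>
    Run.seq_of (run_insert hS (j := C.n) ?ins) fun σ₃ h₃ =>
    Run.seq <| Run.putDyn (by norm_num) (by decide) (by simp) ?bd fun m₄ e₄ f₄ =>
    Run.seq_of (run_sweepLoop (j := 2 * C.n) hS le_rfl (e₄.trans (by simp)) ?inv) fun σ₅ h₅ =>
      run_finish hS h₅).time ?time
  case time =>
    have h1 : (2 * nE).cost = 4 := by decide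
    rw [h1]
    have h2 := C.s_le_n
    -- Everything is measured in events: `2 * n` of the sweep, `n` for the insertions, and `s ≤ n`
    -- for building the trees and for the final reports together.
    have h3 := Nat.mul_le_mul_left C.n (show 6 * refreshTime C C.B + 7000 ≤ eventTime C by
      rw [eventTime]; omega)
    have h4 := Nat.mul_le_mul h2 (show refreshTime C (2 * C.B) + 2 * refreshTime C C.B + 30 +
      (2000 * C.B.toNat + 550) ≤ eventTime C by rw [eventTime]; omega)
    rw [Nat.mul_add] at h4
    have h5 := Nat.mul_le_mul_left (2 * C.n) (show eventTime C + 10 ≤ eventTime C + 20 by omega)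
    have h6 : 4 * C.n * (eventTime C + 20) = C.n * eventTime C + C.n * eventTime C +
      2 * C.n * (eventTime C + 20) + 40 * C.n := by ring
    omega
  case ins =>
    have hd : {b | C.s - 0 ≤ b ∧ b < C.s} = ∅ := by
      ext b
      simp only [Set.mem_ofPred_eq, Set.mem_empty_iff_false, iff_false]
      omega
    have ht := h₂.trees
    have hv := h₂.vtree
    rw [hd] at ht hv
    exact ⟨le_rfl, ⟨C.n, by rw [sub_self]; exact h₂.start, by rw [sub_self]; exact ht⟩, hv⟩
  case bd =>
    exact C.bd_index (by simp; omega) (by simp; omega)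
  case inv =>
    obtain ⟨-, ⟨e, hs, hT⟩, hv⟩ := h₃
    rw [Nat.cast_zero, sub_zero] at hs hT
    have g : ∀ r, r ≠ 12 → m₄ r = σ₃.mem r := f₄
    rw [Nat.sub_self]
    refine ⟨by omega, ?_, ?_, ?_, ?_, ?_, ?_, ?_, fun j hj => by omega, ?_, ?_, ?_⟩
    all_goals try dsimp only
    · rw [g _ (by omega), hs.r0, hS.zero]
    · rw [g _ (by omega), hs.r1, Kth, hS.zero]; exact hs.kth
    · rw [g _ (by omega), hs.r4]
    · rw [g _ (by omega), hs.r5]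
    · rw [g _ (by omega), hs.r6]
    · rw [g _ (by omega), hs.r7, hS.zero]
    · rw [g _ (by omega), hs.r8]
    · rw [g _ (by omega), hs.r1, hS.zero]
      exact hT.congr_mem fun r _ _ => g r (by omega)
    · exact hv.congr_mem fun x _ _ => g _ (by omega)
    · refine ⟨fun _ => 0, fun _ _ => le_rfl, fun b hb => ?_, fun _ _ => by omega,
        fun b _ x _ _ _ j _ h => ?_, [], Reported.nil C V, hs.out⟩
      · dsimp only
        rw [g _ (by omega), hs.cell b hb, hS.zero]
      · rw [Nat.le_zero.mp h]

end KVis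

namespace KVis

/-! ## The plane -/

/-- The cross product. -/
def cross (a b : Pt) : ℝ := a.1 * b.2 - a.2 * b.1

theorem cross_self (a : Pt) : cross a a = 0 := by unfold cross; ring
theorem cross_swap (a b : Pt) : cross b a = -cross a b := by unfold cross; ring
theorem cross_add_right (a b c : Pt) : cross a (b + c) = cross a b + cross a c := by
  simp [cross]; ring
theorem cross_add_left (a b c : Pt) : cross (a + b) c = cross a c + cross b c := by
  simp [cross]; ring
theorem cross_smul_right (t : ℝ) (a b : Pt) : cross a (t • b) = t * cross a b := by
  simp [cross]; ring
theorem cross_smul_left (t : ℝ) (a b : Pt) : cross (t • a) b = t * cross a b := by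
  simp [cross]; ring

/-- Cramer's rule, free of division. -/
theorem cross_smul_eq (a b d : Pt) : cross a b • d = cross d b • a + cross a d • b := by
  ext <;> simp [cross] <;> ring

theorem eq_combination {a b : Pt} (h : cross a b ≠ 0) (d : Pt) :
    d = (cross d b / cross a b) • a + (cross a d / cross a b) • b := by
  have h1 := congrArg (fun x => (cross a b)⁻¹ • x) (cross_smul_eq a b d)
  simp only [smul_smul, smul_add, inv_mul_cancel₀ h, one_smul] at h1
  rw [div_eq_inv_mul, div_eq_inv_mul]
  exact h1

theorem continuous_cross_left (a : Pt) : Continuous fun d => cross a d := by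
  unfold cross; fun_prop

theorem continuous_cross_right (a : Pt) : Continuous fun d => cross d a := by
  unfold cross; fun_prop

/-- By Cramer's rule `cross d b` and `cross a d` are, up to the factor `cross a b`, the coefficients
of `d` in the basis `a, b`; on the segment they are nonnegative and sum to one. -/
theorem add_mem_segment_iff {a b : Pt} (h : 0 < cross a b) (q d : Pt) :
    q + d ∈ segment ℝ (q + a) (q + b) ↔
      0 ≤ cross a d ∧ 0 ≤ cross d b ∧ cross a d + cross d b = cross a b := by
  constructor
  · rintro ⟨s, t, hs, ht, hst, h1⟩
    have h2 : d = s • a + t • b := by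
      have h3 : s • (q + a) + t • (q + b) = (s + t) • q + (s • a + t • b) := by module
      rw [h3, hst, one_smul] at h1
      exact (add_left_cancel h1).symm
    have h4 : cross a d = t * cross a b := by
      rw [h2, cross_add_right, cross_smul_right, cross_smul_right, cross_self]; ring
    have h5 : cross d b = s * cross a b := by
      rw [h2, cross_add_left, cross_smul_left, cross_smul_left, cross_self]; ring
    rw [h4, h5]
    refine ⟨by positivity, by positivity, ?_⟩
    rw [← add_mul, add_comm t, hst, one_mul]
  · rintro ⟨h1, h2, h3⟩
    have h4 : cross d b / cross a b + cross a d / cross a b = 1 := by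
      rw [← add_div, add_comm, h3, div_self h.ne']
    refine ⟨_, _, by positivity, by positivity, h4, ?_⟩
    conv_rhs => rw [eq_combination h.ne' d]
    have : ∀ s t : ℝ, s • (q + a) + t • (q + b) = (s + t) • q + (s • a + t • b) := fun s t => by
      module
    rw [this, h4, one_smul]

theorem add_mem_openSegment_iff {a b : Pt} (h : 0 < cross a b) (q d : Pt) :
    q + d ∈ openSegment ℝ (q + a) (q + b) ↔
      0 < cross a d ∧ 0 < cross d b ∧ cross a d + cross d b = cross a b := by
  constructor
  · rintro ⟨s, t, hs, ht, hst, h1⟩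
    have h2 : d = s • a + t • b := by
      have h3 : s • (q + a) + t • (q + b) = (s + t) • q + (s • a + t • b) := by module
      rw [h3, hst, one_smul] at h1
      exact (add_left_cancel h1).symm
    have h4 : cross a d = t * cross a b := by
      rw [h2, cross_add_right, cross_smul_right, cross_smul_right, cross_self]; ring
    have h5 : cross d b = s * cross a b := by
      rw [h2, cross_add_left, cross_smul_left, cross_smul_left, cross_self]; ring
    rw [h4, h5]
    refine ⟨by positivity, by positivity, ?_⟩
    rw [← add_mul, add_comm t, hst, one_mul]
  · rintro ⟨h1, h2, h3⟩
    have h4 : cross d b / cross a b + cross a d / cross a b = 1 := by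
      rw [← add_div, add_comm, h3, div_self h.ne']
    refine ⟨_, _, by positivity, by positivity, h4, ?_⟩
    conv_rhs => rw [eq_combination h.ne' d]
    have : ∀ s t : ℝ, s • (q + a) + t • (q + b) = (s + t) • q + (s • a + t • b) := fun s t => by
      module
    rw [this, h4, one_smul]

theorem add_mem_openSegment_self_iff (q d e : Pt) :
    q + e ∈ openSegment ℝ q (q + d) ↔ ∃ t : ℝ, 0 < t ∧ t < 1 ∧ e = t • d := by
  constructor
  · rintro ⟨s, t, hs, ht, hst, h1⟩
    refine ⟨t, ht, by linarith, ?_⟩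
    have h3 : s • q + t • (q + d) = (s + t) • q + t • d := by module
    rw [h3, hst, one_smul] at h1
    exact (add_left_cancel h1).symm
  · rintro ⟨t, h0, h1, rfl⟩
    exact ⟨1 - t, t, by linarith, h0, by ring, by module⟩

theorem collinear_of_cross_eq_zero {q a b : Pt} (h : cross a b = 0) :
    Collinear ℝ {q, q + a, q + b} := by
  rw [collinear_iff_of_mem (p₀ := q) (by simp)]
  by_cases ha : a = 0
  · refine ⟨b, fun p hp => ?_⟩
    rcases hp with rfl | rfl | rfl
    · exact ⟨0, by simp⟩
    · exact ⟨0, by simp [ha]⟩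
    · exact ⟨1, by simp [add_comm]⟩
  · refine ⟨a, fun p hp => ?_⟩
    rcases hp with rfl | rfl | rfl
    · exact ⟨0, by simp⟩
    · exact ⟨1, by simp [add_comm]⟩
    · unfold cross at h
      by_cases h1 : a.1 = 0
      · have h2 : a.2 ≠ 0 := fun h2 => ha (Prod.ext h1 h2)
        refine ⟨b.2 / a.2, ?_⟩
        rw [vadd_eq_add, add_comm]
        congr 1
        ext
        · simp only [Prod.smul_fst, smul_eq_mul, h1, mul_zero]
          rw [h1] at h
          have : a.2 * b.1 = 0 := by linarith
          exact (mul_eq_zero.mp this).resolve_left h2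
        · simp [h2]
      · refine ⟨b.1 / a.1, ?_⟩
        rw [vadd_eq_add, add_comm]
        congr 1
        ext
        · simp [h1]
        · simp only [Prod.smul_snd, smul_eq_mul]
          field_simp
          linarith

/-! ### Rays -/

theorem dir_angle {q p : Pt} (h : p ≠ q) : ∃ r : ℝ, 0 < r ∧ p = q + r • dir (angle q p) := by
  obtain ⟨z, hz⟩ : ∃ z : ℂ, z = ⟨p.1 - q.1, p.2 - q.2⟩ := ⟨_, rfl⟩
  have hz0 : z ≠ 0 := by
    rintro rfl
    have h1 := congrArg Complex.re hz
    have h2 := congrArg Complex.im hz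
    exact h (Prod.ext (by simpa using (sub_eq_zero.mp h1.symm)) (by simpa using (sub_eq_zero.mp h2.symm)))
  refine ⟨‖z‖, norm_pos_iff.mpr hz0, ?_⟩
  have h1 : dir (angle q p) = (Real.cos z.arg, Real.sin z.arg) := by
    unfold dir angle
    rw [← hz, toIcoMod, zsmul_eq_mul, Real.cos_sub_int_mul_two_pi, Real.sin_sub_int_mul_two_pi]
  rw [h1]
  ext
  · have := Complex.norm_mul_cos_arg z
    simp only [Prod.fst_add, Prod.smul_fst, smul_eq_mul, this]
    rw [hz]; simp
  · have := Complex.norm_mul_sin_arg z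
    simp only [Prod.snd_add, Prod.smul_snd, smul_eq_mul, this]
    rw [hz]; simp

theorem mem_ray_angle {q p : Pt} (h : p ≠ q) (e : Pt) :
    q + e ∈ ray q (angle q p) ↔ ∃ t : ℝ, 0 < t ∧ e = t • (p - q) := by
  obtain ⟨r, hr, hp⟩ := dir_angle h
  have h1 : p - q = r • dir (angle q p) := by
    conv_lhs => rw [hp]
    abel
  rw [h1]
  constructor
  · rintro ⟨t, ht, h2⟩
    refine ⟨t / r, by positivity, ?_⟩
    rw [smul_smul, div_mul_cancel₀ _ hr.ne']
    exact add_left_cancel h2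
  · rintro ⟨t, ht, rfl⟩
    exact ⟨t * r, by positivity, by rw [smul_smul]⟩

theorem angle_mem (q p : Pt) : angle q p ∈ Set.Ico 0 (2 * Real.pi) := by
  have := toIcoMod_mem_Ico Real.two_pi_pos 0 (Complex.arg ⟨p.1 - q.1, p.2 - q.2⟩)
  rwa [zero_add] at this

theorem eq_angle {q p : Pt} {θ : ℝ} (hθ : θ ∈ Set.Ico 0 (2 * Real.pi)) (h : p ∈ ray q θ) :
    θ = angle q p := by
  obtain ⟨t, ht, rfl⟩ := h
  have h1 : (⟨(q + t • dir θ).1 - q.1, (q + t • dir θ).2 - q.2⟩ : ℂ) =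
      t * (Complex.cos θ + Complex.sin θ * Complex.I) := by
    apply Complex.ext <;> simp [dir, Complex.cos_ofReal_re, Complex.sin_ofReal_re]
  unfold angle
  rw [h1, Complex.arg_mul_cos_add_sin_mul_I_eq_toIocMod ht]
  have h2 : toIcoMod Real.two_pi_pos 0 (toIocMod Real.two_pi_pos (-Real.pi) θ) =
      toIcoMod Real.two_pi_pos 0 θ := by
    rw [toIocMod, toIcoMod_sub_zsmul]
  rw [h2]
  exact ((toIcoMod_eq_self Real.two_pi_pos).2 (by simpa using hθ)).symm

end KVis

/-! ### Segments in coordinates given by cross products with their endpoints -/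

namespace KVis

/-- The vertex with the number `u`, relative to the query point. -/
def vec (I : List ℤ) (u : ℤ) : Pt := (px I u, py I u)

theorem cross_vec (I : List ℤ) (u v : ℤ) : cross (vec I u) (vec I v) = cr I u v := by
  simp [cross, vec, cr]

/-- The barycentric coordinates, up to a factor `X I x`, of a vector with respect to the endpoints
of segment `x`. -/
def al (I : List ℤ) (x : ℤ) (d : Pt) : ℝ := cross (vec I (sa I x)) d
def be (I : List ℤ) (x : ℤ) (d : Pt) : ℝ := cross d (vec I (sb I x))

/-- The sum of `al` and `be`. The vector `d` ends on segment `x` if this is `X I x`. -/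
def de (I : List ℤ) (x : ℤ) (d : Pt) : ℝ := al I x d + be I x d

section
variable (I : List ℤ) (x : ℤ) (c d : Pt) (s t : ℝ) (v : ℤ)

theorem al_add : al I x (c + d) = al I x c + al I x d := cross_add_right _ _ _
theorem be_add : be I x (c + d) = be I x c + be I x d := cross_add_left _ _ _
theorem al_smul : al I x (t • d) = t * al I x d := cross_smul_right _ _ _
theorem be_smul : be I x (t • d) = t * be I x d := cross_smul_left _ _ _
theorem de_add : de I x (c + d) = de I x c + de I x d := by simp only [de, al_add, be_add]; ring
theorem de_smul : de I x (t • d) = t * de I x d := by simp only [de, al_smul, be_smul]; ring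
theorem al_vec : al I x (vec I v) = cr I (sa I x) v := cross_vec _ _ _
theorem be_vec : be I x (vec I v) = cr I v (sb I x) := cross_vec _ _ _
theorem de_vec : de I x (vec I v) = D I v x := by simp [de, al_vec, be_vec, D]
theorem cross_sa_sb : cross (vec I (sa I x)) (vec I (sb I x)) = X I x := cross_vec _ _ _

theorem continuous_al : Continuous (al I x) := continuous_cross_left _
theorem continuous_be : Continuous (be I x) := continuous_cross_right _
theorem continuous_de : Continuous (de I x) := (continuous_al I x).add (continuous_be I x)

/-- The cross product of two vectors in the coordinates with respect to a segment. -/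
theorem X_mul_cross : X I x * cross c d = be I x c * al I x d - al I x c * be I x d := by
  rw [← cross_sa_sb]
  unfold al be cross
  ring

theorem cl_iff : Cl I v x ↔ 0 ≤ al I x (vec I v) ∧ 0 ≤ be I x (vec I v) ∧ 0 < de I x (vec I v) := by
  rw [al_vec, be_vec, de_vec, Cl]; norm_cast

theorem act_iff : Act I v x ↔ 0 ≤ al I x (vec I v) ∧ 0 < be I x (vec I v) := by
  rw [al_vec, be_vec, Act]; norm_cast

theorem bef_iff : Bef I v x ↔ 0 < al I x (vec I v) ∧ 0 ≤ be I x (vec I v) := by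
  rw [al_vec, be_vec, Bef]; norm_cast

theorem lt_iff (y : ℤ) : Lt I v x y ↔ X I x * de I y (vec I v) < X I y * de I x (vec I v) := by
  rw [de_vec, de_vec, Lt]; norm_cast

end

/-- The input array of the machine describes the segments `S` and the query point `q`. -/
structure Scene (C : Env) (B : Set Pt) (S : Segs C.n) (q : Pt) : Prop where
  vertex : ∀ i b, S i b = q + vec C.I (vertexCode (i, b))
  valid : Valid B S q

section
variable {C : Env} {B : Set Pt} {S : Segs C.n} {q : Pt}

theorem vertexCode_mem {n : ℕ} (u : Fin n × Bool) : 0 ≤ vertexCode u ∧ vertexCode u < 2 * n := by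
  have := u.1.2
  unfold vertexCode
  split_ifs <;> omega

theorem vertexCode_div {n : ℕ} (u : Fin n × Bool) : vertexCode u / 2 = (u.1 : ℤ) := by
  unfold vertexCode
  split_ifs <;> omega

theorem vertexCode_inj {n : ℕ} {u v : Fin n × Bool} : vertexCode u = vertexCode v ↔ u = v := by
  refine ⟨fun h => ?_, fun h => h ▸ rfl⟩
  have h1 : u.1 = v.1 := Fin.ext (by have := vertexCode_div u; have := vertexCode_div v; omega)
  refine Prod.ext h1 ?_
  unfold vertexCode at h
  rw [h1] at h
  rcases hu : u.2 <;> rcases hv : v.2 <;> simp [hu, hv] at h ⊢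

theorem exists_vertexCode {n : ℕ} {u : ℤ} (h : 0 ≤ u ∧ u < 2 * n) :
    ∃ v : Fin n × Bool, vertexCode v = u := by
  refine ⟨(⟨(u / 2).toNat, by omega⟩, decide (u % 2 = 1)), ?_⟩
  unfold vertexCode
  by_cases h1 : u % 2 = 1
  · simp only [h1, decide_true, if_true]; omega
  · simp only [h1, decide_false, Bool.false_eq_true, if_false]; omega

theorem Scene.gen (h : Scene C B S q) : Gen C.I C.n where
  pos := C.one_le_s.trans C.s_le_n
  gp := fun u v hu hu' hv hv' huv hc => by
    obtain ⟨u, rfl⟩ := exists_vertexCode ⟨hu, hu'⟩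
    obtain ⟨v, rfl⟩ := exists_vertexCode ⟨hv, hv'⟩
    refine h.valid.general u v (fun h => huv (h ▸ rfl)) ?_
    rw [h.vertex, h.vertex]
    refine collinear_of_cross_eq_zero ?_
    rw [cross_vec, hc, Int.cast_zero]

theorem fin_mem {n : ℕ} (i : Fin n) : 0 ≤ (i : ℤ) ∧ (i : ℤ) < n := by have := i.2; omega

theorem Scene.X_pos (h : Scene C B S q) (i : Fin C.n) : (0 : ℝ) < X C.I i := by
  exact_mod_cast h.gen.X_pos (fin_mem i)

theorem Scene.endpoints (h : Scene C B S q) (i : Fin C.n) :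
    (S i false = q + vec C.I (sa C.I i) ∧ S i true = q + vec C.I (sb C.I i)) ∨
    (S i false = q + vec C.I (sb C.I i) ∧ S i true = q + vec C.I (sa C.I i)) := by
  rw [h.vertex, h.vertex]
  rcases sa_sb C.I i with h1 | h1
  · left; rw [h1.1, h1.2]; simp [vertexCode]
  · right; rw [h1.1, h1.2]; simp [vertexCode]

theorem Scene.mem_seg (h : Scene C B S q) (i : Fin C.n) (d : Pt) :
    q + d ∈ seg S i ↔ 0 ≤ al C.I i d ∧ 0 ≤ be C.I i d ∧ de C.I i d = X C.I i := by
  have h1 : seg S i = segment ℝ (q + vec C.I (sa C.I i)) (q + vec C.I (sb C.I i)) := by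
    unfold seg
    rcases h.endpoints i with h1 | h1
    · rw [h1.1, h1.2]
    · rw [h1.1, h1.2, segment_symm]
  rw [h1, add_mem_segment_iff (by rw [cross_sa_sb]; exact h.X_pos i), cross_sa_sb]
  rfl

/-- The only candidate for the crossing is the multiple of `d` on the line of the segment, with the
factor `X / de`. It lies before `d` exactly if `X < de`. -/
theorem Scene.crosses_iff (h : Scene C B S q) (i : Fin C.n) (d : Pt) :
    Crosses S q (q + d) i ↔ 0 < al C.I i d ∧ 0 < be C.I i d ∧ X C.I i < de C.I i d := by
  have h1 : openSegment ℝ (S i false) (S i true) =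
      openSegment ℝ (q + vec C.I (sa C.I i)) (q + vec C.I (sb C.I i)) := by
    rcases h.endpoints i with h1 | h1
    · rw [h1.1, h1.2]
    · rw [h1.1, h1.2, openSegment_symm]
  have hX := h.X_pos i
  have h2 : ∀ e, q + e ∈ openSegment ℝ (S i false) (S i true) ↔
      0 < al C.I i e ∧ 0 < be C.I i e ∧ de C.I i e = X C.I i := fun e => by
    rw [h1, add_mem_openSegment_iff (by rw [cross_sa_sb]; exact hX), cross_sa_sb]
    rfl
  constructor
  · rintro ⟨p, hp, hp'⟩
    obtain ⟨e, rfl⟩ : ∃ e, p = q + e := ⟨p - q, by simp⟩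
    obtain ⟨t, ht, ht', rfl⟩ := (add_mem_openSegment_self_iff q d e).1 hp
    rw [h2, al_smul, be_smul, de_smul] at hp'
    refine ⟨pos_of_mul_pos_right hp'.1 ht.le, pos_of_mul_pos_right hp'.2.1 ht.le, ?_⟩
    have h3 : 0 < de C.I i d := pos_of_mul_pos_right (hp'.2.2 ▸ hX) ht.le
    rw [← hp'.2.2]
    nlinarith
  · rintro ⟨h3, h4, h5⟩
    have h6 := hX.trans h5
    have h7 : 0 < X C.I i / de C.I i d := by positivity
    refine ⟨q + ((X C.I i : ℝ) / de C.I i d) • d, (add_mem_openSegment_self_iff _ _ _).2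
      ⟨_, h7, (div_lt_one h6).2 h5, rfl⟩, (h2 _).2 ?_⟩
    rw [al_smul, be_smul, de_smul]
    exact ⟨by positivity, by positivity, div_mul_cancel₀ _ h6.ne'⟩

/-- Segments that meet a ray at the same distance are equal. -/
theorem Scene.eq_of_dist (h : Scene C B S q) {i j : Fin C.n} {d : Pt}
    (hi : 0 ≤ al C.I i d ∧ 0 ≤ be C.I i d ∧ 0 < de C.I i d)
    (hj : 0 ≤ al C.I j d ∧ 0 ≤ be C.I j d ∧ 0 < de C.I j d)
    (hd : X C.I i * de C.I j d = X C.I j * de C.I i d) : i = j := by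
  by_contra hij
  have h7 : 0 < X C.I i / de C.I i d := div_pos (h.X_pos i) hi.2.2
  suffices hp : q + ((X C.I i : ℝ) / de C.I i d) • d ∈ seg S i ∩ seg S j from
    Set.disjoint_iff.mp (h.valid.disjoint hij) hp
  refine ⟨(h.mem_seg _ _).2 ?_, (h.mem_seg _ _).2 ?_⟩ <;> rw [al_smul, be_smul, de_smul]
  · exact ⟨mul_nonneg h7.le hi.1, mul_nonneg h7.le hi.2.1, div_mul_cancel₀ _ hi.2.2.ne'⟩
  · refine ⟨mul_nonneg h7.le hj.1, mul_nonneg h7.le hj.2.1, ?_⟩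
    rw [div_mul_eq_mul_div, hd, mul_div_cancel_right₀ _ hi.2.2.ne']

theorem exists_fin {n : ℕ} {x : ℤ} (h0 : 0 ≤ x) (h1 : x < n) : ∃ i : Fin n, (i : ℤ) = x :=
  ⟨⟨x.toNat, by omega⟩, by simp; omega⟩

/-- The vertices can be swept. -/
theorem Scene.exists_sweep (h : Scene C B S q) : ∃ V, Sweep C.I C.n V := by
  obtain ⟨V, h1, h2, h3, h4⟩ := h.gen.exists_order
  refine ⟨V, ⟨⟨h.gen, h1, h2, h3, h4⟩, fun x y hx hx' hy hy' hxy dx dy a1 a2 a3 a4 a5 a6 he => hxy ?_⟩⟩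
  obtain ⟨i, rfl⟩ := exists_fin hx hx'
  obtain ⟨j, rfl⟩ := exists_fin hy hy'
  obtain ⟨d, hd⟩ : ∃ d : Pt, d = ((dx : ℝ), (dy : ℝ)) := ⟨_, rfl⟩
  have e1 : ∀ x : ℤ, al C.I x d =
      ((px C.I (sa C.I x) * dy - py C.I (sa C.I x) * dx : ℤ) : ℝ) := fun x => by
    simp [al, cross, vec, hd]
  have e2 : ∀ x : ℤ, be C.I x d =
      ((dx * py C.I (sb C.I x) - dy * px C.I (sb C.I x) : ℤ) : ℝ) := fun x => by
    simp [be, cross, vec, hd]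
  refine congrArg (fun i : Fin C.n => (i : ℤ)) (h.eq_of_dist (d := d) ?_ ?_ ?_) <;> simp only [de, e1, e2] <;> norm_cast

end

end KVis

namespace KVis

/-! ## The visible parts of the segments -/

/-- The direction `d` lies between the vertices `V m` and `V (m + 1)`. -/
def Cone (I : List ℤ) (V : ℕ → ℤ) (m : ℕ) (d : Pt) : Prop :=
  0 ≤ cross (vec I (V m)) d ∧ 0 ≤ cross d (vec I (V (m + 1)))

section
variable {C : Env} {B : Set Pt} {S : Segs C.n} {q : Pt} {V : ℕ → ℤ} {m : ℕ} {x y : ℤ} {d : Pt}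

/-- A gap without segments may span an angle of `π` or more. If a segment meets its rays, the gap
ends no later than this segment does, and a segment is seen under an angle below `π`. -/
theorem Sweep.gap_pos (hS : Sweep C.I C.n V) (hm : m < 2 * C.n) (hx : x ∈ Gs C.I C.n (V m)) :
    (0 : ℝ) < cross (vec C.I (V m)) (vec C.I (V (m + 1))) := by
  obtain ⟨h1, h2⟩ := mem_Gs.1 hx
  have hb := sb_mem C.I h1
  rw [cross_vec]
  have h3 := h2.2
  rcases hS.next hm hb.1 hb.2 h2.2 with h | h
  · rw [h] at h3; exact_mod_cast h3
  · exact_mod_cast h.1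

theorem Sweep.gap_coords (hS : Sweep C.I C.n V) (hm : m < 2 * C.n) (hx : x ∈ Gs C.I C.n (V m)) :
    (0 ≤ al C.I x (vec C.I (V m)) ∧ 0 < be C.I x (vec C.I (V m))) ∧
      (0 < al C.I x (vec C.I (V (m + 1))) ∧ 0 ≤ be C.I x (vec C.I (V (m + 1)))) :=
  ⟨(act_iff _ _ _).1 (mem_Gs.1 hx).2, (bef_iff _ _ _).1 ((mem_Gs_next hS.toOrder hm).1 hx).2⟩

/-- Directions between consecutive vertices are combinations of them. -/
theorem Cone.exists_combination (hd : Cone C.I V m d)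
    (h : (0 : ℝ) < cross (vec C.I (V m)) (vec C.I (V (m + 1)))) :
    ∃ s t : ℝ, 0 ≤ s ∧ 0 ≤ t ∧ d = s • vec C.I (V m) + t • vec C.I (V (m + 1)) ∧
      (0 < cross (vec C.I (V m)) d → 0 < t) ∧ (0 < cross d (vec C.I (V (m + 1))) → 0 < s) :=
  ⟨_, _, div_nonneg hd.2 h.le, div_nonneg hd.1 h.le, eq_combination h.ne' d,
    fun h1 => div_pos h1 h, fun h1 => div_pos h1 h⟩

/-- Between two vertices the order of the segments is constant. -/
theorem Sweep.lt_iff_of_cone (hS : Sweep C.I C.n V) (hm : m < 2 * C.n)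
    (hx : x ∈ Gs C.I C.n (V m)) (hy : y ∈ Gs C.I C.n (V m)) (hd : Cone C.I V m d) (hd0 : d ≠ 0) :
    Lt C.I (V m) x y ↔ X C.I x * de C.I y d < X C.I y * de C.I x d := by
  obtain ⟨s, t, hs, ht, hst, -, -⟩ := hd.exists_combination (hS.gap_pos hm hx)
  have key : ∀ x y, x ∈ Gs C.I C.n (V m) → y ∈ Gs C.I C.n (V m) → Lt C.I (V m) x y →
      X C.I x * de C.I y d < X C.I y * de C.I x d := by
    intro x y hx hy h
    have h2 := (lt_next_of_mem hS hm hx hy).1 h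
    rw [lt_iff] at h h2
    rw [hst]
    simp only [de_add, de_smul]
    rcases hs.eq_or_lt with h3 | h3
    · rcases ht.eq_or_lt with h4 | h4
      · rw [← h3, ← h4] at hst
        simp at hst
        exact absurd hst hd0
      · nlinarith [mul_lt_mul_of_pos_left h2 h4, mul_le_mul_of_nonneg_left h.le hs]
    · nlinarith [mul_lt_mul_of_pos_left h h3, mul_le_mul_of_nonneg_left h2.le ht]
  refine ⟨key x y hx hy, fun h => ?_⟩
  have hx' := mem_Gs.1 hx
  have hy' := mem_Gs.1 hy
  by_cases hxy : x = y
  · subst hxy; exact absurd h (lt_irrefl _)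
  · exact (hS.lt_total hx'.1 hy'.1 hxy hx'.2.cl hy'.2.cl).resolve_right fun h1 =>
      lt_asymm h (key y x hy hx h1)

/-- Segments that are crossed between two consecutive vertices meet all rays there. -/
theorem Sweep.mem_Gs_of_cone (hS : Sweep C.I C.n V) (hm : m < 2 * C.n)
    (h0 : (0 : ℝ) < cross (vec C.I (V m)) (vec C.I (V (m + 1)))) (hd : Cone C.I V m d)
    (hx : 0 ≤ x ∧ x < C.n) (ha : 0 < al C.I x d) (hb : 0 < be C.I x d) : x ∈ Gs C.I C.n (V m) := by
  rw [mem_Gs, act_iff]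
  refine ⟨hx, ?_⟩
  have hsa := sa_mem C.I hx
  have hX : (0 : ℝ) < X C.I x := by exact_mod_cast hS.gen.X_pos hx
  obtain ⟨s, t, hs, ht, hst, ht', -⟩ := hd.exists_combination h0
  have e : al C.I x d = s * al C.I x (vec C.I (V m)) + t * al C.I x (vec C.I (V (m + 1))) := by
    conv_lhs => rw [hst]
    rw [al_add, al_smul, al_smul]
  have e' : be C.I x d = s * be C.I x (vec C.I (V m)) + t * be C.I x (vec C.I (V (m + 1))) := by
    conv_lhs => rw [hst]
    rw [be_add, be_smul, be_smul]
  -- If the segment began after `V m`, it would begin at `V (m + 1)` or later, and `d` could not lie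
  -- strictly behind its first endpoint.
  have h1 : 0 ≤ al C.I x (vec C.I (V m)) := by
    by_contra h1
    rw [al_vec, cr_swap] at h1
    push_cast at h1
    have h2 : 0 < cr C.I (V m) (sa C.I x) := by
      rw [not_le, neg_lt_zero] at h1; exact_mod_cast h1
    rcases hS.next hm hsa.1 hsa.2 h2 with h3 | ⟨-, h3⟩
    · unfold al at ha
      rw [h3, cross_swap] at ha
      linarith [hd.2]
    · have h4 : al C.I x (vec C.I (V (m + 1))) < 0 := by
        rw [al_vec, cr_swap]; push_cast; rw [neg_lt_zero]; exact_mod_cast h3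
      have h5 : al C.I x (vec C.I (V m)) < 0 := by
        rw [al_vec, cr_swap]; push_cast; rw [neg_lt_zero]; exact_mod_cast h2
      nlinarith [mul_nonneg hs (neg_nonneg.mpr h5.le), mul_nonneg ht (neg_nonneg.mpr h4.le)]
  refine ⟨h1, ?_⟩
  have h2 := X_mul_cross C.I x (vec C.I (V m)) d
  rcases hd.1.eq_or_lt with h3 | h3
  · by_contra h4
    have h5 : t = 0 := by
      have h6 : cross (vec C.I (V m)) d = t * cross (vec C.I (V m)) (vec C.I (V (m + 1))) := by
        conv_lhs => rw [hst]
        rw [cross_add_right, cross_smul_right, cross_smul_right, cross_self]; ring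
      rw [← h3] at h6
      exact (mul_eq_zero.mp h6.symm).resolve_right h0.ne'
    rw [h5] at e'
    nlinarith
  · by_contra h4
    nlinarith [mul_pos hX h3, mul_nonneg h1 hb.le]

/-- The position of a direction on segment `x`. -/
noncomputable def par (I : List ℤ) (x : ℤ) (d : Pt) : ℝ := al I x d / de I x d

/-- The position at which a ray hits a segment increases with the angle. This replaces the circular
order of directions by the order of real numbers. -/
theorem par_le_iff {I : List ℤ} {c d : Pt} (hX : 0 < X I x) (hc : 0 < de I x c) (hd : 0 < de I x d) :
    par I x c ≤ par I x d ↔ 0 ≤ cross c d := by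
  have h := X_mul_cross I x c d
  have hX' : (0 : ℝ) < X I x := by exact_mod_cast hX
  rw [par, par, div_le_div_iff₀ hc hd, ← mul_nonneg_iff_of_pos_left hX', h, de, de]
  constructor <;> intro h <;> linarith

theorem par_lt_iff {I : List ℤ} {c d : Pt} (hX : 0 < X I x) (hc : 0 < de I x c) (hd : 0 < de I x d) :
    par I x c < par I x d ↔ 0 < cross c d := by
  rw [← not_le, par_le_iff hX hd hc, cross_swap, not_le, neg_lt_zero]

/-- The ray through a point of a segment lies between two consecutive vertices. -/
theorem Sweep.exists_cone (hS : Sweep C.I C.n V) (hx : 0 ≤ x ∧ x < C.n) (ha : 0 ≤ al C.I x d)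
    (hb : 0 ≤ be C.I x d) :
    ∃ m < 2 * C.n, x ∈ Gs C.I C.n (V m) ∧ Cone C.I V m d := by
  classical
  have hX := hS.gen.X_pos hx
  have hsa := sa_mem C.I hx
  -- The gap begins at the last vertex not after `d` whose ray meets the segment before its end; the
  -- first endpoint of the segment is a candidate. If the next vertex also came before `d`, it would
  -- contradict the maximality, or be the end of the segment, which `d` does not pass.
  obtain ⟨w, hw, hmax⟩ := Finset.exists_max_image ((Finset.Ico (0 : ℤ) (2 * C.n)).filter fun w =>
    Act C.I w x ∧ 0 ≤ cross (vec C.I w) d) (fun w => par C.I x (vec C.I w))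
    ⟨sa C.I x, by simpa [hsa, (hS.gen.act_sa hx).1, al] using ha⟩
  simp only [Finset.mem_filter, Finset.mem_Ico] at hw hmax
  obtain ⟨hw, hact, hwd⟩ := hw
  obtain ⟨m, hm, rfl⟩ : ∃ m < 2 * C.n, V m = w := by
    obtain ⟨m, h1, h2, h3⟩ := hS.surj w hw.1 hw.2
    rcases h2.lt_or_eq with h4 | rfl
    · exact ⟨m, h4, h3⟩
    · exact ⟨0, by omega, by rw [← h3, hS.last, hS.zero]⟩
  have hG : x ∈ Gs C.I C.n (V m) := mem_Gs.2 ⟨hx, hact⟩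
  refine ⟨m, hm, hG, hwd, ?_⟩
  obtain ⟨⟨h1, h2⟩, h3, h4⟩ := hS.gap_coords hm hG
  have hv := hS.mem (m + 1)
  by_contra h5
  rw [cross_swap, neg_nonneg, not_le] at h5
  rcases h4.eq_or_lt with h6 | h6
  · have h7 : sb C.I x = V (m + 1) := by
      rw [be_vec] at h6
      have h6' : cr C.I (V (m + 1)) (sb C.I x) = 0 := by exact_mod_cast h6.symm
      exact ((hS.gen.cr_eq_zero hv (sb_mem C.I hx)).1 h6').symm
    unfold be at hb
    rw [h7, cross_swap] at hb
    linarith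
  · have h7 := hmax (V (m + 1)) ⟨hv, (act_iff _ _ _).2 ⟨h3.le, h6⟩, h5.le⟩
    rw [par_le_iff hX (add_pos h3 h6) (add_pos_of_nonneg_of_pos h1 h2), cross_swap] at h7
    linarith [hS.gap_pos hm hG]

theorem ncard_fin {n : ℕ} (P : ℤ → Prop) [DecidablePred P] :
    {i : Fin n | P i}.ncard = ((Finset.Ico (0 : ℤ) n).filter P).card := by
  have hinj : Function.Injective fun i : Fin n => (i : ℤ) := fun i j h => Fin.ext (by simpa using h)
  rw [← Set.ncard_image_of_injective _ hinj, ← Set.ncard_coe_finset]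
  congr 1
  ext x
  simp only [Set.mem_image, Set.mem_ofPred_eq, Finset.coe_filter, Finset.mem_Ico]
  constructor
  · rintro ⟨i, h, rfl⟩
    exact ⟨fin_mem i, h⟩
  · rintro ⟨h, h'⟩
    obtain ⟨i, rfl⟩ := exists_fin h.1 h.2
    exact ⟨i, h', rfl⟩

open scoped Classical in
theorem Scene.kVisible_iff (h : Scene C B S q) (k : ℕ) (d : Pt) :
    KVisible S q k (q + d) ↔ ((Finset.Ico (0 : ℤ) C.n).filter fun x =>
      0 < al C.I x d ∧ 0 < be C.I x d ∧ X C.I x < de C.I x d).card ≤ k := by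
  unfold KVisible
  simp only [h.crosses_iff]
  rw [← ncard_fin]

theorem ne_zero_of_de (h : 0 < de C.I x d) : d ≠ 0 := by
  rintro rfl
  simp [de, al, be, cross] at h

/-- A segment of rank at most `k` between two vertices is visible there. -/
theorem Scene.visible_of_vis (h : Scene C B S q) (hS : Sweep C.I C.n V) (hm : m < 2 * C.n)
    {i : Fin C.n} (hd : q + d ∈ seg S i) (hv : Vis C V m i) (hc : Cone C.I V m d) :
    KVisible S q C.k (q + d) := by
  classical
  rw [h.kVisible_iff]
  obtain ⟨ha, hb, hde⟩ := (h.mem_seg i d).1 hd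
  have hX := h.X_pos i
  refine le_trans (Finset.card_le_card fun y hy => ?_) hv.2
  simp only [Finset.mem_filter, Finset.mem_Ico] at hy ⊢
  obtain ⟨hy0, h1, h2, h3⟩ := hy
  -- A segment that is properly crossed in a direction of the closed cone meets the rays of the
  -- whole gap, so it is counted by the rank. This includes the two boundary rays.
  have hG := hS.mem_Gs_of_cone hm (hS.gap_pos hm hv.1) hc hy0 h1 h2
  refine ⟨hG, (hS.lt_iff_of_cone hm hG hv.1 hc (ne_zero_of_de (hde ▸ hX))).2 ?_⟩
  rw [hde]
  nlinarith

/-- A visible point of a segment lies between two consecutive vertices between which the segment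
has rank at most `k`. -/
theorem Scene.exists_vis (h : Scene C B S q) (hS : Sweep C.I C.n V) {i : Fin C.n}
    (hd : q + d ∈ seg S i) (hv : KVisible S q C.k (q + d)) :
    ∃ m < 2 * C.n, Vis C V m i ∧ Cone C.I V m d := by
  classical
  rw [h.kVisible_iff] at hv
  obtain ⟨ha, hb, hde⟩ := (h.mem_seg i d).1 hd
  have hX := h.X_pos i
  have hi := fin_mem i
  have hd0 := ne_zero_of_de (hde ▸ hX)
  -- A gap is suitable if every segment in front of `i` there is properly crossed towards `d`; then
  -- the rank is at most the number of crossings.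
  have key : ∀ m < 2 * C.n, (i : ℤ) ∈ Gs C.I C.n (V m) → Cone C.I V m d →
      (∀ y ∈ Gs C.I C.n (V m), Lt C.I (V m) y i → 0 < al C.I y d ∧ 0 < be C.I y d) →
      ∃ m < 2 * C.n, Vis C V m i ∧ Cone C.I V m d := fun m hm hG hc hy => by
    refine ⟨m, hm, ⟨hG, le_trans (Finset.card_le_card fun y hy' => ?_) hv⟩, hc⟩
    simp only [Finset.mem_filter, Finset.mem_Ico] at hy' ⊢
    obtain ⟨h1, h2⟩ := hy y hy'.1 hy'.2
    refine ⟨(mem_Gs.1 hy'.1).1, h1, h2, ?_⟩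
    have h3 := (hS.lt_iff_of_cone hm hy'.1 hG hc hd0).1 hy'.2
    rw [hde, mul_comm] at h3
    exact lt_of_mul_lt_mul_left h3 hX.le
  have vertex : ∀ m < 2 * C.n, ∀ t : ℝ, 0 < t → d = t • vec C.I (V (m + 1)) →
      ∃ m < 2 * C.n, Vis C V m i ∧ Cone C.I V m d := fun m hm t ht hdt => by
    have hcl : Cl C.I (V (m + 1)) i := by
      rw [cl_iff]
      rw [hdt, al_smul] at ha
      rw [hdt, be_smul] at hb
      rw [hdt, de_smul] at hde
      exact ⟨nonneg_of_mul_nonneg_right ha ht, nonneg_of_mul_nonneg_right hb ht,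
        pos_of_mul_pos_right (hde ▸ hX) ht.le⟩
    have hv := hS.mem (m + 1)
    obtain ⟨z, hz⟩ : ∃ z, z = V (m + 1) / 2 := ⟨_, rfl⟩
    have hz0 : 0 ≤ z ∧ z < C.n := by omega
    have strict : ∀ y : ℤ, 0 ≤ y ∧ y < C.n → y ≠ z → Cl C.I (V (m + 1)) y →
        Act C.I (V (m + 1)) y ∧ Bef C.I (V (m + 1)) y ∧ 0 < al C.I y d ∧ 0 < be C.I y d := by
      intro y hy hyz hcy
      have h1 := hS.gen.act_iff_bef hv hy (hz ▸ hyz)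
      have h2 : Act C.I (V (m + 1)) y ∧ Bef C.I (V (m + 1)) y := by
        have : Act C.I (V (m + 1)) y ∨ Bef C.I (V (m + 1)) y := by
          unfold Act Bef
          have := hcy.1
          have := hcy.2.1
          have := hcy.2.2
          unfold D at this
          omega
        tauto
      refine ⟨h2.1, h2.2, ?_, ?_⟩
      · rw [hdt, al_smul]
        exact mul_pos ht ((bef_iff _ _ _).1 h2.2).1
      · rw [hdt, be_smul]
        exact mul_pos ht ((act_iff _ _ _).1 h2.1).2
    have hzz : Act C.I (V (m + 1)) z ∧ ¬ Bef C.I (V (m + 1)) z ∨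
        ¬ Act C.I (V (m + 1)) z ∧ Bef C.I (V (m + 1)) z := by
      rcases owner C.I (V (m + 1)) with h1 | h1
      · left; rw [h1, ← hz]; exact hS.gen.act_sa hz0
      · right; rw [h1, ← hz]; exact hS.gen.bef_sb hz0
    -- If `d` points to a vertex, touching the segment `z` of this vertex is not a proper crossing,
    -- yet `z` meets one of the two adjacent gaps. The gap without `z` is taken, except for `i = z`,
    -- when the gap with `z` is needed; there `z` does not come before itself.
    by_cases hg : Bef C.I (V (m + 1)) z ↔ (i : ℤ) = z
    · have hiG : (i : ℤ) ∈ Gs C.I C.n (V m) := by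
        rw [mem_Gs_next hS.toOrder hm]
        refine ⟨hi, ?_⟩
        by_cases hiz : (i : ℤ) = z
        · rw [hiz]; exact hg.2 hiz
        · exact (strict i hi hiz hcl).2.1
      refine key m hm hiG ⟨?_, ?_⟩ fun y hy hyi => ?_
      · rw [hdt, cross_smul_right]; exact (mul_pos ht (hS.gap_pos hm hiG)).le
      · rw [hdt, cross_smul_left, cross_self, mul_zero]
      · have h1 := (mem_Gs_next hS.toOrder hm).1 hy
        refine (strict y h1.1 (fun hyz => ?_) h1.2.cl).2.2
        rw [hyz] at h1 hyi
        rw [← hg.1 h1.2] at hyi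
        exact lt_irrefl' _ _ _ hyi
    · obtain ⟨m', hm', hV⟩ : ∃ m' < 2 * C.n, V m' = V (m + 1) := by
        by_cases h1 : m + 1 < 2 * C.n
        · exact ⟨_, h1, rfl⟩
        · exact ⟨0, by omega, by rw [show m + 1 = 2 * C.n by omega, hS.last, hS.zero]⟩
      have hg' : Act C.I (V (m + 1)) z ↔ (i : ℤ) = z := by tauto
      have hiG : (i : ℤ) ∈ Gs C.I C.n (V m') := by
        rw [mem_Gs, hV]
        refine ⟨hi, ?_⟩
        by_cases hiz : (i : ℤ) = z
        · rw [hiz]; exact hg'.2 hiz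
        · exact (strict i hi hiz hcl).1
      refine key m' hm' hiG ⟨?_, ?_⟩ fun y hy hyi => ?_
      · rw [hdt, hV, cross_smul_right, cross_self, mul_zero]
      · rw [hdt, cross_smul_left, ← hV]; exact (mul_pos ht (hS.gap_pos hm' hiG)).le
      · rw [mem_Gs, hV] at hy
        refine (strict y hy.1 (fun hyz => ?_) hy.2.cl).2.2
        rw [hyz] at hy hyi
        rw [← hg'.1 hy.2] at hyi
        exact lt_irrefl' _ _ _ hyi
  obtain ⟨m, hm, hG, hc⟩ := hS.exists_cone hi ha hb
  have hpos := hS.gap_pos hm hG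
  obtain ⟨s, t, hs, ht, hst, ht', hs'⟩ := hc.exists_combination hpos
  -- The direction is that of `V (m + 1)`, or that of `V m` with `V 0` read as `V (2 * n)`, or
  -- strictly inside the gap, where all segments of the gap are properly met.
  rcases hs.eq_or_lt with h1 | h1
  · refine vertex m hm t (ht.lt_of_ne ?_) ?_
    · rintro rfl; rw [← h1] at hst; simp at hst; exact hd0 hst
    · rw [hst, ← h1]; simp
  rcases ht.eq_or_lt with h2 | h2
  · have hd' : d = s • vec C.I (V m) := by rw [hst, ← h2]; simp
    rcases Nat.eq_zero_or_pos m with rfl | h3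
    · have := hS.gen.pos
      refine vertex (2 * C.n - 1) (by omega) s h1 ?_
      rw [show 2 * C.n - 1 + 1 = 2 * C.n by omega, hS.last]
      rw [hS.zero] at hd'
      exact hd'
    · refine vertex (m - 1) (by omega) s h1 ?_
      rw [show m - 1 + 1 = m by omega]
      exact hd'
  refine key m hm hG hc fun y hy _ => ?_
  obtain ⟨⟨h3, h4⟩, h5, h6⟩ := hS.gap_coords hm hy
  rw [hst]
  simp only [al_add, be_add, al_smul, be_smul]
  exact ⟨by positivity, by positivity⟩

end

end KVis

/-! ### Positions on a segment, and the pieces between two vertices -/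

namespace KVis

section
variable {C : Env} {B : Set Pt} {S : Segs C.n} {q : Pt} {V : ℕ → ℤ} {m : ℕ} {x y : ℤ} {d : Pt}
  {i : Fin C.n}

/-- The point in a given position on a segment. -/
noncomputable def Scene.line (_ : Scene C B S q) (i : Fin C.n) : ℝ →ᵃ[ℝ] Pt :=
  AffineMap.lineMap (q + vec C.I (sa C.I i)) (q + vec C.I (sb C.I i))

theorem Scene.line_apply (h : Scene C B S q) (t : ℝ) :
    h.line i t = q + ((1 - t) • vec C.I (sa C.I i) + t • vec C.I (sb C.I i)) := by
  rw [Scene.line, AffineMap.lineMap_apply_module]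
  module

theorem Scene.eq_line (h : Scene C B S q) (hd : q + d ∈ seg S i) :
    q + d = h.line i (par C.I i d) := by
  obtain ⟨-, -, h3⟩ := (h.mem_seg i d).1 hd
  have hX := h.X_pos i
  have h4 : cross (vec C.I (sa C.I i)) (vec C.I (sb C.I i)) ≠ 0 := by
    rw [cross_sa_sb]; exact hX.ne'
  rw [h.line_apply]
  congr 1
  have h5 : 1 - par C.I i d = be C.I i d / X C.I i := by
    rw [par, h3, eq_div_iff hX.ne', sub_mul, div_mul_cancel₀ _ hX.ne', ← h3, de]; ring
  have h6 := eq_combination h4 d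
  rw [cross_sa_sb] at h6
  rw [h5, par, h3]
  exact h6

theorem Scene.par_line (h : Scene C B S q) {t : ℝ} (ht : q + d = h.line i t) :
    al C.I i d = t * X C.I i ∧ be C.I i d = (1 - t) * X C.I i ∧ de C.I i d = X C.I i ∧
      par C.I i d = t := by
  have hX := h.X_pos i
  rw [h.line_apply] at ht
  rw [add_left_cancel ht]
  have h1 : al C.I i ((1 - t) • vec C.I (sa C.I i) + t • vec C.I (sb C.I i)) = t * X C.I i := by
    simp only [al_add, al_smul, al_vec, cr_self, X]; simp
  have h2 : be C.I i ((1 - t) • vec C.I (sa C.I i) + t • vec C.I (sb C.I i)) =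
      (1 - t) * X C.I i := by
    simp only [be_add, be_smul, be_vec, cr_self, X]; simp
  refine ⟨h1, h2, by rw [de, h1, h2]; ring, ?_⟩
  rw [par, de, h1, h2, ← add_mul, add_sub_cancel, one_mul, mul_div_cancel_right₀ _ hX.ne']

theorem Scene.mem_ray_vertex (h : Scene C B S q) (u : Fin C.n × Bool) (e : Pt) :
    q + e ∈ ray q (angle q (S u.1 u.2)) ↔ ∃ t : ℝ, 0 < t ∧ e = t • vec C.I (vertexCode u) := by
  rw [h.vertex]
  have h1 : q + vec C.I (vertexCode u) ≠ q := fun h1 => by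
    have h2 : vec C.I (vertexCode u) = 0 := by simpa using h1
    have h3 := h.X_pos u.1
    rw [← cross_sa_sb] at h3
    have h4 := owner C.I (vertexCode u)
    rw [vertexCode_div] at h4
    rcases h4 with h4 | h4
    · rw [← h4, h2] at h3; simp [cross] at h3
    · rw [← h4, h2] at h3; simp [cross] at h3
  rw [mem_ray_angle h1, add_sub_cancel_left]

theorem par_smul (I : List ℤ) (x : ℤ) {t : ℝ} (ht : 0 < t) (d : Pt) : par I x (t • d) = par I x d := by
  rw [par, par, al_smul, de_smul, mul_div_mul_left _ _ ht.ne']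

/-- The point of a segment on the ray through a vertex. -/
theorem Scene.mem_ray_inter (h : Scene C B S q) {u : Fin C.n × Bool} (hu : Cl C.I (vertexCode u) i)
    (p : Pt) : p ∈ ray q (angle q (S u.1 u.2)) ∩ seg S i ↔
      p = h.line i (par C.I i (vec C.I (vertexCode u))) := by
  obtain ⟨h1, h2, h3⟩ := (cl_iff _ _ _).1 hu
  have hX := h.X_pos i
  obtain ⟨e, rfl⟩ : ∃ e, p = q + e := ⟨p - q, by simp⟩
  constructor
  · rintro ⟨hr, hs⟩
    obtain ⟨t, ht, rfl⟩ := (h.mem_ray_vertex u e).1 hr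
    rw [h.eq_line hs, par_smul _ _ ht]
  · intro he
    have h4 : 0 < X C.I i / de C.I i (vec C.I (vertexCode u)) := div_pos hX h3
    have h5 : q + (X C.I i / de C.I i (vec C.I (vertexCode u))) • vec C.I (vertexCode u) ∈ seg S i := by
      rw [h.mem_seg, al_smul, be_smul, de_smul]
      exact ⟨mul_nonneg h4.le h1, mul_nonneg h4.le h2, div_mul_cancel₀ _ h3.ne'⟩
    have h6 := h.eq_line h5
    rw [par_smul _ _ h4] at h6
    rw [he, ← h6]
    exact ⟨(h.mem_ray_vertex u _).2 ⟨_, h4, rfl⟩, h5⟩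

/-- The piece is the image of an interval of positions under an affine map, since either ray meets
the segment in a single point. -/
theorem Scene.mem_piece (h : Scene C B S q) {u w : Fin C.n × Bool} (hu : Cl C.I (vertexCode u) i)
    (hw : Cl C.I (vertexCode w) i)
    (huw : par C.I i (vec C.I (vertexCode u)) ≤ par C.I i (vec C.I (vertexCode w))) (d : Pt) :
    q + d ∈ piece S q i u w ↔ q + d ∈ seg S i ∧ par C.I i (vec C.I (vertexCode u)) ≤ par C.I i d ∧
      par C.I i d ≤ par C.I i (vec C.I (vertexCode w)) := by
  have h1 : piece S q i u w = h.line i '' Set.Icc (par C.I i (vec C.I (vertexCode u)))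
      (par C.I i (vec C.I (vertexCode w))) := by
    rw [← segment_eq_Icc huw, image_segment]
    ext p
    unfold piece
    simp only [h.mem_ray_inter hu, h.mem_ray_inter hw]
    simp
  rw [h1]
  constructor
  · rintro ⟨t, ht, he⟩
    obtain ⟨e1, e2, e3, e4⟩ := h.par_line he.symm
    have hX := h.X_pos i
    have b1 : 0 ≤ par C.I i (vec C.I (vertexCode u)) := by
      obtain ⟨c1, c2, c3⟩ := (cl_iff _ _ _).1 hu
      exact div_nonneg c1 c3.le
    have b2 : par C.I i (vec C.I (vertexCode w)) ≤ 1 := by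
      obtain ⟨c1, c2, c3⟩ := (cl_iff _ _ _).1 hw
      rw [par, div_le_one c3, de]
      linarith
    refine ⟨(h.mem_seg i d).2 ⟨?_, ?_, e3⟩, by rw [e4]; exact ht.1, by rw [e4]; exact ht.2⟩
    · rw [e1]; exact mul_nonneg (b1.trans ht.1) hX.le
    · rw [e2]; exact mul_nonneg (by linarith [ht.2]) hX.le
  · rintro ⟨h2, h3, h4⟩
    exact ⟨_, ⟨h3, h4⟩, (h.eq_line h2).symm⟩

theorem Sweep.cl_of_gap (hS : Sweep C.I C.n V) (hm : m < 2 * C.n) (hx : x ∈ Gs C.I C.n (V m)) :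
    Cl C.I (V m) x ∧ Cl C.I (V (m + 1)) x :=
  ⟨(mem_Gs.1 hx).2.cl, ((mem_Gs_next hS.toOrder hm).1 hx).2.cl⟩

theorem Sweep.par_lt_next (hS : Sweep C.I C.n V) (hm : m < 2 * C.n) (hx : x ∈ Gs C.I C.n (V m)) :
    par C.I x (vec C.I (V m)) < par C.I x (vec C.I (V (m + 1))) := by
  obtain ⟨h1, h2⟩ := hS.cl_of_gap hm hx
  rw [par_lt_iff (hS.gen.X_pos (mem_Gs.1 hx).1) ((cl_iff _ _ _).1 h1).2.2 ((cl_iff _ _ _).1 h2).2.2]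
  exact hS.gap_pos hm hx

theorem Sweep.par_lt_of_gaps (hS : Sweep C.I C.n V) {a b : ℕ} (hab : a < b) (hb : b ≤ 2 * C.n)
    (hx : ∀ j, a ≤ j → j < b → x ∈ Gs C.I C.n (V j)) :
    par C.I x (vec C.I (V a)) < par C.I x (vec C.I (V b)) := by
  induction b, hab using Nat.le_induction with
  | base => exact hS.par_lt_next (by omega) (hx a le_rfl (by omega))
  | succ b hab' ih =>
    exact (ih (by omega) fun j h1 h2 => hx j h1 (by omega)).trans
      (hS.par_lt_next (by omega) (hx b (by omega) (by omega)))

/-- The steps are half-open, so that a position on a common boundary of two gaps is assigned to one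
of them only. -/
theorem exists_step (g : ℕ → ℝ) {a b : ℕ} {t : ℝ} (hab : a < b) (ha : g a ≤ t) (hb : t < g b) :
    ∃ j, a ≤ j ∧ j < b ∧ g j ≤ t ∧ t < g (j + 1) := by
  induction b, hab using Nat.le_induction with
  | base => exact ⟨a, le_rfl, by omega, ha, hb⟩
  | succ b hab' ih =>
    by_cases h : t < g b
    · obtain ⟨j, h1, h2, h3⟩ := ih h
      exact ⟨j, h1, by omega, h3⟩
    · exact ⟨b, by omega, by omega, not_lt.mp h, hb⟩

theorem Sweep.cone_iff (hS : Sweep C.I C.n V) (hm : m < 2 * C.n) (hx : x ∈ Gs C.I C.n (V m))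
    (hd : 0 < de C.I x d) : Cone C.I V m d ↔ par C.I x (vec C.I (V m)) ≤ par C.I x d ∧
      par C.I x d ≤ par C.I x (vec C.I (V (m + 1))) := by
  obtain ⟨h1, h2⟩ := hS.cl_of_gap hm hx
  have hX := hS.gen.X_pos (mem_Gs.1 hx).1
  rw [par_le_iff hX ((cl_iff _ _ _).1 h1).2.2 hd, par_le_iff hX hd ((cl_iff _ _ _).1 h2).2.2, Cone]

/-- The part of a segment between two vertices consists of the parts between consecutive ones. -/
theorem Sweep.between_iff (hS : Sweep C.I C.n V) {a b : ℕ} (hab : a < b) (hb : b ≤ 2 * C.n)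
    (hx : ∀ j, a ≤ j → j < b → x ∈ Gs C.I C.n (V j)) (hd : 0 < de C.I x d) :
    (par C.I x (vec C.I (V a)) ≤ par C.I x d ∧ par C.I x d ≤ par C.I x (vec C.I (V b))) ↔
      ∃ j, a ≤ j ∧ j < b ∧ Cone C.I V j d := by
  constructor
  · rintro ⟨h1, h2⟩
    rcases h2.lt_or_eq with h2 | h2
    · obtain ⟨j, h3, h4, h5, h6⟩ := exists_step (fun j => par C.I x (vec C.I (V j))) hab h1 h2
      exact ⟨j, h3, h4, (hS.cone_iff (by omega) (hx j h3 h4) hd).2 ⟨h5, h6.le⟩⟩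
    · obtain ⟨c, rfl⟩ : ∃ c, b = c + 1 := ⟨b - 1, by omega⟩
      have hc := hx c (by omega) (by omega)
      exact ⟨c, by omega, by omega, (hS.cone_iff (by omega) hc hd).2
        ⟨h2 ▸ (hS.par_lt_next (by omega) hc).le, h2.le⟩⟩
  · rintro ⟨j, h1, h2, h3⟩
    obtain ⟨h4, h5⟩ := (hS.cone_iff (by omega) (hx j h1 h2) hd).1 h3
    constructor
    · rcases h1.lt_or_eq with h6 | rfl
      · exact (hS.par_lt_of_gaps h6 (by omega) fun k h7 h8 => hx k h7 (by omega)).le.trans h4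
      · exact h4
    · rcases (show j + 1 ≤ b from h2).lt_or_eq with h6 | h6
      · exact h5.trans (hS.par_lt_of_gaps h6 hb fun k h7 h8 => hx k (by omega) h8).le
      · rw [← h6]; exact h5

/-- The parts of a segment between different pairs of consecutive vertices do not overlap. -/
theorem Sweep.gaps_disjoint (hS : Sweep C.I C.n V) {j k : ℕ} (hj : j < 2 * C.n) (hk : k < 2 * C.n)
    (hjk : j ≠ k) (hxj : x ∈ Gs C.I C.n (V j)) (hxk : x ∈ Gs C.I C.n (V k)) {t : ℝ}
    (h1 : par C.I x (vec C.I (V j)) ≤ t) (h2 : t < par C.I x (vec C.I (V (j + 1))))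
    (h3 : par C.I x (vec C.I (V k)) ≤ t) (h4 : t < par C.I x (vec C.I (V (k + 1)))) : False := by
  have hX := hS.gen.X_pos (mem_Gs.1 hxj).1
  wlog h5 : par C.I x (vec C.I (V j)) ≤ par C.I x (vec C.I (V k)) generalizing j k
  · exact this hk hj hjk.symm hxk hxj h3 h4 h1 h2 (le_of_not_ge h5)
  obtain ⟨cj, cj'⟩ := hS.cl_of_gap hj hxj
  obtain ⟨ck, -⟩ := hS.cl_of_gap hk hxk
  rw [cl_iff] at cj cj' ck
  have hvk := hS.mem k
  have hvj := hS.mem j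
  rcases h5.lt_or_eq with h6 | h6
  · rw [par_lt_iff hX cj.2.2 ck.2.2, cross_vec] at h6
    have h7 : ¬ par C.I x (vec C.I (V (j + 1))) ≤ par C.I x (vec C.I (V k)) :=
      not_le.mpr (h3.trans_lt h2)
    rw [par_le_iff hX cj'.2.2 ck.2.2, cross_vec] at h7
    rcases hS.next hj hvk.1 hvk.2 (by exact_mod_cast h6) with h8 | h8
    · rw [h8, cr_self] at h7; simp at h7
    · exact h7 (by exact_mod_cast h8.2.le)
  · have h7 := (par_le_iff hX ck.2.2 cj.2.2).1 h6.ge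
    have h8 := (par_le_iff hX cj.2.2 ck.2.2).1 h6.le
    rw [cross_vec] at h7 h8
    rw [cr_swap] at h7
    push_cast at h7
    have h9 : cr C.I (V j) (V k) = 0 := by
      have : (cr C.I (V j) (V k) : ℝ) = 0 := by linarith
      exact_mod_cast this
    rw [hS.gen.cr_eq_zero hvj hvk] at h9
    -- Below `2 * n`, the sequence `V` is injective: vertex `0` recurs only at the index `2 * n`.
    have hz : ∀ l < 2 * C.n, 1 ≤ l → V l ≠ V 0 := fun l hl hl' h => by
      rw [hS.zero, ← hS.last] at h
      have := hS.inj hl' hl.le (by omega) le_rfl h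
      omega
    rcases Nat.eq_zero_or_pos j with rfl | hj0
    · exact hz k hk (by omega) h9.symm
    · rcases Nat.eq_zero_or_pos k with rfl | hk0
      · exact hz j hj hj0 h9
      · exact hjk (hS.inj hj0 hj.le hk0 hk.le h9)

/-- If two pieces shared the positions `t < t'`, then `t` would belong to a half-open gap of each of
them, and these gaps have different indices. -/
theorem Sweep.parts_inter (hS : Sweep C.I C.n V) {a b a' b' : ℕ}
    (hab : a < b) (hb : b ≤ 2 * C.n) (hab' : a' < b') (hb' : b' ≤ 2 * C.n)
    (hx : ∀ j, a ≤ j → j < b → x ∈ Gs C.I C.n (V j))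
    (hx' : ∀ j, a' ≤ j → j < b' → x ∈ Gs C.I C.n (V j)) (hd : b ≤ a' ∨ b' ≤ a) {t t' : ℝ}
    (htt : t < t') (h1 : par C.I x (vec C.I (V a)) ≤ t) (h2 : t' ≤ par C.I x (vec C.I (V b)))
    (h3 : par C.I x (vec C.I (V a')) ≤ t) (h4 : t' ≤ par C.I x (vec C.I (V b'))) : False := by
  obtain ⟨j, j1, j2, j3, j4⟩ := exists_step (fun j => par C.I x (vec C.I (V j))) hab h1 (htt.trans_le h2)
  obtain ⟨k, k1, k2, k3, k4⟩ := exists_step (fun j => par C.I x (vec C.I (V j))) hab' h3 (htt.trans_le h4)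
  exact hS.gaps_disjoint (by omega) (by omega) (by omega) (hx j j1 j2) (hx' k k1 k2) j3 j4 k3 k4

end

end KVis

namespace KVis

/-! ## Windows -/

section
variable {C : Env} {B : Set Pt} {S : Segs C.n} {q : Pt} {V : ℕ → ℤ} {m : ℕ} {x y : ℤ} {d : Pt}
  {i j : Fin C.n} {u : Fin C.n × Bool}

theorem Scene.exists_dir (h : Scene C B S q) (u : Fin C.n × Bool) :
    ∃ r : ℝ, 0 < r ∧ vec C.I (vertexCode u) = r • dir (angle q (S u.1 u.2)) := by
  have h1 : q + vec C.I (vertexCode u) ≠ q := fun h1 => by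
    have h2 : vec C.I (vertexCode u) = 0 := by simpa using h1
    have h3 := h.X_pos u.1
    rw [← cross_sa_sb] at h3
    have h4 := owner C.I (vertexCode u)
    rw [vertexCode_div] at h4
    rcases h4 with h4 | h4
    · rw [← h4, h2] at h3; simp [cross] at h3
    · rw [← h4, h2] at h3; simp [cross] at h3
  obtain ⟨r, hr, h2⟩ := dir_angle h1
  refine ⟨r, hr, ?_⟩
  rw [h.vertex]
  exact add_left_cancel h2

/-- The position of a segment on the ray through a vertex. -/
noncomputable def pos (I : List ℤ) (v x : ℤ) : ℝ := X I x / de I x (vec I v)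

theorem Scene.mem_ray_seg (h : Scene C B S q) (t : ℝ) :
    (0 < t ∧ q + t • vec C.I (vertexCode u) ∈ seg S i) ↔
      Cl C.I (vertexCode u) i ∧ t = pos C.I (vertexCode u) i := by
  have hX := h.X_pos i
  rw [h.mem_seg, al_smul, be_smul, de_smul, cl_iff, pos]
  constructor
  · rintro ⟨ht, h1, h2, h3⟩
    have h4 : 0 < de C.I i (vec C.I (vertexCode u)) := pos_of_mul_pos_right (h3 ▸ hX) ht.le
    exact ⟨⟨nonneg_of_mul_nonneg_right h1 ht, nonneg_of_mul_nonneg_right h2 ht, h4⟩,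
      (eq_div_iff h4.ne').2 h3⟩
  · rintro ⟨⟨h1, h2, h3⟩, rfl⟩
    have := div_pos hX h3
    exact ⟨this, mul_nonneg this.le h1, mul_nonneg this.le h2, div_mul_cancel₀ _ h3.ne'⟩

theorem pos_lt_iff {v : ℤ} (hx : Cl C.I v x) (hy : Cl C.I v y) :
    pos C.I v x < pos C.I v y ↔ Lt C.I v x y := by
  rw [lt_iff, pos, pos, div_lt_div_iff₀ ((cl_iff _ _ _).1 hx).2.2 ((cl_iff _ _ _).1 hy).2.2]

theorem Scene.meetsAt_iff (h : Scene C B S q) {r : ℝ} (hr : 0 < r)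
    (hd : vec C.I (vertexCode u) = r • dir (angle q (S u.1 u.2))) (t : ℝ) :
    MeetsAt S q (angle q (S u.1 u.2)) i t ↔
      Cl C.I (vertexCode u) i ∧ t = r * pos C.I (vertexCode u) i := by
  have h1 := h.mem_ray_seg (u := u) (i := i) (t / r)
  have h2 : (t / r) • vec C.I (vertexCode u) = t • dir (angle q (S u.1 u.2)) := by
    rw [hd, smul_smul, div_mul_cancel₀ _ hr.ne']
  rw [h2, div_pos_iff_of_pos_right hr, div_eq_iff hr.ne', mul_comm _ r] at h1
  exact h1

theorem Scene.before_iff (h : Scene C B S q) :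
    Before S q (angle q (S u.1 u.2)) i j ↔ Cl C.I (vertexCode u) i ∧ Cl C.I (vertexCode u) j ∧
      Lt C.I (vertexCode u) i j := by
  obtain ⟨r, hr, hd⟩ := h.exists_dir u
  unfold Before
  simp only [h.meetsAt_iff hr hd]
  constructor
  · rintro ⟨t, t', ⟨h1, rfl⟩, ⟨h2, rfl⟩, h3⟩
    exact ⟨h1, h2, (pos_lt_iff h1 h2).1 (lt_of_mul_lt_mul_left h3 hr.le)⟩
  · rintro ⟨h1, h2, h3⟩
    exact ⟨_, _, ⟨h1, rfl⟩, ⟨h2, rfl⟩, mul_lt_mul_of_pos_left ((pos_lt_iff h1 h2).2 h3) hr⟩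

theorem Scene.vertex_mem_ray (h : Scene C B S q) (w : Fin C.n × Bool) :
    S w.1 w.2 ∈ ray q (angle q (S u.1 u.2)) ↔ w = u := by
  rw [show S w.1 w.2 = q + vec C.I (vertexCode w) from h.vertex w.1 w.2, h.mem_ray_vertex]
  constructor
  · rintro ⟨t, -, h1⟩
    have h2 : cross (vec C.I (vertexCode w)) (vec C.I (vertexCode u)) = 0 := by
      rw [h1, cross_smul_left, cross_self, mul_zero]
    rw [cross_vec, Int.cast_eq_zero, h.gen.cr_eq_zero (vertexCode_mem w) (vertexCode_mem u)] at h2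
    exact vertexCode_inj.1 h2
  · rintro rfl
    exact ⟨1, one_pos, (one_smul _ _).symm⟩

theorem Scene.mult_eq (h : Scene C B S q) :
    mult S q (angle q (S u.1 u.2)) i = if (i : ℤ) = vertexCode u / 2 then 2 else 1 := by
  classical
  unfold mult
  refine if_congr ?_ rfl rfl
  rw [vertexCode_div]
  constructor
  · rintro ⟨b, hb⟩
    rw [← (h.vertex_mem_ray (i, b)).1 hb]
  · intro h1
    have h2 : i = u.1 := Fin.ext (by exact_mod_cast h1)
    exact ⟨u.2, (h.vertex_mem_ray (i, u.2)).2 (by rw [h2])⟩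

theorem card_fin {n : ℕ} (P : ℤ → Prop) [DecidablePred P] :
    (Finset.univ.filter fun i : Fin n => P i).card = ((Finset.Ico (0 : ℤ) n).filter P).card := by
  rw [← ncard_fin, ← Set.ncard_coe_finset]
  simp

/-- By general position the ray contains one endpoint only, so exactly one segment, the owner
`vertexCode u / 2`, has two entries. -/
theorem Scene.entriesBefore_eq (h : Scene C B S q) (hj : Cl C.I (vertexCode u) j) :
    entriesBefore S q (angle q (S u.1 u.2)) j = rank (Lt C.I (vertexCode u))
      (Cs C.I C.n (vertexCode u)) j + if Lt C.I (vertexCode u) (vertexCode u / 2) j then 1 else 0 := by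
  classical
  have hz : Cl C.I (vertexCode u) (vertexCode u / 2) := by
    have hz0 : 0 ≤ vertexCode u / 2 ∧ vertexCode u / 2 < C.n := by
      have := vertexCode_mem u; omega
    rcases owner C.I (vertexCode u) with h1 | h1
    · have := (h.gen.act_sa hz0).1.cl
      rwa [← h1] at this
    · have := (h.gen.bef_sb hz0).2.cl
      rwa [← h1] at this
  have h1 : ∀ i : Fin C.n, mult S q (angle q (S u.1 u.2)) i = 1 + if i = u.1 then 1 else 0 := by
    intro i
    rw [h.mult_eq, vertexCode_div]
    have : (i : ℤ) = (u.1 : ℤ) ↔ i = u.1 := by rw [Fin.ext_iff]; norm_cast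
    simp only [this]
    split_ifs <;> rfl
  unfold entriesBefore
  simp only [h1, Finset.sum_add_distrib, Finset.sum_const, smul_eq_mul, mul_one,
    Finset.sum_ite_eq', Finset.mem_filter, Finset.mem_univ, true_and, h.before_iff]
  congr 1
  · rw [card_fin (fun x => Cl C.I (vertexCode u) x ∧ Cl C.I (vertexCode u) j ∧
      Lt C.I (vertexCode u) x j), rank, Cs, Finset.filter_filter]
    congr 1
    ext x
    simp only [Finset.mem_filter, hj, true_and]
  · rw [vertexCode_div] at hz ⊢
    simp only [hz, hj, true_and]

end

/-- The segment of the vertex `v` and the other segments that meet the ray through `v`. -/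
noncomputable def others (C : Env) (v : ℤ) : Finset ℤ := (Cs C.I C.n v).erase (v / 2)

section
variable {C : Env} {B : Set Pt} {S : Segs C.n} {q : Pt} {V : ℕ → ℤ} {m : ℕ} {v x y g g' : ℤ}

theorem Gen.cl_owner (h : Gen C.I C.n) (hv : 0 ≤ v ∧ v < 2 * C.n) : Cl C.I v (v / 2) := by
  have hz0 : 0 ≤ v / 2 ∧ v / 2 < C.n := by omega
  rcases owner C.I v with h1 | h1
  · have := (h.act_sa hz0).1.cl
    rwa [← h1] at this
  · have := (h.bef_sb hz0).2.cl
    rwa [← h1] at this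

theorem Gen.strict (h : Gen C.I C.n) (hv : 0 ≤ v ∧ v < 2 * C.n) (hx : 0 ≤ x ∧ x < C.n)
    (hxz : x ≠ v / 2) (hc : Cl C.I v x) : Act C.I v x ∧ Bef C.I v x := by
  have h1 := h.act_iff_bef hv hx hxz
  have : Act C.I v x ∨ Bef C.I v x := by
    unfold Act Bef
    have := hc.1
    have := hc.2.1
    have := hc.2.2
    unfold D at this
    omega
  tauto

theorem Gen.owner_mem (h : Gen C.I C.n) (hv : 0 ≤ v ∧ v < 2 * C.n) : v / 2 ∈ Cs C.I C.n v :=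
  mem_Cs.2 ⟨by omega, h.cl_owner hv⟩

theorem rank_erase (hz : v / 2 ∈ Cs C.I C.n v) (x : ℤ) : rank (Lt C.I v) (Cs C.I C.n v) x =
    rank (Lt C.I v) (others C v) x + if Lt C.I v (v / 2) x then 1 else 0 := by
  classical
  unfold rank others
  rw [Finset.filter_erase]
  split_ifs with h
  · rw [Finset.card_erase_add_one]
    simp [hz, h]
  · rw [Finset.erase_eq_of_notMem, add_zero]
    simp [h]

theorem Sweep.rank_lt (hS : Sweep C.I C.n V) (hx : x ∈ Cs C.I C.n v) (hy : y ∈ Cs C.I C.n v)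
    (h : Lt C.I v x y) : rank (Lt C.I v) (Cs C.I C.n v) x < rank (Lt C.I v) (Cs C.I C.n v) y := by
  classical
  have hl := hS.linOn (v := v) (le_refl (C.n : ℤ))
  refine Finset.card_lt_card ?_
  rw [Finset.ssubset_iff_of_subset]
  · exact ⟨x, by simp [hx, h], by simp [hl.irrefl x hx]⟩
  · intro w hw
    simp only [Finset.mem_filter] at hw ⊢
    exact ⟨hw.1, hl.trans w hw.1 x hx y hy hw.2 h⟩

/-- The first and the second end of a window. -/
theorem Sweep.kth_cases (hS : Sweep C.I C.n V) (hv : 0 ≤ v ∧ v < 2 * C.n)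
    (hz : rank (Lt C.I v) (Cs C.I C.n v) (v / 2) ≤ C.k) :
    (g ∈ Cs C.I C.n v → rank (Lt C.I v) (Cs C.I C.n v) g = C.k → g = v / 2 ∨ Lt C.I v (v / 2) g) ∧
    (g' ∈ others C v → rank (Lt C.I v) (others C v) g' = C.k →
      Lt C.I v (v / 2) g' ∧ rank (Lt C.I v) (Cs C.I C.n v) g' = C.k + 1) := by
  have hl := hS.linOn (v := v) (le_refl (C.n : ℤ))
  have hzA := hS.gen.owner_mem hv
  constructor
  · intro h1 h2
    by_contra! h3
    have h4 := hS.rank_lt h1 hzA ((hl.total _ h1 _ hzA h3.1).resolve_right h3.2)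
    omega
  · intro h1 h2
    obtain ⟨h3, h4⟩ := Finset.mem_erase.1 h1
    have h5 := rank_erase hzA g'
    rcases hl.total _ h4 _ hzA h3 with h6 | h6
    · have := hS.rank_lt h4 hzA h6
      rw [if_neg (hl.asymm h4 hzA h6)] at h5
      omega
    · rw [if_pos h6] at h5
      exact ⟨h6, by omega⟩

/-- Removing the owner of `v` leaves the element of rank `k` in place if the owner comes after it,
and moves it one place on otherwise. So the program recognizes a window by `e` having changed,
without testing the visibility of the endpoint. -/
theorem Sweep.ne_iff_rank_le (hS : Sweep C.I C.n V) (hv : 0 ≤ v ∧ v < 2 * C.n)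
    (hg : g ∈ Cs C.I C.n v) (hgk : rank (Lt C.I v) (Cs C.I C.n v) g = C.k)
    (hg' : g' ∈ others C v) (hgk' : rank (Lt C.I v) (others C v) g' = C.k) :
    g ≠ g' ↔ rank (Lt C.I v) (Cs C.I C.n v) (v / 2) ≤ C.k := by
  have hl := hS.linOn (v := v) (le_refl (C.n : ℤ))
  have hzA := hS.gen.owner_mem hv
  constructor
  · contrapose!
    intro hz
    have h1 : g ≠ v / 2 := by rintro rfl; omega
    have h2 : ¬ Lt C.I v (v / 2) g := fun h => by have := hS.rank_lt hzA hg h; omega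
    have h3 := rank_erase hzA g
    rw [if_neg h2] at h3
    exact IsKth.unique (n := C.n) (k := C.k) (r := Lt C.I v) (G := others C v)
      (.inl ⟨Finset.mem_erase.2 ⟨h1, hg⟩, by omega⟩) (.inl ⟨hg', hgk'⟩) hl (Finset.erase_subset _ _)
      (n_notMem_Cs C v)
  · rintro hz rfl
    have := ((hS.kth_cases (g := 0) hv hz).2 hg' hgk').2
    omega

/-- The segments before and after a vertex are those on its ray without and with its own one, or
the other way around. -/
theorem Sweep.event_cases (hS : Sweep C.I C.n V) (hm : m < 2 * C.n) :
    (first C.I (V (m + 1)) = 1 ∧ V (m + 1) = sa C.I (V (m + 1) / 2) ∧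
      Gs C.I C.n (V m) = others C (V (m + 1)) ∧
      Gs C.I C.n (V (m + 1)) = Cs C.I C.n (V (m + 1))) ∨
    (first C.I (V (m + 1)) = 0 ∧ V (m + 1) = sb C.I (V (m + 1) / 2) ∧
      Gs C.I C.n (V m) = Cs C.I C.n (V (m + 1)) ∧
      Gs C.I C.n (V (m + 1)) = others C (V (m + 1))) := by
  have hv := hS.mem (m + 1)
  have hz0 : 0 ≤ V (m + 1) / 2 ∧ V (m + 1) / 2 < C.n := by omega
  have hP : ∀ x, x ∈ others C (V (m + 1)) ↔ x ≠ V (m + 1) / 2 ∧ (0 ≤ x ∧ x < C.n) ∧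
      Act C.I (V (m + 1)) x ∧ Bef C.I (V (m + 1)) x := fun x => by
    rw [others, Finset.mem_erase, mem_Cs]
    exact ⟨fun h => ⟨h.1, h.2.1, hS.gen.strict hv h.2.1 h.1 h.2.2⟩,
      fun h => ⟨h.1, h.2.1, h.2.2.1.cl⟩⟩
  have hA : ∀ x, x ≠ V (m + 1) / 2 → (x ∈ others C (V (m + 1)) ↔ x ∈ Cs C.I C.n (V (m + 1))) :=
    fun x hx => by rw [others, Finset.mem_erase]; simp [hx]
  have hO : V (m + 1) / 2 ∉ others C (V (m + 1)) := fun h => (Finset.mem_erase.1 h).1 rfl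
  have h1 : ∀ x, x ≠ V (m + 1) / 2 →
      (x ∈ Gs C.I C.n (V m) ↔ x ∈ others C (V (m + 1))) ∧
      (x ∈ Gs C.I C.n (V (m + 1)) ↔ x ∈ others C (V (m + 1))) := fun x hx => by
    rw [mem_Gs_next hS.toOrder hm, mem_Gs, hP]
    have := fun h => hS.gen.act_iff_bef hv (x := x) h hx
    tauto
  have hzA := hS.gen.owner_mem hv
  by_cases hf : V (m + 1) = sa C.I (V (m + 1) / 2)
  · have h2 := hS.gen.act_sa hz0
    rw [← hf] at h2
    refine .inl ⟨if_pos hf, hf, ?_, ?_⟩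
    · ext x
      by_cases hx : x = V (m + 1) / 2
      · rw [hx, mem_Gs_next hS.toOrder hm]
        exact iff_of_false (fun h => h2.2 h.2) hO
      · exact (h1 x hx).1
    · ext x
      by_cases hx : x = V (m + 1) / 2
      · rw [hx, mem_Gs]
        exact iff_of_true ⟨hz0, h2.1⟩ hzA
      · rw [(h1 x hx).2, hA x hx]
  · have hf' := (owner C.I (V (m + 1))).resolve_left hf
    have h2 := hS.gen.bef_sb hz0
    rw [← hf'] at h2
    refine .inr ⟨if_neg hf, hf', ?_, ?_⟩
    · ext x
      by_cases hx : x = V (m + 1) / 2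
      · rw [hx, mem_Gs_next hS.toOrder hm]
        exact iff_of_true ⟨hz0, h2.2⟩ hzA
      · rw [(h1 x hx).1, hA x hx]
    · ext x
      by_cases hx : x = V (m + 1) / 2
      · rw [hx, mem_Gs]
        exact iff_of_false (fun h => h2.1 h.2) hO
      · exact (h1 x hx).2

/-- The ends of the windows, in terms of the segments on the ray. -/
theorem Sweep.win_iff (hS : Sweep C.I C.n V) (hm : m < 2 * C.n) (y τ : ℤ) :
    Win C V m y τ ↔ τ = first C.I (V (m + 1)) ∧ ∃ g g', g ∈ Cs C.I C.n (V (m + 1)) ∧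
      rank (Lt C.I (V (m + 1))) (Cs C.I C.n (V (m + 1))) g = C.k ∧ g' ∈ others C (V (m + 1)) ∧
      rank (Lt C.I (V (m + 1))) (others C (V (m + 1))) g' = C.k ∧ g ≠ g' ∧ (y = g ∨ y = g') := by
  have lt_n : ∀ x, x ∈ Cs C.I C.n (V (m + 1)) → x < C.n := fun x hx => (mem_Cs.1 hx).1.2
  have lt_n' : ∀ x, x ∈ others C (V (m + 1)) → x < C.n := fun x hx =>
    lt_n x (Finset.mem_of_mem_erase hx)
  have kth : ∀ e, Kth C V m e ↔
      IsKth (Lt C.I (V (m + 1))) C.n C.k (Gs C.I C.n (V m)) e := fun e => by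
    refine ⟨kth_next hS hm, fun h => ?_⟩
    rcases h with ⟨h1, h2⟩ | h
    · exact .inl ⟨h1, by rw [← h2]; exact rank_congr fun y hy => lt_next_of_mem hS hm hy h1⟩
    · exact .inr h
  have kth_lt : ∀ {G : Finset ℤ} {e : ℤ}, (∀ x ∈ G, x < C.n) →
      (IsKth (Lt C.I (V (m + 1))) C.n C.k G e ∧ e < C.n ↔
        e ∈ G ∧ rank (Lt C.I (V (m + 1))) G e = C.k) := fun {G e} hG => by
    constructor
    · rintro ⟨h | h, h'⟩
      · exact h
      · omega
    · exact fun h => ⟨.inl h, hG e h.1⟩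
  have h2 : ∀ e, Kth C V (m + 1) e ↔ IsKth (Lt C.I (V (m + 1))) C.n C.k (Gs C.I C.n (V (m + 1))) e :=
    fun e => Iff.rfl
  unfold Win
  simp only [kth, h2]
  -- At a first endpoint the old set is the one without the owner, so the old segment is `g'` and
  -- the new one `g`; at a last endpoint it is the other way around.
  rcases hS.event_cases hm with ⟨-, -, h3, h4⟩ | ⟨-, -, h3, h4⟩ <;> rw [h3, h4]
  · constructor
    · rintro ⟨e, e', q1, q2, q3, q4, q5, q6, q7⟩
      have p1 := (kth_lt lt_n').1 ⟨q1, q3⟩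
      have p2 := (kth_lt lt_n).1 ⟨q2, q4⟩
      exact ⟨q7, e', e, p2.1, p2.2, p1.1, p1.2, q5.symm, q6.symm⟩
    · rintro ⟨q7, e', e, q1, q2, q3, q4, q5, q6⟩
      have p1 := (kth_lt lt_n').2 ⟨q3, q4⟩
      have p2 := (kth_lt lt_n).2 ⟨q1, q2⟩
      exact ⟨e, e', p1.1, p2.1, p1.2, p2.2, q5.symm, q6.symm, q7⟩
  · constructor
    · rintro ⟨e, e', q1, q2, q3, q4, q5, q6, q7⟩
      have p1 := (kth_lt lt_n).1 ⟨q1, q3⟩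
      have p2 := (kth_lt lt_n').1 ⟨q2, q4⟩
      exact ⟨q7, e, e', p1.1, p1.2, p2.1, p2.2, q5, q6⟩
    · rintro ⟨q7, e, e', q1, q2, q3, q4, q5, q6⟩
      have p1 := (kth_lt lt_n).2 ⟨q1, q2⟩
      have p2 := (kth_lt lt_n').2 ⟨q3, q4⟩
      exact ⟨e, e', p1.1, p2.1, p1.2, p2.2, q5, q6, q7⟩

end

end KVis

/-! ### The ends and the types of the windows -/

namespace KVis

section
variable {C : Env} {B : Set Pt} {S : Segs C.n} {q : Pt} {V : ℕ → ℤ} {m : ℕ} {x y v g g' : ℤ} {d : Pt}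
  {u : Fin C.n × Bool}

/-- A vector crosses a segment if it passes between the endpoints and ends beyond it. -/
def Beyond (I : List ℤ) (x : ℤ) (d : Pt) : Prop := 0 < al I x d ∧ 0 < be I x d ∧ X I x < de I x d

theorem de_owner :
    de C.I (v / 2) (vec C.I v) = X C.I (v / 2) := by
  rw [de_vec, D, X]
  rcases owner C.I v with h1 | h1
  · have h2 := cr_self C.I v
    generalize v / 2 = z at *
    subst h1
    rw [cr_self]; simp
  · generalize v / 2 = z at *
    subst h1
    rw [cr_self]; simp

/-- Every other segment that meets the ray meets it in its interior, so the segments crossed on the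
way to the vertex are exactly those before its owner. -/
theorem Scene.kVisible_vertex (h : Scene C B S q) (u : Fin C.n × Bool) :
    KVisible S q C.k (S u.1 u.2) ↔ rank (Lt C.I (vertexCode u)) (Cs C.I C.n (vertexCode u))
      (vertexCode u / 2) ≤ C.k := by
  classical
  have hv := vertexCode_mem u
  have hz : 0 ≤ vertexCode u / 2 ∧ vertexCode u / 2 < C.n := by omega
  have hX : (0 : ℝ) < X C.I (vertexCode u / 2) := by exact_mod_cast h.gen.X_pos hz
  rw [h.vertex, h.kVisible_iff, rank]
  change (Finset.card (Finset.filter _ _)) ≤ _ ↔ _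
  refine iff_of_eq (congrArg (· ≤ C.k) (congrArg Finset.card ?_))
  ext x
  simp only [Finset.mem_filter, Finset.mem_Ico, mem_Cs, lt_iff]
  rw [de_owner, mul_comm, mul_lt_mul_iff_right₀ hX, cl_iff]
  constructor
  · rintro ⟨hx, h1, h2, h3⟩
    exact ⟨⟨hx, h1.le, h2.le, add_pos h1 h2⟩, h3⟩
  · rintro ⟨⟨hx, h1⟩, h2⟩
    have hxz : x ≠ vertexCode u / 2 := by
      rintro rfl
      rw [de_owner] at h2
      exact lt_irrefl _ h2
    have h3 := h.gen.strict hv hx hxz ((cl_iff _ _ _).2 h1)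
    exact ⟨hx, ((bef_iff _ _ _).1 h3.2).1, ((act_iff _ _ _).1 h3.1).2, h2⟩

theorem Scene.isEdge_iff (h : Scene C B S q) (i : Fin C.n) (j : ℕ) :
    IsEdge S q (angle q (S u.1 u.2)) j i ↔ Cl C.I (vertexCode u) i ∧
      rank (Lt C.I (vertexCode u)) (Cs C.I C.n (vertexCode u)) i +
        (if Lt C.I (vertexCode u) (vertexCode u / 2) i then 1 else 0) < j ∧
      j ≤ rank (Lt C.I (vertexCode u)) (Cs C.I C.n (vertexCode u)) i +
        (if Lt C.I (vertexCode u) (vertexCode u / 2) i then 1 else 0) +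
        (if (i : ℤ) = vertexCode u / 2 then 2 else 1) := by
  obtain ⟨r, hr, hd⟩ := h.exists_dir u
  unfold IsEdge
  simp only [h.meetsAt_iff hr hd, exists_and_left, exists_eq, and_true]
  refine and_congr_right fun hc => ?_
  rw [h.entriesBefore_eq hc, h.mult_eq]

theorem Scene.mem_ray_inter_iff (h : Scene C B S q) {i : Fin C.n} (hc : Cl C.I (vertexCode u) i)
    (p : Pt) : p ∈ ray q (angle q (S u.1 u.2)) ∩ seg S i ↔
      p = q + pos C.I (vertexCode u) i • vec C.I (vertexCode u) := by
  obtain ⟨e, rfl⟩ : ∃ e, p = q + e := ⟨p - q, by simp⟩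
  rw [Set.mem_inter_iff, h.mem_ray_vertex]
  constructor
  · rintro ⟨⟨t, ht, rfl⟩, hs⟩
    rw [((h.mem_ray_seg t).1 ⟨ht, hs⟩).2]
  · intro h1
    obtain ⟨h2, h3⟩ := (h.mem_ray_seg (u := u) (i := i) _).2 ⟨hc, rfl⟩
    rw [h1]
    exact ⟨⟨_, h2, add_left_cancel h1 ▸ rfl⟩, h3⟩

/-- The segments `g` and `g'` contain the ends of the window on the ray through the vertex `v`. -/
structure Ends (C : Env) (v g g' : ℤ) : Prop where
  mem : g ∈ Cs C.I C.n v
  rank : rank (Lt C.I v) (Cs C.I C.n v) g = C.k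
  mem' : g' ∈ others C v
  rank' : KVis.rank (Lt C.I v) (others C v) g' = C.k
  ne : g ≠ g'

/-- If the owner of the vertex has rank at most `k`, entry `k + 2` belongs to the segment of rank
`k`, either as the second entry of the owner or shifted by its double entry. Entry `k + 3` belongs
to the segment of rank `k + 1`, which has rank `k` among the others. -/
theorem Scene.isWindow_iff (h : Scene C B S q) (hS : Sweep C.I C.n V) (i j : Fin C.n) (a b : Pt) :
    IsWindow S q C.k (angle q (S u.1 u.2)) i j a b ↔ Ends C (vertexCode u) i j ∧
      a = q + pos C.I (vertexCode u) i • vec C.I (vertexCode u) ∧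
      b = q + pos C.I (vertexCode u) j • vec C.I (vertexCode u) := by
  have hv := vertexCode_mem u
  have hl := hS.linOn (v := vertexCode u) (le_refl (C.n : ℤ))
  have hzA := h.gen.owner_mem hv
  have h1 : (∃ i c, S i c ∈ ray q (angle q (S u.1 u.2)) ∧ KVisible S q C.k (S i c)) ↔
      KVis.rank (Lt C.I (vertexCode u)) (Cs C.I C.n (vertexCode u)) (vertexCode u / 2) ≤ C.k := by
    rw [← h.kVisible_vertex u]
    constructor
    · rintro ⟨i, c, h2, h3⟩
      obtain rfl := (h.vertex_mem_ray (i, c)).1 h2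
      exact h3
    · exact fun h2 => ⟨u.1, u.2, (h.vertex_mem_ray u).2 rfl, h2⟩
  have hirr : ¬ Lt C.I (vertexCode u) (vertexCode u / 2) (vertexCode u / 2) := lt_irrefl' _ _ _
  unfold IsWindow
  rw [h1]
  constructor
  · rintro ⟨hz, hi, hj, ha, hb⟩
    rw [h.isEdge_iff] at hi hj
    have hiA := mem_Cs.2 ⟨fin_mem i, hi.1⟩
    have hjA := mem_Cs.2 ⟨fin_mem j, hj.1⟩
    have hjz : (j : ℤ) ≠ vertexCode u / 2 := fun h2 => by
      rw [h2, if_neg hirr, if_pos rfl] at hj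
      omega
    have e1 : KVis.rank (Lt C.I (vertexCode u)) (Cs C.I C.n (vertexCode u)) i = C.k := by
      by_cases h2 : (i : ℤ) = vertexCode u / 2
      · rw [h2, if_neg hirr, if_pos rfl] at hi
        rw [h2]; omega
      · rw [if_neg h2] at hi
        rcases hl.total _ hiA _ hzA h2 with h3 | h3
        · have := hS.rank_lt hiA hzA h3
          rw [if_neg (hl.asymm hiA hzA h3)] at hi
          omega
        · rw [if_pos h3] at hi
          omega
    have e2 : KVis.rank (Lt C.I (vertexCode u)) (others C (vertexCode u)) j = C.k := by
      have h4 := rank_erase hzA j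
      rw [if_neg hjz] at hj
      rcases hl.total _ hjA _ hzA hjz with h3 | h3
      · have := hS.rank_lt hjA hzA h3
        rw [if_neg (hl.asymm hjA hzA h3)] at hj h4
        omega
      · rw [if_pos h3] at hj h4
        omega
    have hjP : (j : ℤ) ∈ others C (vertexCode u) := Finset.mem_erase.2 ⟨hjz, hjA⟩
    exact ⟨⟨hiA, e1, hjP, e2, (hS.ne_iff_rank_le hv hiA e1 hjP e2).2 hz⟩,
      (h.mem_ray_inter_iff hi.1 a).1 ha, (h.mem_ray_inter_iff hj.1 b).1 hb⟩
  · rintro ⟨he, ha, hb⟩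
    have hz := (hS.ne_iff_rank_le hv he.mem he.rank he.mem' he.rank').1 he.ne
    have hci := (mem_Cs.1 he.mem).2
    have hjA := (Finset.mem_erase.1 he.mem')
    have hcj := (mem_Cs.1 hjA.2).2
    obtain ⟨c1, c2⟩ := hS.kth_cases (g := i) (g' := j) hv hz
    obtain ⟨c3, c4⟩ := c2 he.mem' he.rank'
    refine ⟨hz, ?_, ?_, (h.mem_ray_inter_iff hci a).2 ha, (h.mem_ray_inter_iff hcj b).2 hb⟩
    · rw [h.isEdge_iff, he.rank]
      refine ⟨hci, ?_⟩
      rcases c1 he.mem he.rank with h2 | h2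
      · rw [h2, if_neg hirr, if_pos rfl]; omega
      · have h3 : (i : ℤ) ≠ vertexCode u / 2 := fun h3 => hirr (h3 ▸ h2)
        rw [if_pos h2, if_neg h3]; omega
    · rw [h.isEdge_iff, c4, if_pos c3, if_neg hjA.1]
      exact ⟨hcj, by omega, by omega⟩

/-- The ends have consecutive ranks `k` and `k + 1` on the ray, so no segment meets the ray between
them, and the vertex itself is not behind the first end. -/
theorem Ends.pos_lt (he : Ends C v g g') (hS : Sweep C.I C.n V) (hv : 0 ≤ v ∧ v < 2 * C.n) :
    pos C.I v (v / 2) ≤ pos C.I v g ∧ pos C.I v g < pos C.I v g' ∧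
      ∀ x ∈ Cs C.I C.n v, Lt C.I v x g' → pos C.I v x ≤ pos C.I v g := by
  have hl := hS.linOn (v := v) (le_refl (C.n : ℤ))
  have hzA := hS.gen.owner_mem hv
  have hz := (hS.ne_iff_rank_le hv he.mem he.rank he.mem' he.rank').1 he.ne
  have hg'A := (Finset.mem_erase.1 he.mem').2
  obtain ⟨c1, c2⟩ := hS.kth_cases (g := g) (g' := g') hv hz
  obtain ⟨c3, c4⟩ := c2 he.mem' he.rank'
  have hr := he.rank
  have hcg := (mem_Cs.1 he.mem).2
  refine ⟨?_, ?_, fun x hx hxg => ?_⟩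
  · rcases c1 he.mem he.rank with h2 | h2
    · rw [h2]
    · exact ((pos_lt_iff (mem_Cs.1 hzA).2 hcg).2 h2).le
  · rw [pos_lt_iff hcg (mem_Cs.1 hg'A).2]
    refine (hl.total _ he.mem _ hg'A he.ne).resolve_right fun h => ?_
    have := hS.rank_lt hg'A he.mem h
    omega
  · refine not_lt.mp fun h => ?_
    rw [pos_lt_iff hcg (mem_Cs.1 hx).2] at h
    have h1 := hS.rank_lt he.mem hx h
    have h2 := hS.rank_lt hx hg'A hxg
    omega

theorem pos_pos (h : Gen C.I C.n) (hx : x ∈ Cs C.I C.n v) : 0 < pos C.I v x := by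
  have h1 : (0 : ℝ) < X C.I x := by exact_mod_cast h.X_pos (mem_Cs.1 hx).1
  exact div_pos h1 ((cl_iff _ _ _).1 (mem_Cs.1 hx).2).2.2

open Filter Topology

theorem eventually_al_pos {t : ℝ} (ht : 0 < t) (h : 0 < al C.I x d) :
    ∀ᶠ e in 𝓝 (t • d), 0 < al C.I x e :=
  Tendsto.eventually_const_lt (by rw [al_smul]; positivity) ((continuous_al C.I x).tendsto (t • d))

theorem eventually_be_pos {t : ℝ} (ht : 0 < t) (h : 0 < be C.I x d) :
    ∀ᶠ e in 𝓝 (t • d), 0 < be C.I x e :=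
  Tendsto.eventually_const_lt (by rw [be_smul]; positivity) ((continuous_be C.I x).tendsto (t • d))

theorem eventually_lt_de (hx : x ∈ Cs C.I C.n v) {t : ℝ} (ht : pos C.I v x < t) :
    ∀ᶠ e in 𝓝 (t • vec C.I v), X C.I x < de C.I x e := by
  refine Tendsto.eventually_const_lt ?_ ((continuous_de C.I x).tendsto (t • vec C.I v))
  rw [de_smul]
  exact (div_lt_iff₀ ((cl_iff _ _ _).1 (mem_Cs.1 hx).2).2.2).1 ht

theorem eventually_de_lt (hx : x ∈ Cs C.I C.n v) {t : ℝ} (ht : t < pos C.I v x) :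
    ∀ᶠ e in 𝓝 (t • vec C.I v), de C.I x e < X C.I x := by
  refine Tendsto.eventually_lt_const ?_ ((continuous_de C.I x).tendsto (t • vec C.I v))
  rw [de_smul]
  exact (lt_div_iff₀ ((cl_iff _ _ _).1 (mem_Cs.1 hx).2).2.2).1 ht

/-- Near a point of a window, the same segments are crossed, except for the segment of the
vertex. -/
theorem Ends.eventually_beyond (he : Ends C v g g') (hS : Sweep C.I C.n V)
    (hv : 0 ≤ v ∧ v < 2 * C.n) {t : ℝ} (ht : pos C.I v g < t) (ht' : t < pos C.I v g')
    (hx : 0 ≤ x ∧ x < C.n) (hxz : x ≠ v / 2) :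
    ∀ᶠ d in 𝓝 (t • vec C.I v), Beyond C.I x d ↔ x ∈ others C v ∧ Lt C.I v x g' := by
  have h0 : 0 < t := (pos_pos hS.gen he.mem).trans ht
  have hl := hS.linOn (v := v) (le_refl (C.n : ℤ))
  have hg'A := (Finset.mem_erase.1 he.mem').2
  by_cases hA : x ∈ Cs C.I C.n v
  · have hP : x ∈ others C v := Finset.mem_erase.2 ⟨hxz, hA⟩
    have hc := (mem_Cs.1 hA).2
    obtain ⟨h1, h2⟩ := hS.gen.strict hv hx hxz hc
    by_cases hlt : Lt C.I v x g'
    · filter_upwards [eventually_al_pos h0 ((bef_iff _ _ _).1 h2).1,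
        eventually_be_pos h0 ((act_iff _ _ _).1 h1).2,
        eventually_lt_de hA (((he.pos_lt hS hv).2.2 x hA hlt).trans_lt ht)] with d d1 d2 d3
      exact iff_of_true ⟨d1, d2, d3⟩ ⟨hP, hlt⟩
    · have h3 : pos C.I v g' ≤ pos C.I v x := not_lt.mp fun h =>
        hlt ((pos_lt_iff hc (mem_Cs.1 hg'A).2).1 h)
      filter_upwards [eventually_de_lt hA (ht'.trans_le h3)] with d d1
      exact iff_of_false (fun h => lt_asymm d1 h.2.2) fun h => hlt h.2
  · have h1 : al C.I x (vec C.I v) < 0 ∨ be C.I x (vec C.I v) < 0 := by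
      by_contra! h
      refine hA (mem_Cs.2 ⟨hx, (cl_iff _ _ _).2 ⟨h.1, h.2, ?_⟩⟩)
      refine (add_nonneg h.1 h.2).lt_of_ne fun h2 => ?_
      have h3 : al C.I x (vec C.I v) = 0 := by linarith [h.1, h.2]
      rw [al_vec, Int.cast_eq_zero, hS.gen.cr_eq_zero (sa_mem C.I hx) hv] at h3
      exact hxz (eq_owner (.inl h3.symm))
    have hnot : ¬ (x ∈ others C v ∧ Lt C.I v x g') := fun h => hA (Finset.mem_of_mem_erase h.1)
    rcases h1 with h1 | h1
    · filter_upwards [Tendsto.eventually_lt_const (u := 0) (by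
        rw [al_smul]; exact mul_neg_of_pos_of_neg h0 h1) ((continuous_al C.I x).tendsto
          (t • vec C.I v))] with d d1
      exact iff_of_false (fun h => lt_asymm d1 h.1) hnot
    · filter_upwards [Tendsto.eventually_lt_const (u := 0) (by
        rw [be_smul]; exact mul_neg_of_pos_of_neg h0 h1) ((continuous_be C.I x).tendsto
          (t • vec C.I v))] with d d1
      exact iff_of_false (fun h => lt_asymm d1 h.2.1) hnot

/-- Whether the region near a point of a window lies to the left of its ray. -/
theorem Ends.eventually_kVisible (he : Ends C v g g') (h : Scene C B S q) (hS : Sweep C.I C.n V)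
    (hv : 0 ≤ v ∧ v < 2 * C.n) {t : ℝ} (ht : pos C.I v g < t) (ht' : t < pos C.I v g') :
    ∀ᶠ d in 𝓝 (t • vec C.I v), 0 < cross (vec C.I v) d →
      (KVisible S q C.k (q + d) ↔ v ≠ sa C.I (v / 2)) := by
  classical
  have h0 : 0 < t := (pos_pos hS.gen he.mem).trans ht
  have hz : 0 ≤ v / 2 ∧ v / 2 < C.n := by omega
  have hzA := hS.gen.owner_mem hv
  have hX : (0 : ℝ) < X C.I (v / 2) := by exact_mod_cast h.gen.X_pos hz
  have h1 : ∀ᶠ d in 𝓝 (t • vec C.I v), ∀ x ∈ (Finset.Ico (0 : ℤ) C.n).erase (v / 2),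
      (Beyond C.I x d ↔ x ∈ others C v ∧ Lt C.I v x g') := by
    rw [eventually_all_finset]
    intro x hx
    rw [Finset.mem_erase, Finset.mem_Ico] at hx
    exact he.eventually_beyond hS hv ht ht' hx.2 hx.1
  -- Immediately to the left of the ray, and beyond the vertex, the owner is crossed exactly if it
  -- extends to the left, that is, if `v` is its first endpoint.
  have h2 : ∀ᶠ d in 𝓝 (t • vec C.I v), 0 < cross (vec C.I v) d →
      (Beyond C.I (v / 2) d ↔ v = sa C.I (v / 2)) := by
    rcases owner C.I v with ho | ho
    · have hb : 0 < be C.I (v / 2) (vec C.I v) := by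
        have := (hS.gen.act_sa hz).1
        rw [← ho, act_iff] at this
        exact this.2
      filter_upwards [eventually_be_pos h0 hb,
        eventually_lt_de hzA ((he.pos_lt hS hv).1.trans_lt ht)] with d d1 d2 d3
      refine iff_of_true ⟨?_, d1, d2⟩ ho
      rw [al, ← ho]
      exact d3
    · refine Eventually.of_forall fun d d1 => iff_of_false (fun h2 => ?_) fun h2 => ?_
      · have h3 := h2.2.1
        rw [be, ← ho, cross_swap] at h3
        linarith
      · have := (sa_sb C.I (v / 2))
        omega
  filter_upwards [h1, h2] with d d1 d2 d3
  rw [h.kVisible_iff]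
  -- Without the owner there are exactly `k` crossings near a point of the window, so the owner
  -- alone decides about visibility.
  have hcard : ((others C v).filter fun x => Lt C.I v x g').card = C.k := by
    rw [← he.rank', KVis.rank]
    congr 1
    ext x
    simp
  have hnot : v / 2 ∉ (others C v).filter fun x => Lt C.I v x g' := fun h3 =>
    (Finset.mem_erase.1 (Finset.mem_filter.1 h3).1).1 rfl
  have hsub : ∀ x ∈ others C v, 0 ≤ x ∧ x < C.n := fun x hx =>
    (mem_Cs.1 (Finset.mem_of_mem_erase hx)).1
  by_cases hs : v = sa C.I (v / 2)
  · have h3 : ((Finset.Ico (0 : ℤ) C.n).filter fun x =>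
        0 < al C.I x d ∧ 0 < be C.I x d ∧ X C.I x < de C.I x d) =
        insert (v / 2) ((others C v).filter fun x => Lt C.I v x g') := by
      ext x
      rw [Finset.mem_filter, Finset.mem_insert, Finset.mem_filter, Finset.mem_Ico]
      by_cases hx : x = v / 2
      · rw [hx]
        exact iff_of_true ⟨hz, (d2 d3).2 hs⟩ (.inl rfl)
      · constructor
        · exact fun h3 => .inr ((d1 x (by simp [hx, h3.1])).1 h3.2)
        · intro h3
          have h4 := h3.resolve_left hx
          have h5 := hsub x h4.1
          exact ⟨h5, (d1 x (by simp [hx, h5])).2 h4⟩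
    rw [h3, Finset.card_insert_of_notMem hnot, hcard]
    exact iff_of_false (by omega) (by simpa using hs)
  · have h3 : ((Finset.Ico (0 : ℤ) C.n).filter fun x =>
        0 < al C.I x d ∧ 0 < be C.I x d ∧ X C.I x < de C.I x d) =
        (others C v).filter fun x => Lt C.I v x g' := by
      ext x
      rw [Finset.mem_filter, Finset.mem_filter, Finset.mem_Ico]
      by_cases hx : x = v / 2
      · rw [hx]
        exact iff_of_false (fun h3 => hs ((d2 d3).1 h3.2)) fun h3 => hnot (Finset.mem_filter.2 h3)
      · constructor
        · exact fun h3 => (d1 x (by simp [hx, h3.1])).1 h3.2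
        · intro h4
          have h5 := hsub x h4.1
          exact ⟨h5, (d1 x (by simp [hx, h5])).2 h4⟩
    rw [h3, hcard]
    exact iff_of_true le_rfl hs

/-- The points between the query point and a segment belong to the box. -/
theorem Scene.mem_box (h : Scene C B S q) (hB : Convex ℝ B) (i : Fin C.n) (ha : 0 < al C.I i d)
    (hb : 0 < be C.I i d) (hd : de C.I i d < X C.I i) : q + d ∈ B := by
  have hX := h.X_pos i
  have h0 : 0 < de C.I i d := add_pos ha hb
  have h1 : q + ((X C.I i : ℝ) / de C.I i d) • d ∈ seg S i := by
    rw [h.mem_seg, al_smul, be_smul, de_smul]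
    exact ⟨by positivity, by positivity, div_mul_cancel₀ _ h0.ne'⟩
  have h2 : de C.I i d / X C.I i ≤ 1 := (div_le_one hX).2 hd.le
  -- The point lies between `q` and the point at which its ray hits the segment; both are in the
  -- convex box.
  have h3 := hB h.valid.query (h.valid.inBox i h1) (sub_nonneg.2 h2)
    (show 0 ≤ de C.I i d / X C.I i by positivity) (by ring)
  convert h3 using 1
  rw [smul_add, smul_smul, show de C.I i d / X C.I i * (X C.I i / de C.I i d) = 1 by field_simp]
  module

theorem Scene.leftOf_iff (h : Scene C B S q) (d : Pt) :
    LeftOf q (angle q (S u.1 u.2)) (q + d) ↔ 0 < cross (vec C.I (vertexCode u)) d := by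
  obtain ⟨r, hr, hd⟩ := h.exists_dir u
  rw [hd, cross_smul_left, mul_pos_iff_of_pos_left hr]
  simp [LeftOf, cross]

/-- The type of a window. -/
theorem Scene.regionOnLeft_iff (h : Scene C B S q) (hS : Sweep C.I C.n V) (hB : Convex ℝ B)
    {i j : Fin C.n} (he : Ends C (vertexCode u) i j) :
    RegionOnLeft B S q C.k (angle q (S u.1 u.2))
      (q + pos C.I (vertexCode u) i • vec C.I (vertexCode u))
      (q + pos C.I (vertexCode u) j • vec C.I (vertexCode u)) ↔
    vertexCode u ≠ sa C.I (vertexCode u / 2) := by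
  have hv := vertexCode_mem u
  have hlt := (he.pos_lt hS hv).2.1
  constructor
  · intro hR
    obtain ⟨t, ht, ht'⟩ := exists_between hlt
    have hp : q + t • vec C.I (vertexCode u) ∈ openSegment ℝ
        (q + pos C.I (vertexCode u) i • vec C.I (vertexCode u))
        (q + pos C.I (vertexCode u) j • vec C.I (vertexCode u)) := by
      obtain ⟨a, b, ha, hb, hab, e⟩ : t ∈ openSegment ℝ (pos C.I (vertexCode u) i)
          (pos C.I (vertexCode u) j) := by
        rw [openSegment_eq_Ioo hlt]; exact ⟨ht, ht'⟩
      refine ⟨a, b, ha, hb, hab, ?_⟩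
      rw [← e]
      have : ∀ x y : ℝ, a • (q + x • vec C.I (vertexCode u)) + b • (q + y • vec C.I (vertexCode u)) =
        (a + b) • q + (a • x + b • y) • vec C.I (vertexCode u) := fun x y => by
          simp only [smul_eq_mul]; module
      rw [this, hab, one_smul]
    have h1 : ∀ᶠ d in 𝓝 (t • vec C.I (vertexCode u)), 0 < cross (vec C.I (vertexCode u)) d →
        KVisible S q C.k (q + d) := by
      have h2 : Tendsto (fun d : Pt => q + d) (𝓝 (t • vec C.I (vertexCode u)))
          (𝓝 (q + t • vec C.I (vertexCode u))) := (continuous_const.add continuous_id).tendsto _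
      filter_upwards [h2.eventually (hR _ hp)] with d hd hd'
      exact (hd ((h.leftOf_iff d).2 hd')).2
    -- The vector `w` is the ray direction turned left by a right angle. Small steps along it
    -- produce a point on the left at which both local statements apply.
    obtain ⟨w, hw⟩ : ∃ w : Pt, w = (-(vec C.I (vertexCode u)).2, (vec C.I (vertexCode u)).1) :=
      ⟨_, rfl⟩
    have hwp : 0 < cross (vec C.I (vertexCode u)) w := by
      have h3 : (vec C.I (vertexCode u)) ≠ 0 :=
        ne_zero_of_de (((cl_iff _ _ _).1 (mem_Cs.1 he.mem).2).2.2)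
      have h4 : (vec C.I (vertexCode u)).1 ≠ 0 ∨ (vec C.I (vertexCode u)).2 ≠ 0 := by
        by_contra! h4
        exact h3 (Prod.ext h4.1 h4.2)
      rw [hw, cross]
      dsimp only
      rcases h4 with h4 | h4
      · nlinarith [mul_self_pos.2 h4, mul_self_nonneg (vec C.I (vertexCode u)).2]
      · nlinarith [mul_self_pos.2 h4, mul_self_nonneg (vec C.I (vertexCode u)).1]
    have h5 : Tendsto (fun ε : ℝ => t • vec C.I (vertexCode u) + ε • w) (𝓝[>] 0)
        (𝓝 (t • vec C.I (vertexCode u))) := by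
      have : Continuous fun ε : ℝ => t • vec C.I (vertexCode u) + ε • w := by fun_prop
      have h6 := this.tendsto 0
      simp only [zero_smul, add_zero] at h6
      exact h6.mono_left nhdsWithin_le_nhds
    obtain ⟨ε, hε, h6, h7⟩ := ((eventually_mem_nhdsWithin (s := Set.Ioi (0 : ℝ)) (a := 0)).and
      ((h5.eventually h1).and (h5.eventually (he.eventually_kVisible h hS hv ht ht')))).exists
    have h8 : 0 < cross (vec C.I (vertexCode u)) (t • vec C.I (vertexCode u) + ε • w) := by
      rw [cross_add_right, cross_smul_right, cross_smul_right, cross_self, mul_zero, zero_add]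
      exact mul_pos hε hwp
    exact (h7 h8).1 (h6 h8)
  · rintro hs p ⟨a, b, ha, hb, hab, rfl⟩
    obtain ⟨t, ht⟩ : ∃ t, t = a * pos C.I (vertexCode u) i + b * pos C.I (vertexCode u) j :=
      ⟨_, rfl⟩
    have e1 : a • (q + pos C.I (vertexCode u) i • vec C.I (vertexCode u)) +
        b • (q + pos C.I (vertexCode u) j • vec C.I (vertexCode u)) =
        q + t • vec C.I (vertexCode u) := by
      have : ∀ x y : ℝ, a • (q + x • vec C.I (vertexCode u)) + b • (q + y • vec C.I (vertexCode u)) =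
        (a + b) • q + (a * x + b * y) • vec C.I (vertexCode u) := fun x y => by module
      rw [this, hab, one_smul, ht]
    rw [e1]
    have ht1 : pos C.I (vertexCode u) i < t := by
      rw [ht, show a = 1 - b by linarith]; nlinarith
    have ht2 : t < pos C.I (vertexCode u) j := by
      rw [ht, show b = 1 - a by linarith]; nlinarith
    obtain ⟨hjz, hjA⟩ := Finset.mem_erase.1 he.mem'
    obtain ⟨h1, h2⟩ := hS.gen.strict hv (fin_mem j) hjz (mem_Cs.1 hjA).2
    have h0 : 0 < t := (pos_pos hS.gen he.mem).trans ht1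
    have h3 : Tendsto (fun x : Pt => x - q) (𝓝 (q + t • vec C.I (vertexCode u)))
        (𝓝 (t • vec C.I (vertexCode u))) := by
      have h4 : Continuous fun x : Pt => x - q := by fun_prop
      have h5 := h4.tendsto (q + t • vec C.I (vertexCode u))
      rwa [add_sub_cancel_left] at h5
    filter_upwards [h3.eventually (eventually_al_pos h0 ((bef_iff _ _ _).1 h2).1),
      h3.eventually (eventually_be_pos h0 ((act_iff _ _ _).1 h1).2),
      h3.eventually (eventually_de_lt hjA ht2),
      h3.eventually (he.eventually_kVisible h hS hv ht1 ht2)] with x x1 x2 x3 x4 x5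
    have e2 : x = q + (x - q) := by abel
    rw [e2] at x5 ⊢
    exact ⟨h.mem_box hB j x1 x2 x3, (x4 ((h.leftOf_iff _).1 x5)).2 hs⟩

end

end KVis

namespace KVis

/-! ## The output -/

theorem WinType.code_inj {τ τ' : WinType} : τ.code = τ'.code ↔ τ = τ' := by
  cases τ <;> cases τ' <;> simp [WinType.code]

theorem Item.words_injective {n : ℕ} : Function.Injective (Item.words (n := n)) := by
  intro a b h
  cases a <;> cases b <;>
    simp_all [Item.words, vertexCode_inj, WinType.code_inj, Fin.ext_iff]

section
variable {C : Env} {B : Set Pt} {S : Segs C.n} {q : Pt} {V : ℕ → ℤ} {l : ℕ → ℕ} {L : List Entry}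

theorem first_eq_iff (I : List ℤ) (v : ℤ) (τ : WinType) :
    τ.code = first I v ↔ (τ = WinType.ccw ↔ v ≠ sa I (v / 2)) := by
  unfold first
  generalize sa I (v / 2) = w
  split_ifs with h <;> cases τ <;> simp [WinType.code, h]

theorem Scene.mem_windowEnds_iff (h : Scene C B S q) (hS : Sweep C.I C.n V) (hB : Convex ℝ B)
    {m : ℕ} (hm : m < 2 * C.n) {u : Fin C.n × Bool} (hu : vertexCode u = V (m + 1)) (j : Fin C.n)
    (τ : WinType) :
    (angle q (S u.1 u.2), j, τ) ∈ windowEnds B S q C.k ↔ Win C V m j τ.code := by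
  rw [hS.win_iff hm, ← hu, first_eq_iff]
  constructor
  · rintro ⟨-, g, g', a, b, hw, hj, ht⟩
    obtain ⟨he, rfl, rfl⟩ := (h.isWindow_iff hS g g' a b).1 hw
    refine ⟨ht.trans (h.regionOnLeft_iff hS hB he), g, g', he.mem, he.rank, he.mem', he.rank', he.ne,
      ?_⟩
    rcases hj with hj | hj
    · exact .inl (congrArg (fun i : Fin C.n => (i : ℤ)) hj)
    · exact .inr (congrArg (fun i : Fin C.n => (i : ℤ)) hj)
  · rintro ⟨ht, g, g', h1, h2, h3, h4, h5, h6⟩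
    have hg := (mem_Cs.1 h1).1
    have hg' := (mem_Cs.1 (Finset.mem_of_mem_erase h3)).1
    obtain ⟨g, rfl⟩ := exists_fin hg.1 hg.2
    obtain ⟨g', rfl⟩ := exists_fin hg'.1 hg'.2
    have he : Ends C (vertexCode u) g g' := ⟨h1, h2, h3, h4, h5⟩
    refine ⟨angle_mem _ _, g, g', _, _, (h.isWindow_iff hS g g' _ _).2 ⟨he, rfl, rfl⟩, ?_,
      ht.trans (h.regionOnLeft_iff hS hB he).symm⟩
    rcases h6 with h6 | h6
    · exact .inl (Fin.ext (by exact_mod_cast h6))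
    · exact .inr (Fin.ext (by exact_mod_cast h6))

variable {M : List (Item C.n)}

theorem mem_window_iff (hR : Reported C V (2 * C.n) l L)
    (hM : ∀ t, t ∈ M ↔ ∃ e ∈ L, t.words = Entry.words V e) (u : Fin C.n × Bool) (j : Fin C.n)
    (τ : WinType) : Item.window u j τ ∈ M ↔
      ∃ m < 2 * C.n, vertexCode u = V (m + 1) ∧ Win C V m j τ.code := by
  rw [hM]
  constructor
  · rintro ⟨⟨m, y, τ'⟩ | ⟨x, a, b⟩, he, hw⟩
    · simp only [Item.words, Entry.words, List.cons.injEq, and_true, true_and] at hw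
      obtain ⟨h1, h2, h3⟩ := hw
      subst h2 h3
      exact ⟨m, ((hR.win _ _ _).1 he).1, h1, ((hR.win _ _ _).1 he).2⟩
    · simp [Item.words, Entry.words] at hw
  · rintro ⟨m, hm, h1, h2⟩
    exact ⟨.inl (m, j, τ.code), (hR.win _ _ _).2 ⟨hm, h2⟩, by simp [Item.words, Entry.words, h1]⟩

theorem mem_part_iff (hM : ∀ t, t ∈ M ↔ ∃ e ∈ L, t.words = Entry.words V e) (i : Fin C.n)
    (u w : Fin C.n × Bool) : Item.part i u w ∈ M ↔
      ∃ a b, .inr ((i : ℤ), a, b) ∈ L ∧ vertexCode u = V a ∧ vertexCode w = V b := by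
  rw [hM]
  constructor
  · rintro ⟨⟨m, y, τ'⟩ | ⟨x, a, b⟩, he, hw⟩
    · simp [Item.words, Entry.words] at hw
    · simp only [Item.words, Entry.words, List.cons.injEq, and_true, true_and] at hw
      obtain ⟨h1, h2, h3⟩ := hw
      subst h1
      exact ⟨a, b, he, h2, h3⟩
  · rintro ⟨a, b, he, h1, h2⟩
    exact ⟨_, he, by simp [Item.words, Entry.words, h1, h2]⟩

/-- The facts about a reported part of a segment. -/
structure PartData (C : Env) (V : ℕ → ℤ) (i : Fin C.n) (u w : Fin C.n × Bool) (a b : ℕ) : Prop where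
  left : vertexCode u = V a
  right : vertexCode w = V b
  lt : a < b
  le : b ≤ 2 * C.n
  vis : ∀ j, a ≤ j → j < b → Vis C V j i

theorem Reported.partData (hR : Reported C V (2 * C.n) l L) (hl : ∀ b < C.s, l b = 2 * C.n)
    {i : Fin C.n} {u w : Fin C.n × Bool} {a b : ℕ} (he : .inr ((i : ℤ), a, b) ∈ L)
    (hu : vertexCode u = V a) (hw : vertexCode w = V b) : PartData C V i u w a b := by
  obtain ⟨h1, h2, h3, h4⟩ := hR.part _ _ _ he
  rw [hl _ (Env.blk_lt h1.1 h1.2.le)] at h3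
  exact ⟨hu, hw, h2, h3, h4⟩

section
variable {i : Fin C.n} {u w u' w' : Fin C.n × Bool} {a b a' b' : ℕ}

theorem PartData.cl (hp : PartData C V i u w a b) (hS : Sweep C.I C.n V) :
    Cl C.I (vertexCode u) i ∧ Cl C.I (vertexCode w) i := by
  have h1 := hp.lt
  have h2 := hp.le
  refine ⟨?_, ?_⟩
  · rw [hp.left]
    exact (hS.cl_of_gap (by omega) (hp.vis a le_rfl h1).1).1
  · have := (hS.cl_of_gap (m := b - 1) (by omega) (hp.vis (b - 1) (by omega) (by omega)).1).2
    rwa [Nat.sub_add_cancel (by omega), ← hp.right] at this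

theorem PartData.par_lt (hp : PartData C V i u w a b) (hS : Sweep C.I C.n V) :
    par C.I i (vec C.I (vertexCode u)) < par C.I i (vec C.I (vertexCode w)) := by
  rw [hp.left, hp.right]
  exact hS.par_lt_of_gaps hp.lt hp.le fun j h1 h2 => (hp.vis j h1 h2).1

theorem PartData.mem_piece (hp : PartData C V i u w a b) (h : Scene C B S q)
    (hS : Sweep C.I C.n V) (d : Pt) : q + d ∈ piece S q i u w ↔ q + d ∈ seg S i ∧
      par C.I i (vec C.I (vertexCode u)) ≤ par C.I i d ∧
        par C.I i d ≤ par C.I i (vec C.I (vertexCode w)) :=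
  h.mem_piece (hp.cl hS).1 (hp.cl hS).2 (hp.par_lt hS).le d

theorem PartData.mem_piece_iff (hp : PartData C V i u w a b) (h : Scene C B S q)
    (hS : Sweep C.I C.n V) (d : Pt) : q + d ∈ piece S q i u w ↔ q + d ∈ seg S i ∧
      ∃ j, a ≤ j ∧ j < b ∧ Cone C.I V j d := by
  rw [hp.mem_piece h hS]
  refine and_congr_right fun hd => ?_
  rw [hp.left, hp.right]
  refine hS.between_iff hp.lt hp.le (fun j h1 h2 => (hp.vis j h1 h2).1) ?_
  rw [((h.mem_seg i d).1 hd).2.2]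
  exact h.X_pos i

theorem PartData.inter_subsingleton (hp : PartData C V i u w a b) (hp' : PartData C V i u' w' a' b')
    (h : Scene C B S q) (hS : Sweep C.I C.n V) (hd : b ≤ a' ∨ b' ≤ a) :
    (piece S q i u w ∩ piece S q i u' w').Subsingleton := by
  have key : ∀ d d' : Pt, q + d ∈ piece S q i u w ∩ piece S q i u' w' →
      q + d' ∈ piece S q i u w ∩ piece S q i u' w' → par C.I i d < par C.I i d' → False := by
    rintro d d' ⟨h1, h2⟩ ⟨h3, h4⟩ hlt
    rw [hp.mem_piece h hS, hp.left, hp.right] at h1 h3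
    rw [hp'.mem_piece h hS, hp'.left, hp'.right] at h2 h4
    exact hS.parts_inter hp.lt hp.le hp'.lt hp'.le (fun j h1 h2 => (hp.vis j h1 h2).1)
      (fun j h1 h2 => (hp'.vis j h1 h2).1) hd hlt h1.2.1 h3.2.2 h2.2.1 h4.2.2
  intro p hp1 p' hp2
  obtain ⟨d, rfl⟩ : ∃ d, p = q + d := ⟨p - q, by simp⟩
  obtain ⟨d', rfl⟩ : ∃ d, p' = q + d := ⟨p' - q, by simp⟩
  rw [h.eq_line ((hp.mem_piece h hS d).1 hp1.1).1, h.eq_line ((hp.mem_piece h hS d').1 hp2.1).1]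
  rcases lt_trichotomy (par C.I i d) (par C.I i d') with h1 | h1 | h1
  · exact (key _ _ hp1 hp2 h1).elim
  · rw [h1]
  · exact (key _ _ hp2 hp1 h1).elim

end

theorem Scene.isReport (h : Scene C B S q) (hS : Sweep C.I C.n V) (hB : Convex ℝ B)
    (hl : ∀ b < C.s, l b = 2 * C.n) (hR : Reported C V (2 * C.n) l L) (hn : M.Nodup)
    (hM : ∀ t, t ∈ M ↔ ∃ e ∈ L, t.words = Entry.words V e) : IsReport B S q C.k M where
  nodup := hn
  windows θ j τ := by
    simp only [mem_window_iff hR hM]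
    constructor
    · intro hx
      obtain ⟨hθ, g, g', a, b, ⟨⟨i, c, hi, -⟩, -⟩, -⟩ := id hx
      have hu := vertexCode_mem (i, c)
      obtain ⟨m, h1, h2, h3⟩ := hS.surj _ hu.1 hu.2
      obtain rfl := eq_angle hθ hi
      obtain ⟨m, rfl⟩ := Nat.exists_eq_add_of_le' h1
      exact ⟨(i, c), ⟨m, by omega, h3.symm,
        (h.mem_windowEnds_iff hS hB (u := (i, c)) (by omega) h3.symm j τ).1 hx⟩, rfl⟩
    · rintro ⟨u, ⟨m, hm, hu, hw⟩, rfl⟩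
      exact (h.mem_windowEnds_iff hS hB hm hu j τ).2 hw
  meets i u w hp := by
    obtain ⟨a, b, he, hu, hw⟩ := (mem_part_iff hM i u w).1 hp
    have hd := hR.partData hl he hu hw
    refine ⟨?_, ⟨_, (h.mem_ray_inter (hd.cl hS).1 _).2 rfl⟩,
      ⟨_, (h.mem_ray_inter (hd.cl hS).2 _).2 rfl⟩⟩
    rintro rfl
    exact (hd.par_lt hS).false
  parts i p := by
    obtain ⟨d, rfl⟩ : ∃ d, p = q + d := ⟨p - q, by simp⟩
    simp only [mem_part_iff hM]
    constructor
    · rintro ⟨hd, -, hv⟩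
      obtain ⟨m, hm, hv, hc⟩ := h.exists_vis hS hd hv
      have hi := fin_mem i
      obtain ⟨a, b, he, ha, hb⟩ := hR.cover i m hi.1 hi.2
        (by rwa [hl _ (Env.blk_lt hi.1 hi.2.le)]) hv
      obtain ⟨u, hu⟩ := exists_vertexCode (hS.mem a)
      obtain ⟨w, hw⟩ := exists_vertexCode (hS.mem b)
      exact ⟨u, w, ⟨a, b, he, hu, hw⟩, ((hR.partData hl he hu hw).mem_piece_iff h hS d).2
        ⟨hd, m, ha, hb, hc⟩⟩
    · rintro ⟨u, w, ⟨a, b, he, hu, hw⟩, hp⟩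
      have hd := hR.partData hl he hu hw
      obtain ⟨h1, j, h2, h3, h4⟩ := (hd.mem_piece_iff h hS d).1 hp
      exact ⟨h1, h.valid.inBox i h1,
        h.visible_of_vis hS (h3.trans_le hd.le) h1 (hd.vis j h2 h3) h4⟩
  noOverlap i u w u' w' hp hp' hne := by
    obtain ⟨a, b, he, hu, hw⟩ := (mem_part_iff hM i u w).1 hp
    obtain ⟨a', b', he', hu', hw'⟩ := (mem_part_iff hM i u' w').1 hp'
    refine (hR.partData hl he hu hw).inter_subsingleton (hR.partData hl he' hu' hw') h hS ?_
    refine (hR.disj _ _ _ _ _ he he').resolve_left ?_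
    rintro ⟨rfl, rfl⟩
    exact hne (Prod.ext (vertexCode_inj.1 (hu.trans hu'.symm)) (vertexCode_inj.1 (hw.trans hw'.symm)))

/-- The start of a piece may be `V 0 = V (2 * n)`, so its words do not determine the index. The end
has a positive index, which is determined, and two pieces of a segment with the same end coincide
because pieces do not overlap. -/
theorem Reported.words_injOn (hR : Reported C V (2 * C.n) l L) (hS : Sweep C.I C.n V)
    (hl : ∀ b < C.s, l b = 2 * C.n) : ∀ e ∈ L, ∀ e' ∈ L, Entry.words V e = Entry.words V e' →
      e = e' := by
  rintro (⟨m, y, τ⟩ | ⟨x, a, b⟩) he (⟨m', y', τ'⟩ | ⟨x', a', b'⟩) he' hw <;>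
    simp only [Entry.words, List.cons.injEq, and_true, true_and, zero_ne_one, one_ne_zero,
      false_and] at hw
  · obtain ⟨h1, rfl, rfl⟩ := hw
    have h2 := ((hR.win _ _ _).1 he).1
    have h3 := ((hR.win _ _ _).1 he').1
    have := hS.inj (by omega) (by omega) (by omega) (by omega) h1
    rw [Nat.succ_injective this]
  · obtain ⟨rfl, -, h1⟩ := hw
    obtain ⟨hx, h2, h3, -⟩ := hR.part _ _ _ he
    obtain ⟨-, h4, h5, -⟩ := hR.part _ _ _ he'
    rw [hl _ (Env.blk_lt hx.1 hx.2.le)] at h3 h5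
    have := hS.inj (by omega) (by omega) (by omega) (by omega) h1
    rcases hR.disj _ _ _ _ _ he he' with h6 | h6 | h6
    · rw [h6.1, h6.2]
    · omega
    · omega

theorem Reported.exists_item (hR : Reported C V (2 * C.n) l L) (hS : Sweep C.I C.n V) :
    ∀ e ∈ L, ∃ t : Item C.n, t.words = Entry.words V e := by
  rintro (⟨m, y, τ⟩ | ⟨x, a, b⟩) he
  · obtain ⟨hm, hw⟩ := (hR.win _ _ _).1 he
    obtain ⟨ht, g, g', h1, -, h3, -, -, hy⟩ := (hS.win_iff hm y τ).1 hw
    obtain ⟨u, hu⟩ := exists_vertexCode (hS.mem (m + 1))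
    have hy : 0 ≤ y ∧ y < C.n := by
      rcases hy with rfl | rfl
      · exact (mem_Cs.1 h1).1
      · exact (mem_Cs.1 (Finset.mem_of_mem_erase h3)).1
    obtain ⟨j, rfl⟩ := exists_fin hy.1 hy.2
    obtain ⟨τ', rfl⟩ : ∃ τ' : WinType, τ'.code = τ := by
      rw [ht, first]
      split_ifs
      · exact ⟨.cw, rfl⟩
      · exact ⟨.ccw, rfl⟩
    exact ⟨.window u j τ', by simp [Item.words, Entry.words, hu]⟩
  · obtain ⟨hx, -⟩ := hR.part _ _ _ he
    obtain ⟨i, rfl⟩ := exists_fin hx.1 hx.2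
    obtain ⟨u, hu⟩ := exists_vertexCode (hS.mem a)
    obtain ⟨w, hw⟩ := exists_vertexCode (hS.mem b)
    exact ⟨.part i u w, by simp [Item.words, Entry.words, hu, hw]⟩

theorem Scene.exists_report (h : Scene C B S q) (hS : Sweep C.I C.n V) (hB : Convex ℝ B)
    (hl : ∀ b < C.s, l b = 2 * C.n) (hR : Reported C V (2 * C.n) l L) :
    ∃ M : List (Item C.n), L.flatMap (Entry.words V) = (M.map Item.words).flatten ∧
      IsReport B S q C.k M := by
  have i₀ : Fin C.n := ⟨0, hS.gen.pos⟩
  have : Nonempty (Item C.n) := ⟨.part i₀ (i₀, true) (i₀, true)⟩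
  choose! f hf using hR.exists_item hS
  refine ⟨L.map f, ?_, h.isReport hS hB hl hR ?_ fun t => ?_⟩
  · rw [List.flatMap_def, List.map_map]
    exact congrArg _ (List.map_congr_left fun e he => (hf e he).symm)
  · refine List.Nodup.map_on (fun e he e' he' hee => hR.words_injOn hS hl e he e' he' ?_) hR.nodup
    rw [← hf e he, ← hf e' he', hee]
  · rw [List.mem_map]
    constructor
    · rintro ⟨e, he, rfl⟩
      exact ⟨e, he, hf e he⟩
    · rintro ⟨e, he, ht⟩
      exact ⟨e, he, Item.words_injective ((hf e he).trans ht.symm)⟩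

end

/-! ## The theorem -/

section
variable {n s k : ℕ} {S : Fin n → Bool → ℤ × ℤ} {q : ℤ × ℤ}

theorem length_inputArray (s k : ℕ) (S : Fin n → Bool → ℤ × ℤ) (q : ℤ × ℤ) :
    (inputArray s k S q).length = 5 + 4 * n := by
  simp [inputArray, List.length_flatten, List.map_ofFn, Function.comp_def]
  omega

theorem getD_flatten_ofFn {n : ℕ} (f : Fin n → List ℤ) (hf : ∀ i, (f i).length = 4) (i : Fin n)
    {r : ℕ} (hr : r < 4) : (List.ofFn f).flatten.getD (4 * i + r) 0 = (f i).getD r 0 := by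
  induction n with
  | zero => exact i.elim0
  | succ n ih =>
    rw [List.ofFn_succ, List.flatten_cons]
    refine Fin.cases ?_ (fun i => ?_) i
    · rw [List.getD_append _ _ _ _ (by rw [hf]; simpa using hr)]
      simp
    · rw [List.getD_append_right _ _ _ _ (by rw [hf, Fin.val_succ]; omega), hf,
        ← ih (fun i => f i.succ) (fun i => hf _) i]
      congr 1
      rw [Fin.val_succ]; omega

theorem getD_inputArray (s k : ℕ) (S : Fin n → Bool → ℤ × ℤ) (q : ℤ × ℤ) (i : Fin n) {r : ℕ}
    (hr : r < 4) : (inputArray s k S q).getD (5 + (4 * i + r)) 0 =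
      [(S i false).1, (S i false).2, (S i true).1, (S i true).2].getD r 0 := by
  rw [inputArray, List.getD_append_right _ _ _ _ (by simp)]
  rw [← getD_flatten_ofFn (fun i => [(S i false).1, (S i false).2, (S i true).1, (S i true).2])
    (fun _ => rfl) i hr]
  congr 1
  simp

/-- The machine with the given input. -/
def inputEnv (hs : 1 ≤ s) (hn : s ≤ n) (k w c : ℕ) (hc : 1000 ≤ c) (S : Fin n → Bool → ℤ × ℤ) (q : ℤ × ℤ)
    (hI : ∀ x ∈ inputArray s k S q, |x| < 2 ^ w) : Env where
  I := inputArray s k S q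
  n := n
  s := s
  k := k
  w := w
  sp := c * s
  bits := c * w
  one_le_s := hs
  s_le_n := hn
  one_le_w := by
    rcases Nat.eq_zero_or_pos w with rfl | h
    · have := hI n (by simp [inputArray])
      rw [pow_zero, Nat.abs_cast] at this
      omega
    · exact h
  length := length_inputArray s k S q
  inp0 := rfl
  inp1 := rfl
  inp2 := rfl
  small := hI
  space := Nat.mul_le_mul_right s (by omega)
  word := Nat.mul_le_mul_right w hc

theorem vec_inputArray (i : Fin n) (b : Bool) : vec (inputArray s k S q) (vertexCode (i, b)) =
    toPt (S i b) - toPt q := by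
  have h3 : (inputArray s k S q).getD 3 0 = q.1 := rfl
  have h4 : (inputArray s k S q).getD 4 0 = q.2 := rfl
  unfold vec px py
  rw [h3, h4]
  cases b
  · rw [show (5 + 2 * vertexCode (i, false)).toNat = 5 + (4 * i + 0) by simp [vertexCode]; omega,
      show (6 + 2 * vertexCode (i, false)).toNat = 5 + (4 * i + 1) by simp [vertexCode]; omega,
      getD_inputArray _ _ _ _ _ (by norm_num), getD_inputArray _ _ _ _ _ (by norm_num)]
    simp [toPt]
  · rw [show (5 + 2 * vertexCode (i, true)).toNat = 5 + (4 * i + 2) by simp [vertexCode]; omega,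
      show (6 + 2 * vertexCode (i, true)).toNat = 5 + (4 * i + 3) by simp [vertexCode]; omega,
      getD_inputArray _ _ _ _ _ (by norm_num), getD_inputArray _ _ _ _ _ (by norm_num)]
    simp [toPt]

/-- An event costs `O(B + log s + 1)`, where `B ≤ 2 n / s`. As `s ≤ n`, the constant is absorbed by
`n / s ≥ 1`, which also covers `s = 1`, where the logarithm vanishes. -/
theorem sweepTime_le (C : Env) : ((4 * C.n * (eventTime C + 20) + 3000 : ℕ) : ℝ) ≤
    1000000 * ((C.n : ℝ) ^ 2 / C.s + C.n * Real.logb 2 C.s) := by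
  have hs : (1 : ℝ) ≤ C.s := by exact_mod_cast C.one_le_s
  have hn : (C.s : ℝ) ≤ C.n := by exact_mod_cast C.s_le_n
  have hs0 : (0 : ℝ) < C.s := by linarith
  have hlog : (Nat.log 2 C.s : ℝ) ≤ Real.logb 2 C.s := by
    have := Real.natLog_le_logb C.s 2
    exact_mod_cast this
  have hB : (C.B.toNat : ℝ) ≤ 2 * C.n / C.s := by
    rw [le_div_iff₀ hs0]
    have h1 := C.B_le
    have h2 : (C.B.toNat : ℤ) = C.B := Int.toNat_of_nonneg (by have := C.B_pos; omega)
    rw [← h2] at h1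
    rw [mul_comm]
    exact_mod_cast h1
  have h1 : 1 ≤ (C.n : ℝ) / C.s := (one_le_div hs0).2 hn
  have h2 : (2 * C.B).toNat = 2 * C.B.toNat := by omega
  have h3 : ((eventTime C : ℕ) : ℝ) = 30800 * C.B.toNat + 43400 * Nat.log 2 C.s + 54800 := by
    unfold eventTime refreshTime
    rw [h2]
    push_cast
    ring
  have h4 : ((4 * C.n * (eventTime C + 20) + 3000 : ℕ) : ℝ) ≤
      C.n * (1000000 * (C.n / C.s + Real.logb 2 C.s)) := by
    push_cast
    rw [h3]
    have h5 : 4 * (30800 * (C.B.toNat : ℝ) + 43400 * Nat.log 2 C.s + 54800 + 20) + 3000 ≤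
        1000000 * (C.n / C.s + Real.logb 2 C.s) := by
      rw [mul_div_assoc] at hB
      have : (0 : ℝ) ≤ Nat.log 2 C.s := by positivity
      linarith
    have h6 := mul_le_mul_of_nonneg_left h5 (show (0 : ℝ) ≤ C.n by positivity)
    have h7 : (3000 : ℝ) ≤ C.n * 3000 := by linarith
    linarith
  refine h4.trans (le_of_eq ?_)
  ring

theorem reports_sweep {c : ℕ} (hc : 1000 ≤ c) {T : ℝ} (hs : 1 ≤ s) (hn : s ≤ n)
    (hT : 1000000 * ((n : ℝ) ^ 2 / s + n * Real.logb 2 s) ≤ T) : Reports sweep c n s T := by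
  intro k w S q lo hi hv hI
  have h : Scene (inputEnv hs hn k w c hc S q hI) (Set.Icc lo hi) (fun i b => toPt (S i b)) (toPt q) :=
    ⟨fun i b => by
      change toPt (S i b) = toPt q + vec (inputArray s k S q) (vertexCode (i, b))
      exact ((vec_inputArray (s := s) (k := k) i b).symm ▸
        add_sub_cancel (toPt q) (toPt (S i b))).symm, hv⟩
  obtain ⟨V, hS⟩ := h.exists_sweep
  have h0 : (inputEnv hs hn k w c hc S q hI).MemOk State.init.mem := fun r => by
    change |(0 : ℤ)| ≤ _
    rw [abs_zero]
    positivity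
  obtain ⟨t, σ, he, ht, -, l, L, hl, hR, ho⟩ := run_sweep hS h0
  obtain ⟨M, hM, hM'⟩ := h.exists_report hS (convex_Icc lo hi) hl hR
  refine ⟨t, σ, M, he, ?_, ho.trans hM, hM'⟩
  exact (Nat.cast_le.2 ht).trans ((sweepTime_le (inputEnv hs hn k w c hc S q hI)).trans hT)

theorem time_le_of_bounded {s₀ : ℕ} (hs : 1 ≤ s) (hn : s ≤ n) (h0 : s ≤ s₀) :
    (n : ℝ) ^ 2 / s + n * Real.logb 2 s ≤ (1 + s₀) * (n : ℝ) ^ 2 := by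
  have hs' : (1 : ℝ) ≤ s := by exact_mod_cast hs
  have hn' : (1 : ℝ) ≤ n := by exact_mod_cast hs.trans hn
  have h0' : (s : ℝ) ≤ s₀ := by exact_mod_cast h0
  have h1 : (n : ℝ) ^ 2 / s ≤ (n : ℝ) ^ 2 := div_le_self (by positivity) hs'
  have h2 : Real.logb 2 s ≤ s := by
    rw [Real.logb_le_iff_le_rpow (by norm_num) (by linarith), Real.rpow_natCast]
    exact_mod_cast (Nat.lt_two_pow_self (n := s)).le
  have h3 : (n : ℝ) * Real.logb 2 s ≤ n * s₀ := by gcongr; linarith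
  have h4 : (n : ℝ) * s₀ ≤ s₀ * (n : ℝ) ^ 2 := by
    have : (n : ℝ) ≤ (n : ℝ) ^ 2 := by nlinarith
    rw [mul_comm]
    gcongr
  linarith

end

end KVis

theorem theorem6 :
    ∃ (P : KVis.Cmd) (c : ℕ),
      (∀ n s : ℕ, 1 ≤ s → s ≤ n →
        KVis.Reports P c n s (c * ((n : ℝ) ^ 2 / s + n * Real.logb 2 s))) ∧
      (∀ s₀ : ℕ, ∃ c₀ : ℕ, ∀ n s : ℕ, 1 ≤ s → s ≤ n → s ≤ s₀ →
        KVis.Reports P c n s (c₀ * (n : ℝ) ^ 2)) := by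
  -- One constant has to serve time, workspace and word length; the latter two need only `1000 ≤ c`.
  -- For bounded `s` the estimate `log s ≤ s ≤ s₀` gives the factor `1 + s₀`.
  refine ⟨KVis.sweep, 1000000, fun n s hs hn => ?_, fun s₀ => ⟨1000000 * (1 + s₀),
    fun n s hs hn h0 => ?_⟩⟩
  · refine KVis.reports_sweep (by norm_num) hs hn ?_
    norm_num
  · refine KVis.reports_sweep (by norm_num) hs hn ?_
    have := KVis.time_le_of_bounded hs hn h0
    push_cast
    linarith
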